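/- \textbf{Definitions.} A \emph{quad-equation} is $Q=0$ with $Q\in\mathbb{C}[x_1,x_2,x_3,x_4]$ irreducible and of degree at most one in each variable. For $\{i,j,k,\ell\}=\{1,2,3,4\}$ its biquadratics are $Q^{i,j}(x_i,x_j)=Q_{x_k}Q_{x_\ell}-Q\,Q_{x_kx_\ell}$. A biquadratic $h(x,y)$ is \emph{degenerate} if some polynomial $(c_1x+d_1)^2(c_2y+d_2)^2\,h\big(\tfrac{a_1x+b_1}{c_1x+d_1},\tfrac{a_2y+b_2}{c_2y+d_2}\big)$ with $a_id_i-b_ic_i\neq0$ is divisible by $x-a$ or by $y-a$ for some $a\in\mathbb{C}$. $Q$ is of \emph{type Q} if none of its six biquadratics is degenerate, and of \emph{type H}$^4$ if exactly four are. Consider systems of quad-equations on the faces of a cube $$A(x,x_1,x_2,x_{12})=0,\quad \bar A(x_3,x_{13},x_{23},x_{123})=0,\quad B(x,x_2,x_3,x_{23})=0,$$ $$\bar B(x_1,x_{12},x_{13},x_{123})=0,\quad C(x,x_1,x_3,x_{13})=0,\quad \bar C(x_2,x_{12},x_{23},x_{123})=0.$$ The system is \emph{3D consistent} if the three values of $x_{123}$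 computed from $\bar A=0$, $\bar B=0$, $\bar C=0$ coincide for arbitrary initial data $x,x_1,x_2,x_3$ (for which all the values can be computed). It has the \emph{tetrahedron property}, described by $K$ and $\bar K$, if $K,\bar K$ are non-zero polynomials such that $K(x,x_{12},x_{13},x_{23})=0$ and $\bar K(x_1,x_2,x_3,x_{123})=0$ for every solution of the system. Two systems are \emph{equivalent modulo} $(\text{M\"ob})^8$ if independent M\"obius transformations of the eight vertex variables transform the equations of one into those of the other, up to non-zero constant factors. \textbf{Theorem.} (1) Consider a 3D consistent system such that $B,\bar B$ are of type Q; $A,\bar A,C,\bar C$ are of type H$^4$; and the non-degenerate biquadratics of $\bar A$, $C$, $\bar C$ are on the edges that these faces share with $B$ and $\bar B$. Then the system has the tetrahedron property. Moreover, either the system itself, or the system obtained from it by the reflection of the cube that interchanges the faces of $B$ and $\bar B$ (i.e. by the relabelling $x\leftrightarrow x_1$, $x_2\leftrightarrow x_{12}$, $x_3\leftrightarrow x_{13}$, $x_{23}\leftrightarrow x_{123}$), is equivalent modulo $(\text{M\"ob})^8$ to one of the following three systems, with parameters $\alpha,\beta,\gamma,\epsilon,\delta\in\mathbb{C}$. They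 are written in terms of two polynomials $A(x,x_1,x_2,x_{12};\alpha,\beta)$ and $B(x,x_2,x_3,x_{23};\epsilon)$ as \begin{align*} \bar A&=A(x_3,x_{13},x_{23},x_{123};\alpha,\beta),& \bar B&=B(x_1,x_{12},x_{13},x_{123};0),\\ C&=A(x,x_1,x_3,x_{13};\alpha,\gamma),& \bar C&=A(x_2,x_{12},x_{23},x_{123};\alpha,\gamma),\\ K&=A(x,x_{12},x_{23},x_{13};\beta,\gamma),& \bar K&=A(x_2,x_1,x_3,x_{123};\beta,\gamma). \end{align*} (i) $\alpha,\beta,\gamma$ pairwise distinct and \begin{align*} A&=(x-x_2)(x_1-x_{12})-(\alpha-\beta)(1+\epsilon x_1x_{12}),\\ B&=(\beta-\gamma)(x-x_2)(x_3-x_{23})-(\alpha-\beta)(x-x_{23})(x_2-x_3)-\epsilon(\alpha-\beta)(\beta-\gamma)(\alpha-\gamma); \end{align*} (ii) $\alpha,\beta,\gamma$ pairwise distinct and \begin{align*} A={}&(x-x_2)(x_1-x_{12})-(\alpha-\beta)(x+x_1+x_2+x_{12})-\alpha^2+\beta^2\\ &-\epsilon(\alpha-\beta)(2x_1+\alpha+\beta)(2x_{12}+\alpha+\beta)-\epsilon(\alpha-\beta)^3,\\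 B={}&(\beta-\gamma)(x-x_2)(x_3-x_{23})-(\alpha-\beta)(x-x_{23})(x_2-x_3)+(\alpha-\beta)(\beta-\gamma)(\alpha-\gamma)\\ &-2\epsilon(\alpha-\beta)(\beta-\gamma)(\alpha-\gamma)(x+x_2+x_3+x_{23})\\ &-4\epsilon^2(\alpha-\beta)(\beta-\gamma)(\alpha-\gamma)\big((\alpha-\beta)^2+(\alpha-\beta)(\beta-\gamma)+(\beta-\gamma)^2\big); \end{align*} (iii) $\alpha,\beta,\gamma$ non-zero with pairwise distinct squares and \begin{align*} A={}&\alpha(xx_1+x_2x_{12})-\beta(xx_{12}+x_1x_2)+(\alpha^2-\beta^2)\Big(\delta+\frac{\epsilon x_1x_{12}}{\alpha\beta}\Big),\\ B={}&\gamma(\alpha^2-\beta^2)(xx_2+x_3x_{23})-\beta(\alpha^2-\gamma^2)(xx_3+x_2x_{23})+\alpha(\beta^2-\gamma^2)(xx_{23}+x_2x_3)\\ &+\frac{\delta\epsilon(\alpha^2-\beta^2)(\alpha^2-\gamma^2)(\beta^2-\gamma^2)}{\alpha\beta\gamma}. \end{align*} (2) Conversely, for all these parameter values each of the three systems is 3D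 consistent, satisfies the assumptions on the types and on the non-degenerate biquadratics in (1), and has the tetrahedron property described by its $K$ and $\bar K$. Moreover, each of them, including $K$ and $\bar K$, is obtained by the flips $x_2\leftrightarrow x_{12}$, $x_3\leftrightarrow x_{13}$ (under which the faces of $B,\bar B$ and the tetrahedra of $K,\bar K$ are interchanged) from the system with the same parameters \begin{align*} \bar A&=A(x_{13},x_3,x_{123},x_{23};\alpha,\beta),& B&=A(x,x_2,x_3,x_{23};\beta,\gamma),\\ \bar B&=A(x_{12},x_1,x_{123},x_{13};\beta,\gamma),& C&=A(x,x_1,x_3,x_{13};\alpha,\gamma),\\ \bar C&=A(x_{12},x_2,x_{123},x_{23};\alpha,\gamma),& \bar K&=K(x_1,x_2,x_3,x_{123};0) \end{align*} in which $A(x,x_1,x_2,x_{12};\alpha,\beta)$ is the polynomial $A$ above with $x_2$ and $x_{12}$ interchanged, and $K(x,x_{12},x_{13},x_{23};\epsilon)$ is the polynomial $B$ above with $x_2,x_3$ replaced by $x_{12},x_{13}$. -/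

import Mathlib

noncomputable section

open MvPolynomial

/-- Polynomials in four variables over `ℂ`. -/
abbrev Poly4 : Type := MvPolynomial (Fin 4) ℂ

/-- The action of Möbius transformations `x_i ↦ (a_i x_i + b_i) / (c_i x_i + d_i)` on a polynomial
`f` of degree at most `m i` in the variable `x_i`:
`M[f](x) = ∏ i, (c_i x_i + d_i) ^ m_i * f (…, (a_i x_i + b_i) / (c_i x_i + d_i), …)`,
written out monomial by monomial. -/
def moebAct (m : Fin 4 → ℕ) (g : Fin 4 → GL (Fin 2) ℂ) (f : Poly4) : Poly4 :=
  ∑ s ∈ f.support, C (f.coeff s) *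
    ∏ i : Fin 4, ((C ((g i).1 0 0) * X i + C ((g i).1 0 1)) ^ s i *
      (C ((g i).1 1 0) * X i + C ((g i).1 1 1)) ^ (m i - s i))

/-- A quad-equation is given by an irreducible multi-affine polynomial in four variables. -/
def IsQuadEquation (Q : Poly4) : Prop :=
  Irreducible Q ∧ ∀ i, Q.degreeOf i ≤ 1

/-- `biquad Q k l = Q_{x_k} Q_{x_l} - Q Q_{x_k x_l}`. For `{i, j, k, l} = {0, 1, 2, 3}` and `Q`
multi-affine it is the biquadratic `Q^{i,j}`, a polynomial in `x_i` and `x_j` only. -/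
def biquad (Q : Poly4) (k l : Fin 4) : Poly4 :=
  pderiv k Q * pderiv l Q - Q * pderiv k (pderiv l Q)

/-- A biquadratic `h(x_i, x_j)` is degenerate if some polynomial equivalent to it under Möbius
transformations in `x_i` and `x_j` is divisible by some `x_i - a` or some `x_j - a`. -/
def IsDegenerateBiquad (h : Poly4) (i j : Fin 4) : Prop :=
  ∃ (g : Fin 4 → GL (Fin 2) ℂ) (a : ℂ),
    (X i - C a) ∣ moebAct (fun k => if k = i ∨ k = j then 2 else 0) g h ∨
    (X j - C a) ∣ moebAct (fun k => if k = i ∨ k = j then 2 else 0) g h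

/-- The set of those pairs `{i, j}` (among the six pairs of variables) for which the biquadratic
`Q^{i,j}` is degenerate. -/
def degeneratePairs (Q : Poly4) : Set (Finset (Fin 4)) :=
  {e | ∃ π : Equiv.Perm (Fin 4), e = {π 0, π 1} ∧
    IsDegenerateBiquad (biquad Q (π 2) (π 3)) (π 0) (π 1)}

/-- Type Q: all six biquadratics are non-degenerate. -/
def IsTypeQ (Q : Poly4) : Prop :=
  IsQuadEquation Q ∧ degeneratePairs Q = ∅

/-- Type H⁴: exactly four of the six biquadratics are degenerate. -/
def IsTypeH4 (Q : Poly4) : Prop :=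
  IsQuadEquation Q ∧ (degeneratePairs Q).ncard = 4

/-- Six polynomials on the faces of a cube, with the arguments
`A(x, x₁, x₂, x₁₂)`, `A'(x₃, x₁₃, x₂₃, x₁₂₃)`, `B(x, x₂, x₃, x₂₃)`, `B'(x₁, x₁₂, x₁₃, x₁₂₃)`,
`C(x, x₁, x₃, x₁₃)`, `C'(x₂, x₁₂, x₂₃, x₁₂₃)`; the primes stand for bars. -/
structure CubeSystem where
  A : Poly4
  A' : Poly4
  B : Poly4
  B' : Poly4
  C : Poly4
  C' : Poly4

/-- `(a, b, c, d)` solves `Q = 0`. -/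
def Solves (Q : Poly4) (a b c d : ℂ) : Prop :=
  eval ![a, b, c, d] Q = 0

/-- `Q = 0` can be solved uniquely for its last argument at `(a, b, c)`, and `d` is the result
(for multi-affine `Q` the derivative is the coefficient of the last variable). -/
def Determines (Q : Poly4) (a b c d : ℂ) : Prop :=
  eval ![a, b, c, d] Q = 0 ∧ eval ![a, b, c, d] (pderiv 3 Q) ≠ 0

namespace CubeSystem

/-- 3D consistency: for initial data `x, x₁, x₂, x₃`, compute `x₁₂, x₁₃, x₂₃` from `A, C, B`; then
the three values of `x₁₂₃` computed from `A', B', C'` coincide, whenever all of these values can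
be computed. -/
def IsConsistent (S : CubeSystem) : Prop :=
  ∀ x x1 x2 x3 x12 x13 x23 yA yB yC : ℂ,
    Determines S.A x x1 x2 x12 → Determines S.C x x1 x3 x13 → Determines S.B x x2 x3 x23 →
    Determines S.A' x3 x13 x23 yA → Determines S.B' x1 x12 x13 yB →
    Determines S.C' x2 x12 x23 yC → yA = yB ∧ yB = yC

/-- The values at the eight vertices solve all six equations. -/
def IsSolution (S : CubeSystem) (x x1 x2 x3 x12 x13 x23 x123 : ℂ) : Prop :=
  Solves S.A x x1 x2 x12 ∧ Solves S.A' x3 x13 x23 x123 ∧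
  Solves S.B x x2 x3 x23 ∧ Solves S.B' x1 x12 x13 x123 ∧
  Solves S.C x x1 x3 x13 ∧ Solves S.C' x2 x12 x23 x123

/-- The non-zero polynomials `K(x, x₁₂, x₁₃, x₂₃)` and `K'(x₁, x₂, x₃, x₁₂₃)` vanish on every
solution of the system. -/
def IsTetrahedronPair (S : CubeSystem) (K K' : Poly4) : Prop :=
  K ≠ 0 ∧ K' ≠ 0 ∧ ∀ x x1 x2 x3 x12 x13 x23 x123 : ℂ,
    S.IsSolution x x1 x2 x3 x12 x13 x23 x123 →
      Solves K x x12 x13 x23 ∧ Solves K' x1 x2 x3 x123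

/-- The tetrahedron property. -/
def HasTetrahedronProperty (S : CubeSystem) : Prop :=
  ∃ K K' : Poly4, S.IsTetrahedronPair K K'

/-- `B`, `B'` are of type Q, the other faces are of type H⁴, and the non-degenerate biquadratics
of `A'`, `C`, `C'` are on the edges which these faces share with `B` and `B'`: these are
`(x₃, x₂₃)`, `(x₁₃, x₁₂₃)` for `A'`, `(x, x₃)`, `(x₁, x₁₃)` for `C` and
`(x₂, x₂₃)`, `(x₁₂, x₁₂₃)` for `C'`, that is, the arguments `0, 2` and `1, 3` in each case. -/
def HasTwoQFourH4 (S : CubeSystem) : Prop :=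
  IsTypeQ S.B ∧ IsTypeQ S.B' ∧
  IsTypeH4 S.A ∧ IsTypeH4 S.A' ∧ IsTypeH4 S.C ∧ IsTypeH4 S.C' ∧
  (∀ Q ∈ ({S.A', S.C, S.C'} : Set Poly4),
    {0, 2} ∉ degeneratePairs Q ∧ {1, 3} ∉ degeneratePairs Q)

/-- Equality of two polynomials up to a Möbius transformation in each variable and a non-zero
constant factor. -/
def FaceEquiv (P Q : Poly4) (g : Fin 4 → GL (Fin 2) ℂ) : Prop :=
  ∃ c : ℂ, c ≠ 0 ∧ P = MvPolynomial.C c * moebAct (fun _ => 1) g Q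

/-- Equivalence modulo (Möb)⁸: independent Möbius transformations at the eight vertices transform
the equations of `T` into those of `S`. -/
def MoebEquiv (S T : CubeSystem) : Prop :=
  ∃ g g1 g2 g3 g12 g13 g23 g123 : GL (Fin 2) ℂ,
    FaceEquiv S.A T.A ![g, g1, g2, g12] ∧ FaceEquiv S.A' T.A' ![g3, g13, g23, g123] ∧
    FaceEquiv S.B T.B ![g, g2, g3, g23] ∧ FaceEquiv S.B' T.B' ![g1, g12, g13, g123] ∧
    FaceEquiv S.C T.C ![g, g1, g3, g13] ∧ FaceEquiv S.C' T.C' ![g2, g12, g23, g123]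

/-- The reflection of the cube which interchanges the faces of `B` and `B'`, that is
`x ↔ x₁`, `x₂ ↔ x₁₂`, `x₃ ↔ x₁₃`, `x₂₃ ↔ x₁₂₃`. -/
def mirror (S : CubeSystem) : CubeSystem where
  A := rename ![1, 0, 3, 2] S.A
  A' := rename ![1, 0, 3, 2] S.A'
  B := S.B'
  B' := S.B
  C := rename ![1, 0, 3, 2] S.C
  C' := rename ![1, 0, 3, 2] S.C'

end CubeSystem

/-- A system on the cube together with polynomials `K(x, x₁₂, x₁₃, x₂₃)` and
`K'(x₁, x₂, x₃, x₁₂₃)` on its two tetrahedra. -/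
structure TetraSystem extends CubeSystem where
  K : Poly4
  K' : Poly4

/-- The flips `x₂ ↔ x₁₂` and `x₃ ↔ x₁₃`; they interchange the faces of `B`, `B'` and the
tetrahedra of `K`, `K'`. -/
def TetraSystem.flip (T : TetraSystem) : TetraSystem where
  A := rename ![0, 1, 3, 2] T.A
  A' := rename ![1, 0, 2, 3] T.A'
  B := T.K
  B' := T.K'
  C := rename ![0, 1, 3, 2] T.C
  C' := rename ![1, 0, 2, 3] T.C'
  K := T.B
  K' := T.B'

/-- The system written in terms of `P(x, x₁, x₂, x₁₂; α, β)` and `R(x, x₂, x₃, x₂₃; ε)` as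
`A = P(x, x₁, x₂, x₁₂; α, β)`, `A' = P(x₃, x₁₃, x₂₃, x₁₂₃; α, β)`,
`B = R(x, x₂, x₃, x₂₃; ε)`, `B' = R(x₁, x₁₂, x₁₃, x₁₂₃; 0)`,
`C = P(x, x₁, x₃, x₁₃; α, γ)`, `C' = P(x₂, x₁₂, x₂₃, x₁₂₃; α, γ)`,
`K = P(x, x₁₂, x₂₃, x₁₃; β, γ)`, `K' = P(x₂, x₁, x₃, x₁₂₃; β, γ)`. -/
def mkTwoQ (P : ℂ → ℂ → Poly4) (R : ℂ → Poly4) (ε α β γ : ℂ) : TetraSystem where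
  A := P α β
  A' := P α β
  B := R ε
  B' := R 0
  C := P α γ
  C' := P α γ
  K := rename ![0, 1, 3, 2] (P β γ)
  K' := rename ![1, 0, 2, 3] (P β γ)

/-- The system written in terms of `P(x, x₁, x₂, x₁₂; α, β)` and `R(x, x₁₂, x₁₃, x₂₃; ε)` as
`A = P(x, x₁, x₂, x₁₂; α, β)`, `A' = P(x₁₃, x₃, x₁₂₃, x₂₃; α, β)`,
`B = P(x, x₂, x₃, x₂₃; β, γ)`, `B' = P(x₁₂, x₁, x₁₂₃, x₁₃; β, γ)`,
`C = P(x, x₁, x₃, x₁₃; α, γ)`, `C' = P(x₁₂, x₂, x₁₂₃, x₂₃; α, γ)`,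
`K = R(x, x₁₂, x₁₃, x₂₃; ε)`, `K' = R(x₁, x₂, x₃, x₁₂₃; 0)`. -/
def mkSixH4 (P : ℂ → ℂ → Poly4) (R : ℂ → Poly4) (ε α β γ : ℂ) : TetraSystem where
  A := P α β
  A' := rename ![1, 0, 3, 2] (P α β)
  B := P β γ
  B' := rename ![1, 0, 3, 2] (P β γ)
  C := P α γ
  C' := rename ![1, 0, 3, 2] (P α γ)
  K := R ε
  K' := R 0

/-! Throughout, `X 0, X 1, X 2, X 3` are the four arguments in the order indicated. -/

/-- `A(x, x₁, x₂, x₁₂; α, β)` of the first system. -/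
def a1 (ε α β : ℂ) : Poly4 :=
  (X 0 - X 2) * (X 1 - X 3) - C (α - β) * (1 + C ε * X 1 * X 3)

/-- `B(x, x₂, x₃, x₂₃; ε)` of the first system. -/
def b1 (α β γ ε : ℂ) : Poly4 :=
  C (β - γ) * (X 0 - X 1) * (X 2 - X 3) - C (α - β) * (X 0 - X 3) * (X 1 - X 2)
    - C (ε * (α - β) * (β - γ) * (α - γ))

/-- `A(x, x₁, x₂, x₁₂; α, β)` of the second system. -/
def a2 (ε α β : ℂ) : Poly4 :=
  (X 0 - X 2) * (X 1 - X 3) - C (α - β) * (X 0 + X 1 + X 2 + X 3) - C (α ^ 2) + C (β ^ 2)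
    - C (ε * (α - β)) * (2 * X 1 + C (α + β)) * (2 * X 3 + C (α + β)) - C (ε * (α - β) ^ 3)

/-- `B(x, x₂, x₃, x₂₃; ε)` of the second system. -/
def b2 (α β γ ε : ℂ) : Poly4 :=
  C (β - γ) * (X 0 - X 1) * (X 2 - X 3) - C (α - β) * (X 0 - X 3) * (X 1 - X 2)
    + C ((α - β) * (β - γ) * (α - γ))
    - C (2 * ε * (α - β) * (β - γ) * (α - γ)) * (X 0 + X 1 + X 2 + X 3)
    - C (4 * ε ^ 2 * (α - β) * (β - γ) * (α - γ) *
        ((α - β) ^ 2 + (α - β) * (β - γ) + (β - γ) ^ 2))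

/-- `A(x, x₁, x₂, x₁₂; α, β)` of the third system. -/
def a3 (δ ε α β : ℂ) : Poly4 :=
  C α * (X 0 * X 1 + X 2 * X 3) - C β * (X 0 * X 3 + X 1 * X 2)
    + C (α ^ 2 - β ^ 2) * (C δ + C (ε / (α * β)) * X 1 * X 3)

/-- `B(x, x₂, x₃, x₂₃; ε)` of the third system. -/
def b3 (δ α β γ ε : ℂ) : Poly4 :=
  C (γ * (α ^ 2 - β ^ 2)) * (X 0 * X 1 + X 2 * X 3)
    - C (β * (α ^ 2 - γ ^ 2)) * (X 0 * X 2 + X 1 * X 3)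
    + C (α * (β ^ 2 - γ ^ 2)) * (X 0 * X 3 + X 1 * X 2)
    + C (δ * ε * (α ^ 2 - β ^ 2) * (α ^ 2 - γ ^ 2) * (β ^ 2 - γ ^ 2) / (α * β * γ))

/-- `A(x, x₁, x₂, x₁₂; α, β)` of the first system with six equations of type H⁴. -/
def a1First (ε α β : ℂ) : Poly4 :=
  (X 0 - X 3) * (X 1 - X 2) - C (α - β) * (1 + C ε * X 1 * X 2)

/-- `A(x, x₁, x₂, x₁₂; α, β)` of the second system with six equations of type H⁴. -/
def a2First (ε α β : ℂ) : Poly4 :=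
  (X 0 - X 3) * (X 1 - X 2) - C (α - β) * (X 0 + X 1 + X 2 + X 3) - C (α ^ 2) + C (β ^ 2)
    - C (ε * (α - β)) * (2 * X 1 + C (α + β)) * (2 * X 2 + C (α + β)) - C (ε * (α - β) ^ 3)

/-- `A(x, x₁, x₂, x₁₂; α, β)` of the third system with six equations of type H⁴. -/
def a3First (δ ε α β : ℂ) : Poly4 :=
  C α * (X 0 * X 1 + X 2 * X 3) - C β * (X 0 * X 2 + X 1 * X 3)
    + C (α ^ 2 - β ^ 2) * (C δ + C (ε / (α * β)) * X 1 * X 2)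

/-- The three systems with two equations of type Q and four of type H⁴; `k` is the number of the
system. The parameter `δ` occurs in the third system only. -/
def listedSystem (k : Fin 3) (δ ε α β γ : ℂ) : TetraSystem :=
  match k with
  | 0 => mkTwoQ (a1 ε) (b1 α β γ) ε α β γ
  | 1 => mkTwoQ (a2 ε) (b2 α β γ) ε α β γ
  | 2 => mkTwoQ (a3 δ ε) (b3 δ α β γ) ε α β γ

/-- The three systems with six equations of type H⁴ and all non-degenerate biquadratics on
diagonals. As polynomials in their four arguments, the polynomials `K(x, x₁₂, x₁₃, x₂₃; ε)` of
these systems are `b1`, `b2`, `b3`. -/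
def firstCaseSystem (k : Fin 3) (δ ε α β γ : ℂ) : TetraSystem :=
  match k with
  | 0 => mkSixH4 (a1First ε) (b1 α β γ) ε α β γ
  | 1 => mkSixH4 (a2First ε) (b2 α β γ) ε α β γ
  | 2 => mkSixH4 (a3First δ ε) (b3 δ α β γ) ε α β γ

/-- The parameter values for which no equation of the `k`-th system degenerates. -/
def Admissible (k : Fin 3) (α β γ : ℂ) : Prop :=
  match k with
  | 0 => α ≠ β ∧ β ≠ γ ∧ α ≠ γ
  | 1 => α ≠ β ∧ β ≠ γ ∧ α ≠ γ
  | 2 => α ≠ 0 ∧ β ≠ 0 ∧ γ ≠ 0 ∧ α ^ 2 ≠ β ^ 2 ∧ β ^ 2 ≠ γ ^ 2 ∧ α ^ 2 ≠ γ ^ 2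

end

/-!
A polynomial that is at most linear in each of its four variables is a multilinear form on `(ℂ²)⁴`
with an affine point `x` written as `(x, 1)`, and Möbius transformations are linear transformations
of the four arguments. A biquadratic is degenerate if and only if it vanishes when one of its
arguments takes a fixed value in `ℙ¹` (`mem_degeneratePairs_iff`). The value of a vertex variable
computed from a face is a polynomial vector in the other three, so consistency amounts to
polynomial identities `Sys.HC`, which hold wherever all values can be computed, hence everywhere
(`Sys.hc_of_isConsistent`).

*Classification.* An equation of type H⁴ with non-degenerate biquadratics on two opposite pairs of
vertices vanishes identically at a pair of values of one of these pairs (`IsH4.exists_vanish`). For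
the face of `C` this is a pair of values of `x, x₃`, possibly after reflection of the cube. By
consistency and the non-degeneracy of the biquadratics of `B` and `B'` it propagates to the other
faces around the cube (`Sys.HC.propagate`), which also makes the face of `A` one of the same kind;
the values at the vertices of `B` can be moved to infinity (`Good.exists_std`). The four faces
around `B'` become equations `uᵢ mᵢ(yᵢ, yᵢ₊₁) + uᵢ₊₁ m'ᵢ(yᵢ, yᵢ₊₁) + nᵢ(yᵢ, yᵢ₊₁) = 0` with `i`
modulo 4, with bilinear forms `mᵢ`, `m'ᵢ`, `nᵢ`, where `u` runs through the vertices of `B` and `y`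
through those of `B'`. Their composition is an affine map of `u₀`, which must be the identity on
the zero set of `B'`. Both the difference of the products `m₀ m₁ m₂ m₃` and `m'₀ m'₁ m'₂ m'₃` and a
second polynomial, linear in the `nᵢ`, are therefore divisible by `T = B'` (`Std.valid`).

Comparing zeros in these divisibilities shows that `T` is a combination of `m'₁ m'₃` and `m₀ m₂`
and also of `m₁ m₃` and `m'₀ m'₂`, if `m'ᵢ` is not proportional to `mᵢ`
(`Loop.Valid.exists_T_eq_of_ns`), and a combination of `m₁ m₃` and `m₀ m₂` otherwise
(`Loop.Valid.exists_T_eq_of_scalar`). In the first case the `nᵢ` are determined by one of them up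
to translations of the `uᵢ` (`Loop.Valid.exists_translation`). Transformations of the `yᵢ` turn
`m₀`, `m₁` and `m₃` into the determinant (`Std.exists_om`), and simultaneous transformations of the
`yᵢ` remain. If the quadratic form `m'₀(y, y)` has two distinct zeros, the result is the third
system (`Std.exists_sysRel_of_two_zeros`). If it has a double zero, the result is the second
system, or, if the `nᵢ` can be removed, the reflection of the first system in different coordinates
(`Loop.Translated.exists_sysRel`, `Loop.Translated.sysRel_mirror`). Proportional coefficients lead
to the first system (`Loop.IsDet.isListed`). The remaining face `B` is determined by the other five
(`Std.sysRel_of_loop`).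

*Converse.* For the listed systems, eliminating a common vertex variable from two face polynomials
gives, up to factors at the edges, the tetrahedron polynomial of the other vertices; these
identities `Triple` imply consistency, and the tetrahedron property for generic solutions. At the
solutions where the factors vanish, the tetrahedron property follows from the further identities of
`Tetra`. The property is invariant under Möbius transformations and the reflection, so that it
passes from the listed systems to all systems (`Sys.IsListed.exists_isTetraPair`).
-/

noncomputable section

open MvPolynomial

/-! ### Multi-affine polynomials as multilinear forms -/

/-- Homogeneous coordinates on `ℙ¹`; the affine point `x` is `![x, 1]`. -/
abbrev Vec : Type := Fin 2 → ℂ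

/-- Coefficients of a multilinear form in four vectors. -/
abbrev Ten : Type := Fin 2 → Fin 2 → Fin 2 → Fin 2 → ℂ

/-- The multilinear form with coefficients `c`. -/
def form (c : Ten) (u v w z : Vec) : ℂ :=
  ∑ i, ∑ j, ∑ k, ∑ l, c i j k l * (u i * v j * w k * z l)

/-- The point at infinity of `ℙ¹`. -/
def e0 : Vec := ![1, 0]

/-- The origin of `ℙ¹`. -/
def e1 : Vec := ![0, 1]

/-- Homogeneous coordinates of an affine point. -/
def aff (x : ℂ) : Vec := ![x, 1]

@[simp] lemma e0_zero : e0 0 = 1 := rfl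
@[simp] lemma e0_one : e0 1 = 0 := rfl
@[simp] lemma e1_zero : e1 0 = 0 := rfl
@[simp] lemma e1_one : e1 1 = 1 := rfl
@[simp] lemma aff_zero (x : ℂ) : aff x 0 = x := rfl
@[simp] lemma aff_one (x : ℂ) : aff x 1 = 1 := rfl

lemma vec_ne_zero_iff {p : Vec} : p ≠ 0 ↔ p 0 ≠ 0 ∨ p 1 ≠ 0 := by
  rw [Ne, funext_iff, Fin.forall_fin_two]
  simp only [Pi.zero_apply]
  tauto

lemma e0_ne_zero : e0 ≠ 0 := vec_ne_zero_iff.2 (by simp)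

lemma e1_ne_zero : e1 ≠ 0 := vec_ne_zero_iff.2 (by simp)

lemma aff_ne_zero (x : ℂ) : aff x ≠ 0 := vec_ne_zero_iff.2 (by simp)

lemma form_eq (c : Ten) (u v w z : Vec) : form c u v w z =
    c 0 0 0 0 * (u 0 * v 0 * w 0 * z 0) + c 0 0 0 1 * (u 0 * v 0 * w 0 * z 1) +
    c 0 0 1 0 * (u 0 * v 0 * w 1 * z 0) + c 0 0 1 1 * (u 0 * v 0 * w 1 * z 1) +
    c 0 1 0 0 * (u 0 * v 1 * w 0 * z 0) + c 0 1 0 1 * (u 0 * v 1 * w 0 * z 1) +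
    c 0 1 1 0 * (u 0 * v 1 * w 1 * z 0) + c 0 1 1 1 * (u 0 * v 1 * w 1 * z 1) +
    c 1 0 0 0 * (u 1 * v 0 * w 0 * z 0) + c 1 0 0 1 * (u 1 * v 0 * w 0 * z 1) +
    c 1 0 1 0 * (u 1 * v 0 * w 1 * z 0) + c 1 0 1 1 * (u 1 * v 0 * w 1 * z 1) +
    c 1 1 0 0 * (u 1 * v 1 * w 0 * z 0) + c 1 1 0 1 * (u 1 * v 1 * w 0 * z 1) +
    c 1 1 1 0 * (u 1 * v 1 * w 1 * z 0) + c 1 1 1 1 * (u 1 * v 1 * w 1 * z 1) := by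
  simp only [form, Fin.sum_univ_two]
  ring

@[fun_prop]
lemma Differentiable.form {E : Type*} [NormedAddCommGroup E] [NormedSpace ℂ E] {c : Ten}
    {u v w z : E → Vec} (hu : Differentiable ℂ u) (hv : Differentiable ℂ v)
    (hw : Differentiable ℂ w) (hz : Differentiable ℂ z) :
    Differentiable ℂ fun e => form c (u e) (v e) (w e) (z e) := by
  simp only [form_eq]
  fun_prop

/-- The multilinear form with its four arguments indexed by `Fin 4`. -/
def formF (c : Ten) (U : Fin 4 → Vec) : ℂ := form c (U 0) (U 1) (U 2) (U 3)

@[fun_prop]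
lemma Differentiable.formF {E : Type*} [NormedAddCommGroup E] [NormedSpace ℂ E] {c : Ten}
    {U : E → Fin 4 → Vec} (hU : Differentiable ℂ U) :
    Differentiable ℂ fun e => formF c (U e) := by
  unfold _root_.formF
  fun_prop

/-- The determinant of the form in its arguments `k` and `l`; up to sign, this is the biquadratic
in the other two arguments, in homogeneous coordinates. -/
def bq (c : Ten) (k l : Fin 4) (U : Fin 4 → Vec) : ℂ :=
  formF c (Function.update (Function.update U k e0) l e0) *
    formF c (Function.update (Function.update U k e1) l e1) -
  formF c (Function.update (Function.update U k e0) l e1) *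
    formF c (Function.update (Function.update U k e1) l e0)

/-- The multi-affine polynomial belonging to a multilinear form. -/
def ofTen (c : Ten) : Poly4 :=
  ∑ i, ∑ j, ∑ k, ∑ l, C (c i j k l) *
    ((if i = 0 then X 0 else 1) * (if j = 0 then X 1 else 1) * (if k = 0 then X 2 else 1) *
      (if l = 0 then X 3 else 1))

lemma eval_ofTen (c : Ten) (x : Fin 4 → ℂ) :
    eval x (ofTen c) = formF c (fun i => aff (x i)) := by
  simp [ofTen, formF, form_eq, Fin.sum_univ_two]
  ring

lemma eval_ofTen' (c : Ten) (a b d e : ℂ) :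
    eval ![a, b, d, e] (ofTen c) = form c (aff a) (aff b) (aff d) (aff e) := by
  simp [eval_ofTen, formF]

lemma degreeOf_ofTen_le (c : Ten) (i : Fin 4) : (ofTen c).degreeOf i ≤ 1 := by
  classical
  have h (j k : Fin 4) (p : Prop) [Decidable p] :
      degreeOf j (if p then X k else 1 : Poly4) ≤ if j = k then 1 else 0 := by
    split_ifs <;> simp_all [degreeOf_X]
  unfold ofTen
  refine (degreeOf_sum_le _ _ _).trans (Finset.sup_le fun a _ => ?_)
  refine (degreeOf_sum_le _ _ _).trans (Finset.sup_le fun b _ => ?_)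
  refine (degreeOf_sum_le _ _ _).trans (Finset.sup_le fun d _ => ?_)
  refine (degreeOf_sum_le _ _ _).trans (Finset.sup_le fun e _ => ?_)
  refine (degreeOf_C_mul_le _ _ _).trans ?_
  refine (degreeOf_mul_le _ _ _).trans ?_
  refine (Nat.add_le_add ((degreeOf_mul_le _ _ _).trans
    (Nat.add_le_add (degreeOf_mul_le _ _ _) le_rfl)) le_rfl).trans ?_
  have h0 := h i 0 (a = 0)
  have h1 := h i 1 (b = 0)
  have h2 := h i 2 (d = 0)
  have h3 := h i 3 (e = 0)
  fin_cases i <;> simp at h0 h1 h2 h3 ⊢ <;> omega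

lemma exists_eq_ofTen {Q : Poly4} (hQ : ∀ i, Q.degreeOf i ≤ 1) : ∃ c, Q = ofTen c := by
  classical
  let s (t : Fin 2 × Fin 2 × Fin 2 × Fin 2) : Fin 4 →₀ ℕ :=
    Finsupp.equivFunOnFinite.symm
      ![1 - (t.1 : ℕ), 1 - (t.2.1 : ℕ), 1 - (t.2.2.1 : ℕ), 1 - (t.2.2.2 : ℕ)]
  have s_apply (t) (i : Fin 4) : s t i =
    ![1 - (t.1 : ℕ), 1 - (t.2.1 : ℕ), 1 - (t.2.2.1 : ℕ), 1 - (t.2.2.2 : ℕ)] i := rfl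
  have hs : Function.Injective s := by
    rintro ⟨a, b, d, e⟩ ⟨a', b', d', e'⟩ h
    have h0 := DFunLike.congr_fun h 0
    have h1 := DFunLike.congr_fun h 1
    have h2 := DFunLike.congr_fun h 2
    have h3 := DFunLike.congr_fun h 3
    simp [s_apply] at h0 h1 h2 h3
    simp only [Prod.mk.injEq, Fin.ext_iff]
    omega
  have hsub : Q.support ⊆ Finset.univ.image s := by
    intro t ht
    have ht' (i) : t i ≤ 1 := (monomial_le_degreeOf i ht).trans (hQ i)
    refine Finset.mem_image.2 ⟨(⟨1 - t 0, by omega⟩, ⟨1 - t 1, by omega⟩, ⟨1 - t 2, by omega⟩,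
      ⟨1 - t 3, by omega⟩), Finset.mem_univ _, ?_⟩
    ext i
    have := ht' i
    fin_cases i <;> simp [s_apply] at this ⊢ <;> omega
  refine ⟨fun i j k l => Q.coeff (s (i, j, k, l)), MvPolynomial.funext fun x => ?_⟩
  rw [eval_ofTen, eval_eq', Finset.sum_subset hsub (fun t _ ht => by
    rw [notMem_support_iff.1 ht, zero_mul]), Finset.sum_image hs.injOn]
  simp only [Fintype.sum_prod_type, formF, form]
  refine Finset.sum_congr rfl fun i _ => Finset.sum_congr rfl fun j _ =>
    Finset.sum_congr rfl fun k _ => Finset.sum_congr rfl fun l _ => ?_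
  congr 1
  have hpow (y : ℂ) (m : Fin 2) : y ^ (1 - (m : ℕ)) = aff y m := by
    fin_cases m <;> simp
  simp [Fin.prod_univ_four, s_apply, hpow]

lemma eval_pderiv_ofTen (c : Ten) (k : Fin 4) (x : Fin 4 → ℂ) :
    eval x (pderiv k (ofTen c)) = formF c (Function.update (fun i => aff (x i)) k e0) := by
  fin_cases k <;> simp [ofTen, formF, form_eq, Fin.sum_univ_two, pderiv_X,
    Function.update] <;> ring

lemma eval_pderiv_pderiv_ofTen (c : Ten) {k l : Fin 4} (hkl : k ≠ l) (x : Fin 4 → ℂ) :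
    eval x (pderiv k (pderiv l (ofTen c))) =
      formF c (Function.update (Function.update (fun i => aff (x i)) k e0) l e0) := by
  fin_cases k <;> fin_cases l <;> first | exact absurd rfl hkl | skip
  all_goals
    simp [ofTen, formF, form_eq, Fin.sum_univ_two, pderiv_X, Function.update]
    ring

lemma eval_biquad_ofTen (c : Ten) {k l : Fin 4} (hkl : k ≠ l) (x : Fin 4 → ℂ) :
    eval x (biquad (ofTen c) k l) = -bq c k l (fun i => aff (x i)) := by
  simp only [biquad, map_sub, map_mul, eval_pderiv_ofTen, eval_pderiv_pderiv_ofTen c hkl,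
    eval_ofTen, bq]
  fin_cases k <;> fin_cases l <;> first | exact absurd rfl hkl | skip
  all_goals
    simp [formF, form_eq, Function.update]
    ring

/-! ### Zeros of products of functions -/

/-- Entire functions in several variables form an integral domain. -/
theorem eq_zero_or_eq_zero_of_mul {E : Type*} [NormedAddCommGroup E] [NormedSpace ℂ E]
    {f g : E → ℂ} (hf : Differentiable ℂ f) (hg : Differentiable ℂ g)
    (h : ∀ x, f x * g x = 0) : (∀ x, f x = 0) ∨ ∀ x, g x = 0 := by
  by_contra! hne
  obtain ⟨⟨a, ha⟩, b, hb⟩ := hne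
  have hl : Differentiable ℂ fun t : ℂ => a + t • (b - a) := by fun_prop
  have hA (f : E → ℂ) (hf : Differentiable ℂ f) :
      AnalyticOnNhd ℂ (fun t : ℂ => f (a + t • (b - a))) Set.univ := fun t _ =>
    (hf.comp hl).analyticAt t
  rcases AnalyticOnNhd.eq_zero_or_eq_zero_of_mul_eq_zero (hA f hf) (hA g hg)
    (fun t _ => h _) isPreconnected_univ with h0 | h0
  · exact ha (by simpa using h0 0 trivial)
  · exact hb (by simpa using h0 1 trivial)

theorem eq_zero_of_mul_of_ne {E : Type*} [NormedAddCommGroup E] [NormedSpace ℂ E]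
    {f g : E → ℂ} (hf : Differentiable ℂ f) (hg : Differentiable ℂ g)
    (hne : ∃ x, f x ≠ 0) (h : ∀ x, f x * g x = 0) (x : E) : g x = 0 := by
  rcases eq_zero_or_eq_zero_of_mul hf hg h with h0 | h0
  · exact absurd (h0 _) hne.choose_spec
  · exact h0 x

theorem exists_mul_ne_zero {E : Type*} [NormedAddCommGroup E] [NormedSpace ℂ E]
    {f g : E → ℂ} (hf : Differentiable ℂ f) (hg : Differentiable ℂ g)
    (hfne : ∃ x, f x ≠ 0) (hgne : ∃ x, g x ≠ 0) : ∃ x, f x * g x ≠ 0 := by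
  by_contra! h
  exact hgne.choose_spec (eq_zero_of_mul_of_ne hf hg hfne h _)

/-! ### Möbius transformations -/

/-- The homogenization of `f`, regarded as a polynomial of degree `m i` in the variable `x_i`. -/
def hom (m : Fin 4 → ℕ) (f : Poly4) (U : Fin 4 → Vec) : ℂ :=
  ∑ s ∈ f.support, coeff s f * ∏ i, ((U i 0) ^ s i * (U i 1) ^ (m i - s i))

lemma eval_moebAct (m : Fin 4 → ℕ) (g : Fin 4 → GL (Fin 2) ℂ) (f : Poly4) (x : Fin 4 → ℂ) :
    eval x (moebAct m g f) = hom m f (fun i => (g i).1.mulVec (aff (x i))) := by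
  simp [moebAct, hom, Matrix.mulVec, dotProduct, Fin.sum_univ_two]

lemma hom_of_ne {m : Fin 4 → ℕ} {f : Poly4} (hf : ∀ i, f.degreeOf i ≤ m i) {U : Fin 4 → Vec}
    (hU : ∀ i, U i 1 ≠ 0) :
    hom m f U = (∏ i, (U i 1) ^ m i) * eval (fun i => U i 0 / U i 1) f := by
  rw [hom, eval_eq', Finset.mul_sum]
  refine Finset.sum_congr rfl fun s hs => ?_
  rw [mul_left_comm, ← Finset.prod_mul_distrib]
  congr 1
  refine Finset.prod_congr rfl fun i _ => ?_
  have hi : s i ≤ m i := (monomial_le_degreeOf i hs).trans (hf i)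
  have h1 := hU i
  rw [← Nat.sub_add_cancel hi, pow_add, Nat.add_sub_cancel, div_pow]
  field_simp

lemma hom_eq {m : Fin 4 → ℕ} {f : Poly4} (hf : ∀ i, f.degreeOf i ≤ m i)
    {G : (Fin 4 → Vec) → ℂ} (hG : Differentiable ℂ G)
    (h : ∀ U : Fin 4 → Vec, (∀ i, U i 1 ≠ 0) →
      G U = (∏ i, (U i 1) ^ m i) * eval (fun i => U i 0 / U i 1) f) (U : Fin 4 → Vec) :
    hom m f U = G U := by
  refine sub_eq_zero.1 (eq_zero_of_mul_of_ne (f := fun U : Fin 4 → Vec => ∏ i, U i 1)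
    (g := fun U => hom m f U - G U) (by fun_prop) ?_ ⟨fun _ => e1, by simp⟩ ?_ U)
  · unfold hom
    fun_prop
  · intro U
    by_cases hU : ∀ i, U i 1 ≠ 0
    · rw [h U hU, hom_of_ne hf hU, sub_self, mul_zero]
    · push Not at hU
      obtain ⟨i, hi⟩ := hU
      rw [Finset.prod_eq_zero (Finset.mem_univ i) hi, zero_mul]

@[fun_prop]
lemma Differentiable.mulVec {E : Type*} [NormedAddCommGroup E] [NormedSpace ℂ E]
    (M : Matrix (Fin 2) (Fin 2) ℂ) {u : E → Vec} (hu : Differentiable ℂ u) :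
    Differentiable ℂ fun e => M.mulVec (u e) := by
  refine differentiable_pi.2 fun i => ?_
  simp only [Matrix.mulVec, dotProduct, Fin.sum_univ_two]
  fun_prop

lemma formF_smul (c : Ten) (t : Fin 4 → ℂ) (W : Fin 4 → Vec) :
    formF c (fun i => t i • W i) = (∏ i, t i) * formF c W := by
  simp [formF, form_eq, Fin.prod_univ_four]
  ring

lemma smul_aff_div {u : Vec} (hu : u 1 ≠ 0) : u 1 • aff (u 0 / u 1) = u := by
  ext i
  fin_cases i <;> simp [mul_div_cancel₀ _ hu]

lemma hom_ofTen (c : Ten) (U : Fin 4 → Vec) : hom (fun _ => 1) (ofTen c) U = formF c U := by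
  refine hom_eq (degreeOf_ofTen_le c) (by fun_prop) (fun U hU => ?_) U
  have h : U = fun i => U i 1 • aff (U i 0 / U i 1) := funext fun i => (smul_aff_div (hU i)).symm
  conv_lhs => rw [h, formF_smul]
  simp [eval_ofTen]

lemma eval_moebAct_ofTen (g : Fin 4 → GL (Fin 2) ℂ) (c : Ten) (x : Fin 4 → ℂ) :
    eval x (moebAct (fun _ => 1) g (ofTen c)) =
      formF c (fun i => (g i).1.mulVec (aff (x i))) := by
  rw [eval_moebAct, hom_ofTen]

lemma update_update_smul (t : Fin 4 → ℂ) (W : Fin 4 → Vec) (k l : Fin 4) (a b : Vec) :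
    Function.update (Function.update (fun i => t i • W i) k a) l b =
      fun i => (if i = k ∨ i = l then 1 else t i) •
        Function.update (Function.update W k a) l b i := by
  ext i j
  by_cases hl : i = l
  · subst hl; simp
  · by_cases hk : i = k
    · subst hk; simp [hl]
    · simp [hk, hl]

lemma bq_smul (c : Ten) (k l : Fin 4) (t : Fin 4 → ℂ) (W : Fin 4 → Vec) :
    bq c k l (fun i => t i • W i) =
      (∏ i, if i = k ∨ i = l then 1 else t i) ^ 2 * bq c k l W := by
  simp only [bq, update_update_smul, formF_smul]
  ring

@[fun_prop]
lemma Differentiable.bq {E : Type*} [NormedAddCommGroup E] [NormedSpace ℂ E] {c : Ten}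
    {k l : Fin 4} {U : E → Fin 4 → Vec} (hU : Differentiable ℂ U) :
    Differentiable ℂ fun e => bq c k l (U e) := by
  have h (a b : Vec) : Differentiable ℂ fun e =>
      Function.update (Function.update (U e) k a) l b := by
    refine differentiable_pi.2 fun i => ?_
    by_cases hl : i = l
    · subst hl; simp
    · by_cases hk : i = k
      · subst hk; simp [hl]
      · simp only [Function.update_of_ne hl, Function.update_of_ne hk]
        fun_prop
  unfold _root_.bq
  have h00 := h e0 e0
  have h01 := h e0 e1
  have h10 := h e1 e0
  have h11 := h e1 e1
  fun_prop

lemma degreeOf_pderiv_le (i k : Fin 4) (f : Poly4) : degreeOf i (pderiv k f) ≤ degreeOf i f := by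
  refine degreeOf_le_iff.2 fun s hs => ?_
  rw [mem_support_iff, coeff_pderiv] at hs
  have := monomial_le_degreeOf i (mem_support_iff.2 (left_ne_zero_of_mul hs))
  exact le_trans (by simp) this

lemma degreeOf_eq_zero_of_eval {i : Fin 4} {f : Poly4}
    (h : ∀ x, eval (Function.update x i 0) f = eval x f) : degreeOf i f = 0 := by
  classical
  have hf : bind₁ (fun j => if j = i then (0 : Poly4) else X j) f = f := by
    refine MvPolynomial.funext fun x => ?_
    rw [← h x, ← coe_aeval_eq_eval, ← coe_aeval_eq_eval, RingHom.coe_coe, RingHom.coe_coe,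
      aeval_bind₁]
    congr 2
    funext j
    by_cases hj : j = i
    · subst hj; simp
    · simp [hj]
  rw [← Nat.le_zero, degreeOf_le_iff]
  intro s hs
  by_contra hne
  have hi : i ∈ vars f := (mem_vars_iff_mem_support i).2 ⟨s, hs, by simpa using hne⟩
  rw [← hf] at hi
  have := vars_bind₁ _ _ hi
  simp only [Finset.mem_biUnion] at this
  obtain ⟨j, -, hj⟩ := this
  split_ifs at hj with hji
  · simp at hj
  · simp only [vars_X, Finset.mem_singleton] at hj
    exact hji hj.symm

lemma degreeOf_biquad_le (c : Ten) {k l : Fin 4} (hkl : k ≠ l) (i : Fin 4) :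
    degreeOf i (biquad (ofTen c) k l) ≤ if i = k ∨ i = l then 0 else 2 := by
  have h0 := degreeOf_ofTen_le c i
  split_ifs with h
  · refine (degreeOf_eq_zero_of_eval fun x => ?_).le
    simp only [eval_biquad_ofTen c hkl, bq]
    have hu (a b : Vec) :
        Function.update (Function.update (fun j => aff (Function.update x i 0 j)) k a) l b =
          Function.update (Function.update (fun j => aff (x j)) k a) l b := by
      ext j m
      by_cases hl : j = l
      · subst hl; simp
      · by_cases hk : j = k
        · subst hk; simp [hl]
        · have : j ≠ i := by rintro rfl; tauto
          simp [hk, hl, this]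
    simp only [hu]
  · have h1 (k) := (degreeOf_pderiv_le i k (ofTen c)).trans h0
    have h2 := (degreeOf_pderiv_le i k _).trans (h1 l)
    unfold biquad
    rw [sub_eq_add_neg]
    refine (degreeOf_add_le _ _ _).trans (max_le ?_ ?_)
    · exact (degreeOf_mul_le _ _ _).trans (Nat.add_le_add (h1 k) (h1 l))
    · rw [← neg_mul, show -ofTen c = C (-1) * ofTen c by simp]
      exact (degreeOf_mul_le _ _ _).trans
        (Nat.add_le_add ((degreeOf_C_mul_le _ _ _).trans h0) h2)

lemma hom_biquad (c : Ten) {k l : Fin 4} (hkl : k ≠ l) (U : Fin 4 → Vec) :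
    hom (fun i => if i = k ∨ i = l then 0 else 2) (biquad (ofTen c) k l) U = -bq c k l U := by
  refine hom_eq (G := fun U => -bq c k l U) (degreeOf_biquad_le c hkl) (by fun_prop)
    (fun U hU => ?_) U
  have h : U = fun i => U i 1 • aff (U i 0 / U i 1) := funext fun i => (smul_aff_div (hU i)).symm
  conv_lhs => rw [h, bq_smul]
  rw [eval_biquad_ofTen c hkl, ← Finset.prod_pow]
  rw [mul_neg]
  congr 2
  refine Finset.prod_congr rfl fun i _ => ?_
  split_ifs <;> simp

/-! ### Degenerate biquadratics -/

lemma X_sub_C_dvd {i : Fin 4} {a : ℂ} {f : Poly4}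
    (h : ∀ x : Fin 4 → ℂ, x i = a → eval x f = 0) : X i - C a ∣ f := by
  rw [← Ideal.mem_span_singleton, ← Ideal.Quotient.eq_zero_iff_mem]
  set π := Ideal.Quotient.mkₐ ℂ (Ideal.span {(X i - C a : Poly4)})
  have hi : π (X i) = π (C a) := by
    rw [← sub_eq_zero, ← map_sub]
    exact Ideal.Quotient.eq_zero_iff_mem.2 (Ideal.mem_span_singleton_self _)
  have hf : bind₁ (Function.update X i (C a)) f = (0 : Poly4) := by
    refine MvPolynomial.funext fun x => ?_
    rw [map_zero, ← h (Function.update x i a) (by simp), ← coe_aeval_eq_eval,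
      ← coe_aeval_eq_eval, RingHom.coe_coe, RingHom.coe_coe, aeval_bind₁]
    congr 2
    funext j
    by_cases hj : j = i
    · subst hj; simp
    · simp [hj]
  have hπ : π.comp (bind₁ (Function.update X i (C a))) = π := by
    refine MvPolynomial.algHom_ext fun j => ?_
    by_cases hj : j = i
    · subst hj; simp [hi]
    · simp [hj]
  have := DFunLike.congr_fun hπ f
  rw [AlgHom.comp_apply, hf, map_zero] at this
  exact this.symm

/-- The biquadratic obtained by eliminating the arguments `k` and `l` vanishes identically at some
point `p ∈ ℙ¹` for one of its two arguments. -/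
def IsDeg (c : Ten) (k l : Fin 4) : Prop :=
  ∃ i, i ≠ k ∧ i ≠ l ∧ ∃ p : Vec, p ≠ 0 ∧ ∀ U : Fin 4 → Vec, U i = p → bq c k l U = 0

lemma bq_comm (c : Ten) {k l : Fin 4} (hkl : k ≠ l) (U : Fin 4 → Vec) :
    bq c k l U = bq c l k U := by
  simp only [bq, Function.update_comm hkl]
  ring

lemma isDeg_comm {c : Ten} {k l : Fin 4} (hkl : k ≠ l) : IsDeg c k l ↔ IsDeg c l k := by
  simp only [IsDeg, bq_comm c hkl]
  exact ⟨fun ⟨i, h1, h2, h⟩ => ⟨i, h2, h1, h⟩, fun ⟨i, h1, h2, h⟩ => ⟨i, h2, h1, h⟩⟩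

lemma exists_gl_mulVec_e1 {p : Vec} (hp : p ≠ 0) : ∃ g : GL (Fin 2) ℂ, g.1.mulVec e1 = p := by
  rcases vec_ne_zero_iff.1 hp with h | h
  · refine ⟨Matrix.GeneralLinearGroup.mkOfDetNeZero !![0, p 0; 1, p 1] (by
      simpa [Matrix.det_fin_two] using h), ?_⟩
    ext i
    fin_cases i <;> simp [Matrix.GeneralLinearGroup.mkOfDetNeZero, Matrix.mulVec, dotProduct]
  · refine ⟨Matrix.GeneralLinearGroup.mkOfDetNeZero !![1, p 0; 0, p 1] (by
      simpa [Matrix.det_fin_two] using h), ?_⟩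
    ext i
    fin_cases i <;> simp [Matrix.GeneralLinearGroup.mkOfDetNeZero, Matrix.mulVec, dotProduct]

lemma gl_mulVec_ne_zero (g : GL (Fin 2) ℂ) {p : Vec} (hp : p ≠ 0) : g.1.mulVec p ≠ 0 := by
  intro h
  apply hp
  have : (g⁻¹).1.mulVec (g.1.mulVec p) = p := by
    rw [Matrix.mulVec_mulVec, ← Units.val_mul, inv_mul_cancel, Units.val_one, Matrix.one_mulVec]
  rw [← this, h, Matrix.mulVec_zero]

lemma isDegenerateBiquad_iff (c : Ten) (π : Equiv.Perm (Fin 4)) :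
    IsDegenerateBiquad (biquad (ofTen c) (π 2) (π 3)) (π 0) (π 1) ↔ IsDeg c (π 2) (π 3) := by
  have hne : π 2 ≠ π 3 := by simp
  have hm : (fun k => if k = π 0 ∨ k = π 1 then 2 else 0) =
      fun k => if k = π 2 ∨ k = π 3 then 0 else 2 := by
    funext k
    obtain ⟨a, rfl⟩ := π.surjective k
    fin_cases a <;> simp
  have hcases (i) : (i ≠ π 2 ∧ i ≠ π 3) ↔ (i = π 0 ∨ i = π 1) := by
    obtain ⟨a, rfl⟩ := π.surjective i
    fin_cases a <;> simp
  unfold IsDegenerateBiquad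
  rw [hm]
  constructor
  · rintro ⟨g, a, hd⟩
    obtain ⟨i, hi, hd⟩ : ∃ i, (i = π 0 ∨ i = π 1) ∧ (X i - C a : Poly4) ∣
        moebAct (fun k => if k = π 2 ∨ k = π 3 then 0 else 2) g
          (biquad (ofTen c) (π 2) (π 3)) := by
      rcases hd with hd | hd
      exacts [⟨_, Or.inl rfl, hd⟩, ⟨_, Or.inr rfl, hd⟩]
    obtain ⟨h2, h3⟩ := (hcases i).2 hi
    refine ⟨i, h2, h3, (g i).1.mulVec (aff a), gl_mulVec_ne_zero _ (aff_ne_zero a), ?_⟩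
    have key (x : Fin 4 → ℂ) (hx : x i = a) :
        bq c (π 2) (π 3) (fun j => (g j).1.mulVec (aff (x j))) = 0 := by
      obtain ⟨q, hq⟩ := hd
      have := congrArg (eval x) hq
      rw [eval_moebAct, hom_biquad c hne, map_mul] at this
      simpa [hx] using this
    -- first for the points that are affine in the coordinates given by `g`, then for all
    have key2 (W : Fin 4 → Vec) :
        bq c (π 2) (π 3) (fun j => (g j).1.mulVec (Function.update W i (aff a) j)) = 0 := by
      refine eq_zero_of_mul_of_ne (f := fun W : Fin 4 → Vec => ∏ i, W i 1)
        (g := fun W => bq c (π 2) (π 3)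
          (fun j => (g j).1.mulVec (Function.update W i (aff a) j))) (by fun_prop) ?_
          ⟨fun _ => e1, by simp⟩ (fun W => ?_) W
      · refine Differentiable.bq (differentiable_pi.2 fun j => ?_)
        by_cases hj : j = i
        · subst hj; simp
        · simp only [Function.update_of_ne hj]
          fun_prop
      · by_cases hW : ∀ j, W j 1 ≠ 0
        · have : (fun j => (g j).1.mulVec (Function.update W i (aff a) j)) = fun j =>
              (Function.update (fun j => W j 1) i 1 j) •
              (g j).1.mulVec (aff (Function.update (fun j => W j 0 / W j 1) i a j)) := by
            funext j
            by_cases hj : j = i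
            · subst hj; simp
            · simp only [Function.update_of_ne hj, ← Matrix.mulVec_smul, smul_aff_div (hW j)]
          rw [this, bq_smul, key _ (by simp), mul_zero, mul_zero]
        · push Not at hW
          obtain ⟨j, hj⟩ := hW
          rw [Finset.prod_eq_zero (Finset.mem_univ j) hj, zero_mul]
    intro U hU
    have := key2 fun j => (g j)⁻¹.1.mulVec (U j)
    convert this using 2
    funext j
    by_cases hj : j = i
    · subst hj; simp [hU]
    · rw [Function.update_of_ne hj, Matrix.mulVec_mulVec, ← Units.val_mul, mul_inv_cancel,
        Units.val_one, Matrix.one_mulVec]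
  · rintro ⟨i, h2, h3, p, hp, h⟩
    obtain ⟨g, hg⟩ := exists_gl_mulVec_e1 hp
    refine ⟨fun _ => g, 0, ?_⟩
    have : (X i - C 0 : Poly4) ∣ moebAct (fun k => if k = π 2 ∨ k = π 3 then 0 else 2)
        (fun _ => g) (biquad (ofTen c) (π 2) (π 3)) := by
      refine X_sub_C_dvd fun x hx => ?_
      rw [eval_moebAct, hom_biquad c hne, h, neg_zero]
      rw [hx, ← hg]
      rfl
    rcases (hcases i).1 ⟨h2, h3⟩ with rfl | rfl
    exacts [Or.inl this, Or.inr this]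

lemma mem_degeneratePairs_iff (c : Ten) (π : Equiv.Perm (Fin 4)) :
    {π 0, π 1} ∈ degeneratePairs (ofTen c) ↔ IsDeg c (π 2) (π 3) := by
  rw [← isDegenerateBiquad_iff]
  refine ⟨?_, fun h => ⟨π, rfl, h⟩⟩
  rintro ⟨σ, hσ, h⟩
  rw [isDegenerateBiquad_iff] at h ⊢
  have hs (i) : (i = π 0 ∨ i = π 1) ↔ (i = σ 0 ∨ i = σ 1) := by
    simpa using Finset.ext_iff.1 hσ i
  have hc (τ : Equiv.Perm (Fin 4)) (i) : (i = τ 2 ∨ i = τ 3) ↔ ¬ (i = τ 0 ∨ i = τ 1) := by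
    obtain ⟨a, rfl⟩ := τ.surjective i
    fin_cases a <;> simp
  have hs' (i) : (i = π 2 ∨ i = π 3) ↔ (i = σ 2 ∨ i = σ 3) := by rw [hc, hc, hs]
  have h2 := (hs' (π 2)).1 (Or.inl rfl)
  have h3 := (hs' (π 3)).1 (Or.inr rfl)
  have hπ : π 2 ≠ π 3 := by simp
  have hσ' : σ 2 ≠ σ 3 := by simp
  rcases h2 with h2 | h2 <;> rcases h3 with h3 | h3
  · exact absurd (h2.trans h3.symm) hπ
  · rwa [h2, h3]
  · rw [h2, h3]; exact (isDeg_comm hσ').1 h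
  · exact absurd (h2.trans h3.symm) hπ

/-! ### Irreducibility -/

/-- None of the six biquadratics vanishes identically. -/
def NonzeroBiquads (c : Ten) : Prop := ∀ k l : Fin 4, k ≠ l → ∃ U, bq c k l U ≠ 0

lemma isDeg_of_forall_eq_e0 {c : Ten} {k : Fin 4}
    (h : ∀ U : Fin 4 → Vec, U k = e0 → formF c U = 0) {a b : Fin 4} (hab : a ≠ b) :
    IsDeg c a b := by
  by_cases hk : k = a ∨ k = b
  · have hex : ∀ a b : Fin 4, ∃ i, i ≠ a ∧ i ≠ b := by decide
    obtain ⟨i, hia, hib⟩ := hex a b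
    refine ⟨i, hia, hib, e1, e1_ne_zero, fun U _ => ?_⟩
    have h0 (a b : Fin 4) (v : Vec) (hab : a ≠ b) (hk : k = a) :
        formF c (Function.update (Function.update U a e0) b v) = 0 :=
      h _ (by subst hk; simp [hab])
    rcases hk with hk | hk
    · rw [bq, h0 a b _ hab hk, h0 a b _ hab hk]; ring
    · rw [bq_comm c hab, bq, h0 b a _ hab.symm hk, h0 b a _ hab.symm hk]; ring
  · push Not at hk
    refine ⟨k, hk.1, hk.2, e0, e0_ne_zero, fun U hU => ?_⟩
    have h0 (v w : Vec) : formF c (Function.update (Function.update U a v) b w) = 0 :=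
      h _ (by simp [hk.1, hk.2, hU])
    simp only [bq, h0, zero_mul, sub_zero]

/-- For an irreducible polynomial a biquadratic vanishes identically only if the polynomial does not
depend on one of its variables, and then all biquadratics are degenerate. -/
lemma nonzeroBiquads_of_irreducible {c : Ten} (hc : Irreducible (ofTen c)) {a b : Fin 4}
    (hab : a ≠ b) (hd : ¬ IsDeg c a b) : NonzeroBiquads c := by
  have hp (k : Fin 4) : pderiv k (ofTen c) ≠ 0 := by
    intro h0
    refine hd (isDeg_of_forall_eq_e0 (k := k) (fun U hU => ?_) hab)
    refine eq_zero_of_mul_of_ne (f := fun U : Fin 4 → Vec => ∏ i, U i 1)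
      (g := fun U => formF c (Function.update U k e0)) (by fun_prop) ?_
      ⟨fun _ => e1, by simp⟩ (fun U => ?_) U |>.symm ▸ by rw [← hU, Function.update_eq_self]
    · refine Differentiable.formF (differentiable_pi.2 fun i => ?_)
      by_cases hi : i = k
      · subst hi; simp
      · simp only [Function.update_of_ne hi]
        fun_prop
    · by_cases hU : ∀ j, U j 1 ≠ 0
      · have : Function.update U k e0 = fun j => (Function.update (fun j => U j 1) k 1 j) •
            Function.update (fun j => aff (U j 0 / U j 1)) k e0 j := by
          funext j
          by_cases hj : j = k
          · subst hj; simp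
          · simp only [Function.update_of_ne hj, smul_aff_div (hU j)]
        rw [this, formF_smul, ← eval_pderiv_ofTen, h0, map_zero, mul_zero, mul_zero]
      · push Not at hU
        obtain ⟨j, hj⟩ := hU
        rw [Finset.prod_eq_zero (Finset.mem_univ j) hj, zero_mul]
  have hnd (k : Fin 4) : ¬ ofTen c ∣ pderiv k (ofTen c) := by
    rintro ⟨r, hr⟩
    have hr0 : r ≠ 0 := by rintro rfl; exact hp k (by rw [hr, mul_zero])
    have h1 : degreeOf k (pderiv k (ofTen c)) = 0 := by
      refine degreeOf_eq_zero_of_eval fun x => ?_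
      rw [eval_pderiv_ofTen, eval_pderiv_ofTen]
      congr 1
      funext j
      by_cases hj : j = k
      · subst hj; simp
      · simp [hj]
    rw [hr, degreeOf_mul_eq hc.ne_zero hr0] at h1
    apply hp k
    refine pderiv_eq_zero_of_notMem_vars fun hk => ?_
    obtain ⟨s, hs, hks⟩ := (mem_vars_iff_mem_support k).1 hk
    have := monomial_le_degreeOf k hs
    have h2 : s k ≠ 0 := by simpa using hks
    omega
  intro k l hkl
  by_contra! h
  have hz : biquad (ofTen c) k l = 0 :=
    MvPolynomial.funext fun x => by rw [eval_biquad_ofTen c hkl, h, neg_zero, map_zero]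
  have : ofTen c ∣ pderiv k (ofTen c) * pderiv l (ofTen c) :=
    ⟨_, sub_eq_zero.1 hz⟩
  rcases hc.prime.dvd_or_dvd this with h | h
  exacts [hnd k h, hnd l h]

lemma pderiv_eq_zero_of_degreeOf {k : Fin 4} {f : Poly4} (h : degreeOf k f = 0) :
    pderiv k f = 0 := by
  refine pderiv_eq_zero_of_notMem_vars fun hk => ?_
  obtain ⟨s, hs, hks⟩ := (mem_vars_iff_mem_support k).1 hk
  have := monomial_le_degreeOf k hs
  have h2 : s k ≠ 0 := by simpa using hks
  omega

/-- The two factors of a reducible multi-affine polynomial have no variable in common, and then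
the biquadratic obtained by eliminating a variable of each factor is zero. -/
lemma irreducible_of_nonzeroBiquads {c : Ten} (h : NonzeroBiquads c) :
    Irreducible (ofTen c) := by
  have hne : ofTen c ≠ 0 := by
    intro h0
    obtain ⟨U, hU⟩ := h 0 1 (by decide)
    apply hU
    have h1 (U) : formF c U = 0 := by rw [← hom_ofTen, h0]; simp [hom]
    simp [bq, h1]
  have hcl {P R : Poly4} (hPR : ofTen c = P * R) (k : Fin 4) :
      degreeOf k P = 0 ∨ degreeOf k R = 0 := by
    have hP : P ≠ 0 := by rintro rfl; simp at hPR; exact hne hPR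
    have hR : R ≠ 0 := by rintro rfl; simp at hPR; exact hne hPR
    have := degreeOf_ofTen_le c k
    rw [hPR, degreeOf_mul_eq hP hR] at this
    omega
  have hbq {P R : Poly4} (hPR : ofTen c = P * R) {k l : Fin 4} (hkl : k ≠ l)
      (hk : degreeOf k R = 0) (hl : degreeOf l P = 0) : False := by
    obtain ⟨U, hU⟩ := h k l hkl
    rw [← neg_ne_zero, ← hom_biquad c hkl] at hU
    apply hU
    have : biquad (ofTen c) k l = 0 := by
      have hk' := pderiv_eq_zero_of_degreeOf hk
      have hl' := pderiv_eq_zero_of_degreeOf hl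
      have hkl' : pderiv k (pderiv l R) = 0 :=
        pderiv_eq_zero_of_degreeOf (Nat.le_zero.1 ((degreeOf_pderiv_le k l R).trans hk.le))
      rw [biquad, hPR]
      simp only [Derivation.leibniz, hk', hl', hkl', smul_eq_mul, mul_zero, zero_add, add_zero]
      ring
    rw [this]
    simp [hom]
  have hunit {P : Poly4} (hP : P ≠ 0) (hdeg : ∀ k, degreeOf k P = 0) : IsUnit P := by
    have : P.totalDegree = 0 := by
      rw [totalDegree_eq_zero_iff]
      intro s hs k
      have := monomial_le_degreeOf k hs
      rw [hdeg k] at this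
      omega
    rw [totalDegree_eq_zero_iff_eq_C.1 this] at hP ⊢
    exact (isUnit_iff_ne_zero.2 fun h0 => hP (by rw [h0, C_0])).map C
  refine ⟨fun hu => ?_, fun P R hPR => ?_⟩
  · obtain ⟨U, hU⟩ := h 0 1 (by decide)
    apply hU
    obtain ⟨r, -, hr⟩ := MvPolynomial.isUnit_iff_eq_C_of_isReduced.1 hu
    rw [← neg_eq_zero, ← hom_biquad c (by decide : (0 : Fin 4) ≠ 1)]
    have : biquad (ofTen c) 0 1 = 0 := by rw [hr]; simp [biquad]
    rw [this]
    simp [hom]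
  · have hP : P ≠ 0 := by rintro rfl; simp at hPR; exact hne hPR
    have hR : R ≠ 0 := by rintro rfl; simp at hPR; exact hne hPR
    by_cases hk : ∃ k, degreeOf k P ≠ 0
    · obtain ⟨k, hk⟩ := hk
      right
      refine hunit hR fun l => ?_
      by_contra hl
      have hkR := (hcl hPR k).resolve_left hk
      have hlP := (hcl hPR l).resolve_right hl
      exact hbq hPR (by rintro rfl; exact hk hlP) hkR hlP
    · push Not at hk
      exact Or.inl (hunit hP hk)

/-- A polynomial vanishes on the hypersurface of an irreducible multi-affine polynomial if it
vanishes at those points where the equation can be solved uniquely for its last argument. -/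
lemma ofTen_dvd {c : Ten} (hc : Irreducible (ofTen c)) (h3 : ∃ u v w, form c u v w e0 ≠ 0)
    {F : Poly4} (hF : ∀ x y z t : ℂ, form c (aff x) (aff y) (aff z) (aff t) = 0 →
      form c (aff x) (aff y) (aff z) e0 ≠ 0 → eval ![x, y, z, t] F = 0) : ofTen c ∣ F := by
  have hF' (x : Fin 4 → ℂ) (h0 : eval x (ofTen c) = 0)
      (h1 : eval x (pderiv 3 (ofTen c)) ≠ 0) : eval x F = 0 := by
    have hx : x = ![x 0, x 1, x 2, x 3] := by ext i; fin_cases i <;> rfl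
    rw [eval_ofTen] at h0
    rw [eval_pderiv_ofTen] at h1
    rw [hx]
    exact hF _ _ _ _ h0 (by simpa [formF, Function.update] using h1)
  have hmem : F * pderiv 3 (ofTen c) ∈
      vanishingIdeal ℂ (zeroLocus ℂ (Ideal.span {ofTen c})) := by
    rw [mem_vanishingIdeal_iff]
    intro x hx
    have hx0 : eval x (ofTen c) = 0 := by
      simpa using mem_zeroLocus_iff.1 hx _ (Ideal.mem_span_singleton_self _)
    by_cases h1 : eval x (pderiv 3 (ofTen c)) = 0
    · simp [h1]
    · simp [hF' x hx0 h1]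
  rw [vanishingIdeal_zeroLocus_eq_radical, Ideal.IsPrime.radical
    ((Ideal.span_singleton_prime hc.ne_zero).2 hc.prime), Ideal.mem_span_singleton] at hmem
  refine (hc.prime.dvd_or_dvd hmem).resolve_right ?_
  rintro ⟨r, hr⟩
  have hp : pderiv 3 (ofTen c) ≠ 0 := by
    intro h0
    obtain ⟨u, v, w, hne⟩ := h3
    apply hne
    have key (U : Fin 4 → Vec) : (∏ i, U i 1) * form c (U 0) (U 1) (U 2) e0 = 0 := by
      by_cases hU : ∀ j, U j 1 ≠ 0
      · have := eval_pderiv_ofTen c 3 fun j => U j 0 / U j 1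
        rw [h0, map_zero] at this
        rw [← smul_aff_div (hU 0), ← smul_aff_div (hU 1), ← smul_aff_div (hU 2)]
        have h2 := formF_smul c ![U 0 1, U 1 1, U 2 1, 1]
          ![aff (U 0 0 / U 0 1), aff (U 1 0 / U 1 1), aff (U 2 0 / U 2 1), e0]
        simp only [formF, Function.update] at this h2
        simp at this h2
        rw [h2, ← this, mul_zero, mul_zero]
      · push Not at hU
        obtain ⟨j, hj⟩ := hU
        rw [Finset.prod_eq_zero (Finset.mem_univ j) hj, zero_mul]
    exact eq_zero_of_mul_of_ne (by fun_prop) (by fun_prop) ⟨fun _ => e1, by simp⟩ key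
      ![u, v, w, e0]
  have hr0 : r ≠ 0 := by rintro rfl; exact hp (by rw [hr, mul_zero])
  have h1 : degreeOf 3 (pderiv 3 (ofTen c)) = 0 := by
    refine degreeOf_eq_zero_of_eval fun x => ?_
    rw [eval_pderiv_ofTen, eval_pderiv_ofTen]
    congr 1
    funext j
    by_cases hj : j = 3
    · subst hj; simp
    · simp [hj]
  rw [hr, degreeOf_mul_eq hc.ne_zero hr0] at h1
  exact hp (pderiv_eq_zero_of_degreeOf (by omega))

/-! ### The types Q and H⁴ -/

/-- The six pairs of variables. -/
def allPairs : Finset (Finset (Fin 4)) := {{0, 1}, {0, 2}, {0, 3}, {1, 2}, {1, 3}, {2, 3}}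

lemma degeneratePairs_subset (Q : Poly4) : degeneratePairs Q ⊆ allPairs := by
  have h : ∀ a b : Fin 4, a ≠ b → ({a, b} : Finset (Fin 4)) ∈ allPairs := by decide
  rintro e ⟨π, rfl, -⟩
  exact h _ _ (by simp)

lemma mem_degeneratePairs_iff' (c : Ten) {i j k l : Fin 4}
    (h : Function.Bijective ![i, j, k, l]) :
    {i, j} ∈ degeneratePairs (ofTen c) ↔ IsDeg c k l :=
  mem_degeneratePairs_iff c (Equiv.ofBijective _ h)

lemma isTypeQ_ofTen_iff {c : Ten} :
    IsTypeQ (ofTen c) ↔ NonzeroBiquads c ∧ ∀ k l, k ≠ l → ¬ IsDeg c k l := by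
  constructor
  · rintro ⟨⟨hirr, -⟩, hd⟩
    have h (k l : Fin 4) (hkl : k ≠ l) : ¬ IsDeg c k l := by
      obtain ⟨i, j, hij⟩ : ∃ i j, Function.Bijective ![i, j, k, l] := by
        revert k l
        decide
      rw [← mem_degeneratePairs_iff' c hij, hd]
      exact Set.notMem_empty _
    exact ⟨nonzeroBiquads_of_irreducible hirr (by decide : (0 : Fin 4) ≠ 1) (h _ _ (by decide)),
      h⟩
  · rintro ⟨hnz, hd⟩
    refine ⟨⟨irreducible_of_nonzeroBiquads hnz, degreeOf_ofTen_le c⟩,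
      Set.eq_empty_iff_forall_notMem.2 ?_⟩
    rintro e ⟨π, rfl, h⟩
    exact hd _ _ (by simp) ((isDegenerateBiquad_iff c π).1 h)

/-- The four pairs of variables other than `{0, 2}` and `{1, 3}`. -/
def crossPairs : Finset (Finset (Fin 4)) := {{0, 1}, {0, 3}, {1, 2}, {2, 3}}

lemma crossPairs_ncard : (crossPairs : Set (Finset (Fin 4))).ncard = 4 := by
  rw [Set.ncard_coe_finset]
  decide

/-- The biquadratics in the arguments `0, 2` and `1, 3` are not degenerate, and the other four
are. -/
structure IsH4 (c : Ten) : Prop where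
  nonzero : NonzeroBiquads c
  nd02 : ¬ IsDeg c 1 3
  nd13 : ¬ IsDeg c 0 2
  d01 : IsDeg c 2 3
  d03 : IsDeg c 1 2
  d12 : IsDeg c 0 3
  d23 : IsDeg c 0 1

lemma isH4_of_degeneratePairs {c : Ten} (hirr : Irreducible (ofTen c))
    (h : degeneratePairs (ofTen c) = crossPairs) : IsH4 c := by
  have h02 : ¬ IsDeg c 1 3 := by
    rw [← mem_degeneratePairs_iff' c (i := 0) (j := 2) (by decide), h]; decide
  refine ⟨nonzeroBiquads_of_irreducible hirr (by decide : (1 : Fin 4) ≠ 3) h02, h02, ?_, ?_, ?_,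
    ?_, ?_⟩
  · rw [← mem_degeneratePairs_iff' c (i := 1) (j := 3) (by decide), h]; decide
  · rw [← mem_degeneratePairs_iff' c (i := 0) (j := 1) (by decide), h]; decide
  · rw [← mem_degeneratePairs_iff' c (i := 0) (j := 3) (by decide), h]; decide
  · rw [← mem_degeneratePairs_iff' c (i := 1) (j := 2) (by decide), h]; decide
  · rw [← mem_degeneratePairs_iff' c (i := 2) (j := 3) (by decide), h]; decide

lemma IsTypeH4.isH4 {c : Ten} (h : IsTypeH4 (ofTen c))
    (h02 : {0, 2} ∉ degeneratePairs (ofTen c)) (h13 : {1, 3} ∉ degeneratePairs (ofTen c)) :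
    IsH4 c := by
  refine isH4_of_degeneratePairs h.1.1 (Set.eq_of_subset_of_ncard_le ?_ ?_)
  · intro e he
    have := degeneratePairs_subset _ he
    simp only [allPairs, Finset.coe_insert, Finset.coe_singleton, Set.mem_insert_iff,
      Set.mem_singleton_iff] at this
    rcases this with rfl | rfl | rfl | rfl | rfl | rfl
    · decide
    · exact absurd he h02
    · decide
    · decide
    · exact absurd he h13
    · decide
  · rw [crossPairs_ncard, h.2]

lemma IsTypeH4.isH4_of_isDeg {c : Ten} (h : IsTypeH4 (ofTen c)) (h01 : IsDeg c 2 3)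
    (h03 : IsDeg c 1 2) (h12 : IsDeg c 0 3) (h23 : IsDeg c 0 1) : IsH4 c := by
  refine isH4_of_degeneratePairs h.1.1 (Set.eq_of_subset_of_ncard_le ?_ ?_
    (allPairs.finite_toSet.subset (degeneratePairs_subset _))).symm
  · intro e he
    simp only [crossPairs, Finset.coe_insert, Finset.coe_singleton, Set.mem_insert_iff,
      Set.mem_singleton_iff] at he
    rcases he with rfl | rfl | rfl | rfl
    · exact (mem_degeneratePairs_iff' c (k := 2) (l := 3) (by decide)).2 h01
    · exact (mem_degeneratePairs_iff' c (k := 1) (l := 2) (by decide)).2 h03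
    · exact (mem_degeneratePairs_iff' c (k := 0) (l := 3) (by decide)).2 h12
    · exact (mem_degeneratePairs_iff' c (k := 0) (l := 1) (by decide)).2 h23
  · rw [crossPairs_ncard, h.2]

lemma IsH4.isTypeH4 {c : Ten} (h : IsH4 c) : IsTypeH4 (ofTen c) ∧
    {0, 2} ∉ degeneratePairs (ofTen c) ∧ {1, 3} ∉ degeneratePairs (ofTen c) := by
  have h02 : {0, 2} ∉ degeneratePairs (ofTen c) := by
    rw [mem_degeneratePairs_iff' c (k := 1) (l := 3) (by decide)]; exact h.nd02
  have h13 : {1, 3} ∉ degeneratePairs (ofTen c) := by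
    rw [mem_degeneratePairs_iff' c (k := 0) (l := 2) (by decide)]; exact h.nd13
  suffices hc : degeneratePairs (ofTen c) = crossPairs from
    ⟨⟨⟨irreducible_of_nonzeroBiquads h.nonzero, degreeOf_ofTen_le c⟩, by
      rw [hc, crossPairs_ncard]⟩, h02, h13⟩
  apply Set.Subset.antisymm
  · intro e he
    have := degeneratePairs_subset _ he
    simp only [allPairs, Finset.coe_insert, Finset.coe_singleton, Set.mem_insert_iff,
      Set.mem_singleton_iff] at this
    rcases this with rfl | rfl | rfl | rfl | rfl | rfl
    · decide
    · exact absurd he h02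
    · decide
    · decide
    · exact absurd he h13
    · decide
  · intro e he
    simp only [crossPairs, Finset.coe_insert, Finset.coe_singleton, Set.mem_insert_iff,
      Set.mem_singleton_iff] at he
    rcases he with rfl | rfl | rfl | rfl
    · exact (mem_degeneratePairs_iff' c (k := 2) (l := 3) (by decide)).2 h.d01
    · exact (mem_degeneratePairs_iff' c (k := 1) (l := 2) (by decide)).2 h.d03
    · exact (mem_degeneratePairs_iff' c (k := 0) (l := 3) (by decide)).2 h.d12
    · exact (mem_degeneratePairs_iff' c (k := 0) (l := 1) (by decide)).2 h.d23

/-! ### Solving a multilinear equation for one argument -/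

/-- The solution of `form c u v w z = 0` for `z`; it is zero if the equation is degenerate. -/
def k3 (c : Ten) (u v w : Vec) : Vec := ![form c u v w e1, -form c u v w e0]

/-- The solution of `form c u v w z = 0` for `w`. -/
def k2 (c : Ten) (u v z : Vec) : Vec := ![form c u v e1 z, -form c u v e0 z]

/-- The solution of `form c u v w z = 0` for `v`. -/
def k1 (c : Ten) (u w z : Vec) : Vec := ![form c u e1 w z, -form c u e0 w z]

@[fun_prop]
lemma Differentiable.k3 {E : Type*} [NormedAddCommGroup E] [NormedSpace ℂ E] {c : Ten}
    {u v w : E → Vec} (hu : Differentiable ℂ u) (hv : Differentiable ℂ v)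
    (hw : Differentiable ℂ w) : Differentiable ℂ fun e => k3 c (u e) (v e) (w e) := by
  refine differentiable_pi.2 fun i => ?_
  fin_cases i <;> simp [_root_.k3] <;> fun_prop

@[fun_prop]
lemma Differentiable.k2 {E : Type*} [NormedAddCommGroup E] [NormedSpace ℂ E] {c : Ten}
    {u v z : E → Vec} (hu : Differentiable ℂ u) (hv : Differentiable ℂ v)
    (hz : Differentiable ℂ z) : Differentiable ℂ fun e => k2 c (u e) (v e) (z e) := by
  refine differentiable_pi.2 fun i => ?_
  fin_cases i <;> simp [_root_.k2] <;> fun_prop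

lemma form_smul₀ (c : Ten) (t : ℂ) (u v w z : Vec) :
    form c (t • u) v w z = t * form c u v w z := by
  simp only [form_eq, Pi.smul_apply, smul_eq_mul]; ring

lemma form_smul₁ (c : Ten) (t : ℂ) (u v w z : Vec) :
    form c u (t • v) w z = t * form c u v w z := by
  simp only [form_eq, Pi.smul_apply, smul_eq_mul]; ring

lemma form_smul₂ (c : Ten) (t : ℂ) (u v w z : Vec) :
    form c u v (t • w) z = t * form c u v w z := by
  simp only [form_eq, Pi.smul_apply, smul_eq_mul]; ring

lemma form_smul₃ (c : Ten) (t : ℂ) (u v w z : Vec) :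
    form c u v w (t • z) = t * form c u v w z := by
  simp only [form_eq, Pi.smul_apply, smul_eq_mul]; ring

lemma k3_smul₁ (c : Ten) (t : ℂ) (u v w : Vec) : k3 c u (t • v) w = t • k3 c u v w := by
  ext i; fin_cases i <;> simp [k3, form_smul₁]

lemma k3_smul₂ (c : Ten) (t : ℂ) (u v w : Vec) : k3 c u v (t • w) = t • k3 c u v w := by
  ext i; fin_cases i <;> simp [k3, form_smul₂]

lemma form_expand₃ (c : Ten) (u v w z : Vec) :
    form c u v w z = z 0 * form c u v w e0 + z 1 * form c u v w e1 := by
  simp only [form_eq, e0_zero, e0_one, e1_zero, e1_one]; ring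

lemma form_k3 (c : Ten) (u v w : Vec) : form c u v w (k3 c u v w) = 0 := by
  rw [form_expand₃]
  simp [k3]
  ring

lemma form_k2 (c : Ten) (u v z : Vec) : form c u v (k2 c u v z) z = 0 := by
  simp only [k2, form_eq, Matrix.cons_val_zero, Matrix.cons_val_one, e0_zero, e0_one, e1_zero,
    e1_one]; ring

lemma exists_eq_smul_k3 {c : Ten} {u v w z : Vec} (h : form c u v w z = 0)
    (hne : ∃ y, form c u v w y ≠ 0) : ∃ t : ℂ, z = t • k3 c u v w := by
  obtain ⟨y, hy⟩ := hne
  rw [form_expand₃] at h hy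
  by_cases h0 : form c u v w e0 = 0
  · have h1 : form c u v w e1 ≠ 0 := by rintro h1; simp [h0, h1] at hy
    refine ⟨z 0 / form c u v w e1, ?_⟩
    ext i
    fin_cases i
    · simp [k3, h1]
    · simpa [k3, h0, h1] using h
  · refine ⟨-z 1 / form c u v w e0, ?_⟩
    ext i
    fin_cases i
    · simp [k3]
      field_simp
      linear_combination h
    · simp [k3, h0]

/-- The determinant of the form in its arguments `2` and `3`. -/
def d23 (c : Ten) (u v : Vec) : ℂ :=
  form c u v e0 e0 * form c u v e1 e1 - form c u v e0 e1 * form c u v e1 e0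

/-- The determinant of the form in its arguments `1` and `3`. -/
def d13 (c : Ten) (u w : Vec) : ℂ :=
  form c u e0 w e0 * form c u e1 w e1 - form c u e0 w e1 * form c u e1 w e0

/-- The determinant of the form in its arguments `1` and `2`. -/
def d12 (c : Ten) (u z : Vec) : ℂ :=
  form c u e0 e0 z * form c u e1 e1 z - form c u e0 e1 z * form c u e1 e0 z

/-- The determinant of the form in its arguments `0` and `3`. -/
def d03 (c : Ten) (v w : Vec) : ℂ :=
  form c e0 v w e0 * form c e1 v w e1 - form c e0 v w e1 * form c e1 v w e0

/-- The determinant of the form in its arguments `0` and `2`. -/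
def d02 (c : Ten) (v z : Vec) : ℂ :=
  form c e0 v e0 z * form c e1 v e1 z - form c e0 v e1 z * form c e1 v e0 z

/-- The determinant of the form in its arguments `0` and `1`. -/
def d01 (c : Ten) (w z : Vec) : ℂ :=
  form c e0 e0 w z * form c e1 e1 w z - form c e0 e1 w z * form c e1 e0 w z

lemma bq_23 (c : Ten) (U : Fin 4 → Vec) : bq c 2 3 U = d23 c (U 0) (U 1) := by
  simp [bq, formF, d23, Function.update]

lemma bq_13 (c : Ten) (U : Fin 4 → Vec) : bq c 1 3 U = d13 c (U 0) (U 2) := by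
  simp [bq, formF, d13, Function.update]

lemma bq_12 (c : Ten) (U : Fin 4 → Vec) : bq c 1 2 U = d12 c (U 0) (U 3) := by
  simp [bq, formF, d12, Function.update]

lemma bq_03 (c : Ten) (U : Fin 4 → Vec) : bq c 0 3 U = d03 c (U 1) (U 2) := by
  simp [bq, formF, d03, Function.update]

lemma bq_02 (c : Ten) (U : Fin 4 → Vec) : bq c 0 2 U = d02 c (U 1) (U 3) := by
  simp [bq, formF, d02, Function.update]

lemma bq_01 (c : Ten) (U : Fin 4 → Vec) : bq c 0 1 U = d01 c (U 2) (U 3) := by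
  simp [bq, formF, d01, Function.update]

lemma k3_k1 (c : Ten) (u w z : Vec) : k3 c u (k1 c u w z) w = (-d13 c u w) • z := by
  ext i
  fin_cases i <;> simp [k3, k1, d13, form_eq] <;> ring

lemma k3_k2 (c : Ten) (u v z : Vec) : k3 c u v (k2 c u v z) = (-d23 c u v) • z := by
  ext i
  fin_cases i <;> simp [k3, k2, d23, form_eq] <;> ring

@[fun_prop]
lemma Differentiable.d23 {E : Type*} [NormedAddCommGroup E] [NormedSpace ℂ E] {c : Ten}
    {u v : E → Vec} (hu : Differentiable ℂ u) (hv : Differentiable ℂ v) :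
    Differentiable ℂ fun e => d23 c (u e) (v e) := by
  unfold _root_.d23
  fun_prop

@[fun_prop]
lemma Differentiable.d13 {E : Type*} [NormedAddCommGroup E] [NormedSpace ℂ E] {c : Ten}
    {u v : E → Vec} (hu : Differentiable ℂ u) (hv : Differentiable ℂ v) :
    Differentiable ℂ fun e => d13 c (u e) (v e) := by
  unfold _root_.d13
  fun_prop

lemma NonzeroBiquads.exists_d23 {c : Ten} (h : NonzeroBiquads c) : ∃ u v, d23 c u v ≠ 0 := by
  obtain ⟨U, hU⟩ := h 2 3 (by decide)
  exact ⟨_, _, by rwa [bq_23] at hU⟩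

lemma NonzeroBiquads.exists_d13 {c : Ten} (h : NonzeroBiquads c) : ∃ u v, d13 c u v ≠ 0 := by
  obtain ⟨U, hU⟩ := h 1 3 (by decide)
  exact ⟨_, _, by rwa [bq_13] at hU⟩

lemma NonzeroBiquads.exists_form_e0 {c : Ten} (h : NonzeroBiquads c) :
    ∃ u v w, form c u v w e0 ≠ 0 := by
  obtain ⟨u, v, hU⟩ := h.exists_d23
  by_contra! h0
  simp [d23, h0] at hU

/-! ### Systems on the cube -/

/-- A system of multi-affine equations on the faces of a cube, given by multilinear forms; see
`CubeSystem` for the order of the arguments. -/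
structure Sys where
  A : Ten
  A' : Ten
  B : Ten
  B' : Ten
  C : Ten
  C' : Ten

/-- The polynomials of a system. -/
def Sys.toCube (s : Sys) : CubeSystem where
  A := ofTen s.A
  A' := ofTen s.A'
  B := ofTen s.B
  B' := ofTen s.B'
  C := ofTen s.C
  C' := ofTen s.C'

/-- Interchange of the arguments `0` with `1` and `2` with `3`. -/
def mir (c : Ten) : Ten := fun i j k l => c j i l k

lemma form_mir (c : Ten) (u v w z : Vec) : form (mir c) u v w z = form c v u z w := by
  simp only [form_eq, mir]; ring

/-- The reflection of the cube which interchanges the faces of `B` and `B'`. -/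
def Sys.mirror (s : Sys) : Sys where
  A := mir s.A
  A' := mir s.A'
  B := s.B'
  B' := s.B
  C := mir s.C
  C' := mir s.C'

/-- Consistency in polynomial form: for arbitrary `x, x₁, x₂, x₃`, the value of `x₁₂₃` computed
from `B'` satisfies the equations `A'` and `C'`. -/
def Sys.HC (s : Sys) : Prop := ∀ u u1 u2 u3 : Vec,
  form s.A' u3 (k3 s.C u u1 u3) (k3 s.B u u2 u3)
    (k3 s.B' u1 (k3 s.A u u1 u2) (k3 s.C u u1 u3)) = 0 ∧
  form s.C' u2 (k3 s.A u u1 u2) (k3 s.B u u2 u3)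
    (k3 s.B' u1 (k3 s.A u u1 u2) (k3 s.C u u1 u3)) = 0

lemma Sys.HC.apply {s : Sys} (h : s.HC) {u u1 u2 u3 u12 u13 u23 u123 : Vec}
    (hA : form s.A u u1 u2 u12 = 0) (hC : form s.C u u1 u3 u13 = 0)
    (hB : form s.B u u2 u3 u23 = 0) (hB' : form s.B' u1 u12 u13 u123 = 0)
    (hA0 : ∃ w, form s.A u u1 u2 w ≠ 0) (hC0 : ∃ w, form s.C u u1 u3 w ≠ 0)
    (hB0 : ∃ w, form s.B u u2 u3 w ≠ 0) (hB'0 : ∃ w, form s.B' u1 u12 u13 w ≠ 0) :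
    form s.A' u3 u13 u23 u123 = 0 ∧ form s.C' u2 u12 u23 u123 = 0 := by
  obtain ⟨t1, rfl⟩ := exists_eq_smul_k3 hA hA0
  obtain ⟨t2, rfl⟩ := exists_eq_smul_k3 hC hC0
  obtain ⟨t3, rfl⟩ := exists_eq_smul_k3 hB hB0
  obtain ⟨t4, rfl⟩ := exists_eq_smul_k3 hB' hB'0
  simp only [k3_smul₁, k3_smul₂, form_smul₁, form_smul₂, form_smul₃, (h u u1 u2 u3).1,
    (h u u1 u2 u3).2, mul_zero, and_self]

lemma Sys.hc_of_forall {s : Sys} (h : ∀ u u1 u2 u3 u12 u13 u23 u123 : Vec,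
    form s.A u u1 u2 u12 = 0 → form s.C u u1 u3 u13 = 0 → form s.B u u2 u3 u23 = 0 →
    form s.B' u1 u12 u13 u123 = 0 → (∃ w, form s.A u u1 u2 w ≠ 0) →
    (∃ w, form s.C u u1 u3 w ≠ 0) → (∃ w, form s.B u u2 u3 w ≠ 0) →
    (∃ w, form s.B' u1 u12 u13 w ≠ 0) →
    form s.A' u3 u13 u23 u123 = 0 ∧ form s.C' u2 u12 u23 u123 = 0) : s.HC := by
  intro u u1 u2 u3
  have hz (c : Ten) (u v w : Vec) (h0 : ¬ ∃ z, form c u v w z ≠ 0) : k3 c u v w = 0 := by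
    push Not at h0
    ext i
    fin_cases i <;> simp [k3, h0]
  have f1 (c : Ten) (u w z : Vec) : form c u 0 w z = 0 := by simp [form_eq]
  have f2 (c : Ten) (u w z : Vec) : form c u w 0 z = 0 := by simp [form_eq]
  have f3 (c : Ten) (u w z : Vec) : form c u w z 0 = 0 := by simp [form_eq]
  have g1 (c : Ten) (u w : Vec) : k3 c u 0 w = 0 := by
    ext i
    fin_cases i <;> simp [k3, f1]
  have g2 (c : Ten) (u w : Vec) : k3 c u w 0 = 0 := by
    ext i
    fin_cases i <;> simp [k3, f2]
  by_cases hA : ∃ w, form s.A u u1 u2 w ≠ 0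
  swap
  · simp [hz _ _ _ _ hA, f1, f3, g1]
  by_cases hC : ∃ w, form s.C u u1 u3 w ≠ 0
  swap
  · simp [hz _ _ _ _ hC, f1, f3, g2]
  by_cases hB : ∃ w, form s.B u u2 u3 w ≠ 0
  swap
  · simp [hz _ _ _ _ hB, f2]
  by_cases hB' : ∃ w, form s.B' u1 (k3 s.A u u1 u2) (k3 s.C u u1 u3) w ≠ 0
  swap
  · simp [hz _ _ _ _ hB', f3]
  exact h _ _ _ _ _ _ _ _ (form_k3 _ _ _ _) (form_k3 _ _ _ _) (form_k3 _ _ _ _)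
    (form_k3 _ _ _ _) hA hC hB hB'

lemma k3_mir (c : Ten) (u v w : Vec) : k3 (mir c) u v w = k2 c v u w := by
  simp only [k3, k2, form_mir]

/-- Consistency does not depend on the vertex at which the initial data are given. -/
lemma Sys.HC.mirror {s : Sys} (h : s.HC) (hA : NonzeroBiquads s.A) (hC : NonzeroBiquads s.C) :
    s.mirror.HC := by
  have hne : ∃ U : Fin 4 → Vec, (d23 s.A (U 0) (U 1) * d23 s.C (U 0) (U 1)) *
      (d23 s.A (U 0) (U 1) * d23 s.C (U 0) (U 1)) ≠ 0 := by
    have hAC : ∃ U : Fin 4 → Vec, d23 s.A (U 0) (U 1) * d23 s.C (U 0) (U 1) ≠ 0 := by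
      refine exists_mul_ne_zero (by fun_prop) (by fun_prop) ?_ ?_
      · obtain ⟨u, v, huv⟩ := hA.exists_d23
        exact ⟨![u, v, 0, 0], huv⟩
      · obtain ⟨u, v, huv⟩ := hC.exists_d23
        exact ⟨![u, v, 0, 0], huv⟩
    exact exists_mul_ne_zero (by fun_prop) (by fun_prop) hAC hAC
  intro u1 u u12 u13
  simp only [Sys.mirror, k3_mir, form_mir]
  constructor
  · refine eq_zero_of_mul_of_ne (g := fun U : Fin 4 → Vec => form s.A' (k2 s.C (U 0) (U 1) (U 3))
      (U 3) (k3 s.B (U 0) (k2 s.A (U 0) (U 1) (U 2)) (k2 s.C (U 0) (U 1) (U 3)))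
      (k3 s.B' (U 1) (U 2) (U 3))) (by fun_prop) (by fun_prop) hne (fun U => ?_)
      ![u, u1, u12, u13]
    have := (h (U 0) (U 1) (k2 s.A (U 0) (U 1) (U 2)) (k2 s.C (U 0) (U 1) (U 3))).1
    simp only [k3_k2, k3_smul₁, k3_smul₂, form_smul₁, form_smul₃] at this
    linear_combination (-d23 s.A (U 0) (U 1)) * this
  · refine eq_zero_of_mul_of_ne (g := fun U : Fin 4 → Vec => form s.C' (k2 s.A (U 0) (U 1) (U 2))
      (U 2) (k3 s.B (U 0) (k2 s.A (U 0) (U 1) (U 2)) (k2 s.C (U 0) (U 1) (U 3)))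
      (k3 s.B' (U 1) (U 2) (U 3))) (by fun_prop) (by fun_prop) hne (fun U => ?_)
      ![u, u1, u12, u13]
    have := (h (U 0) (U 1) (k2 s.A (U 0) (U 1) (U 2)) (k2 s.C (U 0) (U 1) (U 3))).2
    simp only [k3_k2, k3_smul₁, k3_smul₂, form_smul₁, form_smul₃] at this
    linear_combination (-d23 s.C (U 0) (U 1)) * this

lemma determines_ofTen {c : Ten} {u v w z : Vec} (hu : u 1 ≠ 0) (hv : v 1 ≠ 0) (hw : w 1 ≠ 0)
    (hz : z 1 ≠ 0) (h : form c u v w z = 0) (h0 : form c u v w e0 ≠ 0) :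
    Determines (ofTen c) (u 0 / u 1) (v 0 / v 1) (w 0 / w 1) (z 0 / z 1) := by
  rw [← smul_aff_div hu, ← smul_aff_div hv, ← smul_aff_div hw] at h h0
  rw [← smul_aff_div hz] at h
  simp only [form_smul₀, form_smul₁, form_smul₂, form_smul₃, mul_eq_zero, hu, hv, hw, hz,
    false_or, ne_eq] at h h0
  refine ⟨by rwa [eval_ofTen'], ?_⟩
  rw [eval_pderiv_ofTen]
  simpa [formF, Function.update] using h0

lemma form_solution {c : Ten} {u v w z z' : Vec} (hz : z 1 ≠ 0) (hz' : z' 1 ≠ 0)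
    (h : z 0 / z 1 = z' 0 / z' 1) (h0 : form c u v w z = 0) : form c u v w z' = 0 := by
  rw [← smul_aff_div hz, form_smul₃, mul_eq_zero, or_iff_right hz] at h0
  rw [← smul_aff_div hz', form_smul₃, ← h, h0, mul_zero]

/-- The polynomials that express consistency vanish identically, because they vanish wherever all
values can be computed. -/
lemma Sys.hc_of_isConsistent {s : Sys} (hA : NonzeroBiquads s.A) (hA' : NonzeroBiquads s.A')
    (hB : NonzeroBiquads s.B) (hB' : NonzeroBiquads s.B') (hC : NonzeroBiquads s.C)
    (hC' : NonzeroBiquads s.C') (h : s.toCube.IsConsistent) : s.HC := by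
  -- the products of all the conditions under which the values can be computed
  have n0 : ∃ U : Fin 4 → Vec, U 0 1 * U 1 1 * (U 2 1 * U 3 1) ≠ 0 := ⟨fun _ => e1, by simp⟩
  have nA : ∃ U : Fin 4 → Vec, form s.A (U 0) (U 1) (U 2) e0 ≠ 0 := by
    obtain ⟨u, v, w, h⟩ := hA.exists_form_e0
    exact ⟨![u, v, w, 0], h⟩
  have nB : ∃ U : Fin 4 → Vec, form s.B (U 0) (U 2) (U 3) e0 ≠ 0 := by
    obtain ⟨u, v, w, h⟩ := hB.exists_form_e0
    exact ⟨![u, 0, v, w], h⟩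
  have nC : ∃ U : Fin 4 → Vec, form s.C (U 0) (U 1) (U 3) e0 ≠ 0 := by
    obtain ⟨u, v, w, h⟩ := hC.exists_form_e0
    exact ⟨![u, v, 0, w], h⟩
  have nA' : ∃ U : Fin 4 → Vec, form s.A' (U 3) (k3 s.C (U 0) (U 1) (U 3))
      (k3 s.B (U 0) (U 2) (U 3)) e0 ≠ 0 := by
    obtain ⟨U, hU⟩ : ∃ U : Fin 4 → Vec, form s.A' (U 1) (U 2) (U 3) e0 *
        (d13 s.C (U 0) (U 1) * d13 s.B (U 0) (U 1)) ≠ 0 := by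
      refine exists_mul_ne_zero (by fun_prop) (by fun_prop) ?_
        (exists_mul_ne_zero (by fun_prop) (by fun_prop) ?_ ?_)
      · obtain ⟨u, v, w, h⟩ := hA'.exists_form_e0
        exact ⟨![0, u, v, w], h⟩
      · obtain ⟨u, v, h⟩ := hC.exists_d13
        exact ⟨![u, v, 0, 0], h⟩
      · obtain ⟨u, v, h⟩ := hB.exists_d13
        exact ⟨![u, v, 0, 0], h⟩
    refine ⟨![U 0, k1 s.C (U 0) (U 1) (U 2), k1 s.B (U 0) (U 1) (U 3), U 1], ?_⟩
    simp only [mul_ne_zero_iff] at hU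
    simpa [k3_k1, form_smul₁, form_smul₂, -neg_smul] using ⟨hU.2.2, hU.2.1, hU.1⟩
  have nB' : ∃ U : Fin 4 → Vec, form s.B' (U 1) (k3 s.A (U 0) (U 1) (U 2))
      (k3 s.C (U 0) (U 1) (U 3)) e0 ≠ 0 := by
    obtain ⟨U, hU⟩ : ∃ U : Fin 4 → Vec, form s.B' (U 1) (U 2) (U 3) e0 *
        (d23 s.A (U 0) (U 1) * d23 s.C (U 0) (U 1)) ≠ 0 := by
      refine exists_mul_ne_zero (by fun_prop) (by fun_prop) ?_
        (exists_mul_ne_zero (by fun_prop) (by fun_prop) ?_ ?_)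
      · obtain ⟨u, v, w, h⟩ := hB'.exists_form_e0
        exact ⟨![0, u, v, w], h⟩
      · obtain ⟨u, v, h⟩ := hA.exists_d23
        exact ⟨![u, v, 0, 0], h⟩
      · obtain ⟨u, v, h⟩ := hC.exists_d23
        exact ⟨![u, v, 0, 0], h⟩
    refine ⟨![U 0, U 1, k2 s.A (U 0) (U 1) (U 2), k2 s.C (U 0) (U 1) (U 3)], ?_⟩
    simp only [mul_ne_zero_iff] at hU
    simpa [k3_k2, form_smul₁, form_smul₂, -neg_smul] using ⟨hU.2.2, hU.2.1, hU.1⟩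
  have nC' : ∃ U : Fin 4 → Vec, form s.C' (U 2) (k3 s.A (U 0) (U 1) (U 2))
      (k3 s.B (U 0) (U 2) (U 3)) e0 ≠ 0 := by
    obtain ⟨U, hU⟩ : ∃ U : Fin 4 → Vec, form s.C' (U 1) (U 2) (U 3) e0 *
        (d13 s.A (U 0) (U 1) * d23 s.B (U 0) (U 1)) ≠ 0 := by
      refine exists_mul_ne_zero (by fun_prop) (by fun_prop) ?_
        (exists_mul_ne_zero (by fun_prop) (by fun_prop) ?_ ?_)
      · obtain ⟨u, v, w, h⟩ := hC'.exists_form_e0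
        exact ⟨![0, u, v, w], h⟩
      · obtain ⟨u, v, h⟩ := hA.exists_d13
        exact ⟨![u, v, 0, 0], h⟩
      · obtain ⟨u, v, h⟩ := hB.exists_d23
        exact ⟨![u, v, 0, 0], h⟩
    refine ⟨![U 0, k1 s.A (U 0) (U 1) (U 2), U 1, k2 s.B (U 0) (U 1) (U 3)], ?_⟩
    simp only [mul_ne_zero_iff] at hU
    simpa [k3_k1, k3_k2, form_smul₁, form_smul₂, -neg_smul] using ⟨hU.2.2, hU.2.1, hU.1⟩
  have n1 := exists_mul_ne_zero (by fun_prop) (by fun_prop) n0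
    (exists_mul_ne_zero (by fun_prop) (by fun_prop) nA
    (exists_mul_ne_zero (by fun_prop) (by fun_prop) nB
    (exists_mul_ne_zero (by fun_prop) (by fun_prop) nC
    (exists_mul_ne_zero (by fun_prop) (by fun_prop) nA'
    (exists_mul_ne_zero (by fun_prop) (by fun_prop) nB' nC')))))
  have key (U : Fin 4 → Vec) (hU : U 0 1 * U 1 1 * (U 2 1 * U 3 1) *
      (form s.A (U 0) (U 1) (U 2) e0 * (form s.B (U 0) (U 2) (U 3) e0 *
      (form s.C (U 0) (U 1) (U 3) e0 * (form s.A' (U 3) (k3 s.C (U 0) (U 1) (U 3))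
      (k3 s.B (U 0) (U 2) (U 3)) e0 * (form s.B' (U 1) (k3 s.A (U 0) (U 1) (U 2))
      (k3 s.C (U 0) (U 1) (U 3)) e0 * form s.C' (U 2) (k3 s.A (U 0) (U 1) (U 2))
      (k3 s.B (U 0) (U 2) (U 3)) e0))))) ≠ 0) :
      form s.A' (U 3) (k3 s.C (U 0) (U 1) (U 3)) (k3 s.B (U 0) (U 2) (U 3))
        (k3 s.B' (U 1) (k3 s.A (U 0) (U 1) (U 2)) (k3 s.C (U 0) (U 1) (U 3))) = 0 ∧
      form s.C' (U 2) (k3 s.A (U 0) (U 1) (U 2)) (k3 s.B (U 0) (U 2) (U 3))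
        (k3 s.B' (U 1) (k3 s.A (U 0) (U 1) (U 2)) (k3 s.C (U 0) (U 1) (U 3))) = 0 := by
    simp only [mul_ne_zero_iff] at hU
    obtain ⟨⟨⟨hx, hx1⟩, hx2, hx3⟩, h1, h2, h3, h4, h5, h6⟩ := hU
    have hk (c : Ten) (u v w : Vec) (h : form c u v w e0 ≠ 0) : k3 c u v w 1 ≠ 0 := by
      simpa [k3] using h
    obtain ⟨e1, e2⟩ := h _ _ _ _ _ _ _ _ _ _
      (determines_ofTen hx hx1 hx2 (hk _ _ _ _ h1) (form_k3 _ _ _ _) h1)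
      (determines_ofTen hx hx1 hx3 (hk _ _ _ _ h3) (form_k3 _ _ _ _) h3)
      (determines_ofTen hx hx2 hx3 (hk _ _ _ _ h2) (form_k3 _ _ _ _) h2)
      (determines_ofTen hx3 (hk _ _ _ _ h3) (hk _ _ _ _ h2) (hk _ _ _ _ h4)
        (form_k3 _ _ _ _) h4)
      (determines_ofTen hx1 (hk _ _ _ _ h1) (hk _ _ _ _ h3) (hk _ _ _ _ h5)
        (form_k3 _ _ _ _) h5)
      (determines_ofTen hx2 (hk _ _ _ _ h1) (hk _ _ _ _ h2) (hk _ _ _ _ h6)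
        (form_k3 _ _ _ _) h6)
    exact ⟨form_solution (hk _ _ _ _ h4) (hk _ _ _ _ h5) e1 (form_k3 _ _ _ _),
      form_solution (hk _ _ _ _ h6) (hk _ _ _ _ h5) e2.symm (form_k3 _ _ _ _)⟩
  intro u u1 u2 u3
  constructor
  · refine eq_zero_of_mul_of_ne (by fun_prop) (g := fun U : Fin 4 → Vec =>
      form s.A' (U 3) (k3 s.C (U 0) (U 1) (U 3)) (k3 s.B (U 0) (U 2) (U 3))
        (k3 s.B' (U 1) (k3 s.A (U 0) (U 1) (U 2)) (k3 s.C (U 0) (U 1) (U 3)))) (by fun_prop)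
      n1 (fun U => ?_) ![u, u1, u2, u3]
    by_contra hne
    exact right_ne_zero_of_mul hne (key U (left_ne_zero_of_mul hne)).1
  · refine eq_zero_of_mul_of_ne (by fun_prop) (g := fun U : Fin 4 → Vec =>
      form s.C' (U 2) (k3 s.A (U 0) (U 1) (U 2)) (k3 s.B (U 0) (U 2) (U 3))
        (k3 s.B' (U 1) (k3 s.A (U 0) (U 1) (U 2)) (k3 s.C (U 0) (U 1) (U 3)))) (by fun_prop)
      n1 (fun U => ?_) ![u, u1, u2, u3]
    by_contra hne
    exact right_ne_zero_of_mul hne (key U (left_ne_zero_of_mul hne)).2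

/-! ### Möbius equivalence of systems of multilinear forms -/

/-- The multilinear form `c` is obtained from `d`, up to a non-zero factor, by the linear
transformations `g i` of the arguments. -/
def FaceRel (c d : Ten) (g : Fin 4 → GL (Fin 2) ℂ) : Prop :=
  ∃ κ : ℂ, κ ≠ 0 ∧ ∀ U : Fin 4 → Vec, formF c U = κ * formF d (fun i => (g i).1.mulVec (U i))

lemma FaceRel.exists_form {c d : Ten} {g : Fin 4 → GL (Fin 2) ℂ} (h : FaceRel c d g) :
    ∃ κ : ℂ, κ ≠ 0 ∧ ∀ u v w z : Vec, form c u v w z = κ * form d ((g 0).1.mulVec u)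
      ((g 1).1.mulVec v) ((g 2).1.mulVec w) ((g 3).1.mulVec z) := by
  obtain ⟨κ, hκ, h⟩ := h
  exact ⟨κ, hκ, fun u v w z => by simpa [formF] using h ![u, v, w, z]⟩

lemma FaceRel.of_forall {c d : Ten} {g0 g1 g2 g3 : GL (Fin 2) ℂ} {κ : ℂ} (hκ : κ ≠ 0)
    (h : ∀ u v w z : Vec, form c u v w z = κ * form d (g0.1.mulVec u)
      (g1.1.mulVec v) (g2.1.mulVec w) (g3.1.mulVec z)) : FaceRel c d ![g0, g1, g2, g3] :=
  ⟨κ, hκ, fun U => by simpa [formF] using h (U 0) (U 1) (U 2) (U 3)⟩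

lemma FaceRel.trans {c d e : Ten} {g h : Fin 4 → GL (Fin 2) ℂ} (h1 : FaceRel c d g)
    (h2 : FaceRel d e h) : FaceRel c e (fun i => h i * g i) := by
  obtain ⟨κ, hκ, h1⟩ := h1
  obtain ⟨μ, hμ, h2⟩ := h2
  refine ⟨κ * μ, mul_ne_zero hκ hμ, fun U => ?_⟩
  simp only [h1, h2, Units.val_mul, Matrix.mulVec_mulVec, mul_assoc]

lemma mulVec_inv_mulVec (g : GL (Fin 2) ℂ) (p : Vec) : g.1.mulVec ((g⁻¹).1.mulVec p) = p := by
  rw [Matrix.mulVec_mulVec, ← Units.val_mul, mul_inv_cancel, Units.val_one, Matrix.one_mulVec]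

lemma FaceRel.symm {c d : Ten} {g : Fin 4 → GL (Fin 2) ℂ} (h : FaceRel c d g) :
    FaceRel d c (fun i => (g i)⁻¹) := by
  obtain ⟨κ, hκ, h⟩ := h
  refine ⟨κ⁻¹, inv_ne_zero hκ, fun U => ?_⟩
  rw [h]
  simp only [mulVec_inv_mulVec]
  field_simp

lemma formF_update_update (c : Ten) {k l : Fin 4} (hkl : k ≠ l) (U : Fin 4 → Vec) (a b : Vec) :
    formF c (Function.update (Function.update U k a) l b) =
      a 0 * b 0 * formF c (Function.update (Function.update U k e0) l e0) +
      a 0 * b 1 * formF c (Function.update (Function.update U k e0) l e1) +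
      a 1 * b 0 * formF c (Function.update (Function.update U k e1) l e0) +
      a 1 * b 1 * formF c (Function.update (Function.update U k e1) l e1) := by
  fin_cases k <;> fin_cases l <;> first | exact absurd rfl hkl | skip
  all_goals
    simp [formF, form_eq, Function.update]
    try ring

lemma update_update_mulVec (g : Fin 4 → GL (Fin 2) ℂ) (U : Fin 4 → Vec) (k l : Fin 4) (a b : Vec) :
    (fun i => (g i).1.mulVec (Function.update (Function.update U k a) l b i)) =
      Function.update (Function.update (fun i => (g i).1.mulVec (U i)) k ((g k).1.mulVec a)) l
        ((g l).1.mulVec b) := by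
  funext i
  by_cases hl : i = l
  · subst hl; simp
  · by_cases hk : i = k
    · subst hk; simp [hl]
    · simp [hk, hl]

lemma FaceRel.bq {c d : Ten} {g : Fin 4 → GL (Fin 2) ℂ} (h : FaceRel c d g) {k l : Fin 4}
    (hkl : k ≠ l) : ∃ μ : ℂ, μ ≠ 0 ∧
      ∀ U, bq c k l U = μ * bq d k l (fun i => (g i).1.mulVec (U i)) := by
  obtain ⟨κ, hκ, h⟩ := h
  have hdet (i : Fin 4) : (g i).1.det ≠ 0 :=
    (Matrix.isUnit_iff_isUnit_det _).1 (g i).isUnit |>.ne_zero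
  refine ⟨κ ^ 2 * ((g k).1.det * (g l).1.det), mul_ne_zero (pow_ne_zero 2 hκ)
    (mul_ne_zero (hdet k) (hdet l)), fun U => ?_⟩
  simp only [_root_.bq, h, update_update_mulVec]
  simp only [formF_update_update d hkl _ ((g k).1.mulVec _)]
  simp only [Matrix.det_fin_two, Matrix.mulVec, dotProduct, Fin.sum_univ_two, e0_zero, e0_one,
    e1_zero, e1_one]
  ring

lemma FaceRel.nonzeroBiquads {c d : Ten} {g : Fin 4 → GL (Fin 2) ℂ} (h : FaceRel c d g)
    (hd : NonzeroBiquads d) : NonzeroBiquads c := by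
  intro k l hkl
  obtain ⟨U, hU⟩ := hd k l hkl
  obtain ⟨μ, hμ, hb⟩ := h.bq hkl
  refine ⟨fun i => (g i)⁻¹.1.mulVec (U i), ?_⟩
  rw [hb]
  simpa only [mulVec_inv_mulVec] using mul_ne_zero hμ hU

lemma FaceRel.isDeg {c d : Ten} {g : Fin 4 → GL (Fin 2) ℂ} (h : FaceRel c d g) {k l : Fin 4}
    (hkl : k ≠ l) (hd : IsDeg d k l) : IsDeg c k l := by
  obtain ⟨i, hik, hil, p, hp, hd⟩ := hd
  obtain ⟨μ, hμ, hb⟩ := h.bq hkl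
  refine ⟨i, hik, hil, _, gl_mulVec_ne_zero (g i)⁻¹ hp, fun U hU => ?_⟩
  rw [hb, hd _ (by simp only [hU, mulVec_inv_mulVec]), mul_zero]

lemma FaceRel.isDeg_iff {c d : Ten} {g : Fin 4 → GL (Fin 2) ℂ} (h : FaceRel c d g) {k l : Fin 4}
    (hkl : k ≠ l) : IsDeg c k l ↔ IsDeg d k l := ⟨h.symm.isDeg hkl, h.isDeg hkl⟩

lemma FaceRel.isH4 {c d : Ten} {g : Fin 4 → GL (Fin 2) ℂ} (h : FaceRel c d g) (hd : IsH4 d) :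
    IsH4 c :=
  ⟨h.nonzeroBiquads hd.nonzero, by rw [h.isDeg_iff (by decide)]; exact hd.nd02,
    by rw [h.isDeg_iff (by decide)]; exact hd.nd13, h.isDeg (by decide) hd.d01,
    h.isDeg (by decide) hd.d03, h.isDeg (by decide) hd.d12, h.isDeg (by decide) hd.d23⟩

/-- Equivalence of systems modulo linear transformations at the vertices, which are taken in the
order `x, x₁, x₂, x₃, x₁₂, x₁₃, x₂₃, x₁₂₃`. -/
def SysRel (s t : Sys) : Prop := ∃ g : Fin 8 → GL (Fin 2) ℂ,
  FaceRel s.A t.A ![g 0, g 1, g 2, g 4] ∧ FaceRel s.A' t.A' ![g 3, g 5, g 6, g 7] ∧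
  FaceRel s.B t.B ![g 0, g 2, g 3, g 6] ∧ FaceRel s.B' t.B' ![g 1, g 4, g 5, g 7] ∧
  FaceRel s.C t.C ![g 0, g 1, g 3, g 5] ∧ FaceRel s.C' t.C' ![g 2, g 4, g 6, g 7]

lemma SysRel.trans {s t r : Sys} (h1 : SysRel s t) (h2 : SysRel t r) : SysRel s r := by
  obtain ⟨g, a1, a2, a3, a4, a5, a6⟩ := h1
  obtain ⟨h, b1, b2, b3, b4, b5, b6⟩ := h2
  refine ⟨fun i => h i * g i, ?_, ?_, ?_, ?_, ?_, ?_⟩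
  · convert a1.trans b1 using 1; funext i; fin_cases i <;> rfl
  · convert a2.trans b2 using 1; funext i; fin_cases i <;> rfl
  · convert a3.trans b3 using 1; funext i; fin_cases i <;> rfl
  · convert a4.trans b4 using 1; funext i; fin_cases i <;> rfl
  · convert a5.trans b5 using 1; funext i; fin_cases i <;> rfl
  · convert a6.trans b6 using 1; funext i; fin_cases i <;> rfl

lemma SysRel.symm {s t : Sys} (h1 : SysRel s t) : SysRel t s := by
  obtain ⟨g, a1, a2, a3, a4, a5, a6⟩ := h1
  refine ⟨fun i => (g i)⁻¹, ?_, ?_, ?_, ?_, ?_, ?_⟩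
  · convert a1.symm using 1; funext i; fin_cases i <;> rfl
  · convert a2.symm using 1; funext i; fin_cases i <;> rfl
  · convert a3.symm using 1; funext i; fin_cases i <;> rfl
  · convert a4.symm using 1; funext i; fin_cases i <;> rfl
  · convert a5.symm using 1; funext i; fin_cases i <;> rfl
  · convert a6.symm using 1; funext i; fin_cases i <;> rfl

lemma FaceRel.mir {c d : Ten} {g0 g1 g2 g3 : GL (Fin 2) ℂ} (h : FaceRel c d ![g0, g1, g2, g3]) :
    FaceRel (mir c) (mir d) ![g1, g0, g3, g2] := by
  obtain ⟨κ, hκ, h⟩ := h.exists_form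
  exact .of_forall hκ fun u v w z => by simpa [form_mir] using h v u z w

lemma SysRel.mirror {s t : Sys} (h1 : SysRel s t) : SysRel s.mirror t.mirror := by
  obtain ⟨g, a1, a2, a3, a4, a5, a6⟩ := h1
  exact ⟨![g 1, g 0, g 4, g 5, g 2, g 3, g 7, g 6], a1.mir, a2.mir, a4, a3, a5.mir, a6.mir⟩

lemma Sys.HC.of_rel {s t : Sys} (h : SysRel s t) (ht : t.HC) : s.HC := by
  obtain ⟨g, a1, a2, a3, a4, a5, a6⟩ := h
  obtain ⟨k1, h1, a1⟩ := a1.exists_form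
  obtain ⟨k2, h2, a2⟩ := a2.exists_form
  obtain ⟨k3, h3, a3⟩ := a3.exists_form
  obtain ⟨k4, h4, a4⟩ := a4.exists_form
  obtain ⟨k5, h5, a5⟩ := a5.exists_form
  obtain ⟨k6, h6, a6⟩ := a6.exists_form
  refine Sys.hc_of_forall fun u u1 u2 u3 u12 u13 u23 u123 hA hC hB hB' hA0 hC0 hB0 hB'0 => ?_
  simp only [a1, a2, a3, a4, a5, a6, mul_eq_zero, h1, h2, h3, h4, h5, h6, false_or, ne_eq] at *
  obtain ⟨w1, hA0⟩ := hA0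
  obtain ⟨w2, hC0⟩ := hC0
  obtain ⟨w3, hB0⟩ := hB0
  obtain ⟨w4, hB'0⟩ := hB'0
  exact ht.apply hA hC hB hB' ⟨_, hA0⟩ ⟨_, hC0⟩ ⟨_, hB0⟩ ⟨_, hB'0⟩

/-- A consistent system with nondegeneracy conditions as in the theorem: `B` and `B'` are of type
Q, the other faces of type H⁴, and the non-degenerate biquadratics of all these faces except
possibly `A` are as required. -/
structure Good (s : Sys) : Prop where
  hc : s.HC
  hm : s.mirror.HC
  nzA : NonzeroBiquads s.A
  nzB : NonzeroBiquads s.B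
  nzB' : NonzeroBiquads s.B'
  ndB : ∀ k l, k ≠ l → ¬ IsDeg s.B k l
  ndB' : ∀ k l, k ≠ l → ¬ IsDeg s.B' k l
  hA : IsDeg s.A 2 3 → IsDeg s.A 1 2 → IsDeg s.A 0 3 → IsDeg s.A 0 1 → IsH4 s.A
  hA' : IsH4 s.A'
  hC : IsH4 s.C
  hC' : IsH4 s.C'

lemma Good.of_rel {s t : Sys} (h : SysRel s t) (ht : Good t) : Good s := by
  have hm := ht.hm.of_rel h.mirror
  have hc := ht.hc.of_rel h
  obtain ⟨g, a1, a2, a3, a4, a5, a6⟩ := h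
  exact ⟨hc, hm, a1.nonzeroBiquads ht.nzA, a3.nonzeroBiquads ht.nzB, a4.nonzeroBiquads ht.nzB',
    fun k l hkl h => ht.ndB k l hkl ((a3.isDeg_iff hkl).1 h),
    fun k l hkl h => ht.ndB' k l hkl ((a4.isDeg_iff hkl).1 h),
    fun h1 h2 h3 h4 => a1.isH4 (ht.hA ((a1.isDeg_iff (by decide)).1 h1)
      ((a1.isDeg_iff (by decide)).1 h2) ((a1.isDeg_iff (by decide)).1 h3)
      ((a1.isDeg_iff (by decide)).1 h4)), a2.isH4 ht.hA', a5.isH4 ht.hC, a6.isH4 ht.hC'⟩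

lemma FaceRel.faceEquiv {c d : Ten} {g : Fin 4 → GL (Fin 2) ℂ} (h : FaceRel c d g) :
    CubeSystem.FaceEquiv (ofTen c) (ofTen d) g := by
  obtain ⟨κ, hκ, h⟩ := h
  refine ⟨κ, hκ, MvPolynomial.funext fun x => ?_⟩
  rw [eval_ofTen, map_mul, eval_C, eval_moebAct_ofTen, h]

lemma SysRel.moebEquiv {s t : Sys} (h : SysRel s t) : s.toCube.MoebEquiv t.toCube := by
  obtain ⟨g, a1, a2, a3, a4, a5, a6⟩ := h
  exact ⟨_, _, _, _, _, _, _, _, a1.faceEquiv, a2.faceEquiv, a3.faceEquiv, a4.faceEquiv,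
    a5.faceEquiv, a6.faceEquiv⟩

lemma rename_ofTen_mir (c : Ten) : rename ![1, 0, 3, 2] (ofTen c) = ofTen (mir c) := by
  refine MvPolynomial.funext fun x => ?_
  rw [eval_rename, eval_ofTen, eval_ofTen]
  simp [formF, form_mir]

lemma Sys.toCube_mirror (s : Sys) : s.mirror.toCube = s.toCube.mirror := by
  simp only [Sys.toCube, Sys.mirror, CubeSystem.mirror, rename_ofTen_mir]

lemma bq_mir (c : Ten) (k l : Fin 4) (hkl : k ≠ l) (U : Fin 4 → Vec) :
    bq (mir c) k l U = bq c (![1, 0, 3, 2] k) (![1, 0, 3, 2] l) (fun i => U (![1, 0, 3, 2] i)) := by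
  fin_cases k <;> fin_cases l <;> first | exact absurd rfl hkl | skip
  all_goals simp [bq, formF, form_mir, Function.update]

lemma NonzeroBiquads.mir {c : Ten} (h : NonzeroBiquads c) : NonzeroBiquads (mir c) := by
  intro k l hkl
  have hs : Function.Involutive (![1, 0, 3, 2] : Fin 4 → Fin 4) := fun i => by
    fin_cases i <;> rfl
  obtain ⟨U, hU⟩ := h (![1, 0, 3, 2] k) (![1, 0, 3, 2] l) (hs.injective.ne hkl)
  refine ⟨fun i => U (![1, 0, 3, 2] i), ?_⟩
  rw [bq_mir c k l hkl]
  simpa only [hs _] using hU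

lemma IsDeg.mir {c : Ten} {k l : Fin 4} (hkl : k ≠ l)
    (h : IsDeg c (![1, 0, 3, 2] k) (![1, 0, 3, 2] l)) : IsDeg (mir c) k l := by
  have hs : Function.Involutive (![1, 0, 3, 2] : Fin 4 → Fin 4) := fun i => by
    fin_cases i <;> rfl
  obtain ⟨i, h1, h2, p, hp, h⟩ := h
  refine ⟨![1, 0, 3, 2] i, fun h0 => h1 (by rw [← h0, hs]), fun h0 => h2 (by rw [← h0, hs]), p, hp,
    fun U hU => ?_⟩
  rw [bq_mir c k l hkl]
  exact h _ hU

lemma isDeg_mir {c : Ten} {k l : Fin 4} (hkl : k ≠ l) :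
    IsDeg (_root_.mir c) k l ↔ IsDeg c (![1, 0, 3, 2] k) (![1, 0, 3, 2] l) := by
  have hs : Function.Involutive (![1, 0, 3, 2] : Fin 4 → Fin 4) := fun i => by
    fin_cases i <;> rfl
  refine ⟨fun h => ?_, IsDeg.mir hkl⟩
  have : mir (mir c) = c := rfl
  rw [← this]
  refine IsDeg.mir (hs.injective.ne hkl) ?_
  rwa [hs, hs]

lemma IsH4.mir {c : Ten} (h : IsH4 c) : IsH4 (mir c) := by
  refine ⟨h.nonzero.mir, ?_, ?_, ?_, ?_, ?_, ?_⟩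
  · rw [isDeg_mir (by decide)]; exact h.nd13
  · rw [isDeg_mir (by decide)]; exact h.nd02
  · rw [isDeg_mir (by decide)]; exact (isDeg_comm (by decide)).1 h.d01
  · rw [isDeg_mir (by decide)]; exact h.d12
  · rw [isDeg_mir (by decide)]; exact h.d03
  · rw [isDeg_mir (by decide)]; exact (isDeg_comm (by decide)).1 h.d23

lemma Good.mirror {s : Sys} (h : Good s) : Good s.mirror := by
  refine ⟨h.hm, h.hc, h.nzA.mir, h.nzB', h.nzB, h.ndB', h.ndB, fun h1 h2 h3 h4 => ?_,
    h.hA'.mir, h.hC.mir, h.hC'.mir⟩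
  simp only [Sys.mirror] at h1 h2 h3 h4
  rw [isDeg_mir (by decide)] at h1 h2 h3 h4
  exact (h.hA ((isDeg_comm (by decide)).1 h1) h3 h2 ((isDeg_comm (by decide)).1 h4)).mir

/-- The assumption on the edges is not made for `A`; if the biquadratics of `A` on the other four
pairs are degenerate, they are exactly the degenerate ones. -/
lemma good_of_hasTwoQFourH4 {s : Sys} (h : s.toCube.HasTwoQFourH4) (hc : s.toCube.IsConsistent) :
    Good s := by
  obtain ⟨hB, hB', hA, hA', hC, hC', hnd⟩ := h
  have hB := isTypeQ_ofTen_iff.1 hB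
  have hB' := isTypeQ_ofTen_iff.1 hB'
  have hA' : IsH4 s.A' := hA'.isH4 (hnd _ (by simp [Sys.toCube])).1 (hnd _ (by simp [Sys.toCube])).2
  have hC : IsH4 s.C := hC.isH4 (hnd _ (by simp [Sys.toCube])).1 (hnd _ (by simp [Sys.toCube])).2
  have hC' : IsH4 s.C' := hC'.isH4 (hnd _ (by simp [Sys.toCube])).1 (hnd _ (by simp [Sys.toCube])).2
  have nzA : NonzeroBiquads s.A := by
    obtain ⟨e, he, hne⟩ : ∃ e ∈ allPairs, e ∉ degeneratePairs (ofTen s.A) := by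
      by_contra! hall
      have h6 : ((allPairs : Set (Finset (Fin 4)))).ncard ≤ 4 := by
        refine le_of_le_of_eq ?_ hA.2
        exact Set.ncard_le_ncard hall (allPairs.finite_toSet.subset (degeneratePairs_subset _))
      rw [Set.ncard_coe_finset] at h6
      exact absurd h6 (by decide)
    obtain ⟨i, j, k, l, hb, rfl⟩ : ∃ i j k l : Fin 4, Function.Bijective ![i, j, k, l] ∧
        e = {i, j} := by
      clear hne
      revert e
      decide
    rw [mem_degeneratePairs_iff' s.A hb] at hne
    exact nonzeroBiquads_of_irreducible hA.1.1
      (fun hkl => absurd (@hb.1 2 3 (by simpa using hkl)) (by decide)) hne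
  have hHC := Sys.hc_of_isConsistent nzA hA'.nonzero hB.1 hB'.1 hC.nonzero hC'.nonzero hc
  exact ⟨hHC, hHC.mirror nzA hC.nonzero, nzA, hB.1, hB'.1, hB.2, hB'.2, hA.isH4_of_isDeg, hA', hC,
    hC'⟩

attribute [local irreducible] form k1 k2 k3 d12 d13 d23

/-! ### Bilinear forms and pencils of matrices -/

/-- The bilinear form with matrix `M`. -/
def bil (M : Fin 2 → Fin 2 → ℂ) (u v : Vec) : ℂ :=
  M 0 0 * (u 0 * v 0) + M 0 1 * (u 0 * v 1) + M 1 0 * (u 1 * v 0) + M 1 1 * (u 1 * v 1)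

@[fun_prop]
lemma Differentiable.bil {E : Type*} [NormedAddCommGroup E] [NormedSpace ℂ E]
    {M : Fin 2 → Fin 2 → ℂ} {u v : E → Vec} (hu : Differentiable ℂ u) (hv : Differentiable ℂ v) :
    Differentiable ℂ fun e => bil M (u e) (v e) := by
  unfold _root_.bil
  fun_prop

lemma vec_eq (u : Vec) : u = u 0 • e0 + u 1 • e1 := by
  ext i; fin_cases i <;> simp

lemma exists_smul_of_wedge {y z : Vec} (hy : y ≠ 0) (h : y 0 * z 1 = y 1 * z 0) :
    ∃ t : ℂ, z = t • y := by
  rcases vec_ne_zero_iff.1 hy with h0 | h0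
  · refine ⟨z 0 / y 0, ?_⟩
    ext i
    fin_cases i
    · simp [h0]
    · simp; field_simp; linear_combination h
  · refine ⟨z 1 / y 1, ?_⟩
    ext i
    fin_cases i
    · simp; field_simp; linear_combination -h
    · simp [h0]

lemma exists_dual {q : Vec} (hq : q ≠ 0) : ∃ p : Vec, q 0 * p 1 - q 1 * p 0 = 1 := by
  rcases vec_ne_zero_iff.1 hq with h0 | h0
  · exact ⟨![0, (q 0)⁻¹], by simp [h0]⟩
  · exact ⟨![-(q 1)⁻¹, 0], by simp [h0]⟩

/-- A binary quadratic form has a zero. -/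
lemma exists_quadratic_zero (a b c : ℂ) :
    ∃ u : Vec, u ≠ 0 ∧ a * (u 0 * u 0) + b * (u 0 * u 1) + c * (u 1 * u 1) = 0 := by
  by_cases ha : a = 0
  · exact ⟨e0, e0_ne_zero, by simp [ha]⟩
  · obtain ⟨s, hs⟩ := IsAlgClosed.exists_pow_nat_eq (b ^ 2 - 4 * a * c) (n := 2) (by norm_num)
    refine ⟨![(-b + s) / (2 * a), 1], vec_ne_zero_iff.2 (by simp), ?_⟩
    simp only [Matrix.cons_val_zero, Matrix.cons_val_one]
    field_simp
    linear_combination hs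

/-- Two linear forms on a plane which are proportional have a common zero. -/
lemma exists_common_zero {a b c d : ℂ} (h : a * d - b * c = 0) :
    ∃ v : Vec, v ≠ 0 ∧ a * v 0 + b * v 1 = 0 ∧ c * v 0 + d * v 1 = 0 := by
  by_cases h0 : a = 0 ∧ b = 0
  · by_cases h1 : c = 0 ∧ d = 0
    · exact ⟨e0, e0_ne_zero, by simp [h0.1], by simp [h1.1]⟩
    · refine ⟨![-d, c], vec_ne_zero_iff.2 ?_, by simp [h0.1, h0.2], by simp; ring⟩
      simp only [Matrix.cons_val_zero, Matrix.cons_val_one, ne_eq, neg_eq_zero]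
      tauto
  · refine ⟨![-b, a], vec_ne_zero_iff.2 ?_, by simp; ring, ?_⟩
    · simp only [Matrix.cons_val_zero, Matrix.cons_val_one, ne_eq, neg_eq_zero]
      tauto
    · simp only [Matrix.cons_val_zero, Matrix.cons_val_one]
      linear_combination h

/-- Two bilinear forms have a common zero. -/
lemma exists_bil_zero (M N : Fin 2 → Fin 2 → ℂ) :
    ∃ u v : Vec, u ≠ 0 ∧ v ≠ 0 ∧ bil M u v = 0 ∧ bil N u v = 0 := by
  obtain ⟨u, hu, h⟩ := exists_quadratic_zero (M 0 0 * N 0 1 - M 0 1 * N 0 0)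
    (M 0 0 * N 1 1 + M 1 0 * N 0 1 - M 0 1 * N 1 0 - M 1 1 * N 0 0)
    (M 1 0 * N 1 1 - M 1 1 * N 1 0)
  obtain ⟨v, hv, h1, h2⟩ := exists_common_zero (a := M 0 0 * u 0 + M 1 0 * u 1)
    (b := M 0 1 * u 0 + M 1 1 * u 1) (c := N 0 0 * u 0 + N 1 0 * u 1)
    (d := N 0 1 * u 0 + N 1 1 * u 1) (by linear_combination h)
  exact ⟨u, v, hu, hv, by unfold bil; linear_combination h1, by unfold bil; linear_combination h2⟩

lemma exists_eq_mul_of_det {F : Fin 2 → Fin 2 → ℂ} (h : F 0 0 * F 1 1 - F 0 1 * F 1 0 = 0) :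
    ∃ a b : Vec, ∀ i j, F i j = a i * b j := by
  by_cases h0 : F 0 0 = 0 ∧ F 0 1 = 0
  · refine ⟨![0, 1], F 1, fun i j => ?_⟩
    fin_cases i <;> fin_cases j <;> simp [h0.1, h0.2]
  · obtain ⟨t, ht⟩ := exists_smul_of_wedge (y := F 0) (z := F 1) (vec_ne_zero_iff.2 (by tauto))
      (by linear_combination h)
    refine ⟨![1, t], F 0, fun i j => ?_⟩
    fin_cases i
    · simp
    · simp [ht]

lemma exists_orthogonal {a c : Vec} (h : a 0 * c 1 - a 1 * c 0 = 0) :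
    ∃ q : Vec, q ≠ 0 ∧ q 0 * a 0 + q 1 * a 1 = 0 ∧ q 0 * c 0 + q 1 * c 1 = 0 := by
  obtain ⟨v, hv, h1, h2⟩ := exists_common_zero h
  exact ⟨v, hv, by linear_combination h1, by linear_combination h2⟩

/-- A pencil of singular `2 × 2` matrices has a common kernel on the left or on the right. -/
lemma exists_kernel_of_pencil {F G : Fin 2 → Fin 2 → ℂ} (hF : F 0 0 * F 1 1 - F 0 1 * F 1 0 = 0)
    (hG : G 0 0 * G 1 1 - G 0 1 * G 1 0 = 0)
    (hFG : F 0 0 * G 1 1 + G 0 0 * F 1 1 - F 0 1 * G 1 0 - G 0 1 * F 1 0 = 0) :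
    (∃ q : Vec, q ≠ 0 ∧ ∀ j, q 0 * F 0 j + q 1 * F 1 j = 0 ∧ q 0 * G 0 j + q 1 * G 1 j = 0) ∨
    ∃ q : Vec, q ≠ 0 ∧ ∀ i, q 0 * F i 0 + q 1 * F i 1 = 0 ∧ q 0 * G i 0 + q 1 * G i 1 = 0 := by
  obtain ⟨a, b, hab⟩ := exists_eq_mul_of_det hF
  obtain ⟨c, d, hcd⟩ := exists_eq_mul_of_det hG
  simp only [hab, hcd] at hFG ⊢
  have : (a 0 * c 1 - a 1 * c 0) * (b 0 * d 1 - b 1 * d 0) = 0 := by linear_combination hFG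
  rcases mul_eq_zero.1 this with h | h
  · obtain ⟨q, hq, h1, h2⟩ := exists_orthogonal h
    exact Or.inl ⟨q, hq, fun j => ⟨by linear_combination b j * h1, by linear_combination d j * h2⟩⟩
  · obtain ⟨q, hq, h1, h2⟩ := exists_orthogonal h
    exact Or.inr ⟨q, hq, fun j => ⟨by linear_combination a j * h1, by linear_combination c j * h2⟩⟩

/-! ### Multilinearity -/

lemma form_comb₀ (c : Ten) (a b : ℂ) (u u' v w z : Vec) : form c (a • u + b • u') v w z =
    a * form c u v w z + b * form c u' v w z := by
  simp only [form_eq, Pi.add_apply, Pi.smul_apply, smul_eq_mul]; ring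

lemma form_comb₁ (c : Ten) (a b : ℂ) (u v v' w z : Vec) : form c u (a • v + b • v') w z =
    a * form c u v w z + b * form c u v' w z := by
  simp only [form_eq, Pi.add_apply, Pi.smul_apply, smul_eq_mul]; ring

lemma form_comb₂ (c : Ten) (a b : ℂ) (u v w w' z : Vec) : form c u v (a • w + b • w') z =
    a * form c u v w z + b * form c u v w' z := by
  simp only [form_eq, Pi.add_apply, Pi.smul_apply, smul_eq_mul]; ring

lemma form_comb₃ (c : Ten) (a b : ℂ) (u v w z z' : Vec) : form c u v w (a • z + b • z') =
    a * form c u v w z + b * form c u v w z' := by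
  simp only [form_eq, Pi.add_apply, Pi.smul_apply, smul_eq_mul]; ring

lemma k3_comb₂ (c : Ten) (a b : ℂ) (u v w w' : Vec) : k3 c u v (a • w + b • w') =
    a • k3 c u v w + b • k3 c u v w' := by
  ext i; fin_cases i <;> simp [k3, form_comb₂]; ring

lemma k2_comb₁ (c : Ten) (a b : ℂ) (u v v' w : Vec) : k2 c u (a • v + b • v') w =
    a • k2 c u v w + b • k2 c u v' w := by
  ext i; fin_cases i <;> simp [k2, form_comb₁]; ring

lemma k2_comb₃ (c : Ten) (a b : ℂ) (u v w w' : Vec) : k2 c u v (a • w + b • w') =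
    a • k2 c u v w + b • k2 c u v w' := by
  ext i; fin_cases i <;> simp [k2, form_comb₃]; ring

lemma form_expand₀ (c : Ten) (u v w z : Vec) :
    form c u v w z = u 0 * form c e0 v w z + u 1 * form c e1 v w z := by
  conv_lhs => rw [vec_eq u, form_comb₀]

lemma form_expand₁ (c : Ten) (u v w z : Vec) :
    form c u v w z = v 0 * form c u e0 w z + v 1 * form c u e1 w z := by
  conv_lhs => rw [vec_eq v, form_comb₁]

lemma form_expand₂ (c : Ten) (u v w z : Vec) :
    form c u v w z = w 0 * form c u v e0 z + w 1 * form c u v e1 z := by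
  conv_lhs => rw [vec_eq w, form_comb₂]

/-- The coefficients of a multilinear function. -/
def tenOf (F : Vec → Vec → Vec → Vec → ℂ) : Ten := fun i j k l =>
  F (![e0, e1] i) (![e0, e1] j) (![e0, e1] k) (![e0, e1] l)

lemma form_tenOf {F : Vec → Vec → Vec → Vec → ℂ}
    (h0 : ∀ u v w z, F u v w z = u 0 * F e0 v w z + u 1 * F e1 v w z)
    (h1 : ∀ u v w z, F u v w z = v 0 * F u e0 w z + v 1 * F u e1 w z)
    (h2 : ∀ u v w z, F u v w z = w 0 * F u v e0 z + w 1 * F u v e1 z)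
    (h3 : ∀ u v w z, F u v w z = z 0 * F u v w e0 + z 1 * F u v w e1) (u v w z : Vec) :
    form (tenOf F) u v w z = F u v w z := by
  rw [h0 u, h1 e0, h1 e1, h2 e0 e0, h2 e0 e1, h2 e1 e0, h2 e1 e1,
    h3 e0 e0 e0, h3 e0 e0 e1, h3 e0 e1 e0, h3 e0 e1 e1,
    h3 e1 e0 e0, h3 e1 e0 e1, h3 e1 e1 e0, h3 e1 e1 e1, form_eq]
  simp only [tenOf, Matrix.cons_val_zero, Matrix.cons_val_one]
  ring

/-! ### Consequences of the nondegeneracy of biquadratics -/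

lemma bq_eq_zero_of_kernel {c : Ten} {k l : Fin 4} (hkl : k ≠ l) {q : Vec} (hq : q ≠ 0)
    {U : Fin 4 → Vec} (h : ∀ z, formF c (Function.update (Function.update U k q) l z) = 0) :
    bq c k l U = 0 := by
  have h0 := h e0
  have h1 := h e1
  rw [formF_update_update c hkl] at h0 h1
  simp only [e0_zero, e0_one, e1_zero, e1_one] at h0 h1
  unfold bq
  rcases vec_ne_zero_iff.1 hq with hq | hq
  · refine (mul_eq_zero.1 ?_).resolve_left hq
    linear_combination formF c (Function.update (Function.update U k e1) l e1) * h0 -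
      formF c (Function.update (Function.update U k e1) l e0) * h1
  · refine (mul_eq_zero.1 ?_).resolve_left hq
    linear_combination formF c (Function.update (Function.update U k e0) l e0) * h1 -
      formF c (Function.update (Function.update U k e0) l e1) * h0

lemma isDeg_of_vanish {c : Ten} {i k l : Fin 4} (hik : i ≠ k) (hil : i ≠ l) (hkl : k ≠ l)
    {p q : Vec} (hp : p ≠ 0) (hq : q ≠ 0)
    (h : ∀ U : Fin 4 → Vec, U i = p → U k = q → formF c U = 0) : IsDeg c k l :=
  ⟨i, hik, hil, p, hp, fun U hU => bq_eq_zero_of_kernel hkl hq fun z =>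
    h _ (by simp [hik, hil, hU]) (by simp [hkl])⟩

/-- The form does not vanish identically if two of its arguments are fixed. -/
structure NV (c : Ten) : Prop where
  n01 : ∀ p q : Vec, p ≠ 0 → q ≠ 0 → ∃ a b, form c p q a b ≠ 0
  n02 : ∀ p q : Vec, p ≠ 0 → q ≠ 0 → ∃ a b, form c p a q b ≠ 0
  n03 : ∀ p q : Vec, p ≠ 0 → q ≠ 0 → ∃ a b, form c p a b q ≠ 0
  n12 : ∀ p q : Vec, p ≠ 0 → q ≠ 0 → ∃ a b, form c a p q b ≠ 0
  n13 : ∀ p q : Vec, p ≠ 0 → q ≠ 0 → ∃ a b, form c a p b q ≠ 0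
  n23 : ∀ p q : Vec, p ≠ 0 → q ≠ 0 → ∃ a b, form c a b p q ≠ 0

/-- If the form vanished for two fixed arguments, a biquadratic in one of these would have it as a
zero, for all values of its other variable. -/
lemma nv_of_not_isDeg {c : Ten} (h : ∀ k l, k ≠ l → ¬ IsDeg c k l) : NV c := by
  refine ⟨?_, ?_, ?_, ?_, ?_, ?_⟩ <;> intro p q hp hq <;> by_contra! h0
  · exact h 1 2 (by decide) (isDeg_of_vanish (i := 0) (by decide) (by decide) (by decide) hp hq
      fun U h1 h2 => by rw [formF, h1, h2]; exact h0 _ _)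
  · exact h 2 1 (by decide) (isDeg_of_vanish (i := 0) (by decide) (by decide) (by decide) hp hq
      fun U h1 h2 => by rw [formF, h1, h2]; exact h0 _ _)
  · exact h 3 1 (by decide) (isDeg_of_vanish (i := 0) (by decide) (by decide) (by decide) hp hq
      fun U h1 h2 => by rw [formF, h1, h2]; exact h0 _ _)
  · exact h 2 3 (by decide) (isDeg_of_vanish (i := 1) (by decide) (by decide) (by decide) hp hq
      fun U h1 h2 => by rw [formF, h1, h2]; exact h0 _ _)
  · exact h 3 0 (by decide) (isDeg_of_vanish (i := 1) (by decide) (by decide) (by decide) hp hq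
      fun U h1 h2 => by rw [formF, h1, h2]; exact h0 _ _)
  · exact h 3 0 (by decide) (isDeg_of_vanish (i := 2) (by decide) (by decide) (by decide) hp hq
      fun U h1 h2 => by rw [formF, h1, h2]; exact h0 _ _)

lemma NonzeroBiquads.ne₀ {c : Ten} (h : NonzeroBiquads c) {p : Vec} (hp : p ≠ 0) :
    ∃ v w z, form c p v w z ≠ 0 := by
  by_contra! h0
  obtain ⟨U, hU⟩ := h 0 1 (by decide)
  exact hU (bq_eq_zero_of_kernel (by decide) hp fun z => by simp [formF, Function.update, h0])

lemma NonzeroBiquads.ne₂ {c : Ten} (h : NonzeroBiquads c) {p : Vec} (hp : p ≠ 0) :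
    ∃ u v z, form c u v p z ≠ 0 := by
  by_contra! h0
  obtain ⟨U, hU⟩ := h 2 3 (by decide)
  exact hU (bq_eq_zero_of_kernel (by decide) hp fun z => by simp [formF, Function.update, h0])

lemma exists_kernel_of_d12 {c : Ten} {p : Vec} (h : ∀ z, d12 c p z = 0) :
    (∃ q : Vec, q ≠ 0 ∧ ∀ w z, form c p q w z = 0) ∨
    ∃ q : Vec, q ≠ 0 ∧ ∀ v z, form c p v q z = 0 := by
  have h0 := h e0
  have h1 := h e1
  have h2 := h ((1 : ℂ) • e0 + (1 : ℂ) • e1)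
  simp only [d12, form_comb₃] at h0 h1 h2
  rcases exists_kernel_of_pencil (F := fun i j => form c p (![e0, e1] i) (![e0, e1] j) e0)
    (G := fun i j => form c p (![e0, e1] i) (![e0, e1] j) e1) h0 h1
    (by simp; linear_combination h2 - h0 - h1) with ⟨q, hq, h⟩ | ⟨q, hq, h⟩
  · refine Or.inl ⟨q, hq, fun w z => ?_⟩
    have ha := h 0
    have hb := h 1
    simp only [Matrix.cons_val_zero, Matrix.cons_val_one] at ha hb
    rw [form_expand₃, form_expand₂ _ _ _ _ e0, form_expand₂ _ _ _ _ e1,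
      form_expand₁ _ _ _ e0 e0, form_expand₁ _ _ _ e1 e0, form_expand₁ _ _ _ e0 e1,
      form_expand₁ _ _ _ e1 e1]
    simp [ha, hb]
  · refine Or.inr ⟨q, hq, fun w z => ?_⟩
    have ha := h 0
    have hb := h 1
    simp only [Matrix.cons_val_zero, Matrix.cons_val_one] at ha hb
    rw [form_expand₃, form_expand₁ _ _ _ _ e0, form_expand₁ _ _ _ _ e1,
      form_expand₂ _ _ e0 _ e0, form_expand₂ _ _ e1 _ e0, form_expand₂ _ _ e0 _ e1,
      form_expand₂ _ _ e1 _ e1]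
    simp [ha, hb]

lemma exists_kernel_of_d23 {c : Ten} {p : Vec} (h : ∀ v, d23 c p v = 0) :
    (∃ q : Vec, q ≠ 0 ∧ ∀ v z, form c p v q z = 0) ∨
    ∃ q : Vec, q ≠ 0 ∧ ∀ v w, form c p v w q = 0 := by
  have hf (u v w z) : form (fun i j k l => c i l j k) u w z v = form c u v w z := by
    simp only [form_eq]; ring
  rcases exists_kernel_of_d12 (c := fun i j k l => c i l j k) (p := p) (fun v => by
    simpa [d12, d23, hf] using h v) with ⟨q, hq, h⟩ | ⟨q, hq, h⟩
  · exact Or.inl ⟨q, hq, fun v z => by rw [← hf]; exact h z v⟩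
  · exact Or.inr ⟨q, hq, fun v z => by rw [← hf]; exact h z v⟩

/-- An equation of type H⁴ with non-degenerate biquadratics on `0, 2` and `1, 3` does not contain
the product of its arguments `0` and `2`, or that of `1` and `3`, in suitable coordinates. -/
lemma IsH4.exists_vanish {c : Ten} (h : IsH4 c) :
    (∃ p q : Vec, p ≠ 0 ∧ q ≠ 0 ∧ ∀ v z, form c p v q z = 0) ∨
    ∃ p q : Vec, p ≠ 0 ∧ q ≠ 0 ∧ ∀ u w, form c u p w q = 0 := by
  obtain ⟨i, hi2, hi3, p, hp, hd⟩ := h.d01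
  simp only [bq_23] at hd
  have hi : i = 0 ∨ i = 1 := by omega
  rcases hi with rfl | rfl
  · rcases exists_kernel_of_d23 (c := c) (p := p) (fun v => hd ![p, v, 0, 0] rfl) with
      ⟨q, hq, h1⟩ | ⟨q, hq, h1⟩
    · exact Or.inl ⟨p, q, hp, hq, h1⟩
    · exact absurd ((isDeg_comm (by decide)).1 (isDeg_of_vanish (i := 0) (k := 3) (l := 1)
        (by decide) (by decide) (by decide) hp hq
        fun U h2 h3 => by rw [formF, h2, h3]; exact h1 _ _)) h.nd02
  · rcases exists_kernel_of_d23 (c := _root_.mir c) (p := p) (fun v => by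
      have := hd ![v, p, 0, 0] rfl
      simp only [_root_.d23, Matrix.cons_val_zero, Matrix.cons_val_one] at this
      simp only [_root_.d23, form_mir]
      linear_combination this) with ⟨q, hq, h1⟩ | ⟨q, hq, h1⟩
    · exact Or.inr ⟨p, q, hp, hq, fun u w => by simpa [form_mir] using h1 u w⟩
    · refine absurd ((isDeg_comm (by decide)).1 (isDeg_of_vanish (i := 1) (k := 2) (l := 0)
        (by decide) (by decide) (by decide) hp hq
        fun U h2 h3 => by rw [formF, h2, h3]; simpa [form_mir] using h1 (U 0) (U 3))) h.nd13

/-! ### Rotation of the cube -/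

lemma k1_k3 (c : Ten) (u v w : Vec) : k1 c u w (k3 c u v w) = (-d13 c u w) • v := by
  ext i
  fin_cases i <;> simp [k3, k1, d13, form_eq] <;> ring

lemma k1_smul₃ (c : Ten) (t : ℂ) (u v w : Vec) : k1 c u v (t • w) = t • k1 c u v w := by
  ext i; fin_cases i <;> simp [k1, form_smul₃]

@[fun_prop]
lemma Differentiable.k1 {E : Type*} [NormedAddCommGroup E] [NormedSpace ℂ E] {c : Ten}
    {u w z : E → Vec} (hu : Differentiable ℂ u) (hw : Differentiable ℂ w)
    (hz : Differentiable ℂ z) : Differentiable ℂ fun e => k1 c (u e) (w e) (z e) := by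
  refine differentiable_pi.2 fun i => ?_
  fin_cases i <;> simp [_root_.k1] <;> fun_prop

/-- The rotation of the cube which maps the faces of `B` and `B'` to themselves and takes
`x, x₂, x₂₃, x₃` to `x₃, x, x₂, x₂₃`. -/
def Sys.rot (s : Sys) : Sys where
  A := fun i j k l => s.C k l i j
  A' := fun i j k l => s.C' k l i j
  B := fun i j k l => s.B j l i k
  B' := fun i j k l => s.B' j l i k
  C := s.A'
  C' := s.A

lemma form_rotA (c : Ten) (u v w z : Vec) :
    form (fun i j k l => c k l i j) u v w z = form c w z u v := by
  simp only [form_eq]; ring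

lemma form_rotB (c : Ten) (u v w z : Vec) :
    form (fun i j k l => c j l i k) u v w z = form c v z u w := by
  simp only [form_eq]; ring

/-- The vertex `x₁` computed from `x, x₃, x₁₃`; the coordinates in this and the following
definitions are `x, x₃, x₁₃, x₂₃`. -/
def Sys.X1 (s : Sys) (U : Fin 4 → Vec) : Vec := k1 s.C (U 0) (U 1) (U 2)

/-- The vertex `x₂` computed from `x, x₃, x₂₃`. -/
def Sys.X2 (s : Sys) (U : Fin 4 → Vec) : Vec := k1 s.B (U 0) (U 1) (U 3)

/-- The vertex `x₁₂` computed from `x, x₁, x₂`. -/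
def Sys.Y12 (s : Sys) (U : Fin 4 → Vec) : Vec := k3 s.A (U 0) (s.X1 U) (s.X2 U)

/-- The vertex `x₁₂₃` computed from `x₁, x₁₂, x₁₃`. -/
def Sys.Y (s : Sys) (U : Fin 4 → Vec) : Vec := k3 s.B' (s.X1 U) (s.Y12 U) (U 2)

lemma Sys.differentiable_X1 (s : Sys) : Differentiable ℂ s.X1 := by unfold Sys.X1; fun_prop

lemma Sys.differentiable_X2 (s : Sys) : Differentiable ℂ s.X2 := by unfold Sys.X2; fun_prop

lemma Sys.differentiable_Y12 (s : Sys) : Differentiable ℂ s.Y12 :=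
  .k3 (by fun_prop) s.differentiable_X1 s.differentiable_X2

lemma Sys.differentiable_Y (s : Sys) : Differentiable ℂ s.Y :=
  .k3 s.differentiable_X1 s.differentiable_Y12 (by fun_prop)

lemma Sys.exists_d13_mul_ne {s : Sys} (hB : NonzeroBiquads s.B) (hC : NonzeroBiquads s.C) :
    ∃ U : Fin 4 → Vec, d13 s.C (U 0) (U 1) * d13 s.B (U 0) (U 1) ≠ 0 := by
  refine exists_mul_ne_zero (by fun_prop) (by fun_prop) ?_ ?_
  · obtain ⟨u, v, h⟩ := hC.exists_d13
    exact ⟨![u, v, 0, 0], h⟩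
  · obtain ⟨u, v, h⟩ := hB.exists_d13
    exact ⟨![u, v, 0, 0], h⟩

lemma Sys.exists_Y_ne {s : Sys} (hA : NonzeroBiquads s.A) (hB : NonzeroBiquads s.B)
    (hB' : NonzeroBiquads s.B') (hC : NonzeroBiquads s.C) :
    ∃ U : Fin 4 → Vec, form s.B' (s.X1 U) (s.Y12 U) (U 2) e0 ≠ 0 := by
  have n1 : ∃ U : Fin 4 → Vec, form s.B' (U 1) (k3 s.A (U 0) (U 1) (U 2))
      (k3 s.C (U 0) (U 1) (U 3)) e0 ≠ 0 := by
    obtain ⟨U, hU⟩ : ∃ U : Fin 4 → Vec, form s.B' (U 1) (U 2) (U 3) e0 *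
        (d23 s.A (U 0) (U 1) * d23 s.C (U 0) (U 1)) ≠ 0 := by
      refine exists_mul_ne_zero (by fun_prop) (by fun_prop) ?_
        (exists_mul_ne_zero (by fun_prop) (by fun_prop) ?_ ?_)
      · obtain ⟨u, v, w, h⟩ := hB'.exists_form_e0
        exact ⟨![0, u, v, w], h⟩
      · obtain ⟨u, v, h⟩ := hA.exists_d23
        exact ⟨![u, v, 0, 0], h⟩
      · obtain ⟨u, v, h⟩ := hC.exists_d23
        exact ⟨![u, v, 0, 0], h⟩
    refine ⟨![U 0, U 1, k2 s.A (U 0) (U 1) (U 2), k2 s.C (U 0) (U 1) (U 3)], ?_⟩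
    simp only [mul_ne_zero_iff] at hU
    simpa [k3_k2, form_smul₁, form_smul₂, -neg_smul] using ⟨hU.2.2, hU.2.1, hU.1⟩
  obtain ⟨U, hU⟩ := exists_mul_ne_zero (by fun_prop) (by fun_prop)
    (show ∃ U : Fin 4 → Vec, d13 s.C (U 0) (U 3) * d13 s.B (U 0) (U 3) ≠ 0 from
      (Sys.exists_d13_mul_ne hB hC).imp' (fun U => ![U 0, 0, 0, U 1]) fun U hU => by simpa using hU)
      n1
  refine ⟨![U 0, U 3, k3 s.C (U 0) (U 1) (U 3), k3 s.B (U 0) (U 2) (U 3)], ?_⟩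
  simp only [mul_ne_zero_iff] at hU
  simp only [Sys.X1, Sys.X2, Sys.Y12, Matrix.cons_val_zero, Matrix.cons_val_one, Matrix.cons_val,
    k1_k3, k3_smul₁, k3_smul₂, form_smul₀, form_smul₁, mul_ne_zero_iff, neg_ne_zero]
  tauto

/-- Consistency for initial data `x, x₃, x₁₃, x₂₃`. -/
lemma Sys.HC.Y {s : Sys} (h : s.HC) (hB : NonzeroBiquads s.B) (hC : NonzeroBiquads s.C)
    (U : Fin 4 → Vec) : form s.A' (U 1) (U 2) (U 3) (s.Y U) = 0 ∧
      form s.C' (s.X2 U) (s.Y12 U) (U 3) (s.Y U) = 0 := by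
  have nd := Sys.exists_d13_mul_ne hB hC
  have h0 (U : Fin 4 → Vec) : (d13 s.C (U 0) (U 1) * d13 s.B (U 0) (U 1)) *
      (d13 s.C (U 0) (U 1) * form s.A' (U 1) (U 2) (U 3) (s.Y U)) = 0 ∧
      (d13 s.C (U 0) (U 1) * d13 s.B (U 0) (U 1)) *
        form s.C' (s.X2 U) (s.Y12 U) (U 3) (s.Y U) = 0 := by
    have e1 : k3 s.C (U 0) (s.X1 U) (U 1) = (-d13 s.C (U 0) (U 1)) • U 2 := by
      simp only [Sys.X1, k3_k1]
    have e2 : k3 s.B (U 0) (s.X2 U) (U 1) = (-d13 s.B (U 0) (U 1)) • U 3 := by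
      simp only [Sys.X2, k3_k1]
    have := h (U 0) (s.X1 U) (s.X2 U) (U 1)
    rw [e1, e2, k3_smul₂, form_smul₁, form_smul₂, form_smul₃, form_smul₂, form_smul₃] at this
    unfold Sys.Y Sys.Y12
    exact ⟨by linear_combination -this.1, by linear_combination this.2⟩
  constructor
  · refine eq_zero_of_mul_of_ne (f := fun U => (d13 s.C (U 0) (U 1) * d13 s.B (U 0) (U 1)) *
      d13 s.C (U 0) (U 1)) (g := fun U => form s.A' (U 1) (U 2) (U 3) (s.Y U)) (by fun_prop)
      (by have := s.differentiable_Y; fun_prop)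
      (nd.imp fun U hU => mul_ne_zero hU (left_ne_zero_of_mul hU))
      (fun U => ?_) U
    linear_combination (h0 U).1
  · exact eq_zero_of_mul_of_ne (g := fun U => form s.C' (s.X2 U) (s.Y12 U) (U 3) (s.Y U))
      (by fun_prop) (.form s.differentiable_X2 s.differentiable_Y12 (by fun_prop)
        s.differentiable_Y) nd (fun U => (h0 U).2) U

/-- Consistency is invariant under rotation of the cube. -/
lemma Sys.HC.rot {s : Sys} (h : s.HC) (hA : NonzeroBiquads s.A) (hB : NonzeroBiquads s.B)
    (hB' : NonzeroBiquads s.B') (hC : NonzeroBiquads s.C) : s.rot.HC := by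
  have nY := Sys.exists_Y_ne hA hB hB' hC
  have key2 (U : Fin 4 → Vec) (hU : form s.B' (s.X1 U) (s.Y12 U) (U 2) e0 ≠ 0) :
      form s.C' (s.X2 U) (k1 s.B' (s.X1 U) (U 2) (k3 s.A' (U 1) (U 2) (U 3))) (U 3)
        (k3 s.A' (U 1) (U 2) (U 3)) = 0 ∧
      form s.A (U 0) (s.X1 U) (s.X2 U)
        (k1 s.B' (s.X1 U) (U 2) (k3 s.A' (U 1) (U 2) (U 3))) = 0 := by
    have hY : s.Y U ≠ 0 := vec_ne_zero_iff.2 (Or.inr (by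
      simpa [k3, show s.Y U = k3 s.B' (s.X1 U) (s.Y12 U) (U 2) from rfl] using hU))
    have hY12 : s.Y12 U ≠ 0 := by
      intro h0
      rw [h0] at hU
      exact hU (by simp [form_eq])
    obtain ⟨t, ht⟩ := exists_smul_of_wedge hY (z := k3 s.A' (U 1) (U 2) (U 3)) (by
      have := (h.Y hB hC U).1
      rw [form_expand₃] at this
      simp only [k3, Matrix.cons_val_zero, Matrix.cons_val_one]
      linear_combination -this)
    obtain ⟨t', ht'⟩ := exists_smul_of_wedge hY12 (z := k1 s.B' (s.X1 U) (U 2) (s.Y U)) (by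
      have := form_k3 s.B' (s.X1 U) (s.Y12 U) (U 2)
      rw [form_expand₁] at this
      change _ * form s.B' (s.X1 U) e0 (U 2) (s.Y U) + _ * form s.B' (s.X1 U) e1 (U 2) (s.Y U) = 0
        at this
      simp only [k1, Matrix.cons_val_zero, Matrix.cons_val_one]
      linear_combination -this)
    rw [ht, k1_smul₃, ht']
    simp only [form_smul₁, form_smul₃, (h.Y hB hC U).2, mul_zero, true_and]
    rw [Sys.Y12, form_k3, mul_zero, mul_zero]
  have d1 : Differentiable ℂ fun U : Fin 4 → Vec => form s.B' (s.X1 U) (s.Y12 U) (U 2) e0 :=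
    .form s.differentiable_X1 s.differentiable_Y12 (by fun_prop) (by fun_prop)
  have d2 : Differentiable ℂ fun U : Fin 4 → Vec =>
      k1 s.B' (s.X1 U) (U 2) (k3 s.A' (U 1) (U 2) (U 3)) :=
    .k1 s.differentiable_X1 (by fun_prop) (by fun_prop)
  intro x3 x13 x x23
  have e1 : k3 s.rot.A x3 x13 x = k1 s.C x x3 x13 := by simp [k3, k1, Sys.rot, form_rotA]
  have e2 : k3 s.rot.B x3 x x23 = k1 s.B x x3 x23 := by simp [k3, k1, Sys.rot, form_rotB]
  have e3 (a b c : Vec) : k3 s.rot.B' a b c = k1 s.B' b a c := by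
    simp [k3, k1, Sys.rot, form_rotB]
  rw [e1, e2, e3]
  simp only [Sys.rot, form_rotA]
  constructor
  · refine eq_zero_of_mul_of_ne (g := fun U => form s.C' (s.X2 U) (k1 s.B' (s.X1 U) (U 2)
      (k3 s.A' (U 1) (U 2) (U 3))) (U 3) (k3 s.A' (U 1) (U 2) (U 3))) d1
      (.form s.differentiable_X2 d2 (by fun_prop) (by fun_prop)) nY (fun U => ?_) ![x, x3, x13, x23]
    by_contra hne
    exact right_ne_zero_of_mul hne (key2 U (left_ne_zero_of_mul hne)).1
  · refine eq_zero_of_mul_of_ne (g := fun U => form s.A (U 0) (s.X1 U) (s.X2 U)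
      (k1 s.B' (s.X1 U) (U 2) (k3 s.A' (U 1) (U 2) (U 3)))) d1
      (.form (u := fun U => U 0) (by fun_prop) s.differentiable_X1 s.differentiable_X2 d2) nY
      (fun U => ?_) ![x, x3, x13, x23]
    by_contra hne
    exact right_ne_zero_of_mul hne (key2 U (left_ne_zero_of_mul hne)).2

/-! ### Functions vanishing on the zero set of a multilinear form -/

lemma formF_eq_zero_of_aff {c : Ten} (h : ∀ x : Fin 4 → ℂ, formF c (fun i => aff (x i)) = 0)
    (U : Fin 4 → Vec) : formF c U = 0 := by
  have h0 : ofTen c = 0 := MvPolynomial.funext fun x => by rw [eval_ofTen, h, map_zero]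
  rw [← hom_ofTen, h0]
  simp [hom]

lemma NonzeroBiquads.degreeOf_ne {c : Ten} (h : NonzeroBiquads c) (i : Fin 4) :
    degreeOf i (ofTen c) ≠ 0 := by
  intro h0
  obtain ⟨l, hl⟩ : ∃ l, i ≠ l := ⟨i + 1, by simp⟩
  obtain ⟨U, hU⟩ := h i l hl
  have hb : biquad (ofTen c) i l = 0 := by
    have h1 := pderiv_eq_zero_of_degreeOf h0
    have h2 : pderiv i (pderiv l (ofTen c)) = 0 := by
      refine pderiv_eq_zero_of_degreeOf (Nat.le_zero.1 (h0 ▸ degreeOf_pderiv_le i l (ofTen c)))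
    rw [biquad, h1, h2, zero_mul, mul_zero, sub_zero]
  have := hom_biquad c hl U
  rw [hb] at this
  apply hU
  simpa [hom] using this

/-- A multilinear form that vanishes on the zero set of `T` is a multiple of `T`. -/
lemma exists_smul_of_vanish {T c : Ten} (hT : NonzeroBiquads T)
    (h : ∀ u v w, form c u v w (k3 T u v w) = 0) :
    ∃ κ : ℂ, ∀ u v w z, form c u v w z = κ * form T u v w z := by
  obtain ⟨q, hq⟩ := ofTen_dvd (F := ofTen c) (irreducible_of_nonzeroBiquads hT) hT.exists_form_e0
    fun x y z t h0 h1 => by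
      obtain ⟨s, hs⟩ := exists_eq_smul_k3 h0 ⟨_, h1⟩
      rw [eval_ofTen', hs, form_smul₃, h, mul_zero]
  obtain ⟨κ, hκ⟩ : ∃ κ, q = C κ := by
    by_cases hq0 : q = 0
    · exact ⟨0, by rw [hq0, C_0]⟩
    refine ⟨_, vars_eq_empty_iff_eq_C.1 (Finset.eq_empty_of_forall_notMem fun i hi => ?_)⟩
    have h1 := degreeOf_ofTen_le c i
    rw [hq, degreeOf_mul_eq (irreducible_of_nonzeroBiquads hT).ne_zero hq0] at h1
    have h2 := hT.degreeOf_ne i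
    have h3 : degreeOf i q = 0 := by omega
    classical
    rw [degreeOf_def, Multiset.count_eq_zero] at h3
    exact h3 (by simpa [vars_def] using hi)
  refine ⟨κ, fun u v w z => ?_⟩
  have h0 := formF_eq_zero_of_aff (c := fun i j k l => c i j k l - κ * T i j k l) (fun x => by
    have h1 := congrArg (eval x) hq
    rw [eval_mul, hκ, eval_C, eval_ofTen, eval_ofTen] at h1
    simp only [formF, form_eq] at h1 ⊢
    linear_combination h1) ![u, v, w, z]
  simp [formF] at h0
  simp only [form_eq] at h0 ⊢
  linear_combination h0

/-- A sum of products of two multilinear forms that vanishes on the zero set of `T` is divisible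
by `T`. -/
lemma exists_formF_mul_of_vanish {T : Ten} (hT : NonzeroBiquads T) {n : ℕ} (a b : Fin n → Ten)
    (h : ∀ u v w, ∑ j, form (a j) u v w (k3 T u v w) * form (b j) u v w (k3 T u v w) = 0) :
    ∃ q : Ten, ∀ u v w z, ∑ j, form (a j) u v w z * form (b j) u v w z =
      form T u v w z * form q u v w z := by
  obtain ⟨q, hq⟩ := ofTen_dvd (F := ∑ j, ofTen (a j) * ofTen (b j))
    (irreducible_of_nonzeroBiquads hT) hT.exists_form_e0
    fun x y z t h0 h1 => by
      obtain ⟨s, hs⟩ := exists_eq_smul_k3 h0 ⟨_, h1⟩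
      simp only [map_sum, map_mul, eval_ofTen', hs, form_smul₃]
      rw [← mul_zero (s * s), ← h (aff x) (aff y) (aff z), Finset.mul_sum]
      exact Finset.sum_congr rfl fun j _ => by ring
  obtain ⟨q', rfl⟩ : ∃ q', q = ofTen q' := by
    refine exists_eq_ofTen fun i => ?_
    by_cases hq0 : q = 0
    · simp [hq0]
    have h1 : degreeOf i (∑ j, ofTen (a j) * ofTen (b j)) ≤ 2 := by
      refine (degreeOf_sum_le i _ _).trans (Finset.sup_le fun j _ =>
        (degreeOf_mul_le _ _ _).trans ?_)
      have := degreeOf_ofTen_le (a j) i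
      have := degreeOf_ofTen_le (b j) i
      omega
    rw [hq, degreeOf_mul_eq (irreducible_of_nonzeroBiquads hT).ne_zero hq0] at h1
    have := hT.degreeOf_ne i
    omega
  refine ⟨q', fun u v w z => ?_⟩
  have h0 (U : Fin 4 → Vec) : (∏ i, U i 1) * (∏ i, U i 1) * (∑ j, formF (a j) U * formF (b j) U -
      formF T U * formF q' U) = 0 := by
    by_cases hU : ∀ i, U i 1 ≠ 0
    · have h : U = fun i => U i 1 • aff (U i 0 / U i 1) :=
        funext fun i => (smul_aff_div (hU i)).symm
      have h1 := congrArg (eval fun i => U i 0 / U i 1) hq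
      simp only [map_sum, map_mul, eval_ofTen] at h1
      have h2 (c : Ten) : formF c U = (∏ i, U i 1) * formF c fun i => aff (U i 0 / U i 1) := by
        conv_lhs => rw [h, formF_smul]
      simp only [h2]
      have h3 : ∑ j, (∏ i, U i 1) * formF (a j) (fun i => aff (U i 0 / U i 1)) *
          ((∏ i, U i 1) * formF (b j) fun i => aff (U i 0 / U i 1)) = (∏ i, U i 1) * (∏ i, U i 1) *
          ∑ j, formF (a j) (fun i => aff (U i 0 / U i 1)) *
            formF (b j) (fun i => aff (U i 0 / U i 1)) := by
        rw [Finset.mul_sum]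
        exact Finset.sum_congr rfl fun j _ => by ring
      rw [h3, h1]
      ring
    · push Not at hU
      obtain ⟨j, hj⟩ := hU
      rw [Finset.prod_eq_zero (Finset.mem_univ j) hj, zero_mul, zero_mul]
  have h1 := eq_zero_of_mul_of_ne (f := fun U : Fin 4 → Vec => (∏ i, U i 1) * (∏ i, U i 1))
    (g := fun U => ∑ j, formF (a j) U * formF (b j) U - formF T U * formF q' U) (by fun_prop)
    (by fun_prop) ⟨fun _ => e1, by simp⟩ h0 ![u, v, w, z]
  simpa [formF, sub_eq_zero] using h1

/-! ### Propagation of points of vanishing -/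

/-- Consistency for initial data `x, x₁, x₁₂, x₁₃`. -/
lemma Sys.HC.of_mirror {s : Sys} (h : s.mirror.HC) (u u1 u12 u13 : Vec) :
    form s.A' (k2 s.C u u1 u13) u13 (k3 s.B u (k2 s.A u u1 u12) (k2 s.C u u1 u13))
      (k3 s.B' u1 u12 u13) = 0 ∧
    form s.C' (k2 s.A u u1 u12) u12 (k3 s.B u (k2 s.A u u1 u12) (k2 s.C u u1 u13))
      (k3 s.B' u1 u12 u13) = 0 := by
  have := h u1 u u12 u13
  simpa only [Sys.mirror, k3_mir, form_mir] using this

lemma k2_eq_smul {c : Ten} {p q q' : Vec} (h : ∀ y z, form c p y q z = 0)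
    (hq' : q 0 * q' 1 - q 1 * q' 0 = 1) (y z : Vec) :
    k2 c p y z = form c p y q' z • q := by
  have h0 := h y z
  rw [form_expand₂] at h0
  have h1 := form_expand₂ c p y q' z
  ext i
  fin_cases i
  · simp [k2]
    linear_combination -q 0 * h1 - form c p y e1 z * hq' - q' 0 * h0
  · simp [k2]
    linear_combination -q 1 * h1 + form c p y e0 z * hq' - q' 1 * h0

/-- If the products `x x₂` are missing in `A` (after a change of coordinates), then so are the
products `x x₃` in `C`. -/
lemma Sys.HC.propagate {t : Sys} (hm : t.mirror.HC) (hB : NV t.B) (hB' : NV t.B')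
    (nB' : NonzeroBiquads t.B') (nA : NonzeroBiquads t.A) (nA' : NonzeroBiquads t.A')
    (nC' : NonzeroBiquads t.C')
    (hC : ∀ p r : Vec, p ≠ 0 → r ≠ 0 → ∃ w z, form t.C p r w z ≠ 0) {p q : Vec} (hp : p ≠ 0)
    (hq : q ≠ 0) (h : ∀ y z, form t.A p y q z = 0) :
    ∃ d : Vec, d ≠ 0 ∧ ∀ y z, form t.C p y d z = 0 := by
  obtain ⟨q', hq'⟩ := exists_dual hq
  -- at `x = p`, the vertex `x₂` is `q`, and `x₃` and `x₂₃` depend on `x₁, x₁₃` only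
  set ψ : Vec → Vec → Vec := fun y0 y3 => k2 t.C p y0 y3 with hψ
  set β : Vec → Vec := fun w => k3 t.B p q w with hβ
  have ha : ∃ U : Fin 4 → Vec, form t.A p (U 0) q' (U 1) ≠ 0 := by
    obtain ⟨v, w, z, hne⟩ := nA.ne₀ hp
    by_contra! h0
    have h1 := h0 ![v, z, 0, 0]
    simp only [Matrix.cons_val_zero, Matrix.cons_val_one] at h1
    have h2 := h v z
    rw [form_expand₂] at h1 h2 hne
    have h3 : form t.A p v e0 z = 0 := by
      linear_combination -form t.A p v e0 z * hq' + q' 1 * h2 - q 1 * h1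
    have h4 : form t.A p v e1 z = 0 := by
      linear_combination -form t.A p v e1 z * hq' - q' 0 * h2 + q 0 * h1
    exact hne (by rw [h3, h4, mul_zero, mul_zero, add_zero])
  have key (U : Fin 4 → Vec) :
      form t.A' (ψ (U 0) (U 2)) (U 2) (β (ψ (U 0) (U 2))) (k3 t.B' (U 0) (U 1) (U 2)) = 0 ∧
      form t.C' q (U 1) (β (ψ (U 0) (U 2))) (k3 t.B' (U 0) (U 1) (U 2)) = 0 := by
    have h0 (U : Fin 4 → Vec) := Sys.HC.of_mirror hm p (U 0) (U 1) (U 2)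
    simp only [k2_eq_smul h hq', k3_smul₁, form_smul₂, form_smul₀] at h0
    simp only [hψ, hβ]
    constructor
    · exact eq_zero_of_mul_of_ne (f := fun U : Fin 4 → Vec => form t.A p (U 0) q' (U 1))
        (g := fun U => form t.A' (k2 t.C p (U 0) (U 2)) (U 2) (k3 t.B p q (k2 t.C p (U 0) (U 2)))
          (k3 t.B' (U 0) (U 1) (U 2))) (by fun_prop) (by fun_prop) ha (fun U => (h0 U).1) U
    · refine eq_zero_of_mul_of_ne (f := fun U : Fin 4 → Vec => form t.A p (U 0) q' (U 1) *
        form t.A p (U 0) q' (U 1))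
        (g := fun U => form t.C' q (U 1) (k3 t.B p q (k2 t.C p (U 0) (U 2)))
          (k3 t.B' (U 0) (U 1) (U 2))) (by fun_prop) (by fun_prop)
        (ha.imp fun U hU => mul_ne_zero hU hU) (fun U => ?_) U
      linear_combination (h0 U).2
  have βlin (w : Vec) : β w = w 0 • β e0 + w 1 • β e1 := by
    simp only [hβ]
    conv_lhs => rw [vec_eq w, k3_comb₂]
  have ψlin₀ (y z : Vec) : ψ y z = y 0 • ψ e0 z + y 1 • ψ e1 z := by
    simp only [hψ]
    conv_lhs => rw [vec_eq y, k2_comb₁]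
  have ψlin₁ (y z : Vec) : ψ y z = z 0 • ψ y e0 + z 1 • ψ y e1 := by
    simp only [hψ]
    conv_lhs => rw [vec_eq z, k2_comb₃]
  have βcomb (a b : ℂ) (w w' : Vec) : β (a • w + b • w') = a • β w + b • β w' := by
    simp only [hβ, k3_comb₂]
  -- the equation `C'` at `x₂ = q` is a multiple of `B'`, and the factor is zero because the
  -- bilinear function `β ∘ ψ` has a zero
  have hC'0 (y0 y1 y3 y2 : Vec) : form t.C' q y1 (β (ψ y0 y3)) y2 = 0 := by
    have hform := form_tenOf (F := fun y0 y1 y3 y2 => form t.C' q y1 (β (ψ y0 y3)) y2)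
      (fun y0 y1 y3 y2 => by rw [ψlin₀, βcomb, form_comb₂])
      (fun y0 y1 y3 y2 => by rw [form_expand₁])
      (fun y0 y1 y3 y2 => by rw [ψlin₁, βcomb, form_comb₂])
      (fun y0 y1 y3 y2 => by rw [form_expand₃])
    obtain ⟨κ, hκ⟩ := exists_smul_of_vanish nB' (c := tenOf fun y0 y1 y3 y2 =>
      form t.C' q y1 (β (ψ y0 y3)) y2) fun u v w => by
        rw [hform]
        exact (key ![u, v, w, 0]).2
    simp only [hform] at hκ
    obtain ⟨a, b, ha, hb, h0, h1⟩ := exists_bil_zero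
      (fun i j => β (ψ (![e0, e1] i) (![e0, e1] j)) 0)
      (fun i j => β (ψ (![e0, e1] i) (![e0, e1] j)) 1)
    have hab : β (ψ a b) = 0 := by
      rw [ψlin₀, ψlin₁ e0, ψlin₁ e1, βcomb, βcomb, βcomb]
      unfold bil at h0 h1
      ext i
      fin_cases i
      · simp at h0 ⊢
        linear_combination h0
      · simp at h1 ⊢
        linear_combination h1
    obtain ⟨y, z, hyz⟩ := hB'.n02 a b ha hb
    have := hκ a y b z
    rw [hab] at this
    have h0 : κ = 0 := by
      refine (mul_eq_zero.1 (this.symm.trans ?_)).resolve_right hyz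
      simp [form_eq]
    rw [hκ, h0, zero_mul]
  -- a linear function vanishing at all `ψ y z` is zero or yields the point that is looked for
  by_contra hcon
  push Not at hcon
  have hlin (l : Fin 2 → ℂ) (hl : ∀ y z, ψ y z 0 * l 0 + ψ y z 1 * l 1 = 0) : l = 0 := by
    by_contra hl0
    have hd : (![-l 1, l 0] : Vec) ≠ 0 := vec_ne_zero_iff.2 (by
      rcases vec_ne_zero_iff.1 hl0 with h | h
      · exact Or.inr (by simpa using h)
      · exact Or.inl (by simpa using h))
    obtain ⟨y, z, hyz⟩ := hcon _ hd
    apply hyz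
    have := hl y z
    rw [form_expand₂]
    simp [hψ, k2] at this ⊢
    linear_combination this
  obtain ⟨y, w, z, hC'⟩ := nC'.ne₀ hq
  obtain ⟨l, hl⟩ : ∃ l : Fin 2 → ℂ, ∀ w, form t.C' q y w z = w 0 * l 0 + w 1 * l 1 :=
    ⟨![form t.C' q y e0 z, form t.C' q y e1 z], fun w => by rw [form_expand₂]; simp⟩
  have hl0 : l ≠ 0 := by
    rintro rfl
    exact hC' (by rw [hl]; simp)
  have hβl (w : Vec) : β w 0 * l 0 + β w 1 * l 1 = 0 := by
    have h1 := hlin ![β e0 0 * l 0 + β e0 1 * l 1, β e1 0 * l 0 + β e1 1 * l 1] fun y0 y3 => by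
      have h2 := hC'0 y0 y y3 z
      rw [hl, βlin] at h2
      simp at h2 ⊢
      linear_combination h2
    have h2 := congrFun h1 0
    have h3 := congrFun h1 1
    simp at h2 h3
    rw [βlin]
    simp
    linear_combination w 0 * h2 + w 1 * h3
  obtain ⟨d, hd, hd1⟩ : ∃ d : Vec, d ≠ 0 ∧ ∀ w, ∃ s : ℂ, β w = s • d := by
    have hd : (![-l 1, l 0] : Vec) ≠ 0 := vec_ne_zero_iff.2 (by
      rcases vec_ne_zero_iff.1 hl0 with h | h
      · exact Or.inr (by simpa using h)
      · exact Or.inl (by simpa using h))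
    exact ⟨_, hd, fun w => exists_smul_of_wedge hd (by simp; linear_combination -hβl w)⟩
  obtain ⟨d', hd'⟩ := exists_dual hd
  have hβd (w : Vec) : β w = (β w 0 * d' 1 - β w 1 * d' 0) • d := by
    obtain ⟨s, hs⟩ := hd1 w
    rw [hs]
    congr 1
    simp
    linear_combination -s * hd'
  -- hence `A'` vanishes at `x₂₃ = d` for all `x₃` of the form `ψ y z`
  have hs : ∃ U : Fin 4 → Vec, β (ψ (U 0) (U 2)) 0 * d' 1 - β (ψ (U 0) (U 2)) 1 * d' 0 ≠ 0 := by
    by_contra! h0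
    have h1 := hlin ![β e0 0 * d' 1 - β e0 1 * d' 0, β e1 0 * d' 1 - β e1 1 * d' 0] fun y0 y3 => by
      have h2 := h0 ![y0, 0, y3, 0]
      simp only [Matrix.cons_val_zero, Matrix.cons_val] at h2
      rw [βlin] at h2
      simp at h2 ⊢
      linear_combination h2
    have h2 := congrFun h1 0
    have h3 := congrFun h1 1
    simp at h2 h3
    obtain ⟨a, b, hab⟩ := hB.n01 p q hp hq
    have h4 : β a = 0 := by
      rw [hβd, βlin]
      have : (a 0 • β e0 + a 1 • β e1) 0 * d' 1 - (a 0 • β e0 + a 1 • β e1) 1 * d' 0 = 0 := by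
        simp
        linear_combination a 0 * h2 + a 1 * h3
      rw [this, zero_smul]
    apply hab
    have h5 := congrFun h4 0
    have h6 := congrFun h4 1
    simp [hβ, k3] at h5 h6
    rw [form_expand₃, h5, h6, mul_zero, mul_zero, add_zero]
  have hA'1 (U : Fin 4 → Vec) :
      form t.A' (ψ (U 0) (U 2)) (U 2) d (k3 t.B' (U 0) (U 1) (U 2)) = 0 := by
    refine eq_zero_of_mul_of_ne (f := fun U : Fin 4 → Vec => β (ψ (U 0) (U 2)) 0 * d' 1 -
      β (ψ (U 0) (U 2)) 1 * d' 0) (g := fun U => form t.A' (ψ (U 0) (U 2)) (U 2) d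
      (k3 t.B' (U 0) (U 1) (U 2))) (by simp only [hβ, hψ]; fun_prop)
      (by simp only [hψ]; fun_prop) hs (fun U => ?_) U
    have h1 := (key U).1
    rw [hβd, form_smul₂] at h1
    exact h1
  have hA'2 (U : Fin 4 → Vec) : form t.A' (ψ (U 0) (U 2)) (U 2) d (U 3) = 0 := by
    refine eq_zero_of_mul_of_ne (f := fun U : Fin 4 → Vec => -d13 t.B' (U 0) (U 2))
      (g := fun U => form t.A' (ψ (U 0) (U 2)) (U 2) d (U 3)) (by fun_prop)
      (by simp only [hψ]; fun_prop) ?_ (fun U => ?_) U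
    · obtain ⟨u, v, h⟩ := nB'.exists_d13
      exact ⟨![u, 0, v, 0], by simpa using h⟩
    · have h1 := hA'1 ![U 0, k1 t.B' (U 0) (U 2) (U 3), U 2, 0]
      simp only [Matrix.cons_val_zero, Matrix.cons_val_one, Matrix.cons_val] at h1
      rw [k3_k1, form_smul₃] at h1
      exact h1
  -- so `x₃` does not depend on `x₁`
  have hd12 (z : Vec) : d12 t.C p z = 0 := by
    obtain ⟨u, v, z', hne⟩ := nA'.ne₂ hd
    refine eq_zero_of_mul_of_ne (f := fun z => form t.A' u z d z') (g := fun z => d12 t.C p z)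
      (by fun_prop) (by unfold d12; fun_prop) ⟨v, hne⟩ (fun z => ?_) z
    by_cases h0 : form t.A' u z d z' = 0
    · rw [h0, zero_mul]
    have h1 := hA'2 ![e0, 0, z, z']
    have h2 := hA'2 ![e1, 0, z, z']
    simp only [Matrix.cons_val_zero, Matrix.cons_val] at h1 h2
    rw [form_expand₀] at h1 h2 h0
    have hdet : ψ e0 z 0 * ψ e1 z 1 - ψ e0 z 1 * ψ e1 z 0 = 0 := by
      by_contra hdet
      apply h0
      have h3 : form t.A' e0 z d z' = 0 := by
        refine (mul_eq_zero.1 ?_).resolve_left hdet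
        linear_combination ψ e1 z 1 * h1 - ψ e0 z 1 * h2
      have h4 : form t.A' e1 z d z' = 0 := by
        refine (mul_eq_zero.1 ?_).resolve_left hdet
        linear_combination ψ e0 z 0 * h2 - ψ e1 z 0 * h1
      rw [h3, h4, mul_zero, mul_zero, add_zero]
    simp [hψ, k2] at hdet
    simp only [d12]
    linear_combination (form t.A' u z d z') * hdet
  rcases exists_kernel_of_d12 hd12 with ⟨r, hr, h0⟩ | ⟨r, hr, h0⟩
  · obtain ⟨w, z, hwz⟩ := hC p r hp hr
    exact hwz (h0 w z)
  · obtain ⟨y, z, hyz⟩ := hcon r hr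
    exact hyz (h0 y z)

/-! ### Changes of coordinates -/

lemma mulVec_expand (M : Matrix (Fin 2) (Fin 2) ℂ) (u : Vec) :
    M.mulVec u = u 0 • M.mulVec e0 + u 1 • M.mulVec e1 := by
  conv_lhs => rw [vec_eq u, Matrix.mulVec_add, Matrix.mulVec_smul, Matrix.mulVec_smul]

/-- The multilinear form `c` in new coordinates. -/
def actT (c : Ten) (g0 g1 g2 g3 : GL (Fin 2) ℂ) : Ten := tenOf fun u v w z =>
  form c (g0.1.mulVec u) (g1.1.mulVec v) (g2.1.mulVec w) (g3.1.mulVec z)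

lemma form_actT (c : Ten) (g0 g1 g2 g3 : GL (Fin 2) ℂ) (u v w z : Vec) :
    form (actT c g0 g1 g2 g3) u v w z =
      form c (g0.1.mulVec u) (g1.1.mulVec v) (g2.1.mulVec w) (g3.1.mulVec z) :=
  form_tenOf (fun u v w z => by rw [mulVec_expand _ u, form_comb₀])
    (fun u v w z => by rw [mulVec_expand _ v, form_comb₁])
    (fun u v w z => by rw [mulVec_expand _ w, form_comb₂])
    (fun u v w z => by rw [mulVec_expand _ z, form_comb₃]) u v w z

lemma faceRel_actT (c : Ten) (g0 g1 g2 g3 : GL (Fin 2) ℂ) :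
    FaceRel (actT c g0 g1 g2 g3) c ![g0, g1, g2, g3] :=
  .of_forall one_ne_zero fun u v w z => by rw [form_actT, one_mul]

/-- A system in new coordinates. -/
def Sys.act (s : Sys) (g : Fin 8 → GL (Fin 2) ℂ) : Sys where
  A := actT s.A (g 0) (g 1) (g 2) (g 4)
  A' := actT s.A' (g 3) (g 5) (g 6) (g 7)
  B := actT s.B (g 0) (g 2) (g 3) (g 6)
  B' := actT s.B' (g 1) (g 4) (g 5) (g 7)
  C := actT s.C (g 0) (g 1) (g 3) (g 5)
  C' := actT s.C' (g 2) (g 4) (g 6) (g 7)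

lemma sysRel_act (s : Sys) (g : Fin 8 → GL (Fin 2) ℂ) : SysRel (s.act g) s :=
  ⟨g, faceRel_actT _ _ _ _ _, faceRel_actT _ _ _ _ _, faceRel_actT _ _ _ _ _,
    faceRel_actT _ _ _ _ _, faceRel_actT _ _ _ _ _, faceRel_actT _ _ _ _ _⟩

lemma exists_gl_mulVec {p p' : Vec} (h : p 0 * p' 1 - p 1 * p' 0 ≠ 0) :
    ∃ g : GL (Fin 2) ℂ, ∀ u : Vec, g.1.mulVec u = u 0 • p + u 1 • p' := by
  refine ⟨Matrix.GeneralLinearGroup.mkOfDetNeZero !![p 0, p' 0; p 1, p' 1] (by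
      simpa [Matrix.det_fin_two, mul_comm] using h), fun u => ?_⟩
  ext i
  fin_cases i <;> simp [Matrix.GeneralLinearGroup.mkOfDetNeZero, Matrix.mulVec, dotProduct] <;> ring

lemma exists_gl_mulVec_e0 {p : Vec} (hp : p ≠ 0) : ∃ g : GL (Fin 2) ℂ, g.1.mulVec e0 = p := by
  obtain ⟨p', h⟩ := exists_dual hp
  obtain ⟨g, hg⟩ := exists_gl_mulVec (by rw [h]; exact one_ne_zero)
  exact ⟨g, by rw [hg]; simp⟩

/-! ### Permutations of the arguments -/

lemma bq_of_perm {c d : Ten} (σ : Equiv.Perm (Fin 4)) (h : ∀ U, formF d U = formF c (U ∘ σ))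
    (k l : Fin 4) (U : Fin 4 → Vec) : bq d k l U = bq c (σ.symm k) (σ.symm l) (U ∘ σ) := by
  simp only [bq, h, Function.update_comp_equiv]

lemma NonzeroBiquads.of_perm {c d : Ten} (hc : NonzeroBiquads c) (σ : Equiv.Perm (Fin 4))
    (h : ∀ U, formF d U = formF c (U ∘ σ)) : NonzeroBiquads d := by
  intro k l hkl
  obtain ⟨U, hU⟩ := hc (σ.symm k) (σ.symm l) (σ.symm.injective.ne hkl)
  refine ⟨U ∘ σ.symm, ?_⟩
  rw [bq_of_perm σ h]
  simpa [Function.comp_assoc] using hU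

lemma NonzeroBiquads.rotA {c : Ten} (hc : NonzeroBiquads c) :
    NonzeroBiquads fun i j k l => c k l i j :=
  hc.of_perm (Equiv.ofBijective ![2, 3, 0, 1] (by decide)) fun U => by
    rw [formF, form_rotA]
    rfl

lemma NonzeroBiquads.rotB {c : Ten} (hc : NonzeroBiquads c) :
    NonzeroBiquads fun i j k l => c j l i k :=
  hc.of_perm (Equiv.ofBijective ![1, 3, 0, 2] (by decide)) fun U => by
    rw [formF, form_rotB]
    rfl

lemma NV.rotB {c : Ten} (hc : NV c) : NV fun i j k l => c j l i k := by
  refine ⟨?_, ?_, ?_, ?_, ?_, ?_⟩ <;> intro p q hp hq <;> simp only [form_rotB]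
  · obtain ⟨a, b, h⟩ := hc.n02 q p hq hp
    exact ⟨b, a, h⟩
  · obtain ⟨a, b, h⟩ := hc.n23 p q hp hq
    exact ⟨a, b, h⟩
  · obtain ⟨a, b, h⟩ := hc.n12 q p hq hp
    exact ⟨a, b, h⟩
  · obtain ⟨a, b, h⟩ := hc.n03 p q hp hq
    exact ⟨b, a, h⟩
  · obtain ⟨a, b, h⟩ := hc.n01 p q hp hq
    exact ⟨a, b, h⟩
  · obtain ⟨a, b, h⟩ := hc.n13 q p hq hp
    exact ⟨b, a, h⟩

/-! ### Normalized systems -/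

lemma IsH4.ne₀₁ {c : Ten} (h : IsH4 c) (p r : Vec) (hp : p ≠ 0) (hr : r ≠ 0) :
    ∃ w z, form c p r w z ≠ 0 := by
  by_contra! h0
  exact h.nd13 (isDeg_of_vanish (i := 1) (by decide) (by decide) (by decide) hr hp
    fun U h1 h2 => by rw [formF, h1, h2]; exact h0 _ _)

lemma IsH4.ne₂₃ {c : Ten} (h : IsH4 c) (p r : Vec) (hp : p ≠ 0) (hr : r ≠ 0) :
    ∃ w z, form c w z p r ≠ 0 := by
  by_contra! h0
  exact h.nd13 ((isDeg_comm (by decide)).1 (isDeg_of_vanish (i := 3) (k := 2) (by decide)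
    (by decide) (by decide) hr hp fun U h1 h2 => by rw [formF, h1, h2]; exact h0 _ _))

/-- In each of the faces `A, A', C, C'`, the product of the arguments `0` and `2` is missing. -/
structure Std (s : Sys) : Prop extends Good s where
  vA : ∀ j l, s.A 0 j 0 l = 0
  vA' : ∀ j l, s.A' 0 j 0 l = 0
  vC : ∀ j l, s.C 0 j 0 l = 0
  vC' : ∀ j l, s.C' 0 j 0 l = 0

lemma apply_eq_form (c : Ten) (i j k l : Fin 2) :
    c i j k l = form c (![e0, e1] i) (![e0, e1] j) (![e0, e1] k) (![e0, e1] l) := by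
  fin_cases i <;> fin_cases j <;> fin_cases k <;> fin_cases l <;> simp [form_eq]

/-- Traversing the faces `C`, `A'`, `C'` from `x` by `x₃` and `x₂₃` to `x₂` gives the same as `A`,
if `x₁, x₁₂, x₁₃, x₁₂₃` satisfy `B'`. -/
lemma Good.loop {s : Sys} (h : Good s) (u y0 y1 y3 : Vec) :
    form s.C' (k2 s.A u y0 y1) y1 (k2 s.A' (k2 s.C u y0 y3) y3 (k3 s.B' y0 y1 y3))
      (k3 s.B' y0 y1 y3) = 0 := by
  have hne : ∃ U : Fin 4 → Vec, form s.B (U 0) (k2 s.A (U 0) (U 1) (U 2))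
      (k2 s.C (U 0) (U 1) (U 3)) e0 ≠ 0 := by
    obtain ⟨U, hU⟩ : ∃ U : Fin 4 → Vec, form s.B (U 0) (U 2) (U 3) e0 *
        (d23 s.A (U 0) (U 1) * d23 s.C (U 0) (U 1)) ≠ 0 := by
      refine exists_mul_ne_zero (by fun_prop) (by fun_prop) ?_
        (exists_mul_ne_zero (by fun_prop) (by fun_prop) ?_ ?_)
      · obtain ⟨u, v, w, h⟩ := h.nzB.exists_form_e0
        exact ⟨![u, 0, v, w], h⟩
      · obtain ⟨u, v, h⟩ := h.nzA.exists_d23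
        exact ⟨![u, v, 0, 0], h⟩
      · obtain ⟨u, v, h⟩ := h.hC.nonzero.exists_d23
        exact ⟨![u, v, 0, 0], h⟩
    have e (c : Ten) (u v w : Vec) : k2 c u v (k3 c u v w) = (-d23 c u v) • w := by
      unfold k2 k3 d23
      ext i
      fin_cases i <;> simp [form_eq] <;> ring
    refine ⟨![U 0, U 1, k3 s.A (U 0) (U 1) (U 2), k3 s.C (U 0) (U 1) (U 3)], ?_⟩
    simp only [mul_ne_zero_iff] at hU
    simp [e, form_smul₁, form_smul₂, -neg_smul]
    tauto
  refine eq_zero_of_mul_of_ne (f := fun U : Fin 4 → Vec => form s.B (U 0)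
    (k2 s.A (U 0) (U 1) (U 2)) (k2 s.C (U 0) (U 1) (U 3)) e0) (g := fun U => form s.C'
    (k2 s.A (U 0) (U 1) (U 2)) (U 2) (k2 s.A' (k2 s.C (U 0) (U 1) (U 3)) (U 3)
    (k3 s.B' (U 1) (U 2) (U 3))) (k3 s.B' (U 1) (U 2) (U 3))) (by fun_prop) (by fun_prop) hne
    (fun U => ?_) ![u, y0, y1, y3]
  by_contra hne
  rw [mul_eq_zero, not_or] at hne
  obtain ⟨h1, h2⟩ := Sys.HC.of_mirror h.hm (U 0) (U 1) (U 2) (U 3)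
  set X := k3 s.B (U 0) (k2 s.A (U 0) (U 1) (U 2)) (k2 s.C (U 0) (U 1) (U 3)) with hX
  have hX0 : X ≠ 0 := vec_ne_zero_iff.2 (Or.inr (by simpa [hX, k3] using hne.1))
  obtain ⟨t, ht⟩ := exists_smul_of_wedge hX0 (z := k2 s.A' (k2 s.C (U 0) (U 1) (U 3)) (U 3)
    (k3 s.B' (U 1) (U 2) (U 3))) (by
      rw [form_expand₂] at h1
      simp only [k2, Matrix.cons_val_zero, Matrix.cons_val_one] at h1 ⊢
      linear_combination -h1)
  exact hne.2 (by rw [ht, form_smul₂, h2, mul_zero])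

lemma form_of_vanish {c : Ten} (h : ∀ j l, c 0 j 0 l = 0) (u v w z : Vec) :
    form c u v w z = u 0 * w 1 * bil (fun j l => c 0 j 1 l) v z +
      u 1 * w 0 * bil (fun j l => c 1 j 0 l) v z + u 1 * w 1 * bil (fun j l => c 1 j 1 l) v z := by
  rw [form_eq]
  simp only [h, bil]
  ring

lemma IsH4.det_ne {c : Ten} (hc : IsH4 c) (h : ∀ j l, c 0 j 0 l = 0) :
    c 0 0 1 0 * c 0 1 1 1 - c 0 0 1 1 * c 0 1 1 0 ≠ 0 ∧
    c 1 0 0 0 * c 1 1 0 1 - c 1 0 0 1 * c 1 1 0 0 ≠ 0 := by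
  constructor
  · intro h0
    refine hc.nd02 ⟨0, by decide, by decide, e0, e0_ne_zero, fun U hU => ?_⟩
    rw [bq_13, hU, d13]
    simp only [form_of_vanish h, bil, e0_zero, e0_one, e1_zero, e1_one]
    linear_combination (U 2 1) ^ 2 * h0
  · intro h0
    refine hc.nd02 ⟨2, by decide, by decide, e0, e0_ne_zero, fun U hU => ?_⟩
    rw [bq_13, hU, d13]
    simp only [form_of_vanish h, bil, e0_zero, e0_one, e1_zero, e1_one]
    linear_combination (U 0 1) ^ 2 * h0

/-- The points of vanishing make the four required biquadratics of `A` degenerate. -/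
lemma Std.hA4 {s : Sys} (h : Std s) : IsH4 s.A := by
  have h0 (v z : Vec) : form s.A e0 v e0 z = 0 := by rw [form_of_vanish h.vA]; simp
  refine h.hA (isDeg_of_vanish (i := 0) (by decide) (by decide) (by decide) e0_ne_zero e0_ne_zero
      fun U h1 h2 => by rw [formF, h1, h2, h0])
    ((isDeg_comm (by decide)).1 (isDeg_of_vanish (i := 0) (k := 2) (by decide) (by decide)
      (by decide) e0_ne_zero e0_ne_zero fun U h1 h2 => by rw [formF, h1, h2, h0]))
    (isDeg_of_vanish (i := 2) (by decide) (by decide) (by decide) e0_ne_zero e0_ne_zero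
      fun U h1 h2 => by rw [formF, h1, h2, h0])
    (isDeg_of_vanish (i := 2) (by decide) (by decide) (by decide) e0_ne_zero e0_ne_zero
      fun U h1 h2 => by rw [formF, h1, h2, h0])

/-- The points of vanishing propagate around the cube, and Möbius transformations move them to
infinity. -/
lemma Good.exists_std {s : Sys} (h : Good s) {p q : Vec} (hp : p ≠ 0) (hq : q ≠ 0)
    (hpq : ∀ v z, form s.C p v q z = 0) : ∃ t, SysRel s t ∧ Std t := by
  have hB := nv_of_not_isDeg h.ndB
  have hB' := nv_of_not_isDeg h.ndB'
  have hc1 := h.hc.rot h.nzA h.nzB h.nzB' h.hC.nonzero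
  have hc2 := hc1.rot h.hC.nonzero.rotA h.nzB.rotB h.nzB'.rotB h.hA'.nonzero
  obtain ⟨d, hd, h1⟩ := Sys.HC.propagate (t := s.rot)
    (hc1.mirror h.hC.nonzero.rotA h.hA'.nonzero) hB.rotB hB'.rotB h.nzB'.rotB
    h.hC.nonzero.rotA h.hC'.nonzero.rotA h.nzA h.hA'.ne₀₁ hq hp
    fun y z => by simpa [Sys.rot, form_rotA] using hpq z y
  obtain ⟨e, he, h2⟩ := Sys.HC.propagate (t := s.rot.rot)
    (hc2.mirror h.hA'.nonzero.rotA h.hC'.nonzero.rotA) hB.rotB.rotB hB'.rotB.rotB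
    h.nzB'.rotB.rotB h.hA'.nonzero.rotA h.nzA.rotA h.hC.nonzero.rotA
    (fun p r hp hr => by simpa [Sys.rot, form_rotA] using h.hC'.ne₂₃ p r hp hr) hd hq
    fun y z => by simpa [Sys.rot, form_rotA] using h1 z y
  simp only [Sys.rot, form_rotA] at h1 h2
  obtain ⟨g0, hg0⟩ := exists_gl_mulVec_e0 hp
  obtain ⟨g3, hg3⟩ := exists_gl_mulVec_e0 hq
  obtain ⟨g6, hg6⟩ := exists_gl_mulVec_e0 hd
  obtain ⟨g2, hg2⟩ := exists_gl_mulVec_e0 he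
  have hr := sysRel_act s ![g0, 1, g2, g3, 1, 1, g6, 1]
  set t := s.act ![g0, 1, g2, g3, 1, 1, g6, 1] with ht
  have hg : Good t := h.of_rel hr
  have vC (j l) : t.C 0 j 0 l = 0 := by
    rw [apply_eq_form t.C, ht, Sys.act, form_actT]
    simpa [hg0, hg3] using hpq _ _
  have vA' (j l) : t.A' 0 j 0 l = 0 := by
    rw [apply_eq_form t.A', ht, Sys.act, form_actT]
    simpa [hg6, hg3] using h1 _ _
  have vC' (j l) : t.C' 0 j 0 l = 0 := by
    rw [apply_eq_form t.C', ht, Sys.act, form_actT]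
    simpa [hg6, hg2] using h2 _ _
  refine ⟨t, hr.symm, hg, fun j l => ?_, vA', vC, vC'⟩
  -- at `x = ∞` also `x₃ = x₂₃ = ∞`, and therefore `x₂ = ∞`
  have hmat {c : Ten} (hc : IsH4 c) (h0 : ∀ j l, c 0 j 0 l = 0) (a : Fin 2) :
      ∃ y z, bil (fun j l => if a = 0 then c 0 j 1 l else c 1 j 0 l) y z ≠ 0 := by
    by_contra! h3
    obtain ⟨h4, h5⟩ := hc.det_ne h0
    have e (i j : Fin 2) := h3 (![e0, e1] i) (![e0, e1] j)
    have e00 := e 0 0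
    have e01 := e 0 1
    fin_cases a
    · simp [bil] at e00 e01
      exact h4 (by rw [e00, e01]; ring)
    · simp [bil] at e00 e01
      exact h5 (by rw [e00, e01]; ring)
  have hne : ∃ U : Fin 4 → Vec, bil (fun j l => t.C 0 j 1 l) (U 0) (U 2) *
      (bil (fun j l => t.A' 0 j 1 l) (U 2) (k3 t.B' (U 0) (U 1) (U 2)) *
      bil (fun j l => t.C' 1 j 0 l) (U 1) (k3 t.B' (U 0) (U 1) (U 2))) ≠ 0 := by
    refine exists_mul_ne_zero (by fun_prop) (by fun_prop) ?_
      (exists_mul_ne_zero (by fun_prop) (by fun_prop) ?_ ?_)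
    · obtain ⟨y, z, h3⟩ := hmat hg.hC vC 0
      exact ⟨![y, 0, z, 0], h3⟩
    · obtain ⟨U, hU⟩ : ∃ U : Fin 4 → Vec, d13 t.B' (U 0) (U 1) *
          bil (fun j l => t.A' 0 j 1 l) (U 1) (U 2) ≠ 0 := by
        refine exists_mul_ne_zero (by fun_prop) (by fun_prop) ?_ ?_
        · obtain ⟨y, z, h3⟩ := hg.nzB'.exists_d13
          exact ⟨![y, z, 0, 0], h3⟩
        · obtain ⟨y, z, h3⟩ := hmat hg.hA' vA' 0
          exact ⟨![0, y, z, 0], h3⟩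
      refine ⟨![U 0, k1 t.B' (U 0) (U 1) (U 2), U 1, 0], ?_⟩
      simp only [Matrix.cons_val_zero, Matrix.cons_val_one, Matrix.cons_val, k3_k1]
      contrapose! hU
      simp only [bil, Pi.smul_apply, smul_eq_mul] at hU ⊢
      linear_combination -hU
    · obtain ⟨U, hU⟩ : ∃ U : Fin 4 → Vec, d23 t.B' (U 0) (U 1) *
          bil (fun j l => t.C' 1 j 0 l) (U 1) (U 2) ≠ 0 := by
        refine exists_mul_ne_zero (by fun_prop) (by fun_prop) ?_ ?_
        · obtain ⟨y, z, h3⟩ := hg.nzB'.exists_d23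
          exact ⟨![y, z, 0, 0], h3⟩
        · obtain ⟨y, z, h3⟩ := hmat hg.hC' vC' 1
          exact ⟨![0, y, z, 0], h3⟩
      refine ⟨![U 0, U 1, k2 t.B' (U 0) (U 1) (U 2), 0], ?_⟩
      simp only [Matrix.cons_val_zero, Matrix.cons_val_one, Matrix.cons_val, k3_k2]
      contrapose! hU
      simp only [bil, Pi.smul_apply, smul_eq_mul] at hU ⊢
      linear_combination -hU
  rw [apply_eq_form t.A]
  refine eq_zero_of_mul_of_ne (g := fun U : Fin 4 → Vec => form t.A e0 (U 0) e0 (U 1))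
    (by fun_prop) (by fun_prop) hne (fun U => ?_) ![![e0, e1] j, ![e0, e1] l, 0, 0]
  have h3 := hg.loop e0 (U 0) (U 1) (U 2)
  simp only [form_of_vanish vC', form_of_vanish vA', form_of_vanish vC, k2, e0_zero, e0_one,
    Matrix.cons_val_zero, Matrix.cons_val_one, e1_zero, e1_one] at h3
  linear_combination -h3

/-! ### Bilinear forms on the plane -/

/-- The determinant of two vectors. -/
def om (u v : Vec) : ℂ := u 0 * v 1 - u 1 * v 0

/-- The determinant of a matrix. -/
def det2 (M : Fin 2 → Fin 2 → ℂ) : ℂ := M 0 0 * M 1 1 - M 0 1 * M 1 0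

@[fun_prop]
lemma Differentiable.om {E : Type*} [NormedAddCommGroup E] [NormedSpace ℂ E]
    {u v : E → Vec} (hu : Differentiable ℂ u) (hv : Differentiable ℂ v) :
    Differentiable ℂ fun e => om (u e) (v e) := by
  unfold _root_.om
  fun_prop

/-- The transpose of a matrix. -/
def tr (M : Fin 2 → Fin 2 → ℂ) : Fin 2 → Fin 2 → ℂ := fun i j => M j i

lemma bil_tr (M : Fin 2 → Fin 2 → ℂ) (u v : Vec) : bil (tr M) u v = bil M v u := by
  simp only [bil, tr]; ring

lemma det2_tr (M : Fin 2 → Fin 2 → ℂ) : det2 (tr M) = det2 M := by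
  simp only [det2, tr]; ring

lemma bil_smul (a : ℂ) (M : Fin 2 → Fin 2 → ℂ) (u v : Vec) : bil (a • M) u v = a * bil M u v := by
  simp only [bil, Pi.smul_apply, smul_eq_mul]; ring

lemma bil_expand₁ (M : Fin 2 → Fin 2 → ℂ) (u v : Vec) :
    bil M u v = v 0 * bil M u e0 + v 1 * bil M u e1 := by
  simp only [bil, e0_zero, e0_one, e1_zero, e1_one]; ring

lemma bil_ne_right {M : Fin 2 → Fin 2 → ℂ} (hM : det2 M ≠ 0) {u : Vec} (hu : u ≠ 0) :
    ∃ v, bil M u v ≠ 0 := by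
  by_contra! h
  have h0 := h e0
  have h1 := h e1
  simp [bil] at h0 h1
  rcases vec_ne_zero_iff.1 hu with hu | hu
  · refine mul_ne_zero hM hu ?_
    unfold det2
    linear_combination M 1 1 * h0 - M 1 0 * h1
  · refine mul_ne_zero hM hu ?_
    unfold det2
    linear_combination M 0 0 * h1 - M 0 1 * h0

lemma bil_ne_left {M : Fin 2 → Fin 2 → ℂ} (hM : det2 M ≠ 0) {v : Vec} (hv : v ≠ 0) :
    ∃ u, bil M u v ≠ 0 := by
  obtain ⟨u, hu⟩ := bil_ne_right (M := tr M) (by rwa [det2_tr]) hv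
  exact ⟨u, by rwa [bil_tr] at hu⟩

lemma exists_bil_ne {M : Fin 2 → Fin 2 → ℂ} (hM : det2 M ≠ 0) : ∃ u v, bil M u v ≠ 0 :=
  ⟨e0, bil_ne_right hM e0_ne_zero⟩

lemma eq_smul_of_bil {M N : Fin 2 → Fin 2 → ℂ} {t : ℂ} (h : ∀ u v, bil N u v = t * bil M u v) :
    N = t • M := by
  funext i j
  have := h (![e0, e1] i) (![e0, e1] j)
  fin_cases i <;> fin_cases j <;> simpa [bil] using this

/-- The zero `v` of the linear form `bil M u v`. -/
def rt (M : Fin 2 → Fin 2 → ℂ) (u : Vec) : Vec := ![bil M u e1, -bil M u e0]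

lemma bil_rt (M : Fin 2 → Fin 2 → ℂ) (u : Vec) : bil M u (rt M u) = 0 := by
  simp [bil, rt]; ring

lemma rt_ne_zero {M : Fin 2 → Fin 2 → ℂ} (hM : det2 M ≠ 0) {u : Vec} (hu : u ≠ 0) :
    rt M u ≠ 0 := by
  intro h
  obtain ⟨v, hv⟩ := bil_ne_right hM hu
  apply hv
  have h0 := congrFun h 0
  have h1 := congrFun h 1
  simp [rt] at h0 h1
  rw [bil_expand₁, h0, h1, mul_zero, mul_zero, add_zero]

@[fun_prop]
lemma Differentiable.rt {E : Type*} [NormedAddCommGroup E] [NormedSpace ℂ E]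
    {M : Fin 2 → Fin 2 → ℂ} {u : E → Vec} (hu : Differentiable ℂ u) :
    Differentiable ℂ fun e => rt M (u e) := by
  refine differentiable_pi.2 fun i => ?_
  fin_cases i <;> simp [_root_.rt] <;> fun_prop

/-- A bilinear form vanishing on the zeros of a nondegenerate one is a multiple of it. -/
lemma eq_smul_of_vanish {M N : Fin 2 → Fin 2 → ℂ} (hM : det2 M ≠ 0)
    (h : ∀ u, bil N u (rt M u) = 0) : ∃ t : ℂ, N = t • M := by
  have h0 := h e0
  have h1 := h e1
  have h2 := h ((1 : ℂ) • e0 + (1 : ℂ) • e1)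
  simp [bil, rt] at h0 h1 h2
  have r0 : M 0 ≠ 0 := fun h => hM (by simp [det2, h])
  have r1 : M 1 ≠ 0 := fun h => hM (by simp [det2, h])
  obtain ⟨s0, hs0⟩ := exists_smul_of_wedge r0 (z := N 0) (by linear_combination -h0)
  obtain ⟨s1, hs1⟩ := exists_smul_of_wedge r1 (z := N 1) (by linear_combination -h1)
  have hs : s0 = s1 := by
    refine sub_eq_zero.1 ((mul_eq_zero.1 ?_).resolve_right hM)
    simp [hs0, hs1] at h2
    unfold det2
    linear_combination h2
  refine ⟨s0, funext fun i => ?_⟩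
  fin_cases i
  · exact hs0
  · exact hs1.trans (by rw [← hs]; rfl)

lemma om_decomp {p p' : Vec} (h : om p p' = 1) (y : Vec) : y = om y p' • p + om p y • p' := by
  unfold om at *
  ext i
  fin_cases i
  · simp; linear_combination -y 0 * h
  · simp; linear_combination -y 1 * h

lemma bil_comb₀ (M : Fin 2 → Fin 2 → ℂ) (a b : ℂ) (u u' v : Vec) :
    bil M (a • u + b • u') v = a * bil M u v + b * bil M u' v := by
  simp [bil]; ring

lemma bil_comb₁ (M : Fin 2 → Fin 2 → ℂ) (a b : ℂ) (u v v' : Vec) :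
    bil M u (a • v + b • v') = a * bil M u v + b * bil M u v' := by
  simp [bil]; ring

lemma exists_om_eq_one {p : Vec} (hp : p ≠ 0) : ∃ p', om p p' = 1 := exists_dual hp

lemma exists_om_ne {p : Vec} (hp : p ≠ 0) : ∃ y, om p y ≠ 0 := by
  obtain ⟨p', h⟩ := exists_om_eq_one hp
  exact ⟨p', by rw [h]; exact one_ne_zero⟩

/-- In a factorization of `om p y * bil m y z * om z p` into two bilinear forms, one of which
vanishes for `y = p`, the other one is a multiple of `m`. -/
lemma factor_left {β γ m : Fin 2 → Fin 2 → ℂ} {p : Vec} {c : ℂ} (hm : det2 m ≠ 0) (hp : p ≠ 0)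
    (hc : c ≠ 0) (h : ∀ y z, bil β y z * bil γ y z = c * (om p y * bil m y z * om z p))
    (hγ : ∀ z, bil γ p z = 0) : ∃ t : ℂ, β = t • m := by
  obtain ⟨p', hp'⟩ := exists_om_eq_one hp
  have f1 (y z : Vec) : bil γ y z = om p y * bil γ p' z := by
    conv_lhs => rw [om_decomp hp' y, bil_comb₀, hγ, mul_zero, zero_add]
  have f2 (y z : Vec) : bil β y z * bil γ p' z = c * (bil m y z * om z p) := by
    have := eq_zero_of_mul_of_ne (f := fun y => om p y)
      (g := fun y => bil β y z * bil γ p' z - c * (bil m y z * om z p)) (by fun_prop) (by fun_prop)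
      (exists_om_ne hp) (fun y => by linear_combination h y z - bil β y z * f1 y z) y
    linear_combination this
  have f3 : bil γ p' p = 0 := by
    obtain ⟨z, hz, h1, -⟩ := exists_common_zero (a := bil γ p' e0) (b := bil γ p' e1)
      (c := 0) (d := 0) (by ring)
    have h1 : bil γ p' z = 0 := by rw [bil_expand₁]; linear_combination h1
    obtain ⟨y, hy⟩ := bil_ne_left hm hz
    have h2 := f2 y z
    rw [h1, mul_zero, eq_comm, mul_eq_zero, mul_eq_zero] at h2
    have h3 : om z p = 0 := by tauto
    obtain ⟨t, rfl⟩ := exists_smul_of_wedge hz (z := p) (by unfold om at h3; linear_combination h3)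
    rw [bil_expand₁] at h1 ⊢
    simp
    linear_combination t * h1
  have f4 (z : Vec) : bil γ p' z = om p z * bil γ p' p' := by
    conv_lhs => rw [om_decomp hp' z, bil_comb₁, f3, mul_zero, zero_add]
  have f5 (y z : Vec) : bil β y z * bil γ p' p' = -c * bil m y z := by
    have := eq_zero_of_mul_of_ne (f := fun z => om p z)
      (g := fun z => bil β y z * bil γ p' p' + c * bil m y z) (by fun_prop) (by fun_prop)
      (exists_om_ne hp) (fun z => by
        have h0 : om z p = -om p z := by unfold om; ring
        have := f2 y z
        rw [f4, h0] at this
        linear_combination this) z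
    linear_combination this
  have hne : bil γ p' p' ≠ 0 := by
    intro h0
    obtain ⟨y, z, hyz⟩ := exists_bil_ne hm
    have := f5 y z
    rw [h0, mul_zero, eq_comm, mul_eq_zero, neg_eq_zero] at this
    tauto
  refine ⟨-c / bil γ p' p', eq_smul_of_bil fun y z => ?_⟩
  have := f5 y z
  field_simp
  linear_combination this

lemma factor_cases {β γ m : Fin 2 → Fin 2 → ℂ} {p : Vec} {c : ℂ} (hm : det2 m ≠ 0) (hp : p ≠ 0)
    (hc : c ≠ 0) (h : ∀ y z, bil β y z * bil γ y z = c * (om p y * bil m y z * om z p)) :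
    ((∀ z, bil β p z = 0) ∧ ∀ y, bil β y p = 0) ∨ ∃ t : ℂ, β = t • m := by
  have hpp : om p p = 0 := by unfold om; ring
  rcases eq_zero_or_eq_zero_of_mul (f := fun z => bil β p z) (g := fun z => bil γ p z)
    (by fun_prop) (by fun_prop) (fun z => by rw [h, hpp]; ring) with h1 | h1
  · rcases eq_zero_or_eq_zero_of_mul (f := fun y => bil β y p) (g := fun y => bil γ y p)
      (by fun_prop) (by fun_prop) (fun y => by rw [h, hpp]; ring) with h2 | h2
    · exact Or.inl ⟨h1, h2⟩
    · obtain ⟨t, ht⟩ := factor_left (β := tr β) (γ := tr γ) (m := tr m) (by rwa [det2_tr]) hp hc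
        (fun y z => by
          simp only [bil_tr, h]
          unfold om
          ring) (fun z => by rw [bil_tr]; exact h2 z)
      exact Or.inr ⟨t, congrArg tr ht⟩
  · exact Or.inr (factor_left hm hp hc h h1)

/-! ### Multilinear forms with a factorization along an edge -/

/-- The matrix of the form in the arguments `2` and `3`. -/
def mat23 (T : Ten) (u v : Vec) : Fin 2 → Fin 2 → ℂ := fun i j =>
  form T u v (![e0, e1] i) (![e0, e1] j)

lemma bil_mat23 (T : Ten) (u v w z : Vec) : bil (mat23 T u v) w z = form T u v w z := by
  rw [form_expand₃, form_expand₂ _ _ _ w e0, form_expand₂ _ _ _ w e1]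
  simp [bil, mat23]
  ring

/-- The form `T` modulo `om y0 y1`, if it vanishes for `y0 = y1 = y2` and for `y0 = y1 = y3`. -/
lemma exists_eq_of_diagonal {T : Ten} (h1 : ∀ p z, form T p p p z = 0)
    (h2 : ∀ p y, form T p p y p = 0) : ∃ (k : ℂ) (g : Fin 2 → Fin 2 → ℂ), ∀ y0 y1 y2 y3,
      form T y0 y1 y2 y3 = k * (om y1 y2 * om y3 y0) + om y0 y1 * bil g y2 y3 := by
  refine ⟨T 0 1 0 1 + T 1 0 0 1, fun i j => T 0 1 i j -
    if i = 0 ∧ j = 1 then T 0 1 0 1 + T 1 0 0 1 else 0, fun y0 y1 y2 y3 => ?_⟩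
  have a0 := h1 e0 e0
  have a1 := h1 e1 e0
  have a2 := h1 ![1, 1] e0
  have a3 := h1 ![1, -1] e0
  have b0 := h1 e0 e1
  have b1 := h1 e1 e1
  have b2 := h1 ![1, 1] e1
  have b3 := h1 ![1, -1] e1
  have c1 := h2 e1 e0
  have c2 := h2 ![1, 1] e0
  have c3 := h2 ![1, -1] e0
  have d0 := h2 e0 e1
  have d2 := h2 ![1, 1] e1
  have d3 := h2 ![1, -1] e1
  simp [form_eq] at a0 a1 a2 a3 b0 b1 b2 b3 c1 c2 c3 d0 d2 d3
  simp only [form_eq, om, bil]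
  simp
  grind

/-- If a product of the values of `T` and another form at the zeros of `om y₀ y₁` factorizes,
then `T` is a combination of `om y₁ y₂ * om y₃ y₀` and a multiple of `om y₀ y₁`. -/
lemma exists_eq_of_factor_om {T q : Ten} {m2 θ : Fin 2 → Fin 2 → ℂ} (hT : NV T) (hm : det2 m2 ≠ 0)
    (hθ : ∃ p, bil θ p p ≠ 0) (h : ∀ p y z, form T p p y z * form q p p y z =
      bil θ p p * (om p y * bil m2 y z * om z p)) :
    ∃ (k : ℂ) (g : Fin 2 → Fin 2 → ℂ), ∀ y0 y1 y2 y3,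
      form T y0 y1 y2 y3 = k * (om y1 y2 * om y3 y0) + om y0 y1 * bil g y2 y3 := by
  have key (p : Vec) (hp : bil θ p p ≠ 0) :
      ((∀ z, form T p p p z = 0) ∧ ∀ y, form T p p y p = 0) ∨ ∃ t : ℂ, mat23 T p p = t • m2 := by
    have hp0 : p ≠ 0 := by
      rintro rfl
      simp [bil] at hp
    have := factor_cases (β := mat23 T p p) (γ := mat23 q p p) hm hp0 hp
      (fun y z => by rw [bil_mat23, bil_mat23, h])
    simpa only [bil_mat23] using this
  by_cases hw : ∀ p i j k l, mat23 T p p i j * m2 k l = mat23 T p p k l * m2 i j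
  · -- the form would vanish at a zero of a quadratic form
    exfalso
    obtain ⟨i, j, hij⟩ : ∃ i j, m2 i j ≠ 0 := by
      by_contra! h0
      exact hm (by simp [det2, h0])
    set a := ![e0, e1] i with ha
    set b := ![e0, e1] j with hb
    obtain ⟨p, hp, h0⟩ := exists_quadratic_zero (form T e0 e0 a b)
      (form T e0 e1 a b + form T e1 e0 a b) (form T e1 e1 a b)
    have h1 : form T p p a b = 0 := by
      rw [form_expand₀, form_expand₁ T e0, form_expand₁ T e1]
      linear_combination h0
    obtain ⟨y, z, hyz⟩ := hT.n01 p p hp hp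
    apply hyz
    rw [← bil_mat23]
    have h2 (k l) : mat23 T p p k l = 0 := by
      refine (mul_eq_zero.1 ?_).resolve_right hij
      rw [← hw, show mat23 T p p i j = 0 from h1, zero_mul]
    simp [bil, h2]
  · push Not at hw
    obtain ⟨p0, i, j, k, l, hne⟩ := hw
    have hfun : ∃ p, bil θ p p * (form T p p (![e0, e1] i) (![e0, e1] j) * m2 k l -
        form T p p (![e0, e1] k) (![e0, e1] l) * m2 i j) ≠ 0 :=
      exists_mul_ne_zero (by fun_prop) (by fun_prop) hθ ⟨p0, sub_ne_zero.2 hne⟩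
    refine exists_eq_of_diagonal (fun p z => ?_) (fun p y => ?_)
    · refine eq_zero_of_mul_of_ne (g := fun p => form T p p p z) (by fun_prop) (by fun_prop) hfun
        (fun p => ?_) p
      by_contra h0
      rw [mul_eq_zero, mul_eq_zero] at h0
      rcases key p (by tauto) with h1 | ⟨t, ht⟩
      · exact h0 (Or.inr (h1.1 z))
      · apply h0
        left; right
        change mat23 T p p i j * _ - mat23 T p p k l * _ = 0
        rw [ht]
        simp
        ring
    · refine eq_zero_of_mul_of_ne (g := fun p => form T p p y p) (by fun_prop) (by fun_prop) hfun
        (fun p => ?_) p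
      by_contra h0
      rw [mul_eq_zero, mul_eq_zero] at h0
      rcases key p (by tauto) with h1 | ⟨t, ht⟩
      · exact h0 (Or.inr (h1.2 y))
      · apply h0
        left; right
        change mat23 T p p i j * _ - mat23 T p p k l * _ = 0
        rw [ht]
        simp
        ring

/-- A nondegenerate bilinear form is the determinant in suitable coordinates on the right. -/
lemma exists_gl_right {M : Fin 2 → Fin 2 → ℂ} (hM : det2 M ≠ 0) :
    ∃ g : GL (Fin 2) ℂ, ∀ u v, bil M u (g.1.mulVec v) = om u v := by
  obtain ⟨g, hg⟩ := exists_gl_mulVec (p := ![(det2 M)⁻¹ * M 0 1, -(det2 M)⁻¹ * M 0 0])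
    (p' := ![(det2 M)⁻¹ * M 1 1, -(det2 M)⁻¹ * M 1 0]) (by
      simp
      field_simp
      have : -(M 0 1 * M 1 0) + M 0 0 * M 1 1 ≠ 0 := by
        unfold det2 at hM
        contrapose! hM
        linear_combination hM
      contrapose! this
      linear_combination this)
  refine ⟨g, fun u v => ?_⟩
  rw [hg]
  simp [bil, om]
  field_simp
  unfold det2
  ring

lemma exists_gl_left {M : Fin 2 → Fin 2 → ℂ} (hM : det2 M ≠ 0) :
    ∃ g : GL (Fin 2) ℂ, ∀ u v, bil M (g.1.mulVec u) v = om u v := by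
  obtain ⟨g, hg⟩ := exists_gl_right (M := -tr M) (by
    have : det2 (-tr M) = det2 M := by simp only [det2, tr, Pi.neg_apply]; ring
    rwa [this])
  refine ⟨g, fun u v => ?_⟩
  have := hg v u
  have h1 : bil M (g.1.mulVec u) v = -bil (-tr M) v (g.1.mulVec u) := by
    simp only [bil, tr, Pi.neg_apply]; ring
  rw [h1, this]
  unfold om
  ring

/-! ### Bilinear and multilinear forms in new coordinates -/

/-- The bilinear form `M` in new coordinates. -/
def actM (M : Fin 2 → Fin 2 → ℂ) (g h : GL (Fin 2) ℂ) : Fin 2 → Fin 2 → ℂ := fun i j =>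
  bil M (g.1.mulVec (![e0, e1] i)) (h.1.mulVec (![e0, e1] j))

lemma bil_actM (M : Fin 2 → Fin 2 → ℂ) (g h : GL (Fin 2) ℂ) (u v : Vec) :
    bil (actM M g h) u v = bil M (g.1.mulVec u) (h.1.mulVec v) := by
  rw [mulVec_expand _ u, mulVec_expand _ v]
  simp [bil, actM]
  ring

lemma det2_ne_zero_iff {M : Fin 2 → Fin 2 → ℂ} :
    det2 M ≠ 0 ↔ ∀ u, u ≠ 0 → ∃ v, bil M u v ≠ 0 := by
  refine ⟨fun h u hu => bil_ne_right h hu, fun h h0 => ?_⟩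
  obtain ⟨u, hu, h1, h2⟩ := exists_common_zero (a := M 0 0) (b := M 1 0) (c := M 0 1) (d := M 1 1)
    (by unfold det2 at h0; linear_combination h0)
  obtain ⟨v, hv⟩ := h u hu
  apply hv
  unfold bil
  linear_combination v 0 * h1 + v 1 * h2

lemma det2_actM {M : Fin 2 → Fin 2 → ℂ} (hM : det2 M ≠ 0) (g h : GL (Fin 2) ℂ) :
    det2 (actM M g h) ≠ 0 := by
  refine det2_ne_zero_iff.2 fun u hu => ?_
  obtain ⟨v, hv⟩ := det2_ne_zero_iff.1 hM _ (gl_mulVec_ne_zero g hu)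
  exact ⟨h⁻¹.1.mulVec v, by rwa [bil_actM, mulVec_inv_mulVec]⟩

lemma NV.actT {c : Ten} (hc : NV c) (g0 g1 g2 g3 : GL (Fin 2) ℂ) : NV (actT c g0 g1 g2 g3) := by
  refine ⟨?_, ?_, ?_, ?_, ?_, ?_⟩ <;> intro p q hp hq <;> simp only [form_actT]
  · obtain ⟨a, b, h⟩ := hc.n01 _ _ (gl_mulVec_ne_zero g0 hp) (gl_mulVec_ne_zero g1 hq)
    exact ⟨g2⁻¹.1.mulVec a, g3⁻¹.1.mulVec b, by rwa [mulVec_inv_mulVec, mulVec_inv_mulVec]⟩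
  · obtain ⟨a, b, h⟩ := hc.n02 _ _ (gl_mulVec_ne_zero g0 hp) (gl_mulVec_ne_zero g2 hq)
    exact ⟨g1⁻¹.1.mulVec a, g3⁻¹.1.mulVec b, by rwa [mulVec_inv_mulVec, mulVec_inv_mulVec]⟩
  · obtain ⟨a, b, h⟩ := hc.n03 _ _ (gl_mulVec_ne_zero g0 hp) (gl_mulVec_ne_zero g3 hq)
    exact ⟨g1⁻¹.1.mulVec a, g2⁻¹.1.mulVec b, by rwa [mulVec_inv_mulVec, mulVec_inv_mulVec]⟩
  · obtain ⟨a, b, h⟩ := hc.n12 _ _ (gl_mulVec_ne_zero g1 hp) (gl_mulVec_ne_zero g2 hq)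
    exact ⟨g0⁻¹.1.mulVec a, g3⁻¹.1.mulVec b, by rwa [mulVec_inv_mulVec, mulVec_inv_mulVec]⟩
  · obtain ⟨a, b, h⟩ := hc.n13 _ _ (gl_mulVec_ne_zero g1 hp) (gl_mulVec_ne_zero g3 hq)
    exact ⟨g0⁻¹.1.mulVec a, g2⁻¹.1.mulVec b, by rwa [mulVec_inv_mulVec, mulVec_inv_mulVec]⟩
  · obtain ⟨a, b, h⟩ := hc.n23 _ _ (gl_mulVec_ne_zero g2 hp) (gl_mulVec_ne_zero g3 hq)
    exact ⟨g0⁻¹.1.mulVec a, g1⁻¹.1.mulVec b, by rwa [mulVec_inv_mulVec, mulVec_inv_mulVec]⟩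

lemma one_mulVec_vec (u : Vec) : (1 : GL (Fin 2) ℂ).1.mulVec u = u := by simp

/-- If on the zero set of `m₀` the form `T` divides a product of bilinear forms, then there it is
the product of the two forms in which one of the variables `y₀, y₁` occurs. -/
lemma exists_eq_of_factor {T q : Ten} {m0 m1 m2 m3 θ : Fin 2 → Fin 2 → ℂ} (hT : NV T)
    (h0 : det2 m0 ≠ 0) (h1 : det2 m1 ≠ 0) (h2 : det2 m2 ≠ 0) (h3 : det2 m3 ≠ 0)
    (hθ : ∀ a : ℂ, θ ≠ a • m0) (h : ∀ y0 y1 y2 y3, bil m0 y0 y1 = 0 →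
      form T y0 y1 y2 y3 * form q y0 y1 y2 y3 =
        bil θ y0 y1 * (bil m1 y1 y2 * bil m2 y2 y3 * bil m3 y3 y0)) :
    ∃ (k : ℂ) (g : Fin 2 → Fin 2 → ℂ), ∀ y0 y1 y2 y3,
      form T y0 y1 y2 y3 = k * (bil m1 y1 y2 * bil m3 y3 y0) + bil m0 y0 y1 * bil g y2 y3 := by
  obtain ⟨g1, hg1⟩ := exists_gl_right h0
  obtain ⟨g2, hg2⟩ := exists_gl_right (det2_actM h1 g1 1)
  obtain ⟨g3, hg3⟩ := exists_gl_left h3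
  simp only [bil_actM, one_mulVec_vec] at hg2
  have hθ' : ∃ p, bil (actM θ 1 g1) p p ≠ 0 := by
    by_contra! h4
    have a0 := h4 e0
    have a1 := h4 e1
    have a2 := h4 ![1, 1]
    simp [bil] at a0 a1 a2
    have a3 (u v : Vec) : bil (actM θ 1 g1) u v = actM θ 1 g1 0 1 * om u v := by
      unfold om bil
      linear_combination u 0 * v 0 * a0 + (u 1 * v 1) * a1 + (u 1 * v 0) * (a2 - a0 - a1)
    refine hθ (actM θ 1 g1 0 1) (eq_smul_of_bil fun u v => ?_)
    have := a3 u (g1⁻¹.1.mulVec v)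
    rwa [bil_actM, mulVec_inv_mulVec, one_mulVec_vec, ← hg1, mulVec_inv_mulVec] at this
  obtain ⟨k, g, hk⟩ := exists_eq_of_factor_om (T := actT T 1 g1 g2 g3) (q := actT q 1 g1 g2 g3)
    (m2 := actM m2 g2 g3) (hT.actT _ _ _ _) (det2_actM h2 _ _) hθ' fun p y z => by
      rw [form_actT, form_actT, h _ _ _ _ (by rw [one_mulVec_vec, hg1]; unfold om; ring), bil_actM,
        bil_actM, hg2, one_mulVec_vec, hg3]
  refine ⟨k, actM g g2⁻¹ g3⁻¹, fun y0 y1 y2 y3 => ?_⟩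
  have := hk y0 (g1⁻¹.1.mulVec y1) (g2⁻¹.1.mulVec y2) (g3⁻¹.1.mulVec y3)
  rwa [form_actT, mulVec_inv_mulVec, mulVec_inv_mulVec, mulVec_inv_mulVec, one_mulVec_vec, ← hg1 y0,
    ← hg2 (g1⁻¹.1.mulVec y1), ← hg3 _ y0, mulVec_inv_mulVec, mulVec_inv_mulVec, mulVec_inv_mulVec,
    ← bil_actM] at this

/-- The product of two bilinear forms in the variables `0, 1` and `2, 3`. -/
def ten01 (a c : Fin 2 → Fin 2 → ℂ) : Ten := fun i j k l => a i j * c k l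

/-- The product of two bilinear forms in the variables `1, 2` and `3, 0`. -/
def ten12 (b d : Fin 2 → Fin 2 → ℂ) : Ten := fun i j k l => b j k * d l i

lemma form_ten01 (a c : Fin 2 → Fin 2 → ℂ) (u v w z : Vec) :
    form (ten01 a c) u v w z = bil a u v * bil c w z := by
  simp only [form_eq, ten01, bil]
  ring

lemma form_ten12 (b d : Fin 2 → Fin 2 → ℂ) (u v w z : Vec) :
    form (ten12 b d) u v w z = bil b v w * bil d z u := by
  simp only [form_eq, ten12, bil]
  ring

lemma exists_sum_eq_of_vanish {T : Ten} (hT : NonzeroBiquads T) {n : ℕ}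
    (a b c d : Fin n → Fin 2 → Fin 2 → ℂ) (h : ∀ u v w, ∑ j, bil (a j) u v * bil (b j) v w *
      bil (c j) w (k3 T u v w) * bil (d j) (k3 T u v w) u = 0) :
    ∃ q : Ten, ∀ u v w z, ∑ j, bil (a j) u v * bil (b j) v w * bil (c j) w z * bil (d j) z u =
      form T u v w z * form q u v w z := by
  have e (u v w z : Vec) : ∑ j, bil (a j) u v * bil (b j) v w * bil (c j) w z * bil (d j) z u =
      ∑ j, form (ten01 (a j) (c j)) u v w z * form (ten12 (b j) (d j)) u v w z := by
    refine Finset.sum_congr rfl fun j _ => ?_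
    rw [form_ten01, form_ten12]
    ring
  simp only [e] at h ⊢
  exact exists_formF_mul_of_vanish hT _ _ h

/-! ### Four faces around a face -/

/-- The data of four faces around the face `T`, with edges `y₀y₁, y₁y₂, y₂y₃, y₃y₀` on `T`. The
variables on the opposite edges are `u₀, u₁, u₂, u₃`, and the `i`-th face has the equation
`u i * m i + u (i + 1) * m' i + n i = 0`, where the coefficients are bilinear in the variables
`y i` and `y (i + 1)`. -/
structure Loop where
  m : Fin 4 → Fin 2 → Fin 2 → ℂ
  m' : Fin 4 → Fin 2 → Fin 2 → ℂ
  n : Fin 4 → Fin 2 → Fin 2 → ℂ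
  T : Ten

namespace Loop

variable (L : Loop)

/-- The product of the coefficients `m`. -/
def M (y0 y1 y2 y3 : Vec) : ℂ :=
  bil (L.m 0) y0 y1 * bil (L.m 1) y1 y2 * bil (L.m 2) y2 y3 * bil (L.m 3) y3 y0

/-- The product of the coefficients `m'`. -/
def M' (y0 y1 y2 y3 : Vec) : ℂ :=
  bil (L.m' 0) y0 y1 * bil (L.m' 1) y1 y2 * bil (L.m' 2) y2 y3 * bil (L.m' 3) y3 y0

/-- The constant term which arises if `u₁, u₂, u₃` are eliminated from the four equations. -/
def F (y0 y1 y2 y3 : Vec) : ℂ :=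
  bil (L.n 0) y0 y1 * bil (L.m 1) y1 y2 * bil (L.m 2) y2 y3 * bil (L.m 3) y3 y0 -
  bil (L.m' 0) y0 y1 * bil (L.n 1) y1 y2 * bil (L.m 2) y2 y3 * bil (L.m 3) y3 y0 +
  bil (L.m' 0) y0 y1 * bil (L.m' 1) y1 y2 * bil (L.n 2) y2 y3 * bil (L.m 3) y3 y0 -
  bil (L.m' 0) y0 y1 * bil (L.m' 1) y1 y2 * bil (L.m' 2) y2 y3 * bil (L.n 3) y3 y0

/-- The four equations are compatible for all `u₀` if `T = 0`, and there are no degenerations. -/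
structure Valid : Prop where
  det : ∀ i, det2 (L.m i) ≠ 0
  det' : ∀ i, det2 (L.m' i) ≠ 0
  nv : NV L.T
  nz : NonzeroBiquads L.T
  hD : ∃ q : Ten, ∀ y0 y1 y2 y3, L.M y0 y1 y2 y3 - L.M' y0 y1 y2 y3 =
    form L.T y0 y1 y2 y3 * form q y0 y1 y2 y3
  hF : ∃ q : Ten, ∀ y0 y1 y2 y3, L.F y0 y1 y2 y3 = form L.T y0 y1 y2 y3 * form q y0 y1 y2 y3
  hn : ∀ i (a b : ℂ), L.m' i = a • L.m i → L.n i ≠ b • L.m i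

/-- The same four faces, starting with the second one. -/
def rot : Loop where
  m i := L.m (i + 1)
  m' i := L.m' (i + 1)
  n i := L.n (i + 1)
  T i j k l := L.T l i j k

end Loop

lemma form_rotT (c : Ten) (u v w z : Vec) :
    form (fun i j k l => c l i j k) u v w z = form c z u v w := by
  simp only [form_eq]
  ring

lemma NonzeroBiquads.rotT {c : Ten} (hc : NonzeroBiquads c) :
    NonzeroBiquads fun i j k l => c l i j k :=
  hc.of_perm (Equiv.ofBijective ![3, 0, 1, 2] (by decide)) fun U => by
    rw [formF, form_rotT]
    rfl

lemma NV.rotT {c : Ten} (hc : NV c) : NV fun i j k l => c l i j k := by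
  refine ⟨?_, ?_, ?_, ?_, ?_, ?_⟩ <;> intro p q hp hq <;> simp only [form_rotT]
  · obtain ⟨a, b, h⟩ := hc.n12 p q hp hq
    exact ⟨b, a, h⟩
  · obtain ⟨a, b, h⟩ := hc.n13 p q hp hq
    exact ⟨b, a, h⟩
  · obtain ⟨a, b, h⟩ := hc.n01 q p hq hp
    exact ⟨a, b, h⟩
  · obtain ⟨a, b, h⟩ := hc.n23 p q hp hq
    exact ⟨b, a, h⟩
  · obtain ⟨a, b, h⟩ := hc.n02 q p hq hp
    exact ⟨a, b, h⟩
  · obtain ⟨a, b, h⟩ := hc.n03 q p hq hp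
    exact ⟨a, b, h⟩

lemma form_rt (T : Ten) (M : Fin 2 → Fin 2 → ℂ) (u v w x : Vec) :
    form T u v w (rt M x) = -bil M x (k3 T u v w) := by
  rw [form_expand₃, bil_expand₁ _ _ (k3 T u v w)]
  simp [rt, k3]
  ring

lemma NV.exists_bil_k3_right {T M} (hT : NV T) (hM : det2 M ≠ 0) :
    ∃ u v w, bil M w (k3 T u v w) ≠ 0 := by
  obtain ⟨u, v, h0⟩ := hT.n23 e0 (rt M e0) e0_ne_zero (rt_ne_zero hM e0_ne_zero)
  rw [form_rt, neg_ne_zero] at h0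
  exact ⟨u, v, e0, h0⟩

lemma NV.exists_bil_k3_left {T M} (hT : NV T) (hM : det2 M ≠ 0) :
    ∃ u v w, bil M (k3 T u v w) u ≠ 0 := by
  obtain ⟨u, v, h0⟩ := hT.n03 e0 (rt (tr M) e0) e0_ne_zero
    (rt_ne_zero (by rw [det2_tr]; exact hM) e0_ne_zero)
  rw [form_rt, bil_tr, neg_ne_zero] at h0
  exact ⟨e0, u, v, h0⟩

namespace Loop

variable {L : Loop}

lemma exists_M_sub (hT : NonzeroBiquads L.T)
    (h : ∀ u v w, L.M u v w (k3 L.T u v w) = L.M' u v w (k3 L.T u v w)) :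
    ∃ q : Ten, ∀ y0 y1 y2 y3, L.M y0 y1 y2 y3 - L.M' y0 y1 y2 y3 =
      form L.T y0 y1 y2 y3 * form q y0 y1 y2 y3 := by
  obtain ⟨q, hq⟩ := exists_sum_eq_of_vanish hT ![L.m 0, -L.m' 0] ![L.m 1, L.m' 1]
    ![L.m 2, L.m' 2] ![L.m 3, L.m' 3] fun u v w => by
      have := h u v w
      unfold M M' at this
      have e (N : Fin 2 → Fin 2 → ℂ) (u v) : bil (-N) u v = -bil N u v := by simp [bil]; ring
      simp [Fin.sum_univ_two, e]
      linear_combination this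
  refine ⟨q, fun u v w z => ?_⟩
  rw [← hq]
  have e (N : Fin 2 → Fin 2 → ℂ) (u v) : bil (-N) u v = -bil N u v := by simp [bil]; ring
  simp [Fin.sum_univ_two, e, M, M']
  ring

lemma exists_F (hT : NonzeroBiquads L.T) (h : ∀ u v w, L.F u v w (k3 L.T u v w) = 0) :
    ∃ q : Ten, ∀ y0 y1 y2 y3, L.F y0 y1 y2 y3 =
      form L.T y0 y1 y2 y3 * form q y0 y1 y2 y3 := by
  have e (N : Fin 2 → Fin 2 → ℂ) (u v) : bil (-N) u v = -bil N u v := by simp [bil]; ring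
  obtain ⟨q, hq⟩ := exists_sum_eq_of_vanish hT ![L.n 0, -L.m' 0, L.m' 0, -L.m' 0]
    ![L.m 1, L.n 1, L.m' 1, L.m' 1] ![L.m 2, L.m 2, L.n 2, L.m' 2] ![L.m 3, L.m 3, L.m 3, L.n 3]
    fun u v w => by
      have := h u v w
      unfold F at this
      simp [Fin.sum_univ_four, e]
      linear_combination this
  refine ⟨q, fun u v w z => ?_⟩
  rw [← hq]
  simp [Fin.sum_univ_four, e, F]
  ring

namespace Valid

variable (h : L.Valid)

include h

lemma exists_generic : ∃ y0 y1 y2 y3, form L.T y0 y1 y2 y3 = 0 ∧ L.M y0 y1 y2 y3 ≠ 0 ∧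
    L.M' y0 y1 y2 y3 ≠ 0 := by
  have key : ∀ (m : Fin 4 → Fin 2 → Fin 2 → ℂ), (∀ i, det2 (m i) ≠ 0) → ∃ U : Fin 3 → Vec,
      bil (m 0) (U 0) (U 1) * (bil (m 1) (U 1) (U 2) * (bil (m 2) (U 2) (k3 L.T (U 0) (U 1) (U 2)) *
        bil (m 3) (k3 L.T (U 0) (U 1) (U 2)) (U 0))) ≠ 0 := by
    intro m hm
    refine exists_mul_ne_zero (by fun_prop) (by fun_prop) ?_ (exists_mul_ne_zero (by fun_prop)
      (by fun_prop) ?_ (exists_mul_ne_zero (by fun_prop) (by fun_prop) ?_ ?_))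
    · obtain ⟨u, v, h0⟩ := exists_bil_ne (hm 0)
      exact ⟨![u, v, 0], h0⟩
    · obtain ⟨u, v, h0⟩ := exists_bil_ne (hm 1)
      exact ⟨![0, u, v], h0⟩
    · obtain ⟨u, v, w, h0⟩ := h.nv.exists_bil_k3_right (hm 2)
      exact ⟨![u, v, w], h0⟩
    · obtain ⟨u, v, w, h0⟩ := h.nv.exists_bil_k3_left (hm 3)
      exact ⟨![u, v, w], h0⟩
  obtain ⟨U, hU⟩ := exists_mul_ne_zero (by fun_prop) (by fun_prop) (key L.m h.det) (key L.m' h.det')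
  refine ⟨U 0, U 1, U 2, k3 L.T (U 0) (U 1) (U 2), form_k3 .., ?_, ?_⟩
  · unfold M
    simp only [mul_ne_zero_iff] at hU ⊢
    tauto
  · unfold M'
    simp only [mul_ne_zero_iff] at hU ⊢
    tauto

lemma rot : L.rot.Valid := by
  have e1 : (1 + 1 : Fin 4) = 2 := rfl
  have e2 : (2 + 1 : Fin 4) = 3 := rfl
  have e3 : (3 + 1 : Fin 4) = 0 := rfl
  obtain ⟨q, hq⟩ := h.hD
  obtain ⟨q', hq'⟩ := h.hF
  refine ⟨fun i => h.det _, fun i => h.det' _, h.nv.rotT, h.nz.rotT,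
    exists_M_sub h.nz.rotT fun u v w => ?_, exists_F h.nz.rotT fun u v w => ?_, fun i => h.hn _⟩
  · have h1 := hq (k3 L.rot.T u v w) u v w
    rw [show form L.T (k3 L.rot.T u v w) u v w = 0 by rw [← form_rotT]; exact form_k3 ..] at h1
    simp only [M, M', Loop.rot, zero_add, e1, e2, e3] at h1 ⊢
    linear_combination h1
  · -- after multiplication by `m' 0` this follows from the two identities for the given loop
    refine eq_zero_of_mul_of_ne (f := fun U : Fin 3 → Vec => bil (L.m' 0)
      (k3 L.rot.T (U 0) (U 1) (U 2)) (U 0)) (g := fun U =>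
      L.rot.F (U 0) (U 1) (U 2) (k3 L.rot.T (U 0) (U 1) (U 2)))
      (by fun_prop) (by unfold F; fun_prop) ?_ (fun U => ?_) ![u, v, w]
    · obtain ⟨u, v, w, h0⟩ := h.nv.rotT.exists_bil_k3_left (h.det' 0)
      exact ⟨![u, v, w], h0⟩
    · have h0 : form L.T (k3 L.rot.T (U 0) (U 1) (U 2)) (U 0) (U 1) (U 2) = 0 := by
        rw [← form_rotT]; exact form_k3 ..
      have h1 := hq (k3 L.rot.T (U 0) (U 1) (U 2)) (U 0) (U 1) (U 2)
      have h2 := hq' (k3 L.rot.T (U 0) (U 1) (U 2)) (U 0) (U 1) (U 2)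
      rw [h0] at h1 h2
      generalize k3 L.rot.T (U 0) (U 1) (U 2) = z at *
      simp only [M, M', F, Loop.rot, zero_add, e1, e2, e3] at h1 h2 ⊢
      linear_combination bil (L.n 0) z (U 0) * h1 - bil (L.m 0) z (U 0) * h2

end Valid

end Loop

lemma exists_form_eq_of_vanish {c : Ten} {M : Fin 2 → Fin 2 → ℂ} (hM : det2 M ≠ 0)
    (h : ∀ u w z, form c u (rt M u) w z = 0) :
    ∃ r : Fin 2 → Fin 2 → ℂ, ∀ u v w z, form c u v w z = bil M u v * bil r w z := by
  have key (k l : Fin 2) : ∃ t : ℂ, (fun i j => c i j k l) = t • M := by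
    refine eq_smul_of_vanish hM fun u => ?_
    have e (v : Vec) : bil (fun i j => c i j k l) u v =
        form c u v (![e0, e1] k) (![e0, e1] l) := by
      fin_cases k <;> fin_cases l <;> simp [form_eq, bil]
    rw [e, h]
  choose r hr using key
  refine ⟨r, fun u v w z => ?_⟩
  have e (i j k l) : c i j k l = r k l * M i j := congrFun (congrFun (hr k l) i) j
  simp only [form_eq, e, bil]
  ring

/-- If `T` has two expressions adapted to opposite edges, then they can be combined. -/
lemma exists_form_eq_of_join {T : Ten} {k k2 : ℂ} {m0 m2 x1 x3 g g2 : Fin 2 → Fin 2 → ℂ}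
    (h0 : det2 m0 ≠ 0) (h2 : det2 m2 ≠ 0) (h1 : det2 x1 ≠ 0) (h3 : det2 x3 ≠ 0)
    (hT : ∀ y0 y1 y2 y3, form T y0 y1 y2 y3 =
      k * (bil x1 y1 y2 * bil x3 y3 y0) + bil m0 y0 y1 * bil g y2 y3)
    (hT2 : ∀ y0 y1 y2 y3, form T y0 y1 y2 y3 =
      k2 * (bil x1 y1 y2 * bil x3 y3 y0) + bil m2 y2 y3 * bil g2 y0 y1) :
    ∃ k' : ℂ, ∀ y0 y1 y2 y3, form T y0 y1 y2 y3 =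
      k * (bil x1 y1 y2 * bil x3 y3 y0) + k' * (bil m0 y0 y1 * bil m2 y2 y3) := by
  by_cases hk : k = k2
  · obtain ⟨u, v, huv⟩ := exists_bil_ne h0
    refine ⟨bil g2 u v / bil m0 u v, fun y0 y1 y2 y3 => ?_⟩
    have e1 := hT u v y2 y3
    rw [hT2, ← hk] at e1
    rw [hT]
    field_simp
    linear_combination -bil m0 y0 y1 * e1
  · exfalso
    have hv0 := rt_ne_zero h0 e0_ne_zero
    set v := rt m0 e0 with hv
    have e1 (y2 y3 : Vec) : (k - k2) * (bil x1 v y2 * bil x3 y3 e0) =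
        bil m2 y2 y3 * bil g2 e0 v := by
      have a1 := hT e0 v y2 y3
      rw [hT2, hv, bil_rt] at a1
      linear_combination -a1
    have e2 : bil g2 e0 v = 0 := by
      obtain ⟨y3, hy3⟩ := bil_ne_right h2 (rt_ne_zero h1 hv0)
      have := e1 (rt x1 v) y3
      rw [bil_rt, zero_mul, mul_zero, eq_comm] at this
      exact (mul_eq_zero.1 this).resolve_left hy3
    obtain ⟨y2, hy2⟩ := bil_ne_right h1 hv0
    obtain ⟨y3, hy3⟩ := bil_ne_left h3 e0_ne_zero
    have := e1 y2 y3
    rw [e2, mul_zero, mul_eq_zero, mul_eq_zero, sub_eq_zero] at this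
    tauto

/-- A product of bilinear forms vanishes for suitable values of two of its arguments. -/
lemma NV.coeff_ne_zero {T : Ten} (hT : NV T) {k k' : ℂ} {m0 m2 x1 x3 : Fin 2 → Fin 2 → ℂ}
    (h0 : det2 m0 ≠ 0) (h1 : det2 x1 ≠ 0) (h : ∀ y0 y1 y2 y3, form T y0 y1 y2 y3 =
      k * (bil x1 y1 y2 * bil x3 y3 y0) + k' * (bil m0 y0 y1 * bil m2 y2 y3)) : k ≠ 0 ∧ k' ≠ 0 := by
  constructor
  · rintro rfl
    obtain ⟨a, b, hab⟩ := hT.n01 e0 _ e0_ne_zero (rt_ne_zero h0 e0_ne_zero)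
    exact hab (by rw [h, bil_rt]; ring)
  · rintro rfl
    obtain ⟨a, b, hab⟩ := hT.n12 e0 _ e0_ne_zero (rt_ne_zero h1 e0_ne_zero)
    exact hab (by rw [h, bil_rt]; ring)

namespace Loop

variable {L : Loop}

/-- The two coefficients of each face are linearly independent. -/
def NS (L : Loop) : Prop := ∀ i (a : ℂ), L.m' i ≠ a • L.m i

lemma form_rot_rot (L : Loop) (y0 y1 y2 y3 : Vec) :
    form L.rot.rot.T y2 y3 y0 y1 = form L.T y0 y1 y2 y3 := by
  simp only [rot, form_rotT]

namespace Valid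

variable (h : L.Valid)

include h

lemma ne_smul {i : Fin 4} (hns : ∀ a : ℂ, L.m' i ≠ a • L.m i) (a : ℂ) : L.m i ≠ a • L.m' i := by
  intro h0
  have ha : a ≠ 0 := by
    rintro rfl
    exact h.det i (by simp [h0, det2])
  exact hns a⁻¹ (by rw [h0, inv_smul_smul₀ ha])

/-- At the zeros of `m 0`, the product `m' 0 m' 1 m' 2 m' 3` is divisible by `T`; this determines
`T` modulo `m 0`. -/
lemma exists_T_eq (hns : ∀ a : ℂ, L.m' 0 ≠ a • L.m 0) :
    ∃ (k : ℂ) (g : Fin 2 → Fin 2 → ℂ), ∀ y0 y1 y2 y3, form L.T y0 y1 y2 y3 =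
      k * (bil (L.m' 1) y1 y2 * bil (L.m' 3) y3 y0) + bil (L.m 0) y0 y1 * bil g y2 y3 := by
  obtain ⟨q, hq⟩ := h.hD
  refine exists_eq_of_factor (q := q) (θ := (-1 : ℂ) • L.m' 0) h.nv (h.det 0) (h.det' 1)
    (h.det' 2) (h.det' 3) (fun a ha => hns (-a) ?_) fun y0 y1 y2 y3 h0 => ?_
  · rw [neg_smul, ← ha]; simp
  · rw [← hq, M, M', h0, bil_smul]
    ring

lemma exists_T_eq' (hns : ∀ a : ℂ, L.m' 0 ≠ a • L.m 0) :
    ∃ (k : ℂ) (g : Fin 2 → Fin 2 → ℂ), ∀ y0 y1 y2 y3, form L.T y0 y1 y2 y3 =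
      k * (bil (L.m 1) y1 y2 * bil (L.m 3) y3 y0) + bil (L.m' 0) y0 y1 * bil g y2 y3 := by
  obtain ⟨q, hq⟩ := h.hD
  refine exists_eq_of_factor (q := q) (θ := L.m 0) h.nv (h.det' 0) (h.det 1)
    (h.det 2) (h.det 3) (h.ne_smul hns) fun y0 y1 y2 y3 h0 => ?_
  rw [← hq, M, M', h0]
  ring

/-- If the coefficients of one face are linearly independent, then so are those of the next one. -/
lemma ns_one (hns : ∀ a : ℂ, L.m' 0 ≠ a • L.m 0) (a : ℂ) : L.m' 1 ≠ a • L.m 1 := by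
  intro ha
  obtain ⟨k, g, hk⟩ := h.exists_T_eq hns
  obtain ⟨l, g', hl⟩ := h.exists_T_eq' hns
  set N : Fin 2 → Fin 2 → ℂ := fun i j => k * a * L.m' 3 i j - l * L.m 3 i j
  have hN (u v) : bil N u v = k * a * bil (L.m' 3) u v - l * bil (L.m 3) u v := by
    simp only [N, bil]; ring
  have e1 (y0 y1 y2 y3 : Vec) : bil (L.m 1) y1 y2 * bil N y3 y0 + bil (L.m 0) y0 y1 * bil g y2 y3 -
      bil (L.m' 0) y0 y1 * bil g' y2 y3 = 0 := by
    have := hk y0 y1 y2 y3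
    rw [hl, ha, bil_smul] at this
    rw [hN]
    linear_combination -this
  obtain ⟨p0, p1, hp0, hp1, b0, b1⟩ := exists_bil_zero (L.m 0) (L.m' 0)
  obtain ⟨φ, hφ, hNφ⟩ : ∃ φ, φ ≠ 0 ∧ ∀ v, bil N φ v = 0 := by
    by_contra! h0
    have h1 := det2_ne_zero_iff.2 h0
    obtain ⟨u, hu⟩ := bil_ne_left h1 hp0
    obtain ⟨y2, hy2⟩ := bil_ne_right (h.det 1) hp1
    have := e1 p0 p1 y2 u
    rw [b0, b1, zero_mul, zero_mul, add_zero, sub_zero, mul_eq_zero] at this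
    tauto
  have hg' (y2 : Vec) : bil g' y2 φ = 0 := by
    by_contra h0
    refine hns (bil g y2 φ / bil g' y2 φ) (eq_smul_of_bil fun u v => ?_)
    have := e1 u v y2 φ
    rw [hNφ] at this
    field_simp
    linear_combination -this
  obtain ⟨y1, y2, hy⟩ := h.nv.n03 _ φ (rt_ne_zero (h.det 3) hφ) hφ
  exact hy (by rw [hl, bil_rt, hg']; ring)

lemma ns (i : Fin 4) (hns : ∀ a : ℂ, L.m' i ≠ a • L.m i) : L.NS := by
  have key : ∀ {L : Loop}, L.Valid → (∀ a : ℂ, L.m' 0 ≠ a • L.m 0) → L.NS := by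
    intro L h h0
    have h1 := h.ns_one h0
    have h2 := h.rot.ns_one h1
    have h3 := h.rot.rot.ns_one h2
    intro j
    fin_cases j
    exacts [h0, h1, h2, h3]
  fin_cases i
  · exact key h hns
  · have := key h.rot hns
    intro j
    fin_cases j
    exacts [this 3, this 0, this 1, this 2]
  · have := key h.rot.rot hns
    intro j
    fin_cases j
    exacts [this 2, this 3, this 0, this 1]
  · have := key h.rot.rot.rot hns
    intro j
    fin_cases j
    exacts [this 1, this 2, this 3, this 0]

/-- In the non-scalar case, `T` is a combination of products of coefficients at opposite edges, in
two ways. -/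
lemma exists_T_eq_of_ns (hns : L.NS) : ∃ k k' l l' : ℂ, k ≠ 0 ∧ k' ≠ 0 ∧ l ≠ 0 ∧ l' ≠ 0 ∧
    k * l' = k' * l ∧ (∀ y0 y1 y2 y3, form L.T y0 y1 y2 y3 =
      k * (bil (L.m' 1) y1 y2 * bil (L.m' 3) y3 y0) +
        k' * (bil (L.m 0) y0 y1 * bil (L.m 2) y2 y3)) ∧
    ∀ y0 y1 y2 y3, form L.T y0 y1 y2 y3 =
      l * (bil (L.m 1) y1 y2 * bil (L.m 3) y3 y0) +
        l' * (bil (L.m' 0) y0 y1 * bil (L.m' 2) y2 y3) := by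
  obtain ⟨k, g, hk⟩ := h.exists_T_eq (hns 0)
  obtain ⟨l, g', hl⟩ := h.exists_T_eq' (hns 0)
  obtain ⟨c, g2, hc⟩ := h.rot.rot.exists_T_eq (hns 2)
  obtain ⟨d, g2', hd⟩ := h.rot.rot.exists_T_eq' (hns 2)
  obtain ⟨k', hk'⟩ := exists_form_eq_of_join (h.det 0) (h.det 2) (h.det' 1) (h.det' 3) hk
    fun y0 y1 y2 y3 => by
      rw [← form_rot_rot, hc, mul_comm (bil (L.m' 1) y1 y2)]
      rfl
  obtain ⟨l', hl'⟩ := exists_form_eq_of_join (h.det' 0) (h.det' 2) (h.det 1) (h.det 3) hl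
    fun y0 y1 y2 y3 => by
      rw [← form_rot_rot, hd, mul_comm (bil (L.m 1) y1 y2)]
      rfl
  obtain ⟨hk0, hk'0⟩ := h.nv.coeff_ne_zero (h.det 0) (h.det' 1) hk'
  obtain ⟨hl0, hl'0⟩ := h.nv.coeff_ne_zero (h.det' 0) (h.det 1) hl'
  refine ⟨k, k', l, l', hk0, hk'0, hl0, hl'0, ?_, hk', hl'⟩
  obtain ⟨y0, y1, y2, y3, h0, h1, h2⟩ := h.exists_generic
  obtain ⟨q, hq⟩ := h.hD
  have e1 := hk' y0 y1 y2 y3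
  have e2 := hl' y0 y1 y2 y3
  have e3 := hq y0 y1 y2 y3
  rw [h0] at e1 e2 e3
  refine mul_right_cancel₀ h1 ?_
  unfold M at *
  unfold M' at *
  linear_combination k * l' * e3 + l' * (bil (L.m' 0) y0 y1 * bil (L.m' 2) y2 y3) * (-e1) +
    k' * (bil (L.m 0) y0 y1 * bil (L.m 2) y2 y3) * e2

/-- The consequence of the compatibility for the constant terms. -/
lemma exists_const_eq {l l' : ℂ} (hl : ∀ y0 y1 y2 y3, form L.T y0 y1 y2 y3 =
      l * (bil (L.m 1) y1 y2 * bil (L.m 3) y3 y0) +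
        l' * (bil (L.m' 0) y0 y1 * bil (L.m' 2) y2 y3)) :
    ∃ r : Fin 2 → Fin 2 → ℂ, ∀ y0 y1 y2 y3,
      l' * (bil (L.n 0) y0 y1 * bil (L.m 2) y2 y3 * bil (L.m' 2) y2 y3) +
      l * (bil (L.n 1) y1 y2 * bil (L.m 2) y2 y3 * bil (L.m 3) y3 y0 -
        bil (L.m' 1) y1 y2 * bil (L.n 2) y2 y3 * bil (L.m 3) y3 y0 +
        bil (L.m' 1) y1 y2 * bil (L.m' 2) y2 y3 * bil (L.n 3) y3 y0) =
      form L.T y0 y1 y2 y3 * bil r y2 y3 := by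
  obtain ⟨q, hq⟩ := h.hF
  set c : Ten := fun i j k m => L.n 0 i j * L.m 2 k m - l * q i j k m
  have hc (y0 y1 y2 y3 : Vec) : form c y0 y1 y2 y3 =
      bil (L.n 0) y0 y1 * bil (L.m 2) y2 y3 - l * form q y0 y1 y2 y3 := by
    simp only [c, form_eq, bil]
    ring
  have key (y0 y1 y2 y3 : Vec) : form L.T y0 y1 y2 y3 * form c y0 y1 y2 y3 =
      bil (L.m' 0) y0 y1 * (l' * (bil (L.n 0) y0 y1 * bil (L.m 2) y2 y3 * bil (L.m' 2) y2 y3) +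
      l * (bil (L.n 1) y1 y2 * bil (L.m 2) y2 y3 * bil (L.m 3) y3 y0 -
        bil (L.m' 1) y1 y2 * bil (L.n 2) y2 y3 * bil (L.m 3) y3 y0 +
        bil (L.m' 1) y1 y2 * bil (L.m' 2) y2 y3 * bil (L.n 3) y3 y0)) := by
    have h1 := hq y0 y1 y2 y3
    have h2 := hl y0 y1 y2 y3
    rw [hc]
    unfold F at h1
    linear_combination l * h1 + bil (L.n 0) y0 y1 * bil (L.m 2) y2 y3 * h2
  obtain ⟨r, hr⟩ := exists_form_eq_of_vanish (c := c) (h.det' 0) fun u w z => by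
    refine eq_zero_of_mul_of_ne (f := fun U : Fin 3 → Vec =>
      form L.T (U 0) (rt (L.m' 0) (U 0)) (U 1) (U 2))
      (g := fun U => form c (U 0) (rt (L.m' 0) (U 0)) (U 1) (U 2)) (by fun_prop) (by fun_prop)
      ?_ (fun U => by rw [key, bil_rt, zero_mul]) ![u, w, z]
    obtain ⟨a, b, hab⟩ := h.nv.n01 e0 _ e0_ne_zero (rt_ne_zero (h.det' 0) e0_ne_zero)
    exact ⟨![e0, a, b], hab⟩
  refine ⟨r, fun y0 y1 y2 y3 => ?_⟩
  have := eq_zero_of_mul_of_ne (f := fun U : Fin 4 → Vec => bil (L.m' 0) (U 0) (U 1))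
    (g := fun U => l' * (bil (L.n 0) (U 0) (U 1) * bil (L.m 2) (U 2) (U 3) *
        bil (L.m' 2) (U 2) (U 3)) +
      l * (bil (L.n 1) (U 1) (U 2) * bil (L.m 2) (U 2) (U 3) * bil (L.m 3) (U 3) (U 0) -
        bil (L.m' 1) (U 1) (U 2) * bil (L.n 2) (U 2) (U 3) * bil (L.m 3) (U 3) (U 0) +
        bil (L.m' 1) (U 1) (U 2) * bil (L.m' 2) (U 2) (U 3) * bil (L.n 3) (U 3) (U 0)) -
      form L.T (U 0) (U 1) (U 2) (U 3) * bil r (U 2) (U 3)) (by fun_prop) (by fun_prop) (by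
        obtain ⟨u, v, huv⟩ := exists_bil_ne (h.det' 0)
        exact ⟨![u, v, 0, 0], huv⟩) (fun U => by
          have := key (U 0) (U 1) (U 2) (U 3)
          rw [hr] at this
          linear_combination -this) ![y0, y1, y2, y3]
  simpa [sub_eq_zero] using this

end Valid

end Loop

lemma eq_smul_of_vanish_left {M N : Fin 2 → Fin 2 → ℂ} (hM : det2 M ≠ 0)
    (h : ∀ u, bil N (rt (tr M) u) u = 0) : ∃ t : ℂ, N = t • M := by
  obtain ⟨t, ht⟩ := eq_smul_of_vanish (M := tr M) (N := tr N) (by rwa [det2_tr])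
    (fun u => by rw [bil_tr, h])
  exact ⟨t, congrArg tr ht⟩

lemma bil_rt_left (M : Fin 2 → Fin 2 → ℂ) (u : Vec) : bil M (rt (tr M) u) u = 0 := by
  rw [← bil_tr, bil_rt]

lemma exists_bil_rt_ne {M N : Fin 2 → Fin 2 → ℂ} (hM : det2 M ≠ 0) (h : ∀ t : ℂ, N ≠ t • M) :
    ∃ u, bil N u (rt M u) ≠ 0 := by
  by_contra! h0
  obtain ⟨t, ht⟩ := eq_smul_of_vanish hM h0
  exact h t ht

lemma exists_bil_rt_left_ne {M N : Fin 2 → Fin 2 → ℂ} (hM : det2 M ≠ 0) (h : ∀ t : ℂ, N ≠ t • M) :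
    ∃ u, bil N (rt (tr M) u) u ≠ 0 := by
  by_contra! h0
  obtain ⟨t, ht⟩ := eq_smul_of_vanish_left hM h0
  exact h t ht

namespace Loop.Valid

variable {L : Loop}

/-- The constant terms `d` which satisfy the homogeneous identity with `d 2 = 0` are those which
arise by translations of the variables `u₀` and `u₁`. -/
lemma exists_translation (h : L.Valid) (hns : L.NS) {k k' l l' : ℂ} (hk0 : k ≠ 0) (hl0 : l ≠ 0)
    (hl'0 : l' ≠ 0) (hkl : k * l' = k' * l)
    (hk : ∀ y0 y1 y2 y3, form L.T y0 y1 y2 y3 = k * (bil (L.m' 1) y1 y2 * bil (L.m' 3) y3 y0) +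
        k' * (bil (L.m 0) y0 y1 * bil (L.m 2) y2 y3))
    (hl : ∀ y0 y1 y2 y3, form L.T y0 y1 y2 y3 = l * (bil (L.m 1) y1 y2 * bil (L.m 3) y3 y0) +
        l' * (bil (L.m' 0) y0 y1 * bil (L.m' 2) y2 y3))
    {d0 d1 d3 r : Fin 2 → Fin 2 → ℂ}
    (hd : ∀ y0 y1 y2 y3, l' * (bil d0 y0 y1 * bil (L.m 2) y2 y3 * bil (L.m' 2) y2 y3) +
      l * (bil d1 y1 y2 * bil (L.m 2) y2 y3 * bil (L.m 3) y3 y0 +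
        bil (L.m' 1) y1 y2 * bil (L.m' 2) y2 y3 * bil d3 y3 y0) =
      form L.T y0 y1 y2 y3 * bil r y2 y3) :
    ∃ s1 s3 : ℂ, d3 = s3 • L.m' 3 ∧ d1 = s1 • L.m 1 ∧
      ∀ y0 y1, bil d0 y0 y1 = s3 * bil (L.m 0) y0 y1 + s1 * bil (L.m' 0) y0 y1 := by
  set σ : Vec → Vec := rt (tr (L.m 2)) with hσ
  have dσ : Differentiable ℂ σ := by rw [hσ]; fun_prop
  have bσ (y : Vec) : bil (L.m 2) (σ y) y = 0 := bil_rt_left _ _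
  have a1 (y0 y3 : Vec) : l * (bil (L.m' 2) (σ y3) y3 * bil d3 y3 y0) =
      k * (bil (L.m' 3) y3 y0 * bil r (σ y3) y3) := by
    have := eq_zero_of_mul_of_ne (f := fun U : Fin 3 → Vec => bil (L.m' 1) (U 1) (σ (U 2)))
      (g := fun U => l * (bil (L.m' 2) (σ (U 2)) (U 2) * bil d3 (U 2) (U 0)) -
        k * (bil (L.m' 3) (U 2) (U 0) * bil r (σ (U 2)) (U 2))) (by fun_prop) (by fun_prop) (by
        obtain ⟨u, hu⟩ := bil_ne_left (h.det' 1)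
          (rt_ne_zero (by rw [det2_tr]; exact h.det 2) e0_ne_zero : σ e0 ≠ 0)
        exact ⟨![0, u, e0], hu⟩) (fun U => by
        have := hd (U 0) (U 1) (σ (U 2)) (U 2)
        rw [hk, bσ] at this
        linear_combination this) ![y0, 0, y3]
    simpa [sub_eq_zero] using this
  obtain ⟨s3, hs3⟩ := eq_smul_of_vanish (M := L.m' 3) (N := d3) (h.det' 3) fun u => by
    refine eq_zero_of_mul_of_ne (f := fun u => l * bil (L.m' 2) (σ u) u)
      (g := fun u => bil d3 u (rt (L.m' 3) u)) (by fun_prop) (by fun_prop) ?_ (fun u => ?_) u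
    · obtain ⟨u, hu⟩ := exists_bil_rt_left_ne (h.det 2) (hns 2)
      exact ⟨u, mul_ne_zero hl0 hu⟩
    · have := a1 (rt (L.m' 3) u) u
      rw [bil_rt] at this
      linear_combination this
  have a2 (y3 : Vec) : l * s3 * bil (L.m' 2) (σ y3) y3 = k * bil r (σ y3) y3 := by
    have := eq_zero_of_mul_of_ne (f := fun U : Fin 2 → Vec => bil (L.m' 3) (U 1) (U 0))
      (g := fun U => l * s3 * bil (L.m' 2) (σ (U 1)) (U 1) - k * bil r (σ (U 1)) (U 1))
      (by fun_prop) (by fun_prop) (by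
        obtain ⟨u, v, huv⟩ := exists_bil_ne (h.det' 3)
        exact ⟨![v, u], huv⟩) (fun U => by
        have := a1 (U 0) (U 1)
        rw [hs3, bil_smul] at this
        linear_combination this) ![0, y3]
    simpa [sub_eq_zero] using this
  obtain ⟨t, ht⟩ := eq_smul_of_vanish_left (M := L.m 2) (N := fun i j => k * r i j -
    l * s3 * L.m' 2 i j) (h.det 2) fun u => by
      have := a2 u
      simp only [bil] at this ⊢
      linear_combination -this
  have hr (u v : Vec) : k * bil r u v = l * s3 * bil (L.m' 2) u v + t * bil (L.m 2) u v := by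
    have := congrArg (fun M => bil M u v) ht
    simp only [bil_smul] at this
    simp only [bil] at this ⊢
    linear_combination this
  have a3 : d1 = (t / k) • L.m 1 := by
    refine eq_smul_of_bil fun y1 y2 => ?_
    have := eq_zero_of_mul_of_ne (f := fun U : Fin 3 → Vec => bil (L.m 2) (U 2) (rt (L.m' 2) (U 2))
        * bil (L.m 3) (rt (L.m' 2) (U 2)) (U 0))
      (g := fun U => k * bil d1 (U 1) (U 2) - t * bil (L.m 1) (U 1) (U 2))
      (by fun_prop) (by fun_prop) (exists_mul_ne_zero (by fun_prop) (by fun_prop) (by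
        obtain ⟨u, hu⟩ := exists_bil_rt_ne (h.det' 2) (h.ne_smul (hns 2))
        exact ⟨![0, 0, u], hu⟩) (by
        obtain ⟨v, hv⟩ := bil_ne_right (h.det 3) (rt_ne_zero (h.det' 2) e0_ne_zero)
        exact ⟨![v, 0, e0], hv⟩)) (fun U => by
        have h1 := hd (U 0) (U 1) (U 2) (rt (L.m' 2) (U 2))
        have h2 := hr (U 2) (rt (L.m' 2) (U 2))
        rw [hl, bil_rt] at h1
        rw [bil_rt] at h2
        refine mul_left_cancel₀ hl0 ?_
        linear_combination k * h1 + l * bil (L.m 1) (U 1) (U 2) *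
          bil (L.m 3) (rt (L.m' 2) (U 2)) (U 0) * h2) ![0, y1, y2]
    simp only [Matrix.cons_val_one, Matrix.cons_val_zero, Matrix.cons_val] at this
    field_simp
    linear_combination this
  refine ⟨t / k, s3, hs3, a3, fun y0 y1 => ?_⟩
  have := eq_zero_of_mul_of_ne (f := fun U : Fin 4 → Vec => bil (L.m 2) (U 2) (U 3) *
        bil (L.m' 2) (U 2) (U 3))
      (g := fun U => k * bil d0 (U 0) (U 1) - k * s3 * bil (L.m 0) (U 0) (U 1) -
        t * bil (L.m' 0) (U 0) (U 1))
      (by fun_prop) (by fun_prop) (exists_mul_ne_zero (by fun_prop) (by fun_prop) (by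
        obtain ⟨u, v, hu⟩ := exists_bil_ne (h.det 2)
        exact ⟨![0, 0, u, v], hu⟩) (by
        obtain ⟨u, v, hu⟩ := exists_bil_ne (h.det' 2)
        exact ⟨![0, 0, u, v], hu⟩)) (fun U => by
        have h1 := hd (U 0) (U 1) (U 2) (U 3)
        have h2 := hr (U 2) (U 3)
        have h3 := hk (U 0) (U 1) (U 2) (U 3)
        have h4 := hl (U 0) (U 1) (U 2) (U 3)
        have h5 : bil d1 (U 1) (U 2) * k = t * bil (L.m 1) (U 1) (U 2) := by
          rw [a3, bil_smul]; field_simp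
        rw [hs3, bil_smul] at h1
        refine mul_left_cancel₀ (mul_ne_zero hl'0 hk0) ?_
        linear_combination (exp := 1) k * k * h1 - k * l * bil (L.m 2) (U 2) (U 3) *
          bil (L.m 3) (U 3) (U 0) * h5 + k * form L.T (U 0) (U 1) (U 2) (U 3) * h2 +
          k * l * s3 * bil (L.m' 2) (U 2) (U 3) * h3 + k * t * bil (L.m 2) (U 2) (U 3) * h4 - 
          k * s3 * bil (L.m 0) (U 0) (U 1) * bil (L.m 2) (U 2) (U 3) * bil (L.m' 2) (U 2) (U 3) *
          hkl) ![y0, y1, 0, 0]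
  simp only [Matrix.cons_val_one, Matrix.cons_val_zero] at this
  field_simp
  linear_combination this

/-! ### The case of proportional coefficients -/

lemma exists_T_eq_of_scalar_zero (h : L.Valid) {a : Fin 4 → ℂ} (ha : ∀ i, L.m' i = a i • L.m i) :
    ∃ (k : ℂ) (g : Fin 2 → Fin 2 → ℂ), ∀ y0 y1 y2 y3, form L.T y0 y1 y2 y3 =
      k * (bil (L.m 1) y1 y2 * bil (L.m 3) y3 y0) + bil (L.m 0) y0 y1 * bil g y2 y3 := by
  obtain ⟨q, hq⟩ := h.hF
  refine exists_eq_of_factor (q := q) (θ := L.n 0) h.nv (h.det 0) (h.det 1)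
    (h.det 2) (h.det 3) (fun b => h.hn 0 _ b (ha 0)) fun y0 y1 y2 y3 h0 => ?_
  rw [← hq, F, ha 0, bil_smul, h0]
  ring

/-- If the coefficients of every face are proportional, `T` is a combination of the products of
coefficients at opposite edges. -/
lemma exists_T_eq_of_scalar (h : L.Valid) {a : Fin 4 → ℂ} (ha : ∀ i, L.m' i = a i • L.m i) :
    ∃ k k' : ℂ, k ≠ 0 ∧ k' ≠ 0 ∧ ∀ y0 y1 y2 y3, form L.T y0 y1 y2 y3 =
      k * (bil (L.m 1) y1 y2 * bil (L.m 3) y3 y0) +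
        k' * (bil (L.m 0) y0 y1 * bil (L.m 2) y2 y3) := by
  obtain ⟨k, g, hk⟩ := h.exists_T_eq_of_scalar_zero ha
  obtain ⟨c, g2, hc⟩ := h.rot.rot.exists_T_eq_of_scalar_zero (a := fun i => a (i + 1 + 1))
    fun i => ha _
  obtain ⟨k', hk'⟩ := exists_form_eq_of_join (h.det 0) (h.det 2) (h.det 1) (h.det 3) hk
    fun y0 y1 y2 y3 => by
      rw [← form_rot_rot, hc, mul_comm (bil (L.m 1) y1 y2)]
      rfl
  obtain ⟨hk0, hk'0⟩ := h.nv.coeff_ne_zero (h.det 0) (h.det 1) hk'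
  exact ⟨k, k', hk0, hk'0, hk'⟩

/-- The compatibility condition `M = M'` on the zero set of `T`, for proportional coefficients. -/
lemma prod_eq_one_of_scalar (h : L.Valid) {a : Fin 4 → ℂ} (ha : ∀ i, L.m' i = a i • L.m i) :
    a 0 * a 1 * a 2 * a 3 = 1 := by
  obtain ⟨y0, y1, y2, y3, h0, h1, h2⟩ := h.exists_generic
  obtain ⟨q, hq⟩ := h.hD
  have := hq y0 y1 y2 y3
  rw [h0] at this
  refine mul_right_cancel₀ h1 ?_
  simp only [M, M', ha, bil_smul] at this ⊢
  linear_combination -this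

/-- The compatibility condition `F = 0` on the zero set of `T`, if `m' i = -m i`. -/
lemma exists_const_eq_of_scalar (h : L.Valid) (ha : ∀ i, L.m' i = (-1 : ℂ) • L.m i) {k k' : ℂ}
    (hk : ∀ y0 y1 y2 y3, form L.T y0 y1 y2 y3 = k * (bil (L.m 1) y1 y2 * bil (L.m 3) y3 y0) +
        k' * (bil (L.m 0) y0 y1 * bil (L.m 2) y2 y3)) :
    ∃ r : ℂ, ∀ y0 y1 y2 y3, k * (bil (L.n 1) y1 y2 * bil (L.m 3) y3 y0 +
        bil (L.m 1) y1 y2 * bil (L.n 3) y3 y0) - k' * (bil (L.n 0) y0 y1 * bil (L.m 2) y2 y3 +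
        bil (L.m 0) y0 y1 * bil (L.n 2) y2 y3) = r * form L.T y0 y1 y2 y3 := by
  set c : Ten := fun i j p q => k * (L.n 1 j p * L.m 3 q i + L.m 1 j p * L.n 3 q i) -
    k' * (L.n 0 i j * L.m 2 p q + L.m 0 i j * L.n 2 p q)
  have hc (y0 y1 y2 y3 : Vec) : form c y0 y1 y2 y3 = k * (bil (L.n 1) y1 y2 * bil (L.m 3) y3 y0 +
        bil (L.m 1) y1 y2 * bil (L.n 3) y3 y0) - k' * (bil (L.n 0) y0 y1 * bil (L.m 2) y2 y3 +
        bil (L.m 0) y0 y1 * bil (L.n 2) y2 y3) := by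
    simp only [c, form_eq, bil]
    ring
  obtain ⟨q, hq⟩ := h.hF
  simp only [← hc]
  refine exists_smul_of_vanish h.nz fun u v w => ?_
  refine eq_zero_of_mul_of_ne (f := fun U : Fin 3 → Vec => bil (L.m 0) (U 0) (U 1) *
    bil (L.m 2) (U 2) (k3 L.T (U 0) (U 1) (U 2))) (g := fun U => form c (U 0) (U 1) (U 2)
    (k3 L.T (U 0) (U 1) (U 2))) (by fun_prop) (by fun_prop) ?_ (fun U => ?_) ![u, v, w]
  · refine exists_mul_ne_zero (by fun_prop) (by fun_prop) ?_ ?_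
    · obtain ⟨u, v, h0⟩ := exists_bil_ne (h.det 0)
      exact ⟨![u, v, 0], h0⟩
    · obtain ⟨u, v, w, h0⟩ := h.nv.exists_bil_k3_right (h.det 2)
      exact ⟨![u, v, w], h0⟩
  · have h1 := hq (U 0) (U 1) (U 2) (k3 L.T (U 0) (U 1) (U 2))
    have h2 := hk (U 0) (U 1) (U 2) (k3 L.T (U 0) (U 1) (U 2))
    rw [form_k3] at h1 h2
    simp only [F, ha, bil_smul] at h1
    rw [hc]
    generalize k3 L.T (U 0) (U 1) (U 2) = z at *
    linear_combination k * h1 + (bil (L.n 0) (U 0) (U 1) * bil (L.m 2) (U 2) z +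
        bil (L.m 0) (U 0) (U 1) * bil (L.n 2) (U 2) z) * h2

end Loop.Valid

/-! ### The faces around `B'` -/

/-- The faces `A, C', A', C` around `B'`; the variables `y i` are `x₁, x₁₂, x₁₂₃, x₁₃`, and the
variables `u i` are `x, x₂, x₂₃, x₃`. -/
def Sys.loop (s : Sys) : Loop where
  m := ![fun j l => s.A 0 j 1 l, fun j l => s.C' 0 j 1 l, fun j l => s.A' 1 l 0 j,
    fun j l => s.C 1 l 0 j]
  m' := ![fun j l => s.A 1 j 0 l, fun j l => s.C' 1 j 0 l, fun j l => s.A' 0 l 1 j,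
    fun j l => s.C 0 l 1 j]
  n := ![fun j l => s.A 1 j 1 l, fun j l => s.C' 1 j 1 l, fun j l => s.A' 1 l 1 j,
    fun j l => s.C 1 l 1 j]
  T := fun i j k l => s.B' i j l k

lemma form_swap (c : Ten) (u v w z : Vec) :
    form (fun i j k l => c i j l k) u v w z = form c u v z w := by
  simp only [form_eq]
  ring

lemma NV.swap {c : Ten} (hc : NV c) : NV fun i j k l => c i j l k := by
  refine ⟨?_, ?_, ?_, ?_, ?_, ?_⟩ <;> intro p q hp hq <;> simp only [form_swap]
  · obtain ⟨a, b, h⟩ := hc.n01 p q hp hq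
    exact ⟨b, a, h⟩
  · exact hc.n03 p q hp hq
  · exact hc.n02 p q hp hq
  · exact hc.n13 p q hp hq
  · exact hc.n12 p q hp hq
  · exact hc.n23 q p hq hp

lemma NonzeroBiquads.swap {c : Ten} (hc : NonzeroBiquads c) :
    NonzeroBiquads fun i j k l => c i j l k :=
  hc.of_perm (Equiv.ofBijective ![0, 1, 3, 2] (by decide)) fun U => by
    rw [formF, form_swap]
    rfl

lemma NonzeroBiquads.not_factor {c : Ten} (hc : NonzeroBiquads c) (φ ψ : Vec → Vec → ℂ) :
    ¬ ∀ u v w z, form c u v w z = φ u w * ψ v z := by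
  intro h
  obtain ⟨u, v, h0⟩ := hc.exists_d23
  apply h0
  simp only [d23, h]
  ring

lemma bil_eq_form₁₃ (c : Ten) (i k : Fin 2) (v z : Vec) :
    bil (fun j l => c i j k l) v z = form c (![e0, e1] i) v (![e0, e1] k) z := by
  fin_cases i <;> fin_cases k <;> simp [form_eq, bil]

lemma bil_smul_left (M : Fin 2 → Fin 2 → ℂ) (t : ℂ) (u v : Vec) :
    bil M (t • u) v = t * bil M u v := by
  simp only [bil, Pi.smul_apply, smul_eq_mul]; ring

lemma bil_smul_right (M : Fin 2 → Fin 2 → ℂ) (t : ℂ) (u v : Vec) :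
    bil M u (t • v) = t * bil M u v := by
  simp only [bil, Pi.smul_apply, smul_eq_mul]; ring

lemma bil_swap (M : Fin 2 → Fin 2 → ℂ) (u v : Vec) : bil (fun l j => M j l) u v = bil M v u :=
  bil_tr M u v

lemma Sys.loop_m₀ (s : Sys) (y z : Vec) :
    bil (s.loop.m 0) y z = bil (fun j l => s.A 0 j 1 l) y z := rfl

lemma Sys.loop_m'₀ (s : Sys) (y z : Vec) :
    bil (s.loop.m' 0) y z = bil (fun j l => s.A 1 j 0 l) y z := rfl

lemma Sys.loop_n₀ (s : Sys) (y z : Vec) :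
    bil (s.loop.n 0) y z = bil (fun j l => s.A 1 j 1 l) y z := rfl

lemma Sys.loop_m₁ (s : Sys) (y z : Vec) :
    bil (s.loop.m 1) y z = bil (fun j l => s.C' 0 j 1 l) y z := rfl

lemma Sys.loop_m'₁ (s : Sys) (y z : Vec) :
    bil (s.loop.m' 1) y z = bil (fun j l => s.C' 1 j 0 l) y z := rfl

lemma Sys.loop_n₁ (s : Sys) (y z : Vec) :
    bil (s.loop.n 1) y z = bil (fun j l => s.C' 1 j 1 l) y z := rfl

lemma Sys.loop_m₂ (s : Sys) (y z : Vec) :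
    bil (s.loop.m 2) y z = bil (fun j l => s.A' 1 j 0 l) z y := bil_swap _ _ _

lemma Sys.loop_m'₂ (s : Sys) (y z : Vec) :
    bil (s.loop.m' 2) y z = bil (fun j l => s.A' 0 j 1 l) z y := bil_swap _ _ _

lemma Sys.loop_n₂ (s : Sys) (y z : Vec) :
    bil (s.loop.n 2) y z = bil (fun j l => s.A' 1 j 1 l) z y := bil_swap _ _ _

lemma Sys.loop_m₃ (s : Sys) (y z : Vec) :
    bil (s.loop.m 3) y z = bil (fun j l => s.C 1 j 0 l) z y := bil_swap _ _ _

lemma Sys.loop_m'₃ (s : Sys) (y z : Vec) :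
    bil (s.loop.m' 3) y z = bil (fun j l => s.C 0 j 1 l) z y := bil_swap _ _ _

lemma Sys.loop_n₃ (s : Sys) (y z : Vec) :
    bil (s.loop.n 3) y z = bil (fun j l => s.C 1 j 1 l) z y := bil_swap _ _ _

lemma forall_fin_four {P : Fin 4 → Prop} (h0 : P 0) (h1 : P 1) (h2 : P 2) (h3 : P 3) (i : Fin 4) :
    P i := by
  fin_cases i
  exacts [h0, h1, h2, h3]

/-- A face with proportional coefficients would be a product. -/
lemma NonzeroBiquads.not_smul {c : Ten} (hc : NonzeroBiquads c)
    (hv : ∀ j l, c 0 j 0 l = 0) {a b : ℂ}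
    (ha : ∀ v z, bil (fun j l => c 1 j 0 l) v z = a * bil (fun j l => c 0 j 1 l) v z)
    (hb : ∀ v z, bil (fun j l => c 1 j 1 l) v z = b * bil (fun j l => c 0 j 1 l) v z) : False := by
  refine hc.not_factor (fun u w => u 0 * w 1 + a * (u 1 * w 0) + b * (u 1 * w 1))
    (fun v z => bil (fun j l => c 0 j 1 l) v z) fun u v w z => ?_
  rw [form_of_vanish hv, ha, hb]
  ring

lemma NonzeroBiquads.not_smul' {c : Ten} (hc : NonzeroBiquads c)
    (hv : ∀ j l, c 0 j 0 l = 0) {a b : ℂ}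
    (ha : ∀ v z, bil (fun j l => c 0 j 1 l) v z = a * bil (fun j l => c 1 j 0 l) v z)
    (hb : ∀ v z, bil (fun j l => c 1 j 1 l) v z = b * bil (fun j l => c 1 j 0 l) v z) : False := by
  refine hc.not_factor (fun u w => a * (u 0 * w 1) + u 1 * w 0 + b * (u 1 * w 1))
    (fun v z => bil (fun j l => c 1 j 0 l) v z) fun u v w z => ?_
  rw [form_of_vanish hv, ha, hb]
  ring

namespace Std

variable {s : Sys}

/-- The elimination of `x₂`, `x₂₃` and `x₃` from the four faces gives an equation for `x`, which
holds identically on the zero set of `B'`. -/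
lemma loop_eq_zero (h : Std s) (u : Vec) {y0 y1 y2 y3 : Vec} (hy : y2 = k3 s.B' y0 y1 y3) :
    u 0 * u 1 * (s.loop.M y0 y1 y2 y3 - s.loop.M' y0 y1 y2 y3) +
      u 1 * u 1 * s.loop.F y0 y1 y2 y3 = 0 := by
  have h0 := h.loop u y0 y1 y3
  rw [← hy] at h0
  simp only [form_of_vanish h.vC', form_of_vanish h.vA', form_of_vanish h.vC,
    form_of_vanish h.vA, k2, e0_zero, e0_one, e1_zero, e1_one, Matrix.cons_val_zero,
    Matrix.cons_val_one] at h0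
  simp only [Loop.M, Loop.M', Loop.F, Sys.loop_m₀, Sys.loop_m'₀, Sys.loop_n₀, Sys.loop_m₁,
    Sys.loop_m'₁, Sys.loop_n₁, Sys.loop_m₂, Sys.loop_m'₂, Sys.loop_n₂, Sys.loop_m₃,
    Sys.loop_m'₃, Sys.loop_n₃] at h0 ⊢
  linear_combination h0

/-- The equation for `x`, with the zeros of `B'` parametrized by `x₁, x₁₂, x₁₂₃` instead of
`x₁, x₁₂, x₁₃`. -/
lemma loop_eq_zero' (h : Std s) (u v w : Vec) :
    s.loop.M u v w (k2 s.B' u v w) - s.loop.M' u v w (k2 s.B' u v w) = 0 ∧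
    s.loop.F u v w (k2 s.B' u v w) = 0 := by
  have e (u v w : Vec) (a : ℂ) : d23 s.B' u v * d23 s.B' u v * (a *
      (s.loop.M u v w (k2 s.B' u v w) - s.loop.M' u v w (k2 s.B' u v w)) +
      s.loop.F u v w (k2 s.B' u v w)) = 0 := by
    have := h.loop_eq_zero ![a, 1] (y0 := u) (y1 := v) (y3 := k2 s.B' u v w) rfl
    rw [k3_k2] at this
    simp only [Loop.M, Loop.M', Loop.F, bil_smul_left, bil_smul_right, Matrix.cons_val_zero,
      Matrix.cons_val_one] at this ⊢
    linear_combination this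
  have e' (u v w : Vec) (a : ℂ) : a *
      (s.loop.M u v w (k2 s.B' u v w) - s.loop.M' u v w (k2 s.B' u v w)) +
      s.loop.F u v w (k2 s.B' u v w) = 0 := by
    refine eq_zero_of_mul_of_ne (f := fun U : Fin 3 → Vec => d23 s.B' (U 0) (U 1) *
      d23 s.B' (U 0) (U 1)) (g := fun U => a * (s.loop.M (U 0) (U 1) (U 2)
        (k2 s.B' (U 0) (U 1) (U 2)) - s.loop.M' (U 0) (U 1) (U 2) (k2 s.B' (U 0) (U 1) (U 2))) +
        s.loop.F (U 0) (U 1) (U 2) (k2 s.B' (U 0) (U 1) (U 2))) (by fun_prop)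
      (by unfold Loop.M Loop.M' Loop.F; fun_prop) ?_ (fun U => e _ _ _ _) ![u, v, w]
    obtain ⟨u, v, h0⟩ := h.nzB'.exists_d23
    exact ⟨![u, v, 0], mul_ne_zero h0 h0⟩
  have a0 := e' u v w 0
  have a1 := e' u v w 1
  exact ⟨by linear_combination a1 - a0, by linear_combination a0⟩

lemma det_loop (h : Std s) (i : Fin 4) : det2 (s.loop.m i) ≠ 0 ∧ det2 (s.loop.m' i) ≠ 0 := by
  have dA := h.hA4.det_ne h.vA
  have dA' := h.hA'.det_ne h.vA'
  have dC := h.hC.det_ne h.vC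
  have dC' := h.hC'.det_ne h.vC'
  fin_cases i
  · simpa [Sys.loop, det2] using dA
  · simpa [Sys.loop, det2] using dC'
  · simpa [Sys.loop, det2, mul_comm] using dA'.symm
  · simpa [Sys.loop, det2, mul_comm] using dC.symm

lemma loop_hn (h : Std s) (i : Fin 4) (a b : ℂ) (ha : s.loop.m' i = a • s.loop.m i) :
    s.loop.n i ≠ b • s.loop.m i := by
  intro hb
  have a1 (v z : Vec) := congrArg (fun M => bil M v z) ha
  have b1 (v z : Vec) := congrArg (fun M => bil M v z) hb
  simp only [bil_smul] at a1 b1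
  revert i
  refine forall_fin_four ?_ ?_ ?_ ?_ <;> intro _ _ a1 b1
  · simp only [Sys.loop_m₀, Sys.loop_m'₀, Sys.loop_n₀] at a1 b1
    exact h.nzA.not_smul h.vA a1 b1
  · simp only [Sys.loop_m₁, Sys.loop_m'₁, Sys.loop_n₁] at a1 b1
    exact h.hC'.nonzero.not_smul h.vC' a1 b1
  · simp only [Sys.loop_m₂, Sys.loop_m'₂, Sys.loop_n₂] at a1 b1
    exact h.hA'.nonzero.not_smul' h.vA' (fun v z => a1 z v) (fun v z => b1 z v)
  · simp only [Sys.loop_m₃, Sys.loop_m'₃, Sys.loop_n₃] at a1 b1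
    exact h.hC.nonzero.not_smul' h.vC (fun v z => a1 z v) (fun v z => b1 z v)

lemma valid (h : Std s) : s.loop.Valid := by
  have hk (u v w : Vec) : k3 s.loop.T u v w = k2 s.B' u v w := by
    simp [k3, k2, Sys.loop, form_swap]
  exact ⟨fun i => (h.det_loop i).1, fun i => (h.det_loop i).2, (nv_of_not_isDeg h.ndB').swap,
    h.nzB'.swap, Loop.exists_M_sub h.nzB'.swap fun u v w => by
      rw [hk, ← sub_eq_zero, (h.loop_eq_zero' u v w).1],
    Loop.exists_F h.nzB'.swap fun u v w => by rw [hk, (h.loop_eq_zero' u v w).2], h.loop_hn⟩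

end Std

/-! ### Normalization of the faces around `B'` -/

/-- The multilinear form `c`, multiplied by `a`. -/
def scaleT (a : ℂ) (c : Ten) : Ten := fun i j k l => a * c i j k l

lemma form_scaleT (a : ℂ) (c : Ten) (u v w z : Vec) : form (scaleT a c) u v w z =
    a * form c u v w z := by
  simp only [form_eq, scaleT]
  ring

lemma exists_gl_affine {σ : ℂ} (hσ : σ ≠ 0) (τ : ℂ) :
    ∃ g : GL (Fin 2) ℂ, ∀ u : Vec, g.1.mulVec u = ![σ * u 0 + τ * u 1, u 1] := by
  obtain ⟨g, hg⟩ := exists_gl_mulVec (p := ![σ, 0]) (p' := ![τ, 1]) (by simpa using hσ)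
  refine ⟨g, fun u => ?_⟩
  rw [hg]
  ext i
  fin_cases i
  · simp; ring
  · simp

/-- In a normalized system, one can apply arbitrary Möbius transformations to the variables
`y i`, affine transformations `u i ↦ σ i * u i + τ i` to the variables `u i`, and multiply the
equations by the constants `c i`. -/
lemma Std.exists_change {s : Sys} (h : Std s) (g : Fin 4 → GL (Fin 2) ℂ) {σ c : Fin 4 → ℂ}
    (hσ : ∀ i, σ i ≠ 0) (hc : ∀ i, c i ≠ 0) (τ : Fin 4 → ℂ) :
    ∃ t, SysRel s t ∧ Std t ∧
      (∀ i y z, bil (t.loop.m i) y z =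
        c i * (σ i * bil (s.loop.m i) ((g i).1.mulVec y) ((g (i + 1)).1.mulVec z))) ∧
      (∀ i y z, bil (t.loop.m' i) y z =
        c i * (σ (i + 1) * bil (s.loop.m' i) ((g i).1.mulVec y) ((g (i + 1)).1.mulVec z))) ∧
      (∀ i y z, bil (t.loop.n i) y z =
        c i * (bil (s.loop.n i) ((g i).1.mulVec y) ((g (i + 1)).1.mulVec z) +
          τ i * bil (s.loop.m i) ((g i).1.mulVec y) ((g (i + 1)).1.mulVec z) +
          τ (i + 1) * bil (s.loop.m' i) ((g i).1.mulVec y) ((g (i + 1)).1.mulVec z))) ∧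
      ∀ y0 y1 y2 y3, form t.loop.T y0 y1 y2 y3 = form s.loop.T ((g 0).1.mulVec y0)
        ((g 1).1.mulVec y1) ((g 2).1.mulVec y2) ((g 3).1.mulVec y3) := by
  choose x hx using fun i => exists_gl_affine (hσ i) (τ i)
  set t : Sys := {
    A := scaleT (c 0) (actT s.A (x 0) (g 0) (x 1) (g 1))
    A' := scaleT (c 2) (actT s.A' (x 3) (g 3) (x 2) (g 2))
    B := actT s.B (x 0) (x 1) (x 3) (x 2)
    B' := actT s.B' (g 0) (g 1) (g 3) (g 2)
    C := scaleT (c 3) (actT s.C (x 0) (g 0) (x 3) (g 3))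
    C' := scaleT (c 1) (actT s.C' (x 1) (g 1) (x 2) (g 2)) } with ht
  have hr : SysRel t s := ⟨![x 0, g 0, x 1, x 3, g 1, g 3, x 2, g 2],
    .of_forall (hc 0) fun u v w z => by rw [ht, form_scaleT, form_actT]; rfl,
    .of_forall (hc 2) fun u v w z => by rw [ht, form_scaleT, form_actT]; rfl,
    faceRel_actT _ _ _ _ _, faceRel_actT _ _ _ _ _,
    .of_forall (hc 3) fun u v w z => by rw [ht, form_scaleT, form_actT]; rfl,
    .of_forall (hc 1) fun u v w z => by rw [ht, form_scaleT, form_actT]; rfl⟩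
  have key {d : Ten} (hd : ∀ j l, d 0 j 0 l = 0) (a : ℂ) (i k : Fin 4) (p q : GL (Fin 2) ℂ)
      (j l : Fin 2) : scaleT a (actT d (x i) p (x k) q) 0 j 0 l = 0 := by
    rw [apply_eq_form (scaleT _ _), form_scaleT, form_actT, hx, hx, form_of_vanish hd]
    simp
  have e01 {d : Ten} (hd : ∀ j l, d 0 j 0 l = 0) (a : ℂ) (i k : Fin 4) (p q : GL (Fin 2) ℂ)
      (y z : Vec) : bil (fun j l => scaleT a (actT d (x i) p (x k) q) 0 j 1 l) y z =
      a * (σ i * bil (fun j l => d 0 j 1 l) (p.1.mulVec y) (q.1.mulVec z)) := by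
    rw [bil_eq_form₁₃, form_scaleT, form_actT, hx, hx, form_of_vanish hd]
    simp
  have e10 {d : Ten} (hd : ∀ j l, d 0 j 0 l = 0) (a : ℂ) (i k : Fin 4) (p q : GL (Fin 2) ℂ)
      (y z : Vec) : bil (fun j l => scaleT a (actT d (x i) p (x k) q) 1 j 0 l) y z =
      a * (σ k * bil (fun j l => d 1 j 0 l) (p.1.mulVec y) (q.1.mulVec z)) := by
    rw [bil_eq_form₁₃, form_scaleT, form_actT, hx, hx, form_of_vanish hd]
    simp
  have e11 {d : Ten} (hd : ∀ j l, d 0 j 0 l = 0) (a : ℂ) (i k : Fin 4) (p q : GL (Fin 2) ℂ)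
      (y z : Vec) : bil (fun j l => scaleT a (actT d (x i) p (x k) q) 1 j 1 l) y z =
      a * (bil (fun j l => d 1 j 1 l) (p.1.mulVec y) (q.1.mulVec z) +
        τ i * bil (fun j l => d 0 j 1 l) (p.1.mulVec y) (q.1.mulVec z) +
        τ k * bil (fun j l => d 1 j 0 l) (p.1.mulVec y) (q.1.mulVec z)) := by
    rw [bil_eq_form₁₃, form_scaleT, form_actT, hx, hx, form_of_vanish hd]
    simp only [Matrix.cons_val_zero, Matrix.cons_val_one, e1_zero, e1_one]
    ring
  refine ⟨t, hr.symm, ⟨h.toGood.of_rel hr, key h.vA _ _ _ _ _, key h.vA' _ _ _ _ _,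
    key h.vC _ _ _ _ _, key h.vC' _ _ _ _ _⟩, forall_fin_four ?_ ?_ ?_ ?_,
    forall_fin_four ?_ ?_ ?_ ?_, forall_fin_four ?_ ?_ ?_ ?_, fun y0 y1 y2 y3 => ?_⟩
  · intro y z; simp only [Sys.loop_m₀]; exact e01 h.vA _ _ _ _ _ _ _
  · intro y z; simp only [Sys.loop_m₁]; exact e01 h.vC' _ _ _ _ _ _ _
  · intro y z; simp only [Sys.loop_m₂]; exact e10 h.vA' _ _ _ _ _ _ _
  · intro y z; simp only [Sys.loop_m₃]; exact e10 h.vC _ _ _ _ _ _ _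
  · intro y z; simp only [Sys.loop_m'₀]; exact e10 h.vA _ _ _ _ _ _ _
  · intro y z; simp only [Sys.loop_m'₁]; exact e10 h.vC' _ _ _ _ _ _ _
  · intro y z; simp only [Sys.loop_m'₂]; exact e01 h.vA' _ _ _ _ _ _ _
  · intro y z; simp only [Sys.loop_m'₃]; exact e01 h.vC _ _ _ _ _ _ _
  · intro y z; simp only [Sys.loop_m₀, Sys.loop_m'₀, Sys.loop_n₀]; exact e11 h.vA _ _ _ _ _ _ _
  · intro y z; simp only [Sys.loop_m₁, Sys.loop_m'₁, Sys.loop_n₁]; exact e11 h.vC' _ _ _ _ _ _ _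
  · intro y z
    have e : (2 + 1 : Fin 4) = 3 := rfl
    simp only [Sys.loop_m₂, Sys.loop_m'₂, Sys.loop_n₂, e]
    refine (e11 h.vA' _ _ _ _ _ _ _).trans ?_
    ring
  · intro y z
    have e : (3 + 1 : Fin 4) = 0 := rfl
    simp only [Sys.loop_m₃, Sys.loop_m'₃, Sys.loop_n₃, e]
    refine (e11 h.vC _ _ _ _ _ _ _).trans ?_
    ring
  · simp only [Sys.loop, form_swap, ht, form_actT]

/-! ### Uniqueness of the last face -/

/-- The face `B` is determined by the other faces. -/
lemma Std.exists_smul_B {s t : Sys} (h : Std s) (ht : Good t) (hA : t.A = s.A) (hA' : t.A' = s.A')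
    (hB' : t.B' = s.B') (hC : t.C = s.C) :
    ∃ κ : ℂ, ∀ u v w z, form t.B u v w z = κ * form s.B u v w z := by
  have h1 (u y0 y1 y3 : Vec) : form t.B u (k2 s.A u y0 y1) (k2 s.C u y0 y3)
      (k3 s.B u (k2 s.A u y0 y1) (k2 s.C u y0 y3)) = 0 := by
    refine eq_zero_of_mul_of_ne (f := fun U : Fin 4 → Vec => form s.A' (k2 s.C (U 0) (U 1) (U 3))
      (U 3) e0 (k3 s.B' (U 1) (U 2) (U 3))) (g := fun U => form t.B (U 0)
      (k2 s.A (U 0) (U 1) (U 2)) (k2 s.C (U 0) (U 1) (U 3)) (k3 s.B (U 0)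
      (k2 s.A (U 0) (U 1) (U 2)) (k2 s.C (U 0) (U 1) (U 3)))) (by fun_prop) (by fun_prop) ?_
      (fun U => ?_) ![u, y0, y1, y3]
    · obtain ⟨U, hU⟩ : ∃ U : Fin 3 → Vec, bil (s.loop.m 3) (U 2) (U 0) *
          bil (s.loop.m 2) (k3 s.B' (U 0) (U 1) (U 2)) (U 2) ≠ 0 := by
        refine exists_mul_ne_zero (by fun_prop) (by fun_prop) ?_ ?_
        · obtain ⟨u, v, h0⟩ := exists_bil_ne (h.det_loop 3).1
          exact ⟨![v, 0, u], h0⟩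
        · obtain ⟨u, v, h0⟩ := (nv_of_not_isDeg h.ndB').n23 e0 (rt (tr (s.loop.m 2)) e0) e0_ne_zero
            (rt_ne_zero (by rw [det2_tr]; exact (h.det_loop 2).1) e0_ne_zero)
          rw [form_rt, bil_tr, neg_ne_zero] at h0
          exact ⟨![u, v, e0], h0⟩
      refine ⟨![e1, U 0, U 1, U 2], ?_⟩
      rw [Sys.loop_m₂, Sys.loop_m₃] at hU
      simp [form_of_vanish h.vA', form_of_vanish h.vC, k2] at hU ⊢
      tauto
    · by_contra hne
      rw [mul_eq_zero, not_or] at hne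
      have a1 := (Sys.HC.of_mirror h.hm (U 0) (U 1) (U 2) (U 3)).1
      have a2 := (Sys.HC.of_mirror ht.hm (U 0) (U 1) (U 2) (U 3)).1
      rw [hA, hA', hB', hC] at a2
      rw [form_expand₂] at a1 a2
      apply hne.2
      rw [form_expand₃]
      generalize k2 s.A (U 0) (U 1) (U 2) = X at *
      generalize k2 s.C (U 0) (U 1) (U 3) = Y at *
      generalize k3 s.B' (U 1) (U 2) (U 3) = Z at *
      simp only [k3, Matrix.cons_val_zero, Matrix.cons_val_one] at a1 a2 ⊢
      refine (mul_eq_zero.1 ?_).resolve_left hne.1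
      linear_combination form t.B (U 0) X Y e0 * a1 - form s.B (U 0) X Y e0 * a2
  refine exists_smul_of_vanish h.nzB fun u v w => ?_
  refine eq_zero_of_mul_of_ne (f := fun U : Fin 4 → Vec => (d23 s.A (U 0) (U 3) *
    d23 s.C (U 0) (U 3)) * (d23 s.A (U 0) (U 3) * d23 s.C (U 0) (U 3))) (g := fun U => form t.B
    (U 0) (U 1) (U 2) (k3 s.B (U 0) (U 1) (U 2))) (by fun_prop) (by fun_prop) ?_ (fun U => ?_)
    ![u, v, w, 0]
  · have : ∃ U : Fin 4 → Vec, d23 s.A (U 0) (U 3) * d23 s.C (U 0) (U 3) ≠ 0 := by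
      refine exists_mul_ne_zero (by fun_prop) (by fun_prop) ?_ ?_
      · obtain ⟨u, v, h0⟩ := h.nzA.exists_d23
        exact ⟨![u, 0, 0, v], h0⟩
      · obtain ⟨u, v, h0⟩ := h.hC.nonzero.exists_d23
        exact ⟨![u, 0, 0, v], h0⟩
    exact exists_mul_ne_zero (by fun_prop) (by fun_prop) this this
  · have e (c : Ten) (u v w : Vec) : k2 c u v (k3 c u v w) = (-d23 c u v) • w := by
      unfold k2 k3 d23
      ext i
      fin_cases i <;> simp [form_eq] <;> ring
    have := h1 (U 0) (U 3) (k3 s.A (U 0) (U 3) (U 1)) (k3 s.C (U 0) (U 3) (U 2))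
    rw [e, e, k3_smul₁, k3_smul₂, form_smul₁, form_smul₂, form_smul₃, form_smul₃] at this
    linear_combination this

/-- Two systems are equivalent if their faces other than `B` are. -/
lemma Std.sysRel_of_faceRel {s t : Sys} (h : Std s) (ht : Good t) (g : Fin 8 → GL (Fin 2) ℂ)
    (hA : FaceRel s.A t.A ![g 0, g 1, g 2, g 4]) (hA' : FaceRel s.A' t.A' ![g 3, g 5, g 6, g 7])
    (hB' : FaceRel s.B' t.B' ![g 1, g 4, g 5, g 7]) (hC : FaceRel s.C t.C ![g 0, g 1, g 3, g 5])
    (hC' : FaceRel s.C' t.C' ![g 2, g 4, g 6, g 7]) : SysRel s t := by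
  set r : Sys := { s with B := actT t.B (g 0) (g 2) (g 3) (g 6) } with hr
  have h1 : SysRel r t := ⟨g, hA, hA', faceRel_actT _ _ _ _ _, hB', hC, hC'⟩
  have hg : Good r := ht.of_rel h1
  obtain ⟨κ, hκ⟩ := h.exists_smul_B hg rfl rfl rfl rfl
  have hκ0 : κ ≠ 0 := by
    rintro rfl
    obtain ⟨u, v, w, h0⟩ := hg.nzB.exists_form_e0
    exact h0 (by rw [hκ, zero_mul])
  refine ⟨g, hA, hA', ?_, hB', hC, hC'⟩
  refine .of_forall (κ := κ⁻¹) (inv_ne_zero hκ0) fun u v w z => ?_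
  have := hκ u v w z
  rw [hr, form_actT] at this
  rw [this]
  field_simp

lemma form_eq_of_loop {c d : Ten} (hc : ∀ j l, c 0 j 0 l = 0) (hd : ∀ j l, d 0 j 0 l = 0)
    (h1 : ∀ y z, bil (fun j l => c 0 j 1 l) y z = bil (fun j l => d 0 j 1 l) y z)
    (h2 : ∀ y z, bil (fun j l => c 1 j 0 l) y z = bil (fun j l => d 1 j 0 l) y z)
    (h3 : ∀ y z, bil (fun j l => c 1 j 1 l) y z = bil (fun j l => d 1 j 1 l) y z) :
    FaceRel c d ![1, 1, 1, 1] :=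
  .of_forall one_ne_zero fun u v w z => by
    simp only [one_mulVec_vec, one_mul, form_of_vanish hc, form_of_vanish hd, h1, h2, h3]

/-- Normalized systems are equivalent if their faces around `B'` agree. -/
lemma Std.sysRel_of_loop {s t : Sys} (hs : Std s) (ht : Std t)
    (hm : ∀ i y z, bil (s.loop.m i) y z = bil (t.loop.m i) y z)
    (hm' : ∀ i y z, bil (s.loop.m' i) y z = bil (t.loop.m' i) y z)
    (hn : ∀ i y z, bil (s.loop.n i) y z = bil (t.loop.n i) y z) {κ : ℂ} (hκ : κ ≠ 0)
    (hT : ∀ y0 y1 y2 y3, form s.loop.T y0 y1 y2 y3 = κ * form t.loop.T y0 y1 y2 y3) :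
    SysRel s t := by
  refine hs.sysRel_of_faceRel ht.toGood (fun _ => 1)
    (form_eq_of_loop hs.vA ht.vA (fun y z => ?_) (fun y z => ?_) fun y z => ?_)
    (form_eq_of_loop hs.vA' ht.vA' (fun y z => ?_) (fun y z => ?_) fun y z => ?_)
    (.of_forall hκ fun u v w z => ?_)
    (form_eq_of_loop hs.vC ht.vC (fun y z => ?_) (fun y z => ?_) fun y z => ?_)
    (form_eq_of_loop hs.vC' ht.vC' (fun y z => ?_) (fun y z => ?_) fun y z => ?_)
  · simpa only [Sys.loop_m₀] using hm 0 y z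
  · simpa only [Sys.loop_m'₀] using hm' 0 y z
  · simpa only [Sys.loop_n₀] using hn 0 y z
  · simpa only [Sys.loop_m'₂] using hm' 2 z y
  · simpa only [Sys.loop_m₂] using hm 2 z y
  · simpa only [Sys.loop_n₂] using hn 2 z y
  · simpa only [Sys.loop, form_swap, one_mulVec_vec] using hT u v z w
  · simpa only [Sys.loop_m'₃] using hm' 3 z y
  · simpa only [Sys.loop_m₃] using hm 3 z y
  · simpa only [Sys.loop_n₃] using hn 3 z y
  · simpa only [Sys.loop_m₁] using hm 1 y z
  · simpa only [Sys.loop_m'₁] using hm' 1 y z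
  · simpa only [Sys.loop_n₁] using hn 1 y z

/-! ### The faces of the listed systems -/

/-- The multilinear form of a face polynomial of the listed systems between two faces of type Q:
the coefficient of `x₀` is `m(x₁, x₃)`, that of `x₂` is `m(x₃, x₁)` and the constant term is a
symmetric polynomial `n(x₁, x₃)`, where `m(y, z) = p y - q z - a`. -/
def faceT (p q a n00 n01 n11 : ℂ) : Ten :=
  ![![![![0, 0], ![0, p]], ![![0, 0], ![-q, -a]]],
    ![![![0, -q], ![n00, n01]], ![![p, -a], ![n01, n11]]]]

/-- The coefficients of `f (x₀x₁ + x₂x₃) + g (x₀x₂ + x₁x₃) + h (x₀x₃ + x₁x₂) + e ∑ xᵢ + k`. -/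
def kleinT (f g h e k : ℂ) : Ten :=
  ![![![![0, 0], ![0, f]], ![![0, g], ![h, e]]],
    ![![![0, h], ![g, e]], ![![f, e], ![e, k]]]]

lemma form_faceT (p q a n00 n01 n11 : ℂ) (u v w z : Vec) :
    form (faceT p q a n00 n01 n11) u v w z =
      u 0 * w 1 * (p * (v 0 * z 1) - q * (v 1 * z 0) - a * (v 1 * z 1)) +
      u 1 * w 0 * (p * (v 1 * z 0) - q * (v 0 * z 1) - a * (v 1 * z 1)) +
      u 1 * w 1 * (n00 * (v 0 * z 0) + n01 * (v 0 * z 1 + v 1 * z 0) + n11 * (v 1 * z 1)) := by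
  simp [form_eq, faceT]
  ring

lemma form_kleinT (f g h e k : ℂ) (u v w z : Vec) :
    form (kleinT f g h e k) u v w z =
      f * (u 0 * v 0 * w 1 * z 1 + u 1 * v 1 * w 0 * z 0) +
      g * (u 0 * v 1 * w 0 * z 1 + u 1 * v 0 * w 1 * z 0) +
      h * (u 0 * v 1 * w 1 * z 0 + u 1 * v 0 * w 0 * z 1) +
      e * (u 0 * v 1 * w 1 * z 1 + u 1 * v 0 * w 1 * z 1 + u 1 * v 1 * w 0 * z 1 +
        u 1 * v 1 * w 1 * z 0) + k * (u 1 * v 1 * w 1 * z 1) := by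
  simp [form_eq, kleinT]
  ring

lemma form_faceT_symm (p q a n00 n01 n11 : ℂ) (u v w z : Vec) :
    form (faceT p q a n00 n01 n11) u v w z = form (faceT p q a n00 n01 n11) w z u v := by
  rw [form_faceT, form_faceT]
  ring

lemma nonzeroBiquads_of_exists {c : Ten} (h01 : ∃ w z, d01 c w z ≠ 0) (h02 : ∃ v z, d02 c v z ≠ 0)
    (h03 : ∃ v w, d03 c v w ≠ 0) (h12 : ∃ u z, d12 c u z ≠ 0) (h13 : ∃ u w, d13 c u w ≠ 0)
    (h23 : ∃ u v, d23 c u v ≠ 0) : NonzeroBiquads c := by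
  have key : ∀ k l : Fin 4, k < l → ∃ U, bq c k l U ≠ 0 := by
    intro k l hkl
    obtain ⟨w, z, h01⟩ := h01
    obtain ⟨v, z, h02⟩ := h02
    obtain ⟨v, w, h03⟩ := h03
    obtain ⟨u, z, h12⟩ := h12
    obtain ⟨u, w, h13⟩ := h13
    obtain ⟨u, v, h23⟩ := h23
    fin_cases k <;> fin_cases l <;> first | exact absurd hkl (by decide) | skip
    · exact ⟨![0, 0, _, _], by rw [show (⟨0, _⟩ : Fin 4) = 0 from rfl,
        show (⟨1, _⟩ : Fin 4) = 1 from rfl, bq_01]; exact h01⟩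
    · exact ⟨![0, _, 0, _], by rw [show (⟨0, _⟩ : Fin 4) = 0 from rfl,
        show (⟨2, _⟩ : Fin 4) = 2 from rfl, bq_02]; exact h02⟩
    · exact ⟨![0, _, _, 0], by rw [show (⟨0, _⟩ : Fin 4) = 0 from rfl,
        show (⟨3, _⟩ : Fin 4) = 3 from rfl, bq_03]; exact h03⟩
    · exact ⟨![_, 0, 0, _], by rw [show (⟨1, _⟩ : Fin 4) = 1 from rfl,
        show (⟨2, _⟩ : Fin 4) = 2 from rfl, bq_12]; exact h12⟩
    · exact ⟨![_, 0, _, 0], by rw [show (⟨1, _⟩ : Fin 4) = 1 from rfl,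
        show (⟨3, _⟩ : Fin 4) = 3 from rfl, bq_13]; exact h13⟩
    · exact ⟨![_, _, 0, 0], by rw [show (⟨2, _⟩ : Fin 4) = 2 from rfl,
        show (⟨3, _⟩ : Fin 4) = 3 from rfl, bq_23]; exact h23⟩
  intro k l hkl
  rcases lt_or_gt_of_ne hkl with h | h
  · exact key k l h
  · obtain ⟨U, hU⟩ := key l k h
    exact ⟨U, by rwa [bq_comm c hkl]⟩

/-- A biquadratic that vanishes on no line `U i = p`, in either of its arguments, is
non-degenerate. -/
lemma not_isDeg_of_exists {c : Ten} {i j k l : Fin 4} (hij : Function.Bijective ![i, j, k, l])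
    (hi : ∀ p : Vec, p ≠ 0 → ∃ U : Fin 4 → Vec, U i = p ∧ bq c k l U ≠ 0)
    (hj : ∀ p : Vec, p ≠ 0 → ∃ U : Fin 4 → Vec, U j = p ∧ bq c k l U ≠ 0) : ¬ IsDeg c k l := by
  rintro ⟨i', hk, hl, p, hp, h⟩
  obtain ⟨t, ht⟩ := hij.2 i'
  fin_cases t
  · obtain rfl : i = i' := ht
    obtain ⟨U, hU, hne⟩ := hi p hp
    exact hne (h U hU)
  · obtain rfl : j = i' := ht
    obtain ⟨U, hU, hne⟩ := hj p hp
    exact hne (h U hU)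
  · exact hk ht.symm
  · exact hl ht.symm

lemma exists_ne_zero_of_diag {f : Vec → Vec → ℂ} {c : ℂ} (hc : c ≠ 0)
    (h0 : ∀ u v, v 1 = 0 → f u v = c * (u 1 * u 1 * (v 0 * v 0)))
    (h1 : ∀ u v, u 1 = 0 → f u v = c * (u 0 * u 0 * (v 1 * v 1))) :
    (∀ u : Vec, u ≠ 0 → ∃ v, f u v ≠ 0) ∧ ∀ v : Vec, v ≠ 0 → ∃ u, f u v ≠ 0 := by
  constructor
  · intro u hu
    by_cases h : u 1 = 0
    · have h' : u 0 ≠ 0 := (vec_ne_zero_iff.1 hu).resolve_right (not_not.2 h)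
      exact ⟨e1, by rw [h1 _ _ h]; simpa using ⟨hc, h'⟩⟩
    · exact ⟨e0, by rw [h0 _ _ rfl]; simpa using ⟨hc, h⟩⟩
  · intro v hv
    by_cases h : v 1 = 0
    · have h' : v 0 ≠ 0 := (vec_ne_zero_iff.1 hv).resolve_right (not_not.2 h)
      exact ⟨e1, by rw [h0 _ _ h]; simpa using ⟨hc, h'⟩⟩
    · exact ⟨e0, by rw [h1 _ _ rfl]; simpa using ⟨hc, h⟩⟩

/-- A form all of whose biquadratics are nowhere zero on coordinate lines has all the properties
of type Q. -/
lemma typeQ_of_forall {c : Ten}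
    (h01 : (∀ u : Vec, u ≠ 0 → ∃ v, d01 c u v ≠ 0) ∧ ∀ v : Vec, v ≠ 0 → ∃ u, d01 c u v ≠ 0)
    (h02 : (∀ u : Vec, u ≠ 0 → ∃ v, d02 c u v ≠ 0) ∧ ∀ v : Vec, v ≠ 0 → ∃ u, d02 c u v ≠ 0)
    (h03 : (∀ u : Vec, u ≠ 0 → ∃ v, d03 c u v ≠ 0) ∧ ∀ v : Vec, v ≠ 0 → ∃ u, d03 c u v ≠ 0)
    (h12 : (∀ u : Vec, u ≠ 0 → ∃ v, d12 c u v ≠ 0) ∧ ∀ v : Vec, v ≠ 0 → ∃ u, d12 c u v ≠ 0)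
    (h13 : (∀ u : Vec, u ≠ 0 → ∃ v, d13 c u v ≠ 0) ∧ ∀ v : Vec, v ≠ 0 → ∃ u, d13 c u v ≠ 0)
    (h23 : (∀ u : Vec, u ≠ 0 → ∃ v, d23 c u v ≠ 0) ∧ ∀ v : Vec, v ≠ 0 → ∃ u, d23 c u v ≠ 0) :
    NonzeroBiquads c ∧ ∀ k l, k ≠ l → ¬ IsDeg c k l := by
  refine ⟨nonzeroBiquads_of_exists ⟨e0, h01.1 e0 e0_ne_zero⟩ ⟨e0, h02.1 e0 e0_ne_zero⟩
    ⟨e0, h03.1 e0 e0_ne_zero⟩ ⟨e0, h12.1 e0 e0_ne_zero⟩ ⟨e0, h13.1 e0 e0_ne_zero⟩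
    ⟨e0, h23.1 e0 e0_ne_zero⟩, ?_⟩
  have n01 : ¬ IsDeg c 0 1 := not_isDeg_of_exists (i := 2) (j := 3) (by decide)
    (fun p hp => (h01.1 p hp).elim fun v hv => ⟨![0, 0, p, v], rfl, by rw [bq_01]; exact hv⟩)
    (fun p hp => (h01.2 p hp).elim fun v hv => ⟨![0, 0, v, p], rfl, by rw [bq_01]; exact hv⟩)
  have n02 : ¬ IsDeg c 0 2 := not_isDeg_of_exists (i := 1) (j := 3) (by decide)
    (fun p hp => (h02.1 p hp).elim fun v hv => ⟨![0, p, 0, v], rfl, by rw [bq_02]; exact hv⟩)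
    (fun p hp => (h02.2 p hp).elim fun v hv => ⟨![0, v, 0, p], rfl, by rw [bq_02]; exact hv⟩)
  have n03 : ¬ IsDeg c 0 3 := not_isDeg_of_exists (i := 1) (j := 2) (by decide)
    (fun p hp => (h03.1 p hp).elim fun v hv => ⟨![0, p, v, 0], rfl, by rw [bq_03]; exact hv⟩)
    (fun p hp => (h03.2 p hp).elim fun v hv => ⟨![0, v, p, 0], rfl, by rw [bq_03]; exact hv⟩)
  have n12 : ¬ IsDeg c 1 2 := not_isDeg_of_exists (i := 0) (j := 3) (by decide)
    (fun p hp => (h12.1 p hp).elim fun v hv => ⟨![p, 0, 0, v], rfl, by rw [bq_12]; exact hv⟩)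
    (fun p hp => (h12.2 p hp).elim fun v hv => ⟨![v, 0, 0, p], rfl, by rw [bq_12]; exact hv⟩)
  have n13 : ¬ IsDeg c 1 3 := not_isDeg_of_exists (i := 0) (j := 2) (by decide)
    (fun p hp => (h13.1 p hp).elim fun v hv => ⟨![p, 0, v, 0], rfl, by rw [bq_13]; exact hv⟩)
    (fun p hp => (h13.2 p hp).elim fun v hv => ⟨![v, 0, p, 0], rfl, by rw [bq_13]; exact hv⟩)
  have n23 : ¬ IsDeg c 2 3 := not_isDeg_of_exists (i := 0) (j := 1) (by decide)
    (fun p hp => (h23.1 p hp).elim fun v hv => ⟨![p, v, 0, 0], rfl, by rw [bq_23]; exact hv⟩)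
    (fun p hp => (h23.2 p hp).elim fun v hv => ⟨![v, p, 0, 0], rfl, by rw [bq_23]; exact hv⟩)
  have key : ∀ k l : Fin 4, k < l → ¬ IsDeg c k l := by
    intro k l
    fin_cases k <;> fin_cases l <;> intro hkl <;>
      first | exact absurd hkl (by decide) | assumption
  intro k l hkl
  rcases lt_or_gt_of_ne hkl with h | h
  · exact key k l h
  · rw [isDeg_comm hkl]
    exact key l k h

lemma typeQ_kleinT {f g h : ℂ} (hf : f ≠ 0) (hg : g ≠ 0) (hh : h ≠ 0) (e k : ℂ) :
    NonzeroBiquads (kleinT f g h e k) ∧ ∀ i j, i ≠ j → ¬ IsDeg (kleinT f g h e k) i j := by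
  have hgh : -(g * h) ≠ 0 := neg_ne_zero.2 (mul_ne_zero hg hh)
  have hfh : -(f * h) ≠ 0 := neg_ne_zero.2 (mul_ne_zero hf hh)
  have hfg : -(f * g) ≠ 0 := neg_ne_zero.2 (mul_ne_zero hf hg)
  refine typeQ_of_forall (exists_ne_zero_of_diag hgh ?_ ?_) (exists_ne_zero_of_diag hfh ?_ ?_)
    (exists_ne_zero_of_diag hfg ?_ ?_) (exists_ne_zero_of_diag hfg ?_ ?_)
    (exists_ne_zero_of_diag hfh ?_ ?_) (exists_ne_zero_of_diag hgh ?_ ?_)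
  all_goals
    intro u v hu
    simp [d01, d02, d03, d12, d13, d23, form_kleinT, hu]
    try ring

lemma exists_comb_ne {x y : ℂ} (h : x ≠ 0 ∨ y ≠ 0) : ∃ u : Vec, u 1 * (u 0 * x + u 1 * y) ≠ 0 := by
  by_cases hy : y = 0
  · subst hy
    exact ⟨![1, 1], by simpa using h⟩
  · exact ⟨![0, 1], by simpa using hy⟩

lemma isH4_faceT {p q a n00 n01 n11 : ℂ} (hp : p ≠ 0) (hq : q ≠ 0)
    (h : (p ^ 2 - q ^ 2 ≠ 0 ∧ a = 0) ∨ (p + q) * a ≠ 0 ∨ (n11 ≠ 0 ∧ a = 0)) :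
    IsH4 (faceT p q a n00 n01 n11) := by
  set c := faceT p q a n00 n01 n11 with hc
  -- the biquadratics in `x₀, x₁` and in `x₀, x₃`, up to the symmetry of the face
  have hs : ∃ s : ℂ, ((p ^ 2 - q ^ 2) * s - (p + q) * a ≠ 0 ∨
      p * (n01 * s + n11) + (q * s + a) * (n00 * s + n01) ≠ 0) ∧
      ((p ^ 2 - q ^ 2) * s - (p + q) * a ≠ 0 ∨
      q * (n01 * s + n11) + (p * s - a) * (n00 * s + n01) ≠ 0) := by
    rcases h with ⟨h, ha⟩ | h | ⟨h, ha⟩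
    · exact ⟨1, Or.inl (by simpa [ha] using h), Or.inl (by simpa [ha] using h)⟩
    · exact ⟨0, Or.inl (by simpa using h), Or.inl (by simpa using h)⟩
    · exact ⟨0, Or.inr (by simpa [ha] using ⟨hp, h⟩), Or.inr (by simpa [ha] using ⟨hq, h⟩)⟩
  obtain ⟨s, h1, h2⟩ := hs
  obtain ⟨u, hu⟩ := exists_comb_ne h1
  obtain ⟨w, hw⟩ := exists_comb_ne h2
  have hpq : p * q ≠ 0 := mul_ne_zero hp hq
  have n13 : (∀ u : Vec, u ≠ 0 → ∃ v, d13 c u v ≠ 0) ∧ ∀ v : Vec, v ≠ 0 → ∃ u, d13 c u v ≠ 0 := by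
    refine exists_ne_zero_of_diag hpq ?_ ?_ <;>
    · intro u v hu
      simp [d13, hc, form_faceT, hu]
      ring
  have n02 : (∀ u : Vec, u ≠ 0 → ∃ v, d02 c u v ≠ 0) ∧ ∀ v : Vec, v ≠ 0 → ∃ u, d02 c u v ≠ 0 := by
    have hd (v z : Vec) : d02 c v z = -((p * (v 0 * z 1) - q * (v 1 * z 0) - a * (v 1 * z 1)) *
        (p * (v 1 * z 0) - q * (v 0 * z 1) - a * (v 1 * z 1))) := by
      simp [d02, hc, form_faceT]
    have hlin (x y b d : ℂ) (hx : x ≠ 0 ∨ y ≠ 0) (hb : b ≠ 0 ∨ d ≠ 0) :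
        ∃ z : Vec, (x * z 0 + y * z 1) * (b * z 0 + d * z 1) ≠ 0 :=
      exists_mul_ne_zero (by fun_prop) (by fun_prop)
        (hx.elim (fun h => ⟨e0, by simpa using h⟩) fun h => ⟨e1, by simpa using h⟩)
        (hb.elim (fun h => ⟨e0, by simpa using h⟩) fun h => ⟨e1, by simpa using h⟩)
    constructor
    · intro v hv
      obtain ⟨z, hz⟩ := hlin (-q * v 1) (p * v 0 - a * v 1) (p * v 1) (-q * v 0 - a * v 1)
        (by by_cases h1 : v 1 = 0
            · have := (vec_ne_zero_iff.1 hv).resolve_right (not_not.2 h1)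
              exact Or.inr (by simpa [h1] using ⟨hp, this⟩)
            · exact Or.inl (mul_ne_zero (neg_ne_zero.2 hq) h1))
        (by by_cases h1 : v 1 = 0
            · have := (vec_ne_zero_iff.1 hv).resolve_right (not_not.2 h1)
              exact Or.inr (by simpa [h1] using ⟨hq, this⟩)
            · exact Or.inl (mul_ne_zero hp h1))
      refine ⟨z, ?_⟩
      rw [hd]
      refine neg_ne_zero.2 ?_
      convert hz using 1
      ring
    · intro v hv
      obtain ⟨z, hz⟩ := hlin (-q * v 1) (p * v 0 - a * v 1) (p * v 1) (-q * v 0 - a * v 1)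
        (by by_cases h1 : v 1 = 0
            · have := (vec_ne_zero_iff.1 hv).resolve_right (not_not.2 h1)
              exact Or.inr (by simpa [h1] using ⟨hp, this⟩)
            · exact Or.inl (mul_ne_zero (neg_ne_zero.2 hq) h1))
        (by by_cases h1 : v 1 = 0
            · have := (vec_ne_zero_iff.1 hv).resolve_right (not_not.2 h1)
              exact Or.inr (by simpa [h1] using ⟨hq, this⟩)
            · exact Or.inl (mul_ne_zero hp h1))
      refine ⟨z, ?_⟩
      rw [hd]
      refine neg_ne_zero.2 ?_
      convert hz using 1
      ring
  have hv02 : ∀ U : Fin 4 → Vec, U 0 = e0 → U 2 = e0 → formF c U = 0 := by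
    intro U h0 h2
    simp [formF, hc, form_faceT, h0, h2]
  have hv20 : ∀ U : Fin 4 → Vec, U 2 = e0 → U 0 = e0 → formF c U = 0 :=
    fun U h0 h2 => hv02 U h2 h0
  refine ⟨nonzeroBiquads_of_exists ⟨u, ![s, 1], ?_⟩ ⟨e0, n02.1 e0 e0_ne_zero⟩ ⟨![s, 1], w, ?_⟩
    ⟨w, ![s, 1], ?_⟩ ⟨e0, n13.1 e0 e0_ne_zero⟩ ⟨u, ![s, 1], ?_⟩, ?_, ?_, ?_, ?_, ?_, ?_⟩
  · have : d01 c u ![s, 1] = u 1 * (u 0 * ((p ^ 2 - q ^ 2) * s - (p + q) * a) +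
        u 1 * (p * (n01 * s + n11) + (q * s + a) * (n00 * s + n01))) := by
      simp [d01, hc, form_faceT]
      ring
    rwa [this]
  · have : d03 c ![s, 1] w = -(w 1 * (w 0 * ((p ^ 2 - q ^ 2) * s - (p + q) * a) +
        w 1 * (q * (n01 * s + n11) + (p * s - a) * (n00 * s + n01)))) := by
      simp [d03, hc, form_faceT]
      ring
    rw [this]
    exact neg_ne_zero.2 hw
  · have : d12 c w ![s, 1] = -(w 1 * (w 0 * ((p ^ 2 - q ^ 2) * s - (p + q) * a) +
        w 1 * (q * (n01 * s + n11) + (p * s - a) * (n00 * s + n01)))) := by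
      simp [d12, hc, form_faceT]
      ring
    rw [this]
    exact neg_ne_zero.2 hw
  · have : d23 c u ![s, 1] = u 1 * (u 0 * ((p ^ 2 - q ^ 2) * s - (p + q) * a) +
        u 1 * (p * (n01 * s + n11) + (q * s + a) * (n00 * s + n01))) := by
      simp [d23, hc, form_faceT]
      ring
    rwa [this]
  · exact not_isDeg_of_exists (i := 0) (j := 2) (by decide)
      (fun p hp => (n13.1 p hp).elim fun v hv => ⟨![p, 0, v, 0], rfl, by rw [bq_13]; exact hv⟩)
      (fun p hp => (n13.2 p hp).elim fun v hv => ⟨![v, 0, p, 0], rfl, by rw [bq_13]; exact hv⟩)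
  · exact not_isDeg_of_exists (i := 1) (j := 3) (by decide)
      (fun p hp => (n02.1 p hp).elim fun v hv => ⟨![0, p, 0, v], rfl, by rw [bq_02]; exact hv⟩)
      (fun p hp => (n02.2 p hp).elim fun v hv => ⟨![0, v, 0, p], rfl, by rw [bq_02]; exact hv⟩)
  · exact isDeg_of_vanish (by decide) (by decide) (by decide) e0_ne_zero e0_ne_zero hv02
  · exact (isDeg_comm (by decide)).1
      (isDeg_of_vanish (by decide) (by decide) (by decide) e0_ne_zero e0_ne_zero hv02)
  · exact isDeg_of_vanish (by decide) (by decide) (by decide) e0_ne_zero e0_ne_zero hv20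
  · exact isDeg_of_vanish (by decide) (by decide) (by decide) e0_ne_zero e0_ne_zero hv20

/-! ### The identities behind consistency -/

/-- Three face polynomials, with parameters `(α, β)`, `(α, γ)` and `(β, γ)`, and two Klein-symmetric
polynomials `b` and `b'` such that the elimination of a common vertex variable from two of them
gives the third one, up to factors which depend on the variables at one edge only. -/
structure Triple (c1 c2 c3 b b' : Ten) : Prop where
  /-- Elimination of `x₂` and `x₃` gives the tetrahedron equation of `x, x₁₂, x₂₃, x₁₃`. -/
  eb : ∃ θ : ℂ, θ ≠ 0 ∧ ∀ x y y1 y3 w : Vec, form b x (k2 c1 x y y1) (k2 c2 x y y3) w =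
    θ * (d23 c1 x y * form c3 x y1 w y3)
  /-- Elimination of `x₃` and `x₁₂₃`. -/
  ea : ∃ θ : ℂ, θ ≠ 0 ∧ ∀ x y y1 y3 w : Vec, form c1 (k2 c2 x y y3) y3 w (k3 b' y y1 y3) =
    θ * (form c2 e0 y e1 y3 * form c2 e1 y e0 y3 * form c3 x y1 w y3)
  /-- Elimination of `x₂` and `x₁₂₃`. -/
  ec : ∃ θ : ℂ, θ ≠ 0 ∧ ∀ x y y1 y3 w : Vec, form c2 (k2 c1 x y y1) y1 w (k3 b' y y1 y3) =
    θ * (form c1 e0 y e1 y1 * form c1 e1 y e0 y1 * form c3 x y1 w y3)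

/-- The face polynomials of the first system. -/
def face1 (ε α β : ℂ) : Ten := faceT 1 1 0 (-((α - β) * ε)) 0 (-(α - β))

/-- The face polynomials of the second system. -/
def face2 (ε α β : ℂ) : Ten := faceT 1 1 (α - β) (-(4 * ε * (α - β)))
  (-(α - β) - 2 * ε * (α - β) * (α + β))
  (-((α - β) * (α + β)) - ε * (α - β) * (α + β) ^ 2 - ε * (α - β) ^ 3)

/-- The face polynomials of the third system, with `η` in place of `ε / (α β)`. -/
def face3 (δ η α β : ℂ) : Ten := faceT α β 0 ((α ^ 2 - β ^ 2) * η) 0 ((α ^ 2 - β ^ 2) * δ)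

/-- The polynomials of type Q of the first system. -/
def quad1 (α β γ ε : ℂ) : Ten := kleinT (-(α - β)) (α - γ) (-(β - γ)) 0
  (-(ε * (α - β) * (β - γ) * (α - γ)))

/-- The polynomials of type Q of the second system. -/
def quad2 (α β γ ε : ℂ) : Ten := kleinT (-(α - β)) (α - γ) (-(β - γ))
  (-(2 * ε * (α - β) * (β - γ) * (α - γ)))
  ((α - β) * (β - γ) * (α - γ) - 4 * ε ^ 2 * (α - β) * (β - γ) * (α - γ) *
    ((α - β) ^ 2 + (α - β) * (β - γ) + (β - γ) ^ 2))

/-- The polynomials of type Q of the third system, with `η` in place of `ε / (α β γ)`. -/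
def quad3 (δ α β γ η : ℂ) : Ten := kleinT (γ * (α ^ 2 - β ^ 2)) (-(β * (α ^ 2 - γ ^ 2)))
  (α * (β ^ 2 - γ ^ 2)) 0 (δ * η * (α ^ 2 - β ^ 2) * (α ^ 2 - γ ^ 2) * (β ^ 2 - γ ^ 2))

lemma triple1 {α β γ : ℂ} (hb : α ≠ β) (hc : α ≠ γ) (ε : ℂ) :
    Triple (face1 ε α β) (face1 ε α γ) (face1 ε β γ)
    (quad1 α β γ ε) (quad1 α β γ 0) := by
  have hb' := neg_ne_zero.2 (sub_ne_zero.2 hb)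
  have hc' := neg_ne_zero.2 (sub_ne_zero.2 hc)
  refine ⟨⟨_, hc', ?_⟩, ⟨_, hb', ?_⟩, ⟨_, hc', ?_⟩⟩
  all_goals
    intro x y a b w
    simp only [k2, k3, d23, face1, quad1, form_faceT, form_kleinT, Matrix.cons_val_zero,
      Matrix.cons_val_one, e0_zero, e0_one, e1_zero, e1_one]
    ring

lemma triple2 {α β γ : ℂ} (hb : α ≠ β) (hc : α ≠ γ) (ε : ℂ) :
    Triple (face2 ε α β) (face2 ε α γ) (face2 ε β γ)
    (quad2 α β γ ε) (quad2 α β γ 0) := by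
  have hb' := neg_ne_zero.2 (sub_ne_zero.2 hb)
  have hc' := neg_ne_zero.2 (sub_ne_zero.2 hc)
  refine ⟨⟨_, hc', ?_⟩, ⟨_, hb', ?_⟩, ⟨_, hc', ?_⟩⟩
  all_goals
    intro x y a b w
    simp only [k2, k3, d23, face2, quad2, form_faceT, form_kleinT, Matrix.cons_val_zero,
      Matrix.cons_val_one, e0_zero, e0_one, e1_zero, e1_one]
    ring

lemma triple3 {α β γ : ℂ} (hb : α ^ 2 ≠ β ^ 2) (hc : α ^ 2 ≠ γ ^ 2) (δ η : ℂ) :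
    Triple (face3 δ (γ * η) α β) (face3 δ (β * η) α γ)
    (face3 δ (α * η) β γ) (quad3 δ α β γ η) (quad3 δ α β γ 0) := by
  have hb' := sub_ne_zero.2 hb
  have hc' := sub_ne_zero.2 hc
  refine ⟨⟨_, hc', ?_⟩, ⟨_, hb', ?_⟩, ⟨_, hc', ?_⟩⟩
  all_goals
    intro x y a b w
    simp only [k2, k3, d23, face3, quad3, form_faceT, form_kleinT, Matrix.cons_val_zero,
      Matrix.cons_val_one, e0_zero, e0_one, e1_zero, e1_one]
    ring

lemma Triple.mirror_hc {c1 c2 c3 b b' : Ten} (h : Triple c1 c2 c3 b b') :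
    (Sys.mirror ⟨c1, c1, b, b', c2, c2⟩).HC := by
  obtain ⟨⟨θ, -, hb⟩, ⟨θ1, -, h1⟩, ⟨θ2, -, h2⟩⟩ := h
  intro y x y1 y3
  simp only [Sys.mirror, form_mir, k3_mir]
  have hk : k3 b x (k2 c1 x y y1) (k2 c2 x y y3) = (θ * d23 c1 x y) • k2 c3 x y1 y3 := by
    ext i
    fin_cases i
    · simp [k3, hb, mul_assoc]
      simp [k2]
    · simp [k3, hb, mul_assoc]
      simp [k2]
  rw [hk, form_smul₂, form_smul₂, h1, h2, form_k2]
  simp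

lemma Triple.good {c1 c2 c3 b b' : Ten} (h : Triple c1 c2 c3 b b') (h1 : IsH4 c1) (h2 : IsH4 c2)
    (hb : NonzeroBiquads b ∧ ∀ k l, k ≠ l → ¬ IsDeg b k l)
    (hb' : NonzeroBiquads b' ∧ ∀ k l, k ≠ l → ¬ IsDeg b' k l) :
    Good ⟨c1, c1, b, b', c2, c2⟩ where
  hc := h.mirror_hc.mirror h1.mir.nonzero h2.mir.nonzero
  hm := h.mirror_hc
  nzA := h1.nonzero
  nzB := hb.1
  nzB' := hb'.1
  ndB := hb.2
  ndB' := hb'.2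
  hA := fun _ _ _ _ => h1
  hA' := h1
  hC := h2
  hC' := h2

lemma hasTwoQFourH4_of_isH4 {s : Sys} (hA : IsH4 s.A) (hA' : IsH4 s.A') (hC : IsH4 s.C)
    (hC' : IsH4 s.C') (hb : NonzeroBiquads s.B ∧ ∀ k l, k ≠ l → ¬ IsDeg s.B k l)
    (hb' : NonzeroBiquads s.B' ∧ ∀ k l, k ≠ l → ¬ IsDeg s.B' k l) : s.toCube.HasTwoQFourH4 := by
  refine ⟨isTypeQ_ofTen_iff.2 hb, isTypeQ_ofTen_iff.2 hb', hA.isTypeH4.1, hA'.isTypeH4.1,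
    hC.isTypeH4.1, hC'.isTypeH4.1, ?_⟩
  rintro Q (rfl | rfl | rfl)
  · exact hA'.isTypeH4.2
  · exact hC.isTypeH4.2
  · exact hC'.isTypeH4.2

lemma determines_ofTen_iff {c : Ten} {x y z t : ℂ} : Determines (ofTen c) x y z t ↔
    form c (aff x) (aff y) (aff z) (aff t) = 0 ∧ form c (aff x) (aff y) (aff z) e0 ≠ 0 := by
  rw [Determines, eval_ofTen', eval_pderiv_ofTen]
  simp [formF, Function.update]

lemma eq_of_determines {c : Ten} {x y z t s : ℂ} (h : Determines (ofTen c) x y z t)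
    (hs : form c (aff x) (aff y) (aff z) (aff s) = 0) : t = s := by
  obtain ⟨h, h0⟩ := determines_ofTen_iff.1 h
  rw [form_expand₃] at h hs
  simp only [aff_zero, aff_one] at h hs
  have : (t - s) * form c (aff x) (aff y) (aff z) e0 = 0 := by linear_combination h - hs
  exact sub_eq_zero.1 ((mul_eq_zero.1 this).resolve_right h0)

lemma Sys.HC.isConsistent {s : Sys} (h : s.HC) : s.toCube.IsConsistent := by
  intro x x1 x2 x3 x12 x13 x23 yA yB yC hA hC hB hA' hB' hC'
  have hA0 := determines_ofTen_iff.1 hA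
  have hC0 := determines_ofTen_iff.1 hC
  have hB0 := determines_ofTen_iff.1 hB
  have hB'0 := determines_ofTen_iff.1 hB'
  obtain ⟨h1, h2⟩ := h.apply hA0.1 hC0.1 hB0.1 hB'0.1 ⟨_, hA0.2⟩ ⟨_, hC0.2⟩ ⟨_, hB0.2⟩ ⟨_, hB'0.2⟩
  exact ⟨eq_of_determines hA' h1, (eq_of_determines hC' h2).symm⟩

/-! ### The listed systems as multilinear forms -/

lemma ofTen_face1 (ε α β : ℂ) : ofTen (face1 ε α β) = a1 ε α β := by
  refine MvPolynomial.funext fun x => ?_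
  simp only [eval_ofTen, formF, face1, form_faceT, aff_zero, aff_one, a1]
  simp
  ring

lemma ofTen_face2 (ε α β : ℂ) : ofTen (face2 ε α β) = a2 ε α β := by
  refine MvPolynomial.funext fun x => ?_
  simp only [eval_ofTen, formF, face2, form_faceT, aff_zero, aff_one, a2]
  simp
  ring

lemma ofTen_face3 (δ ε α β : ℂ) : ofTen (face3 δ (ε / (α * β)) α β) = a3 δ ε α β := by
  refine MvPolynomial.funext fun x => ?_
  simp only [eval_ofTen, formF, face3, form_faceT, aff_zero, aff_one, a3]
  simp
  ring

lemma ofTen_quad1 (α β γ ε : ℂ) : ofTen (quad1 α β γ ε) = b1 α β γ ε := by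
  refine MvPolynomial.funext fun x => ?_
  simp only [eval_ofTen, formF, quad1, form_kleinT, aff_zero, aff_one, b1]
  simp
  ring

lemma ofTen_quad2 (α β γ ε : ℂ) : ofTen (quad2 α β γ ε) = b2 α β γ ε := by
  refine MvPolynomial.funext fun x => ?_
  simp only [eval_ofTen, formF, quad2, form_kleinT, aff_zero, aff_one, b2]
  simp
  ring

lemma ofTen_quad3 (δ α β γ ε : ℂ) :
    ofTen (quad3 δ α β γ (ε / (α * β * γ))) = b3 δ α β γ ε := by
  refine MvPolynomial.funext fun x => ?_
  simp only [eval_ofTen, formF, quad3, form_kleinT, aff_zero, aff_one, b3]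
  simp
  ring

/-- The polynomials of a listed system: `c1`, `c2`, `c3` have the parameters `(α, β)`, `(α, γ)` and
`(β, γ)`, and `b`, `b'` are the two faces of type Q. -/
structure Faces where
  c1 : Ten
  c2 : Ten
  c3 : Ten
  b : Ten
  b' : Ten

/-- The polynomials of the `k`-th listed system. -/
def faces (k : Fin 3) (δ ε α β γ : ℂ) : Faces :=
  match k with
  | 0 => ⟨face1 ε α β, face1 ε α γ, face1 ε β γ, quad1 α β γ ε, quad1 α β γ 0⟩
  | 1 => ⟨face2 ε α β, face2 ε α γ, face2 ε β γ, quad2 α β γ ε, quad2 α β γ 0⟩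
  | 2 => ⟨face3 δ (ε / (α * β)) α β, face3 δ (ε / (α * γ)) α γ, face3 δ (ε / (β * γ)) β γ,
      quad3 δ α β γ (ε / (α * β * γ)), quad3 δ α β γ 0⟩

/-- The six faces of the cube, without the tetrahedra. -/
def Faces.sys (f : Faces) : Sys := ⟨f.c1, f.c1, f.b, f.b', f.c2, f.c2⟩

lemma Admissible.exists_eta {α β γ : ℂ} (h : Admissible 2 α β γ) (ε : ℂ) : ∃ η,
    ε / (α * β * γ) = η ∧ ε / (α * β) = γ * η ∧ ε / (α * γ) = β * η ∧ ε / (β * γ) = α * η := by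
  obtain ⟨ha, hb, hc, -⟩ := h
  refine ⟨_, rfl, ?_, ?_, ?_⟩ <;> field_simp

lemma Admissible.triple {k : Fin 3} {α β γ : ℂ} (h : Admissible k α β γ) (δ ε : ℂ) :
    Triple (faces k δ ε α β γ).c1 (faces k δ ε α β γ).c2 (faces k δ ε α β γ).c3
      (faces k δ ε α β γ).b (faces k δ ε α β γ).b' := by
  fin_cases k
  · exact triple1 h.1 h.2.2 ε
  · exact triple2 h.1 h.2.2 ε
  · obtain ⟨η, h0, h1, h2, h3⟩ := h.exists_eta ε
    change Triple (face3 δ (ε / (α * β)) α β) (face3 δ (ε / (α * γ)) α γ)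
      (face3 δ (ε / (β * γ)) β γ) (quad3 δ α β γ (ε / (α * β * γ))) (quad3 δ α β γ 0)
    rw [h0, h1, h2, h3]
    exact triple3 h.2.2.2.1 h.2.2.2.2.2 δ η

lemma isH4_face1 {α β : ℂ} (h : α ≠ β) (ε : ℂ) : IsH4 (face1 ε α β) :=
  isH4_faceT one_ne_zero one_ne_zero (Or.inr (Or.inr ⟨neg_ne_zero.2 (sub_ne_zero.2 h), rfl⟩))

lemma isH4_face2 {α β : ℂ} (h : α ≠ β) (ε : ℂ) : IsH4 (face2 ε α β) :=
  isH4_faceT one_ne_zero one_ne_zero (Or.inr (Or.inl (mul_ne_zero (by norm_num)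
    (sub_ne_zero.2 h))))

lemma isH4_face3 {α β : ℂ} (hα : α ≠ 0) (hβ : β ≠ 0) (h : α ^ 2 ≠ β ^ 2) (δ η : ℂ) :
    IsH4 (face3 δ η α β) :=
  isH4_faceT hα hβ (Or.inl ⟨sub_ne_zero.2 h, rfl⟩)

lemma Admissible.isH4 {k : Fin 3} {α β γ : ℂ} (h : Admissible k α β γ) (δ ε : ℂ) :
    IsH4 (faces k δ ε α β γ).c1 ∧ IsH4 (faces k δ ε α β γ).c2 := by
  fin_cases k
  · exact ⟨isH4_face1 h.1 ε, isH4_face1 h.2.2 ε⟩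
  · exact ⟨isH4_face2 h.1 ε, isH4_face2 h.2.2 ε⟩
  · obtain ⟨ha, hb, hc, hab, -, hac⟩ := h
    exact ⟨isH4_face3 ha hb hab _ _, isH4_face3 ha hc hac _ _⟩

lemma Admissible.typeQ {k : Fin 3} {α β γ : ℂ} (h : Admissible k α β γ) (δ ε : ℂ) :
    (NonzeroBiquads (faces k δ ε α β γ).b ∧
      ∀ i j, i ≠ j → ¬ IsDeg (faces k δ ε α β γ).b i j) ∧
    NonzeroBiquads (faces k δ ε α β γ).b' ∧
      ∀ i j, i ≠ j → ¬ IsDeg (faces k δ ε α β γ).b' i j := by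
  fin_cases k
  · have hf := neg_ne_zero.2 (sub_ne_zero.2 h.1)
    have hg := sub_ne_zero.2 h.2.2
    have hh := neg_ne_zero.2 (sub_ne_zero.2 h.2.1)
    exact ⟨typeQ_kleinT hf hg hh _ _, typeQ_kleinT hf hg hh _ _⟩
  · have hf := neg_ne_zero.2 (sub_ne_zero.2 h.1)
    have hg := sub_ne_zero.2 h.2.2
    have hh := neg_ne_zero.2 (sub_ne_zero.2 h.2.1)
    exact ⟨typeQ_kleinT hf hg hh _ _, typeQ_kleinT hf hg hh _ _⟩
  · obtain ⟨ha, hb, hc, hab, hbc, hac⟩ := h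
    have hf := mul_ne_zero hc (sub_ne_zero.2 hab)
    have hg := neg_ne_zero.2 (mul_ne_zero hb (sub_ne_zero.2 hac))
    have hh := mul_ne_zero ha (sub_ne_zero.2 hbc)
    exact ⟨typeQ_kleinT hf hg hh _ _, typeQ_kleinT hf hg hh _ _⟩

lemma Admissible.std {k : Fin 3} {α β γ : ℂ} (h : Admissible k α β γ) (δ ε : ℂ) :
    Std (faces k δ ε α β γ).sys := by
  refine ⟨(h.triple δ ε).good (h.isH4 δ ε).1 (h.isH4 δ ε).2 (h.typeQ δ ε).1 (h.typeQ δ ε).2,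
    ?_, ?_, ?_, ?_⟩ <;>
  · intro i j
    fin_cases k <;> fin_cases i <;> fin_cases j <;> rfl

lemma listedSystem_eq (k : Fin 3) (δ ε α β γ : ℂ) :
    (listedSystem k δ ε α β γ).toCubeSystem = (faces k δ ε α β γ).sys.toCube := by
  fin_cases k
  · simp only [listedSystem, mkTwoQ, faces, Faces.sys, Sys.toCube, ofTen_face1, ofTen_quad1]
  · simp only [listedSystem, mkTwoQ, faces, Faces.sys, Sys.toCube, ofTen_face2, ofTen_quad2]
  · have hb : ofTen (quad3 δ α β γ 0) = b3 δ α β γ 0 := by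
      rw [← ofTen_quad3, zero_div]
    simp only [listedSystem, mkTwoQ, faces, Faces.sys, Sys.toCube, ofTen_face3, ofTen_quad3, hb]

lemma rename_rename_eq {σ τ ρ : Fin 4 → Fin 4} (h : ∀ i, τ (σ i) = ρ i) (p : Poly4) :
    rename τ (rename σ p) = rename ρ p := by
  rw [rename_rename, show τ ∘ σ = ρ from funext h]

lemma flip_mkSixH4 {P P' : ℂ → ℂ → Poly4} (h : ∀ α β, rename ![0, 1, 3, 2] (P' α β) = P α β)
    (R : ℂ → Poly4) (ε α β γ : ℂ) : (mkSixH4 P' R ε α β γ).flip = mkTwoQ P R ε α β γ := by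
  have h1 (α β : ℂ) : rename ![1, 0, 2, 3] (rename ![1, 0, 3, 2] (P' α β)) = P α β :=
    (rename_rename_eq (by decide) _).trans (h α β)
  have h2 : P' β γ = rename ![0, 1, 3, 2] (P β γ) := by
    rw [← h, rename_rename_eq (ρ := id) (by decide), rename_id_apply]
  have h3 : (rename ![1, 0, 3, 2] (P' β γ) : Poly4) = rename ![1, 0, 2, 3] (P β γ) := by
    rw [← h]
    exact (rename_rename_eq (by decide) _).symm
  simp only [mkSixH4, mkTwoQ, TetraSystem.flip, TetraSystem.mk.injEq, CubeSystem.mk.injEq]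
  exact ⟨⟨h α β, h1 α β, trivial, trivial, h α γ, h1 α γ⟩, h2, h3⟩

lemma listedSystem_eq_flip (k : Fin 3) (δ ε α β γ : ℂ) :
    listedSystem k δ ε α β γ = (firstCaseSystem k δ ε α β γ).flip := by
  fin_cases k
  · refine (flip_mkSixH4 (fun α β => ?_) _ _ _ _ _).symm
    simp [a1First, a1]
  · refine (flip_mkSixH4 (fun α β => ?_) _ _ _ _ _).symm
    have h2 : rename (![0, 1, 3, 2] : Fin 4 → Fin 4) (2 : Poly4) = 2 := map_ofNat _ 2
    simp [a2First, a2, h2]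
    exact Or.inl (by ring)
  · refine (flip_mkSixH4 (fun α β => ?_) _ _ _ _ _).symm
    simp [a3First, a3, mul_comm (X 3 : Poly4) (X 2)]

/-! ### The tetrahedron property of the listed systems -/

/-- A solution of the system with the faces `c1`, `c2`, `b`, `b'` in homogeneous coordinates; the
vertices around the face of `b` are `x0 = x`, `x1 = x₂`, `x2 = x₂₃`, `x3 = x₃`, those around the
face of `b'` are `y0 = x₁`, `y1 = x₁₂`, `y2 = x₁₂₃`, `y3 = x₁₃`. -/
structure PSol (c1 c2 b b' : Ten) (x0 x1 x2 x3 y0 y1 y2 y3 : Vec) : Prop where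
  hx0 : x0 ≠ 0
  hx1 : x1 ≠ 0
  hx2 : x2 ≠ 0
  hx3 : x3 ≠ 0
  hy0 : y0 ≠ 0
  hy1 : y1 ≠ 0
  hy2 : y2 ≠ 0
  hy3 : y3 ≠ 0
  a : form c1 x0 y0 x1 y1 = 0
  a' : form c1 x3 y3 x2 y2 = 0
  b : form b x0 x1 x3 x2 = 0
  b' : form b' y0 y1 y3 y2 = 0
  c : form c2 x0 y0 x3 y3 = 0
  c' : form c2 x1 y1 x2 y2 = 0

/-- The coefficient `m(y, z)` of the first variable of a face polynomial. -/
def fm (c : Ten) (y z : Vec) : ℂ := form c e0 y e1 z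

/-- The shape of the faces of the listed systems, with the further identities from which the
tetrahedron property follows also at singular solutions. -/
structure Tetra (c1 c2 c3 b b' : Ten) : Prop extends Triple c1 c2 c3 b b' where
  shape : ∃ p q r s t : ℂ, p ≠ 0 ∧ q ≠ 0 ∧ r ≠ 0 ∧ q * t - r * s = p * (t - s) ∧
    (∃ i j k, c1 = faceT p q s i j k) ∧ (∃ i j k, c2 = faceT p r t i j k) ∧
    ∃ i j k, c3 = faceT q r (t - s) i j k
  shape_b : ∃ f g h e k : ℂ, f ≠ 0 ∧ g ≠ 0 ∧ h ≠ 0 ∧ b = kleinT f g h e k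
  shape_b' : ∃ f g h e k : ℂ, b' = kleinT f g h e k
  sum : ∃ l : ℂ, ∀ x0 x1 x2 x3 y0 y1 y2 y3 : Vec,
    x1 1 * x3 1 * (y0 1 * y2 1) * form c3 x0 y1 x2 y3 +
      x0 1 * x2 1 * (y1 1 * y3 1) * form c3 x1 y0 x3 y2 =
    x0 1 * x3 1 * (y0 1 * y3 1) * form c2 x1 y1 x2 y2 -
      x2 1 * x3 1 * (y2 1 * y3 1) * form c1 x0 y0 x1 y1 +
      x1 1 * x2 1 * (y1 1 * y2 1) * form c2 x0 y0 x3 y3 -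
      x0 1 * x1 1 * (y0 1 * y1 1) * form c1 x3 y3 x2 y2 +
      l * (x0 1 * x1 1 * x2 1 * x3 1) * form b' y0 y1 y3 y2
  split : ∃ i j : ℂ, i ≠ 0 ∧ j ≠ 0 ∧ ∀ y0 y1 y2 y3 : Vec, form b' y0 y1 y3 y2 =
    i * (fm c2 y2 y1 * fm c2 y0 y3) + j * (fm c1 y0 y1 * fm c1 y2 y3)
  /-- At a singular solution, the tetrahedron equation is a consequence of the vanishing of the
  biquadratics. -/
  sing : ∀ x1 x3 y0 y1 y2 y3 : Vec, x1 1 ≠ 0 → x3 1 ≠ 0 → y0 ≠ 0 → y1 ≠ 0 → y2 ≠ 0 → y3 ≠ 0 →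
    fm c1 y0 y1 = 0 → fm c2 y0 y3 = 0 → fm c2 y1 y2 * fm c2 y2 y1 = 0 →
    fm c1 y2 y3 * fm c1 y3 y2 = 0 → d23 c1 x1 y1 = 0 → d23 c1 x3 y3 = 0 →
    form c3 x1 y0 x3 y2 = 0

lemma fm_faceT (p q a i j k : ℂ) (y z : Vec) : fm (faceT p q a i j k) y z =
    p * (y 0 * z 1) - q * (y 1 * z 0) - a * (y 1 * z 1) := by
  simp [fm, form_faceT]

lemma form_faceT_eq_fm (p q a i j k : ℂ) (u v w z : Vec) : form (faceT p q a i j k) u v w z =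
    u 0 * w 1 * fm (faceT p q a i j k) v z + u 1 * w 0 * fm (faceT p q a i j k) z v +
      u 1 * w 1 * form (faceT p q a i j k) e1 v e1 z := by
  simp only [fm, form_faceT, e0_zero, e0_one, e1_zero, e1_one]
  ring

lemma exists_k2_eq_smul {c : Ten} {u v w z : Vec} (hw : w ≠ 0) (h : form c u v w z = 0) :
    ∃ s : ℂ, k2 c u v z = s • w := by
  refine exists_smul_of_wedge hw ?_
  rw [form_expand₂] at h
  simp only [k2, Matrix.cons_val_zero, Matrix.cons_val_one]
  linear_combination -h

lemma exists_k3_eq_smul {c : Ten} {u v w z : Vec} (hz : z ≠ 0) (h : form c u v w z = 0) :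
    ∃ s : ℂ, k3 c u v w = s • z := by
  refine exists_smul_of_wedge hz ?_
  rw [form_expand₃] at h
  simp only [k3, Matrix.cons_val_zero, Matrix.cons_val_one]
  linear_combination -h

namespace Tetra

variable {c1 c2 c3 b b' : Ten} {x0 x1 x2 x3 y0 y1 y2 y3 : Vec}

lemma symm₁ (t : Tetra c1 c2 c3 b b') (u v w z : Vec) : form c1 u v w z = form c1 w z u v := by
  obtain ⟨p, q, r, s, t, -, -, -, -, ⟨i, j, k, rfl⟩, -, -⟩ := t.shape
  exact form_faceT_symm _ _ _ _ _ _ _ _ _ _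

lemma symm₂ (t : Tetra c1 c2 c3 b b') (u v w z : Vec) : form c2 u v w z = form c2 w z u v := by
  obtain ⟨p, q, r, s, t, -, -, -, -, -, ⟨i, j, k, rfl⟩, -⟩ := t.shape
  exact form_faceT_symm _ _ _ _ _ _ _ _ _ _

lemma symm₃ (t : Tetra c1 c2 c3 b b') (u v w z : Vec) : form c3 u v w z = form c3 w z u v := by
  obtain ⟨p, q, r, s, t, -, -, -, -, -, -, ⟨i, j, k, rfl⟩⟩ := t.shape
  exact form_faceT_symm _ _ _ _ _ _ _ _ _ _

/-- The symmetry of the cube that interchanges `x` with `x₂₃` and `x₂` with `x₃`. -/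
lemma shift (t : Tetra c1 c2 c3 b b') (h : PSol c1 c2 b b' x0 x1 x2 x3 y0 y1 y2 y3) :
    PSol c1 c2 b b' x2 x3 x0 x1 y2 y3 y0 y1 := by
  obtain ⟨f, g, h', e, k, -, -, -, hb⟩ := t.shape_b
  obtain ⟨f2, g2, h2, e2, k2, hb'⟩ := t.shape_b'
  refine ⟨h.hx2, h.hx3, h.hx0, h.hx1, h.hy2, h.hy3, h.hy0, h.hy1, t.symm₁ _ _ _ _ ▸ h.a',
    t.symm₁ _ _ _ _ ▸ h.a, ?_, ?_, t.symm₂ _ _ _ _ ▸ h.c', t.symm₂ _ _ _ _ ▸ h.c⟩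
  · rw [← h.b, hb, form_kleinT, form_kleinT]; ring
  · rw [← h.b', hb', form_kleinT, form_kleinT]; ring

/-- The symmetry of the cube that interchanges `x` with `x₂` and `x₃` with `x₂₃`, and the two
tetrahedra. -/
lemma refl (t : Tetra c1 c2 c3 b b') (h : PSol c1 c2 b b' x0 x1 x2 x3 y0 y1 y2 y3) :
    PSol c1 c2 b b' x1 x0 x3 x2 y1 y0 y3 y2 := by
  obtain ⟨f, g, h', e, k, -, -, -, hb⟩ := t.shape_b
  obtain ⟨f2, g2, h2, e2, k2, hb'⟩ := t.shape_b'
  refine ⟨h.hx1, h.hx0, h.hx3, h.hx2, h.hy1, h.hy0, h.hy3, h.hy2, t.symm₁ _ _ _ _ ▸ h.a,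
    t.symm₁ _ _ _ _ ▸ h.a', ?_, ?_, h.c', h.c⟩
  · rw [← h.b, hb, form_kleinT, form_kleinT]; ring
  · rw [← h.b', hb', form_kleinT, form_kleinT]; ring

lemma form₁ (t : Tetra c1 c2 c3 b b') (u v w z : Vec) : form c1 u v w z =
    u 0 * w 1 * fm c1 v z + u 1 * w 0 * fm c1 z v + u 1 * w 1 * form c1 e1 v e1 z := by
  obtain ⟨p, q, r, s, t, -, -, -, -, ⟨i, j, k, rfl⟩, -, -⟩ := t.shape
  exact form_faceT_eq_fm _ _ _ _ _ _ _ _ _ _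

lemma form₂ (t : Tetra c1 c2 c3 b b') (u v w z : Vec) : form c2 u v w z =
    u 0 * w 1 * fm c2 v z + u 1 * w 0 * fm c2 z v + u 1 * w 1 * form c2 e1 v e1 z := by
  obtain ⟨p, q, r, s, t, -, -, -, -, -, ⟨i, j, k, rfl⟩, -⟩ := t.shape
  exact form_faceT_eq_fm _ _ _ _ _ _ _ _ _ _

lemma form₃ (t : Tetra c1 c2 c3 b b') (u v w z : Vec) : form c3 u v w z =
    u 0 * w 1 * fm c3 v z + u 1 * w 0 * fm c3 z v + u 1 * w 1 * form c3 e1 v e1 z := by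
  obtain ⟨p, q, r, s, t, -, -, -, -, -, -, ⟨i, j, k, rfl⟩⟩ := t.shape
  exact form_faceT_eq_fm _ _ _ _ _ _ _ _ _ _

/-- The zero sets of `fm c1` and `fm c2` compose to that of `fm c3`. -/
lemma chain (t : Tetra c1 c2 c3 b b') (h : y1 ≠ 0) (h1 : fm c1 y1 y0 = 0)
    (h2 : fm c2 y1 y2 = 0) : fm c3 y0 y2 = 0 := by
  obtain ⟨p, q, r, s, t, hp, hq, hr, -, ⟨i, j, k, rfl⟩, ⟨i', j', k', rfl⟩, ⟨i2, j2, k2, rfl⟩⟩ :=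
    t.shape
  rw [fm_faceT] at *
  by_cases hy : y1 1 = 0
  · have hy0 := (vec_ne_zero_iff.1 h).resolve_right (not_not.2 hy)
    have e0 : y0 1 = 0 := by simpa [hy, hp, hy0] using h1
    have e2 : y2 1 = 0 := by simpa [hy, hp, hy0] using h2
    simp [e0, e2]
  · refine (mul_eq_zero.1 (?_ : y1 1 * _ = 0)).resolve_left hy
    linear_combination y0 1 * h2 - y2 1 * h1

lemma chain' (t : Tetra c1 c2 c3 b b') (h : y3 ≠ 0) (h1 : fm c2 y0 y3 = 0)
    (h2 : fm c1 y2 y3 = 0) : fm c3 y0 y2 = 0 := by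
  obtain ⟨p, q, r, s, t, hp, hq, hr, ht, ⟨i, j, k, rfl⟩, ⟨i', j', k', rfl⟩, ⟨i2, j2, k2, rfl⟩⟩ :=
    t.shape
  rw [fm_faceT] at *
  by_cases hy : y3 1 = 0
  · have hy0 := (vec_ne_zero_iff.1 h).resolve_right (not_not.2 hy)
    have e0 : y0 1 = 0 := by simpa [hy, hr, hy0] using h1
    have e2 : y2 1 = 0 := by simpa [hy, hq, hy0] using h2
    simp [e0, e2]
  · refine (mul_eq_zero.1 (?_ : (p * y3 1) * _ = 0)).resolve_left (mul_ne_zero hp hy)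
    linear_combination q * y2 1 * h1 - r * y0 1 * h2 + y0 1 * y2 1 * y3 1 * ht

/-- If the tetrahedron equation of `x₁, x₂, x₃, x₁₂₃` fails, then the biquadratics at all edges
vanish. -/
lemma edges (t : Tetra c1 c2 c3 b b') (h : PSol c1 c2 b b' x0 x1 x2 x3 y0 y1 y2 y3)
    (hK : form c3 x1 y0 x3 y2 ≠ 0) : fm c1 y0 y1 * fm c1 y1 y0 = 0 ∧
      fm c2 y1 y2 * fm c2 y2 y1 = 0 ∧ fm c1 y2 y3 * fm c1 y3 y2 = 0 ∧
      fm c2 y0 y3 * fm c2 y3 y0 = 0 ∧ d23 c1 x1 y1 = 0 ∧ d23 c1 x3 y3 = 0 := by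
  have hb {x0 x1 x2 x3 y0 y1 y2 y3 : Vec} (h : PSol c1 c2 b b' x0 x1 x2 x3 y0 y1 y2 y3)
      (hK : form c3 x0 y1 x2 y3 ≠ 0) : d23 c1 x0 y0 = 0 ∧ fm c1 y0 y1 * fm c1 y1 y0 = 0 ∧
        fm c2 y0 y3 * fm c2 y3 y0 = 0 := by
    obtain ⟨θ, hθ, hb⟩ := t.eb
    obtain ⟨θ1, hθ1, ha⟩ := t.ea
    obtain ⟨θ2, hθ2, hc⟩ := t.ec
    obtain ⟨s, hs⟩ : ∃ s : ℂ, k2 c1 x0 y0 y1 = s • x1 :=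
      exists_k2_eq_smul h.hx1 h.a
    obtain ⟨s', hs'⟩ : ∃ s : ℂ, k2 c2 x0 y0 y3 = s • x3 :=
      exists_k2_eq_smul h.hx3 h.c
    obtain ⟨s2, hs2⟩ : ∃ s : ℂ, k3 b' y0 y1 y3 = s • y2 :=
      exists_k3_eq_smul h.hy2 h.b'
    refine ⟨?_, ?_, ?_⟩
    · have := hb x0 y0 y1 y3 x2
      rw [hs, hs', form_smul₁, form_smul₂, h.b, mul_zero, mul_zero] at this
      simpa [hθ, hK] using this.symm
    · have := hc x0 y0 y1 y3 x2
      rw [hs, hs2, form_smul₀, form_smul₃, h.c', mul_zero, mul_zero] at this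
      have h3 : form c1 e0 y0 e1 y1 * form c1 e1 y0 e0 y1 = 0 := by
        simpa [hθ2, hK] using this.symm
      rwa [t.symm₁ e1 y0] at h3
    · have := ha x0 y0 y1 y3 x2
      rw [hs', hs2, form_smul₀, form_smul₃, h.a', mul_zero, mul_zero] at this
      have h3 : form c2 e0 y0 e1 y3 * form c2 e1 y0 e0 y3 = 0 := by
        simpa [hθ1, hK] using this.symm
      rwa [t.symm₂ e1 y0] at h3
  have h1 := hb (t.refl h) hK
  have h3 := hb (t.shift (t.refl h)) (by rwa [t.symm₃])
  refine ⟨by rw [mul_comm]; exact h1.2.1, h1.2.2, by rw [mul_comm]; exact h3.2.1,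
    by rw [mul_comm]; exact h3.2.2, h1.1, h3.1⟩

/-- At a solution with `y0` on the zero sets of `fm c1 · y1` and `fm c2 · y3`, the failure of the
tetrahedron equation would make all biquadratics in `edges` vanish, and `Tetra.sing` applies. -/
lemma sing_of_sol (t : Tetra c1 c2 c3 b b') (h : PSol c1 c2 b b' x0 x1 x2 x3 y0 y1 y2 y3)
    (h1 : x1 1 ≠ 0) (h3 : x3 1 ≠ 0) (h01 : fm c1 y0 y1 = 0) (h03 : fm c2 y0 y3 = 0) :
    form c3 x1 y0 x3 y2 = 0 := by
  by_contra hK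
  obtain ⟨e1, e2, e3, e4, e5, e6⟩ := t.edges h hK
  exact hK (t.sing _ _ _ _ _ _ h1 h3 h.hy0 h.hy1 h.hy2 h.hy3 h01 h03 e2 e3 e5 e6)

lemma tetra_of_inf (t : Tetra c1 c2 c3 b b') (h : PSol c1 c2 b b' x0 x1 x2 x3 y0 y1 y2 y3)
    (h1 : x1 1 = 0) : form c3 x1 y0 x3 y2 = 0 := by
  have h10 := (vec_ne_zero_iff.1 h.hx1).resolve_right (not_not.2 h1)
  rw [t.form₃, h1]
  by_cases h3 : x3 1 = 0
  · simp [h3]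
  suffices fm c3 y0 y2 = 0 by simp [this]
  have ha := h.a
  have ha' := h.a'
  have hc := h.c
  have hc' := h.c'
  have hb := h.b
  obtain ⟨f, g, h', e, k, hf, hg, hh, rfl⟩ := t.shape_b
  rw [t.form₁] at ha ha'
  rw [t.form₂] at hc hc'
  rw [form_kleinT] at hb
  by_cases h0 : x0 1 = 0
  · have h00 := (vec_ne_zero_iff.1 h.hx0).resolve_right (not_not.2 h0)
    have h2 : x2 1 = 0 := by simpa [h1, h0, h3, h00, h10, hf] using hb
    have h20 := (vec_ne_zero_iff.1 h.hx2).resolve_right (not_not.2 h2)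
    exact t.chain' h.hy3 (by simpa [h0, h3, h00] using hc) (by simpa [h2, h3, h20] using ha')
  · have h2 : x2 1 ≠ 0 := by
      intro h2
      have h20 := (vec_ne_zero_iff.1 h.hx2).resolve_right (not_not.2 h2)
      simp [h1, h2, h0, h3, h10, h20, hg] at hb
    exact t.chain h.hy1 (by simpa [h0, h1, h10] using ha) (by simpa [h1, h2, h10] using hc')

/-- The tetrahedron equation of `x₁, x₂, x₃, x₁₂₃` holds at every solution. -/
lemma tetra' (t : Tetra c1 c2 c3 b b') (h : PSol c1 c2 b b' x0 x1 x2 x3 y0 y1 y2 y3) :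
    form c3 x1 y0 x3 y2 = 0 := by
  by_cases h1 : x1 1 = 0
  · exact t.tetra_of_inf h h1
  by_cases h3 : x3 1 = 0
  · rw [t.symm₃]
    exact t.tetra_of_inf (t.shift h) h3
  have key {x0 x1 x2 x3 y0 y1 y2 y3 : Vec} (h : PSol c1 c2 b b' x0 x1 x2 x3 y0 y1 y2 y3)
      (h1 : x1 1 ≠ 0) (h3 : x3 1 ≠ 0) (h0 : x0 1 = 0) : form c3 x1 y0 x3 y2 = 0 := by
    have h00 := (vec_ne_zero_iff.1 h.hx0).resolve_right (not_not.2 h0)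
    have ha := h.a
    have hc := h.c
    rw [t.form₁] at ha
    rw [t.form₂] at hc
    exact t.sing_of_sol h h1 h3 (by simpa [h0, h1, h00] using ha)
      (by simpa [h0, h3, h00] using hc)
  by_cases h0 : x0 1 = 0
  · exact key h h1 h3 h0
  by_cases h2 : x2 1 = 0
  · rw [t.symm₃]
    exact key (t.shift h) h3 h1 h2
  by_contra hK
  obtain ⟨e1, e2, e3, e4, e5, e6⟩ := t.edges h hK
  have n0 : ¬ (fm c1 y0 y1 = 0 ∧ fm c2 y0 y3 = 0) := fun hn =>
    hK (t.sing_of_sol h h1 h3 hn.1 hn.2)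
  have n2 : ¬ (fm c1 y2 y3 = 0 ∧ fm c2 y2 y1 = 0) := fun hn =>
    hK (by rw [t.symm₃]; exact t.sing_of_sol (t.shift h) h3 h1 hn.1 hn.2)
  have hy : y1 1 * y3 1 ≠ 0 := by
    obtain ⟨p, q, r, s, t, hp, hq, hr, -, ⟨i, j, k, rfl⟩, ⟨i', j', k', rfl⟩, -⟩ := t.shape
    have hinf {y z : Vec} (hy : y ≠ 0) {p q a : ℂ} {i j k} (hp : p ≠ 0) (hq : q ≠ 0)
        (hz : y 1 = 0) (hm : fm (faceT p q a i j k) y z * fm (faceT p q a i j k) z y = 0) :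
        z 1 = 0 := by
      have hy0 := (vec_ne_zero_iff.1 hy).resolve_right (not_not.2 hz)
      simpa [fm_faceT, hz, hp, hq, hy0] using hm
    have hinf' {y z : Vec} {p q a : ℂ} {i j k} (hy : y 1 = 0) (hz : z 1 = 0) :
        fm (faceT p q a i j k) y z = 0 := by simp [fm_faceT, hy, hz]
    refine mul_ne_zero (fun h1 => n0 ?_) fun h3 => n0 ?_
    · have h0 := hinf h.hy1 hp hq h1 (by rw [mul_comm]; exact e1)
      have h3 := hinf h.hy0 hp hr h0 e4
      exact ⟨hinf' h0 h1, hinf' h0 h3⟩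
    · have h0 := hinf h.hy3 hp hr h3 (by rw [mul_comm]; exact e4)
      have h1 := hinf h.hy0 hp hq h0 e1
      exact ⟨hinf' h0 h1, hinf' h0 h3⟩
  have hK0 : form c3 x0 y1 x2 y3 ≠ 0 := by
    intro h'
    obtain ⟨l, hl⟩ := t.sum
    have := hl x0 x1 x2 x3 y0 y1 y2 y3
    rw [h', h.a, h.a', h.c, h.c', h.b'] at this
    simp only [mul_zero, sub_zero, add_zero, zero_add] at this
    exact mul_ne_zero (mul_ne_zero (mul_ne_zero h0 h2) hy) hK this
  have n1 : ¬ (fm c1 y1 y0 = 0 ∧ fm c2 y1 y2 = 0) := fun hn =>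
    hK0 (t.sing_of_sol (t.refl h) h0 h2 hn.1 hn.2)
  have n3 : ¬ (fm c1 y3 y2 = 0 ∧ fm c2 y3 y0 = 0) := fun hn =>
    hK0 (by rw [t.symm₃]; exact t.sing_of_sol (t.shift (t.refl h)) h2 h0 hn.1 hn.2)
  obtain ⟨i, j, hi, hj, hs⟩ := t.split
  have s1 := hs y0 y1 y2 y3
  rw [h.b'] at s1
  simp only [mul_eq_zero] at e1 e2 e3 e4
  by_cases m0 : fm c1 y0 y1 = 0
  · have m3 := fun hn => n0 ⟨m0, hn⟩
    have m3' := e4.resolve_left m3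
    have m2 := fun hn => n3 ⟨hn, m3'⟩
    have m2' := e3.resolve_right m2
    have m1 := fun hn => n2 ⟨m2', hn⟩
    rw [m0, zero_mul, mul_zero, add_zero] at s1
    exact mul_ne_zero hi (mul_ne_zero m1 m3) s1.symm
  · have m0' := e1.resolve_left m0
    have m1 := fun hn => n1 ⟨m0', hn⟩
    have m1' := e2.resolve_left m1
    have m2 := fun hn => n2 ⟨hn, m1'⟩
    rw [m1', zero_mul, mul_zero, zero_add] at s1
    exact mul_ne_zero hj (mul_ne_zero m0 m2) s1.symm

/-- Both tetrahedron equations hold at every solution. -/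
lemma tetra (t : Tetra c1 c2 c3 b b') (h : PSol c1 c2 b b' x0 x1 x2 x3 y0 y1 y2 y3) :
    form c3 x0 y1 x2 y3 = 0 ∧ form c3 x1 y0 x3 y2 = 0 :=
  ⟨t.tetra' (t.refl h), t.tetra' h⟩

end Tetra

lemma d23_faceT (p q a i j k : ℂ) (u v : Vec) : d23 (faceT p q a i j k) u v =
    u 1 * (u 0 * v 1 * ((p ^ 2 - q ^ 2) * v 0 - (p + q) * a * v 1) +
      u 1 * (p * v 1 * (j * v 0 + k * v 1) + (q * v 0 + a * v 1) * (i * v 0 + j * v 1))) := by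
  unfold d23
  simp only [form_faceT, e0_zero, e0_one, e1_zero, e1_one]
  ring

lemma exists_eq_mul {a b : ℂ} (hb : b ≠ 0) : ∃ c, a = c * b := ⟨a / b, by field_simp⟩

lemma tetra1 {α β γ : ℂ} (hab : α ≠ β) (hac : α ≠ γ) (hbc : β ≠ γ) (ε : ℂ) :
    Tetra (face1 ε α β) (face1 ε α γ) (face1 ε β γ) (quad1 α β γ ε) (quad1 α β γ 0) where
  toTriple := triple1 hab hac ε
  shape := ⟨1, 1, 1, 0, 0, one_ne_zero, one_ne_zero, one_ne_zero, by ring, ⟨_, _, _, rfl⟩,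
    ⟨_, _, _, rfl⟩, ⟨_, _, _, by rw [sub_zero]; rfl⟩⟩
  shape_b := ⟨_, _, _, _, _, neg_ne_zero.2 (sub_ne_zero.2 hab), sub_ne_zero.2 hac,
    neg_ne_zero.2 (sub_ne_zero.2 hbc), rfl⟩
  shape_b' := ⟨_, _, _, _, _, rfl⟩
  sum := by
    refine ⟨ε, fun x0 x1 x2 x3 y0 y1 y2 y3 => ?_⟩
    simp only [face1, quad1, form_faceT, form_kleinT]
    ring
  split := by
    refine ⟨α - β, -(α - γ), sub_ne_zero.2 hab, neg_ne_zero.2 (sub_ne_zero.2 hac),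
      fun y0 y1 y2 y3 => ?_⟩
    simp only [face1, quad1, fm_faceT, form_kleinT]
    ring
  sing := by
    intro x1 x3 y0 y1 y2 y3 h1 h3 n0 n1 n2 n3 h01 h03 h12 h23 g1 g3
    simp only [face1, fm_faceT, form_faceT, d23_faceT] at *
    obtain ⟨s, rfl⟩ := exists_smul_of_wedge n1 (z := y0) (by linear_combination -h01)
    obtain ⟨t, rfl⟩ := exists_smul_of_wedge n1 (z := y2) (by
      have : (y1 0 * y2 1 - y1 1 * y2 0) ^ 2 = 0 := by linear_combination -h12
      linear_combination pow_eq_zero_iff (n := 2) two_ne_zero |>.1 this)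
    have hn : ε * (y1 0 * y1 0) + y1 1 * y1 1 = 0 := by
      have : (α - β) * (x1 1 * x1 1) * (ε * (y1 0 * y1 0) + y1 1 * y1 1) = 0 := by
        linear_combination -g1
      exact (mul_eq_zero.1 this).resolve_left
        (mul_ne_zero (sub_ne_zero.2 hab) (mul_ne_zero h1 h1))
    simp only [Pi.smul_apply, smul_eq_mul]
    linear_combination -(β - γ) * s * t * x1 1 * x3 1 * hn

lemma tetra2 {α β γ : ℂ} (hab : α ≠ β) (hac : α ≠ γ) (hbc : β ≠ γ) (ε : ℂ) :
    Tetra (face2 ε α β) (face2 ε α γ) (face2 ε β γ) (quad2 α β γ ε) (quad2 α β γ 0) where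
  toTriple := triple2 hab hac ε
  shape := ⟨1, 1, 1, α - β, α - γ, one_ne_zero, one_ne_zero, one_ne_zero, by ring, ⟨_, _, _, rfl⟩,
    ⟨_, _, _, rfl⟩, ⟨_, _, _, by rw [show α - γ - (α - β) = β - γ by ring]; rfl⟩⟩
  shape_b := ⟨_, _, _, _, _, neg_ne_zero.2 (sub_ne_zero.2 hab), sub_ne_zero.2 hac,
    neg_ne_zero.2 (sub_ne_zero.2 hbc), rfl⟩
  shape_b' := ⟨_, _, _, _, _, rfl⟩
  sum := by
    refine ⟨4 * ε, fun x0 x1 x2 x3 y0 y1 y2 y3 => ?_⟩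
    simp only [face2, quad2, form_faceT, form_kleinT]
    ring
  split := by
    refine ⟨α - β, -(α - γ), sub_ne_zero.2 hab, neg_ne_zero.2 (sub_ne_zero.2 hac),
      fun y0 y1 y2 y3 => ?_⟩
    simp only [face2, quad2, fm_faceT, form_kleinT]
    ring
  sing := by
    intro x1 x3 y0 y1 y2 y3 h1 h3 n0 n1 n2 n3 h01 h03 h12 h23 g1 g3
    simp only [face2, fm_faceT, form_faceT, d23_faceT] at *
    have hab' := sub_ne_zero.2 hab
    by_cases h0 : y0 1 = 0
    · have n00 := (vec_ne_zero_iff.1 n0).resolve_right (not_not.2 h0)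
      have k1 : y1 1 = 0 := by simpa [h0, n00] using h01
      have n10 := (vec_ne_zero_iff.1 n1).resolve_right (not_not.2 k1)
      have k2 : y2 1 = 0 := by simpa [k1, n10] using h12
      have hε : ε = 0 := by simpa [k1, h1, n10, hab'] using g1
      simp [h0, k2, hε]
    · obtain ⟨η, e0⟩ := exists_eq_mul (a := y0 0) h0
      have k1 : y1 1 ≠ 0 := by
        intro k1
        have n10 := (vec_ne_zero_iff.1 n1).resolve_right (not_not.2 k1)
        simp [k1, h0, n10] at h01
      have k3 : y3 1 ≠ 0 := by
        intro k3
        have n30 := (vec_ne_zero_iff.1 n3).resolve_right (not_not.2 k3)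
        simp [k3, h0, n30] at h03
      have e1 : y1 0 = (η - (α - β)) * y1 1 := by
        refine mul_left_cancel₀ h0 ?_
        linear_combination -h01 + y1 1 * e0
      have e3 : y3 0 = (η - (α - γ)) * y3 1 := by
        refine mul_left_cancel₀ h0 ?_
        linear_combination -h03 + y3 1 * e0
      obtain ⟨ξ, f1⟩ := exists_eq_mul (a := x1 0) h1
      obtain ⟨ζ, f3⟩ := exists_eq_mul (a := x3 0) h3
      rw [e1, f1] at g1
      rw [e3, f3] at g3
      rw [e0, f1, f3]
      have p1 : ξ * (2 * (α - β)) = (-(α - β) - 2 * ε * (α - β) * (α + β)) * (η - (α - β)) +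
          (-((α - β) * (α + β)) - ε * (α - β) * (α + β) ^ 2 - ε * (α - β) ^ 3) +
          η * (-(4 * ε * (α - β)) * (η - (α - β)) +
            (-(α - β) - 2 * ε * (α - β) * (α + β))) := by
        refine mul_left_cancel₀ (mul_ne_zero (mul_ne_zero h1 h1) (mul_ne_zero k1 k1)) ?_
        linear_combination -g1
      have p3 : ζ * (2 * (α - β)) = (-(α - β) - 2 * ε * (α - β) * (α + β)) * (η - (α - γ)) +
          (-((α - β) * (α + β)) - ε * (α - β) * (α + β) ^ 2 - ε * (α - β) ^ 3) +
          (η - (α - γ) + (α - β)) * (-(4 * ε * (α - β)) * (η - (α - γ)) +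
            (-(α - β) - 2 * ε * (α - β) * (α + β))) := by
        refine mul_left_cancel₀ (mul_ne_zero (mul_ne_zero h3 h3) (mul_ne_zero k3 k3)) ?_
        linear_combination -g3
      refine (mul_eq_zero.1 (?_ : (2 * (α - β)) * _ = 0)).resolve_left
        (mul_ne_zero two_ne_zero hab')
      linear_combination x1 1 * x3 1 * y0 1 *
        ((η * y2 1 - y2 0 - (β - γ) * y2 1) * p1 + (y2 0 - η * y2 1 - (β - γ) * y2 1) * p3)

lemma tetra3 {α β γ : ℂ} (ha : α ≠ 0) (hb : β ≠ 0) (hc : γ ≠ 0) (hab : α ^ 2 ≠ β ^ 2)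
    (hac : α ^ 2 ≠ γ ^ 2) (hbc : β ^ 2 ≠ γ ^ 2) (δ η : ℂ) :
    Tetra (face3 δ (γ * η) α β) (face3 δ (β * η) α γ) (face3 δ (α * η) β γ) (quad3 δ α β γ η)
      (quad3 δ α β γ 0) where
  toTriple := triple3 hab hac δ η
  shape := ⟨α, β, γ, 0, 0, ha, hb, hc, by ring, ⟨_, _, _, rfl⟩,
    ⟨_, _, _, rfl⟩, ⟨_, _, _, by rw [sub_zero]; rfl⟩⟩
  shape_b := ⟨_, _, _, _, _, mul_ne_zero hc (sub_ne_zero.2 hab),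
    neg_ne_zero.2 (mul_ne_zero hb (sub_ne_zero.2 hac)), mul_ne_zero ha (sub_ne_zero.2 hbc), rfl⟩
  shape_b' := ⟨_, _, _, _, _, rfl⟩
  sum := by
    refine ⟨η, fun x0 x1 x2 x3 y0 y1 y2 y3 => ?_⟩
    simp only [face3, quad3, form_faceT, form_kleinT]
    ring
  split := by
    refine ⟨-(α ^ 2 - β ^ 2) / α, (α ^ 2 - γ ^ 2) / α,
      div_ne_zero (neg_ne_zero.2 (sub_ne_zero.2 hab)) ha, div_ne_zero (sub_ne_zero.2 hac) ha,
      fun y0 y1 y2 y3 => ?_⟩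
    simp only [face3, quad3, fm_faceT, form_kleinT]
    field_simp
    ring
  sing := by
    intro x1 x3 y0 y1 y2 y3 h1 h3 n0 n1 n2 n3 h01 h03 h12 h23 g1 g3
    simp only [face3, fm_faceT, form_faceT, d23_faceT] at *
    have hab' := sub_ne_zero.2 hab
    have hac' := sub_ne_zero.2 hac
    by_cases h0 : y0 1 = 0
    · have n00 := (vec_ne_zero_iff.1 n0).resolve_right (not_not.2 h0)
      have k1 : y1 1 = 0 := by simpa [h0, n00, ha] using h01
      have n10 := (vec_ne_zero_iff.1 n1).resolve_right (not_not.2 k1)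
      have k2 : y2 1 = 0 := by simpa [k1, n10, ha, hc] using h12
      have hη : η = 0 := by simpa [k1, h1, n10, hab', hb, hc] using g1
      simp [h0, k2, hη]
    by_cases h00 : y0 0 = 0
    · have k1 : y1 0 = 0 := by simpa [h0, h00, hb] using h01
      have n10 := (vec_ne_zero_iff.1 n1).resolve_left (not_not.2 k1)
      have k2 : y2 0 = 0 := by simpa [k1, n10, ha, hc] using h12
      have hδ : δ = 0 := by simpa [k1, h1, n10, hab', ha] using g1
      simp [h00, k2, hδ]
    · obtain ⟨s, e0⟩ := exists_eq_mul (a := y0 0) (mul_ne_zero (mul_ne_zero hb hc) h0)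
      have hs : s ≠ 0 := by
        rintro rfl
        exact h00 (by rw [e0, zero_mul])
      have e1 : y1 0 = α * γ * s * y1 1 := by
        refine mul_left_cancel₀ (mul_ne_zero hb h0) ?_
        linear_combination -h01 + α * y1 1 * e0
      have e3 : y3 0 = α * β * s * y3 1 := by
        refine mul_left_cancel₀ (mul_ne_zero hc h0) ?_
        linear_combination -h03 + α * y3 1 * e0
      have k1 : y1 1 ≠ 0 := fun k1 => n1 (by ext i; fin_cases i <;> simp [e1, k1])
      have k3 : y3 1 ≠ 0 := fun k3 => n3 (by ext i; fin_cases i <;> simp [e3, k3])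
      obtain ⟨ξ, f1⟩ := exists_eq_mul (a := x1 0) h1
      obtain ⟨ζ, f3⟩ := exists_eq_mul (a := x3 0) h3
      rw [e1, f1] at g1
      rw [e3, f3] at g3
      rw [e0, f1, f3]
      have p1 : ξ * (γ * s) + δ + α * β * γ ^ 3 * η * s ^ 2 = 0 := by
        refine (mul_eq_zero.1 (?_ : (α ^ 2 - β ^ 2) * (x1 1 * x1 1 * (y1 1 * y1 1)) * α * _ =
          0)).resolve_left (mul_ne_zero (mul_ne_zero hab' (mul_ne_zero (mul_ne_zero h1 h1)
            (mul_ne_zero k1 k1))) ha)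
        linear_combination g1
      have p3 : ζ * (β * s) + δ + α * β ^ 3 * γ * η * s ^ 2 = 0 := by
        refine (mul_eq_zero.1 (?_ : (α ^ 2 - β ^ 2) * (x3 1 * x3 1 * (y3 1 * y3 1)) * α * _ =
          0)).resolve_left (mul_ne_zero (mul_ne_zero hab' (mul_ne_zero (mul_ne_zero h3 h3)
            (mul_ne_zero k3 k3))) ha)
        linear_combination g3
      refine (mul_eq_zero.1 (?_ : s * _ = 0)).resolve_left hs
      linear_combination x1 1 * x3 1 * y0 1 *
        ((β ^ 2 * s * y2 1 - y2 0) * p1 + (y2 0 - γ ^ 2 * s * y2 1) * p3)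

lemma Admissible.tetra {k : Fin 3} {α β γ : ℂ} (h : Admissible k α β γ) (δ ε : ℂ) :
    Tetra (faces k δ ε α β γ).c1 (faces k δ ε α β γ).c2 (faces k δ ε α β γ).c3
      (faces k δ ε α β γ).b (faces k δ ε α β γ).b' := by
  fin_cases k
  · exact tetra1 h.1 h.2.2 h.2.1 ε
  · exact tetra2 h.1 h.2.2 h.2.1 ε
  · obtain ⟨η, h0, h1, h2, h3⟩ := h.exists_eta ε
    obtain ⟨ha, hb, hc, hab, hbc, hac⟩ := h
    change Tetra (face3 δ (ε / (α * β)) α β) (face3 δ (ε / (α * γ)) α γ)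
      (face3 δ (ε / (β * γ)) β γ) (quad3 δ α β γ (ε / (α * β * γ))) (quad3 δ α β γ 0)
    rw [h0, h1, h2, h3]
    exact tetra3 ha hb hc hab hac hbc δ η

lemma Admissible.isH4₃ {k : Fin 3} {α β γ : ℂ} (h : Admissible k α β γ) (δ ε : ℂ) :
    IsH4 (faces k δ ε α β γ).c3 := by
  fin_cases k
  · exact isH4_face1 h.2.1 ε
  · exact isH4_face2 h.2.1 ε
  · exact isH4_face3 h.2.1 h.2.2.1 h.2.2.2.2.1 _ _

/-! ### Tetrahedron polynomials and Möbius transformations -/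

lemma solves_ofTen {c : Ten} {x y z t : ℂ} :
    Solves (ofTen c) x y z t ↔ form c (aff x) (aff y) (aff z) (aff t) = 0 := by
  rw [Solves, eval_ofTen']

/-- A non-zero multilinear form gives a non-zero polynomial. -/
lemma ofTen_ne_zero {c : Ten} (h : ∃ u v w z, form c u v w z ≠ 0) : ofTen c ≠ 0 := by
  rintro h0
  obtain ⟨u, v, w, z, h⟩ := h
  refine h (formF_eq_zero_of_aff (c := c) (fun x => ?_) ![u, v, w, z])
  rw [← eval_ofTen, h0, map_zero]

lemma NonzeroBiquads.exists_ne {c : Ten} (h : NonzeroBiquads c) :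
    ∃ u v w z, form c u v w z ≠ 0 := by
  obtain ⟨u, v, w, h⟩ := h.exists_form_e0
  exact ⟨u, v, w, e0, h⟩

/-- `s` has the tetrahedron property, described by the multilinear forms `κ` and `κ'`, also for
solutions with values at infinity. -/
def Sys.IsTetraPair (s : Sys) (κ κ' : Ten) : Prop :=
  (∃ u v w z, form κ u v w z ≠ 0) ∧ (∃ u v w z, form κ' u v w z ≠ 0) ∧
  ∀ u u1 u2 u3 u12 u13 u23 u123 : Vec, u ≠ 0 → u1 ≠ 0 → u2 ≠ 0 → u3 ≠ 0 → u12 ≠ 0 → u13 ≠ 0 →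
    u23 ≠ 0 → u123 ≠ 0 → form s.A u u1 u2 u12 = 0 → form s.A' u3 u13 u23 u123 = 0 →
    form s.B u u2 u3 u23 = 0 → form s.B' u1 u12 u13 u123 = 0 → form s.C u u1 u3 u13 = 0 →
    form s.C' u2 u12 u23 u123 = 0 → form κ u u12 u13 u23 = 0 ∧ form κ' u1 u2 u3 u123 = 0

lemma Sys.IsTetraPair.isTetrahedronPair {s : Sys} {κ κ' : Ten} (h : s.IsTetraPair κ κ') :
    s.toCube.IsTetrahedronPair (ofTen κ) (ofTen κ') := by
  refine ⟨ofTen_ne_zero h.1, ofTen_ne_zero h.2.1, fun x x1 x2 x3 x12 x13 x23 x123 hs => ?_⟩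
  obtain ⟨hA, hA', hB, hB', hC, hC'⟩ := hs
  rw [solves_ofTen, solves_ofTen]
  exact h.2.2 _ _ _ _ _ _ _ _ (aff_ne_zero _) (aff_ne_zero _) (aff_ne_zero _) (aff_ne_zero _)
    (aff_ne_zero _) (aff_ne_zero _) (aff_ne_zero _) (aff_ne_zero _) (solves_ofTen.1 hA)
    (solves_ofTen.1 hA') (solves_ofTen.1 hB) (solves_ofTen.1 hB') (solves_ofTen.1 hC)
    (solves_ofTen.1 hC')

lemma Sys.IsTetraPair.of_mirror {s : Sys} {κ κ' : Ten} (h : s.mirror.IsTetraPair κ κ') :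
    ∃ μ μ', s.IsTetraPair μ μ' := by
  refine ⟨κ', κ, h.2.1, h.1, fun u u1 u2 u3 u12 u13 u23 u123 n n1 n2 n3 n12 n13 n23 n123 hA hA' hB
    hB' hC hC' => ?_⟩
  have := h.2.2 u1 u u12 u13 u2 u3 u123 u23 n1 n n12 n13 n2 n3 n123 n23
    (by simpa only [Sys.mirror, form_mir] using hA) (by simpa only [Sys.mirror, form_mir] using hA')
    hB' hB (by simpa only [Sys.mirror, form_mir] using hC)
    (by simpa only [Sys.mirror, form_mir] using hC')
  exact ⟨this.2, this.1⟩

lemma SysRel.exists_isTetraPair {s t : Sys} (h : SysRel s t) {κ κ' : Ten}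
    (ht : t.IsTetraPair κ κ') : ∃ μ μ', s.IsTetraPair μ μ' := by
  obtain ⟨g, hA, hA', hB, hB', hC, hC'⟩ := h
  have hne (c : Ten) (hc : ∃ u v w z, form c u v w z ≠ 0) (g0 g1 g2 g3 : GL (Fin 2) ℂ) :
      ∃ u v w z, form (actT c g0 g1 g2 g3) u v w z ≠ 0 := by
    obtain ⟨u, v, w, z, hc⟩ := hc
    refine ⟨g0⁻¹.1.mulVec u, g1⁻¹.1.mulVec v, g2⁻¹.1.mulVec w, g3⁻¹.1.mulVec z, ?_⟩
    rw [form_actT]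
    simpa only [mulVec_inv_mulVec] using hc
  have tr {c d : Ten} {g0 g1 g2 g3 : GL (Fin 2) ℂ} (hcd : FaceRel c d ![g0, g1, g2, g3])
      {u v w z : Vec} (h0 : form c u v w z = 0) : form d (g0.1.mulVec u) (g1.1.mulVec v)
        (g2.1.mulVec w) (g3.1.mulVec z) = 0 := by
    obtain ⟨θ, hθ, hcd⟩ := hcd.exists_form
    rw [hcd] at h0
    exact (mul_eq_zero.1 h0).resolve_left hθ
  refine ⟨actT κ (g 0) (g 4) (g 5) (g 6), actT κ' (g 1) (g 2) (g 3) (g 7), hne _ ht.1 _ _ _ _,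
    hne _ ht.2.1 _ _ _ _, fun u u1 u2 u3 u12 u13 u23 u123 n n1 n2 n3 n12 n13 n23 n123 a a' b b' c
      c' => ?_⟩
  rw [form_actT, form_actT]
  exact ht.2.2 _ _ _ _ _ _ _ _ (gl_mulVec_ne_zero _ n) (gl_mulVec_ne_zero _ n1)
    (gl_mulVec_ne_zero _ n2) (gl_mulVec_ne_zero _ n3) (gl_mulVec_ne_zero _ n12)
    (gl_mulVec_ne_zero _ n13) (gl_mulVec_ne_zero _ n23) (gl_mulVec_ne_zero _ n123)
    (tr hA a) (tr hA' a') (tr hB b) (tr hB' b') (tr hC c) (tr hC' c')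

lemma Admissible.isTetraPair {k : Fin 3} {α β γ : ℂ} (h : Admissible k α β γ) (δ ε : ℂ) :
    (faces k δ ε α β γ).sys.IsTetraPair (fun i j k' l => (faces k δ ε α β γ).c3 i j l k')
      fun i j k' l => (faces k δ ε α β γ).c3 j i k' l := by
  have hne := (h.isH4₃ δ ε).nonzero.exists_ne
  have hf (c : Ten) (u v w z : Vec) :
      form (fun i j k l => c j i k l) u v w z = form c v u w z := by
    simp only [form_eq]; ring
  obtain ⟨u, v, w, z, hne⟩ := hne
  refine ⟨⟨u, v, z, w, by rwa [form_swap]⟩, ⟨v, u, w, z, by rwa [hf]⟩, ?_⟩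
  intro u u1 u2 u3 u12 u13 u23 u123 n n1 n2 n3 n12 n13 n23 n123 a a' b b' c c'
  have := (h.tetra δ ε).tetra
    ⟨n, n2, n23, n3, n1, n12, n123, n13, a, a', b, b', c, c'⟩
  exact ⟨(form_swap _ _ _ _ _).trans this.1, (hf _ _ _ _ _).trans this.2⟩

lemma ofTen_swap (c : Ten) : ofTen (fun i j k l => c i j l k) = rename ![0, 1, 3, 2] (ofTen c) := by
  refine MvPolynomial.funext fun x => ?_
  rw [eval_rename, eval_ofTen, eval_ofTen, formF, formF, form_swap]
  rfl

lemma ofTen_swap' (c : Ten) :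
    ofTen (fun i j k l => c j i k l) = rename ![1, 0, 2, 3] (ofTen c) := by
  refine MvPolynomial.funext fun x => ?_
  rw [eval_rename, eval_ofTen, eval_ofTen, formF, formF]
  simp only [form_eq]
  simp
  ring

lemma listedSystem_K (k : Fin 3) (δ ε α β γ : ℂ) : (listedSystem k δ ε α β γ).K =
    ofTen fun i j k' l => (faces k δ ε α β γ).c3 i j l k' := by
  rw [ofTen_swap]
  fin_cases k
  · simp only [faces, ofTen_face1]; rfl
  · simp only [faces, ofTen_face2]; rfl
  · simp only [faces, ofTen_face3]; rfl

lemma listedSystem_K' (k : Fin 3) (δ ε α β γ : ℂ) : (listedSystem k δ ε α β γ).K' =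
    ofTen fun i j k' l => (faces k δ ε α β γ).c3 j i k' l := by
  rw [ofTen_swap']
  fin_cases k
  · simp only [faces, ofTen_face1]; rfl
  · simp only [faces, ofTen_face2]; rfl
  · simp only [faces, ofTen_face3]; rfl

/-- The second part of the theorem. -/
theorem Admissible.listedSystem {k : Fin 3} {α β γ : ℂ} (h : Admissible k α β γ) (δ ε : ℂ) :
    (listedSystem k δ ε α β γ).toCubeSystem.HasTwoQFourH4 ∧
    (listedSystem k δ ε α β γ).toCubeSystem.IsConsistent ∧
    (listedSystem k δ ε α β γ).toCubeSystem.IsTetrahedronPair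
      (listedSystem k δ ε α β γ).K (listedSystem k δ ε α β γ).K' ∧
    listedSystem k δ ε α β γ = (firstCaseSystem k δ ε α β γ).flip := by
  refine ⟨?_, ?_, ?_, listedSystem_eq_flip k δ ε α β γ⟩
  · rw [listedSystem_eq]
    exact hasTwoQFourH4_of_isH4 (h.isH4 δ ε).1 (h.isH4 δ ε).1 (h.isH4 δ ε).2 (h.isH4 δ ε).2
      (h.typeQ δ ε).1 (h.typeQ δ ε).2
  · rw [listedSystem_eq]
    exact (h.std δ ε).hc.isConsistent
  · rw [listedSystem_eq, listedSystem_K, listedSystem_K']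
    exact (h.isTetraPair δ ε).isTetrahedronPair

/-! ### Uniqueness of the normal form -/

/-- The coefficients of the faces `c1` and `c2` of a listed system, as a loop around the face of
`b'`. -/
structure LoopOf (L : Loop) (c1 c2 b' : Ten) : Prop where
  m0 : ∀ y z, bil (L.m 0) y z = fm c1 y z
  m1 : ∀ y z, bil (L.m 1) y z = fm c2 y z
  m2 : ∀ y z, bil (L.m 2) y z = fm c1 y z
  m3 : ∀ y z, bil (L.m 3) y z = fm c2 y z
  m0' : ∀ y z, bil (L.m' 0) y z = fm c1 z y
  m1' : ∀ y z, bil (L.m' 1) y z = fm c2 z y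
  m2' : ∀ y z, bil (L.m' 2) y z = fm c1 z y
  m3' : ∀ y z, bil (L.m' 3) y z = fm c2 z y
  n0 : ∀ y z, bil (L.n 0) y z = form c1 e1 y e1 z
  n1 : ∀ y z, bil (L.n 1) y z = form c2 e1 y e1 z
  n2 : ∀ y z, bil (L.n 2) y z = form c1 e1 y e1 z
  n3 : ∀ y z, bil (L.n 3) y z = form c2 e1 y e1 z
  T : ∀ y0 y1 y2 y3, form L.T y0 y1 y2 y3 = form b' y0 y1 y3 y2

lemma loopOf_faces {c1 c2 : Ten} (b b' : Ten) (h1 : ∀ u v w z, form c1 u v w z = form c1 w z u v)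
    (h2 : ∀ u v w z, form c2 u v w z = form c2 w z u v) :
    LoopOf (Sys.loop ⟨c1, c1, b, b', c2, c2⟩) c1 c2 b' where
  m0 y z := by rw [Sys.loop_m₀, bil_eq_form₁₃]; rfl
  m1 y z := by rw [Sys.loop_m₁, bil_eq_form₁₃]; rfl
  m2 y z := by rw [Sys.loop_m₂, bil_eq_form₁₃]; exact h1 _ _ _ _
  m3 y z := by rw [Sys.loop_m₃, bil_eq_form₁₃]; exact h2 _ _ _ _
  m0' y z := by rw [Sys.loop_m'₀, bil_eq_form₁₃]; exact h1 _ _ _ _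
  m1' y z := by rw [Sys.loop_m'₁, bil_eq_form₁₃]; exact h2 _ _ _ _
  m2' y z := by rw [Sys.loop_m'₂, bil_eq_form₁₃]; rfl
  m3' y z := by rw [Sys.loop_m'₃, bil_eq_form₁₃]; rfl
  n0 y z := by rw [Sys.loop_n₀, bil_eq_form₁₃]; rfl
  n1 y z := by rw [Sys.loop_n₁, bil_eq_form₁₃]; rfl
  n2 y z := by rw [Sys.loop_n₂, bil_eq_form₁₃]; exact h1 _ _ _ _
  n3 y z := by rw [Sys.loop_n₃, bil_eq_form₁₃]; exact h2 _ _ _ _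
  T y0 y1 y2 y3 := form_swap _ _ _ _ _

/-- Translations of the variables `u i`. -/
lemma Std.exists_translate {s : Sys} (h : Std s) (τ : Fin 4 → ℂ) : ∃ t, SysRel s t ∧ Std t ∧
    (∀ i y z, bil (t.loop.m i) y z = bil (s.loop.m i) y z) ∧
    (∀ i y z, bil (t.loop.m' i) y z = bil (s.loop.m' i) y z) ∧
    (∀ i y z, bil (t.loop.n i) y z = bil (s.loop.n i) y z + τ i * bil (s.loop.m i) y z +
      τ (i + 1) * bil (s.loop.m' i) y z) ∧
    ∀ y0 y1 y2 y3, form t.loop.T y0 y1 y2 y3 = form s.loop.T y0 y1 y2 y3 := by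
  obtain ⟨t, h1, h2, h3, h4, h5, h6⟩ := h.exists_change (fun _ => 1) (σ := fun _ => 1)
    (c := fun _ => 1) (fun _ => one_ne_zero) (fun _ => one_ne_zero) τ
  simp only [one_mulVec_vec, one_mul] at h3 h4 h5 h6
  exact ⟨t, h1, h2, h3, h4, h5, h6⟩

/-- In the non-scalar case, all terms `n i` are determined by one of them, up to translations of
the variables `u i`. -/
lemma Std.sysRel_of_eq_two {s t : Sys} (hs : Std s) (ht : Std t) (hns : s.loop.NS)
    (hm : ∀ i y z, bil (s.loop.m i) y z = bil (t.loop.m i) y z)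
    (hm' : ∀ i y z, bil (s.loop.m' i) y z = bil (t.loop.m' i) y z) {κ : ℂ} (hκ : κ ≠ 0)
    (hT : ∀ y0 y1 y2 y3, form s.loop.T y0 y1 y2 y3 = κ * form t.loop.T y0 y1 y2 y3)
    {a b : ℂ} (hn : ∀ y z, bil (s.loop.n 2) y z = bil (t.loop.n 2) y z +
      a * bil (t.loop.m 2) y z + b * bil (t.loop.m' 2) y z) : SysRel s t := by
  obtain ⟨k, k', l, l', hk0, -, hl0, hl'0, hkl, hk, hl⟩ := hs.valid.exists_T_eq_of_ns hns
  have hl' : ∀ y0 y1 y2 y3, form t.loop.T y0 y1 y2 y3 =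
      l / κ * (bil (t.loop.m 1) y1 y2 * bil (t.loop.m 3) y3 y0) +
        l' / κ * (bil (t.loop.m' 0) y0 y1 * bil (t.loop.m' 2) y2 y3) := by
    intro y0 y1 y2 y3
    refine mul_left_cancel₀ hκ ?_
    rw [← hT, hl, hm, hm, hm', hm']
    field_simp
  -- after a translation of `u 2` and `u 3`, the terms `n 2` agree
  obtain ⟨s', r1, hs', m1, m1', n1, T1⟩ := hs.exists_translate ![0, 0, -a, -b]
  have hn2 (y z : Vec) : bil (s'.loop.n 2) y z = bil (t.loop.n 2) y z := by
    have := n1 2 y z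
    rw [hn, hm, hm'] at this
    rw [this]
    simp
    ring
  obtain ⟨r, hr⟩ := hs'.valid.exists_const_eq (l := l) (l' := l') (fun y0 y1 y2 y3 => by
    rw [T1, hl, m1, m1, m1', m1'])
  obtain ⟨r', hr'⟩ := ht.valid.exists_const_eq hl'
  obtain ⟨w1, w3, h3, h1, h0⟩ := hs.valid.exists_translation hns hk0 hl0 hl'0 hkl hk hl
    (d0 := s'.loop.n 0 - t.loop.n 0) (d1 := s'.loop.n 1 - t.loop.n 1)
    (d3 := s'.loop.n 3 - t.loop.n 3) (r := r - r') (fun y0 y1 y2 y3 => by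
      have e := hr y0 y1 y2 y3
      have e' := hr' y0 y1 y2 y3
      rw [T1] at e
      simp only [m1, m1', hn2] at e
      have hTt := hT y0 y1 y2 y3
      simp only [← hm, ← hm'] at e'
      have hsub (M N : Fin 2 → Fin 2 → ℂ) (u v : Vec) :
          bil (M - N) u v = bil M u v - bil N u v := by
        simp only [bil, Pi.sub_apply]; ring
      rw [hsub, hsub, hsub, hsub]
      generalize form s.loop.T y0 y1 y2 y3 = T at *
      generalize form t.loop.T y0 y1 y2 y3 = T' at *
      generalize bil (s.loop.m 2) y2 y3 = x1 at *
      generalize bil (s.loop.m' 2) y2 y3 = x2 at *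
      generalize bil (s.loop.m' 1) y1 y2 = x3 at *
      generalize bil (s.loop.m 3) y3 y0 = x4 at *
      generalize bil (t.loop.n 2) y2 y3 = x5 at *
      generalize bil (s'.loop.n 0) y0 y1 = z0 at *
      generalize bil (s'.loop.n 1) y1 y2 = z1 at *
      generalize bil (s'.loop.n 3) y3 y0 = z3 at *
      generalize bil (t.loop.n 0) y0 y1 = z0' at *
      generalize bil (t.loop.n 1) y1 y2 = z1' at *
      generalize bil (t.loop.n 3) y3 y0 = z3' at *
      field_simp at e'
      linear_combination e - e' + bil r' y2 y3 * hTt)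
  have hsub {M N P : Fin 2 → Fin 2 → ℂ} {w : ℂ} (h : M - N = w • P) (u v : Vec) :
      bil M u v = bil N u v + w * bil P u v := by
    rw [← bil_smul, ← h]
    simp only [bil, Pi.sub_apply]; ring
  obtain ⟨s2, r2, hs2, m2, m2', n2, T2⟩ := hs'.exists_translate ![-w3, -w1, 0, 0]
  refine r1.trans (r2.trans (hs2.sysRel_of_loop ht (fun i y z => by rw [m2, m1, hm])
    (fun i y z => by rw [m2', m1', hm']) ?_ hκ fun y0 y1 y2 y3 => by rw [T2, T1, hT]))
  refine forall_fin_four ?_ ?_ ?_ ?_ <;> intro y z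
  · have := h0 y z
    have e : bil (s'.loop.n 0 - t.loop.n 0) y z = bil (s'.loop.n 0) y z - bil (t.loop.n 0) y z := by
      simp only [bil, Pi.sub_apply]; ring
    rw [e] at this
    rw [n2, m1, m1']
    simp
    linear_combination this
  · rw [n2, m1, m1', hsub h1]
    simp
  · rw [n2, hn2]
    simp
  · rw [n2, m1, m1', hsub h3]
    simp

/-! ### Normal forms of the coefficients -/

/-- Möbius transformations of the variables `y i`. -/
lemma Std.exists_gauge {s : Sys} (h : Std s) (g : Fin 4 → GL (Fin 2) ℂ) :
    ∃ t, SysRel s t ∧ Std t ∧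
    (∀ i y z, bil (t.loop.m i) y z =
      bil (s.loop.m i) ((g i).1.mulVec y) ((g (i + 1)).1.mulVec z)) ∧
    (∀ i y z, bil (t.loop.m' i) y z =
      bil (s.loop.m' i) ((g i).1.mulVec y) ((g (i + 1)).1.mulVec z)) ∧
    (∀ i y z, bil (t.loop.n i) y z =
      bil (s.loop.n i) ((g i).1.mulVec y) ((g (i + 1)).1.mulVec z)) ∧
    ∀ y0 y1 y2 y3, form t.loop.T y0 y1 y2 y3 = form s.loop.T ((g 0).1.mulVec y0)
      ((g 1).1.mulVec y1) ((g 2).1.mulVec y2) ((g 3).1.mulVec y3) := by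
  obtain ⟨t, h1, h2, h3, h4, h5, h6⟩ := h.exists_change g (σ := fun _ => 1)
    (c := fun _ => 1) (fun _ => one_ne_zero) (fun _ => one_ne_zero) (fun _ => 0)
  simp only [one_mul, zero_mul, add_zero] at h3 h4 h5
  exact ⟨t, h1, h2, h3, h4, h5, h6⟩

/-- Three of the forms `m i` can be transformed into the determinant. -/
lemma Std.exists_om {s : Sys} (h : Std s) : ∃ t, SysRel s t ∧ Std t ∧
    (∀ y z, bil (t.loop.m 0) y z = om y z) ∧ (∀ y z, bil (t.loop.m 1) y z = om y z) ∧
    ∀ y z, bil (t.loop.m 3) y z = om y z := by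
  obtain ⟨g0, h0⟩ := exists_gl_left (h.det_loop 0).1
  obtain ⟨g2, h2⟩ := exists_gl_right (h.det_loop 1).1
  obtain ⟨g3, h3⟩ := exists_gl_left (det2_actM (h.det_loop 3).1 1 g0)
  obtain ⟨t, r, ht, hm, -⟩ := h.exists_gauge ![g0, 1, g2, g3]
  refine ⟨t, r, ht, fun y z => ?_, fun y z => ?_, fun y z => ?_⟩
  · rw [hm, ← h0]
    simp
  · rw [hm, ← h2]
    simp
  · rw [hm, ← h3, bil_actM, one_mulVec_vec]
    rfl

lemma om_gl {g : GL (Fin 2) ℂ} {p p' : Vec} (hg : ∀ u : Vec, g.1.mulVec u = u 0 • p + u 1 • p')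
    (u v : Vec) : om (g.1.mulVec u) (g.1.mulVec v) = om p p' * om u v := by
  rw [hg, hg]
  simp only [om, Pi.add_apply, Pi.smul_apply, smul_eq_mul]
  ring

/-- A common change of basis, of determinant one, in all variables `y i`. -/
lemma Std.exists_basis {s : Sys} (h : Std s) (h0 : ∀ y z, bil (s.loop.m 0) y z = om y z)
    (h1 : ∀ y z, bil (s.loop.m 1) y z = om y z) (h3 : ∀ y z, bil (s.loop.m 3) y z = om y z)
    {p p' : Vec} (hp : om p p' = 1) : ∃ t, SysRel s t ∧ Std t ∧
      (∀ y z, bil (t.loop.m 0) y z = om y z) ∧ (∀ y z, bil (t.loop.m 1) y z = om y z) ∧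
      (∀ y z, bil (t.loop.m 3) y z = om y z) ∧
      (∀ i y z, bil (t.loop.m i) y z =
        bil (s.loop.m i) (y 0 • p + y 1 • p') (z 0 • p + z 1 • p')) ∧
      (∀ i y z, bil (t.loop.m' i) y z =
        bil (s.loop.m' i) (y 0 • p + y 1 • p') (z 0 • p + z 1 • p')) ∧
      (∀ i y z, bil (t.loop.n i) y z =
        bil (s.loop.n i) (y 0 • p + y 1 • p') (z 0 • p + z 1 • p')) ∧
      ∀ y0 y1 y2 y3, form t.loop.T y0 y1 y2 y3 = form s.loop.T (y0 0 • p + y0 1 • p')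
        (y1 0 • p + y1 1 • p') (y2 0 • p + y2 1 • p') (y3 0 • p + y3 1 • p') := by
  obtain ⟨g, hg⟩ := exists_gl_mulVec (p := p) (p' := p') (by
    rw [show p 0 * p' 1 - p 1 * p' 0 = 1 from hp]; exact one_ne_zero)
  obtain ⟨t, r, ht, hm, hm', hn, hT⟩ := h.exists_gauge fun _ => g
  have ho := om_gl hg
  simp only [hp, one_mul] at ho
  refine ⟨t, r, ht, fun y z => by rw [hm, h0, ho], fun y z => by rw [hm, h1, ho],
    fun y z => by rw [hm, h3, ho], ?_, ?_, ?_, ?_⟩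
  · intro i y z; rw [hm, hg, hg]
  · intro i y z; rw [hm', hg, hg]
  · intro i y z; rw [hn, hg, hg]
  · intro y0 y1 y2 y3; rw [hT, hg, hg, hg, hg]

lemma eq_smul_om_of_diag {M N : Fin 2 → Fin 2 → ℂ} (hM : ∀ y z, bil M y z = om y z)
    (h : ∀ y, bil N y y = 0) : ∃ t : ℂ, N = t • M := by
  refine ⟨N 0 1, eq_smul_of_bil fun u v => ?_⟩
  have h00 := h e0
  have h11 := h e1
  have h01 := h ![1, 1]
  simp [bil] at h00 h11 h01
  rw [hM]
  simp only [bil, om, h00, h11]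
  rw [h00, h11] at h01
  linear_combination u 1 * v 0 * h01

/-- In the non-scalar case, the forms `m' i` on the diagonal are proportional to one another, and
they vanish at the zeros of the diagonal of `m 2`. -/
lemma Std.diag {s : Sys} (h : Std s) (hns : s.loop.NS) (h0 : ∀ y z, bil (s.loop.m 0) y z = om y z)
    (h1 : ∀ y z, bil (s.loop.m 1) y z = om y z) (h3 : ∀ y z, bil (s.loop.m 3) y z = om y z) :
    (∃ y, bil (s.loop.m' 0) y y ≠ 0) ∧
    (∃ a : ℂ, ∀ y, bil (s.loop.m' 1) y y = a * bil (s.loop.m' 0) y y) ∧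
    (∃ a : ℂ, s.loop.m' 1 = a • s.loop.m' 3) ∧ (∃ a : ℂ, s.loop.m' 2 = a • tr (s.loop.m' 3)) ∧
    ∀ p, bil (s.loop.m' 0) p p = 0 → bil (s.loop.m' 1) p p = 0 ∧ bil (s.loop.m' 3) p p = 0 ∧
      bil (s.loop.m 2) p p = 0 ∧ bil (s.loop.m' 2) p p = 0 := by
  have hne {i : Fin 4} (hi : ∀ y z, bil (s.loop.m i) y z = om y z) :
      ∃ y, bil (s.loop.m' i) y y ≠ 0 := by
    by_contra! hd
    obtain ⟨a, ha⟩ := eq_smul_om_of_diag hi hd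
    exact hns i a ha
  obtain ⟨k, k', l, l', hk0, hk'0, hl0, hl'0, -, hk, hl⟩ := h.valid.exists_T_eq_of_ns hns
  have det (i : Fin 4) := (h.det_loop i).2
  have om_self (y : Vec) : om y y = 0 := by simp only [om]; ring
  have d1 (y z : Vec) : k * (bil (s.loop.m' 1) y y * bil (s.loop.m' 3) z y) =
      l' * (bil (s.loop.m' 0) y y * bil (s.loop.m' 2) y z) := by
    have := (hk y y y z).symm.trans (hl y y y z)
    rw [h0, h1, om_self] at this
    linear_combination this
  have d2 (y z : Vec) :
      k * (bil (s.loop.m' 1) y z * bil (s.loop.m' 3) y y) =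
      l' * (bil (s.loop.m' 0) y y * bil (s.loop.m' 2) z y) := by
    have := (hk y y z y).symm.trans (hl y y z y)
    rw [h0, h3, om_self] at this
    linear_combination this
  obtain ⟨t, ht⟩ : ∃ t : ℂ, s.loop.m' 2 = t • tr (s.loop.m' 3) := by
    refine eq_smul_of_vanish (by rw [det2_tr]; exact det 3) fun u => ?_
    refine eq_zero_of_mul_of_ne (f := fun u => bil (s.loop.m' 0) u u) (by fun_prop)
      (g := fun u => bil (s.loop.m' 2) u (rt (tr (s.loop.m' 3)) u)) (by fun_prop) (hne h0)
      (fun u => ?_) u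
    have := d1 u (rt (tr (s.loop.m' 3)) u)
    rw [bil_rt_left, mul_zero, mul_zero] at this
    exact (mul_eq_zero.1 this.symm).resolve_left hl'0
  have hS (y z : Vec) : bil (s.loop.m' 2) y z = t * bil (s.loop.m' 3) z y := by
    rw [ht, bil_smul, bil_tr]
  obtain ⟨q, hq⟩ : ∃ q : ℂ, s.loop.m' 1 = q • s.loop.m' 3 := by
    refine eq_smul_of_vanish (det 3) fun u => ?_
    refine eq_zero_of_mul_of_ne (f := fun u => bil (s.loop.m' 3) u u) (by fun_prop)
      (g := fun u => bil (s.loop.m' 1) u (rt (s.loop.m' 3) u)) (by fun_prop) (hne h3)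
      (fun u => ?_) u
    have := d2 u (rt (s.loop.m' 3) u)
    rw [hS, bil_rt] at this
    have h' : k * (bil (s.loop.m' 3) u u * bil (s.loop.m' 1) u (rt (s.loop.m' 3) u)) = 0 := by
      linear_combination this
    exact (mul_eq_zero.1 h').resolve_left hk0
  have hQ (y : Vec) : bil (s.loop.m' 1) y y = l' * t / k * bil (s.loop.m' 0) y y := by
    by_cases hy : y = 0
    · simp [hy, bil]
    obtain ⟨z, hz⟩ := bil_ne_left (det 3) hy
    have := d1 y z
    rw [hS] at this
    have h' : k * bil (s.loop.m' 1) y y = l' * t * bil (s.loop.m' 0) y y :=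
      mul_right_cancel₀ hz (by linear_combination this)
    field_simp
    linear_combination h'
  have hq0 : q ≠ 0 := by
    rintro rfl
    exact det 1 (by rw [hq]; simp [det2])
  refine ⟨hne h0, ⟨_, hQ⟩, ⟨q, hq⟩, ⟨t, ht⟩, fun p hp => ?_⟩
  have p1 : bil (s.loop.m' 1) p p = 0 := by rw [hQ, hp, mul_zero]
  have p3 : bil (s.loop.m' 3) p p = 0 := by
    rw [hq, bil_smul] at p1
    exact (mul_eq_zero.1 p1).resolve_left hq0
  have p2 : bil (s.loop.m' 2) p p = 0 := by rw [hS, p3, mul_zero]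
  refine ⟨p1, p3, ?_, p2⟩
  by_cases hp0 : p = 0
  · simp [hp0, bil]
  obtain ⟨y, hy⟩ := exists_om_ne hp0
  have := (hk p y p p).symm.trans (hl p y p p)
  rw [h0, h3, om_self, p3, p2] at this
  have h' : k' * om p y * bil (s.loop.m 2) p p = 0 := by linear_combination this
  exact (mul_eq_zero.1 h').resolve_left (mul_ne_zero hk'0 hy)

/-- If the forms `m i`, `m' i` are those of a listed system, then so is the face `B'`. -/
lemma Std.exists_smul_T {s t : Sys} {c1 c2 b' : Ten} (hs : Std s) (hns : s.loop.NS)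
    (ht : LoopOf t.loop c1 c2 b') (hm : ∀ i y z, bil (s.loop.m i) y z = bil (t.loop.m i) y z)
    (hm' : ∀ i y z, bil (s.loop.m' i) y z = bil (t.loop.m' i) y z) {i j : ℂ} (hi : i ≠ 0)
    (hb : ∀ y0 y1 y2 y3 : Vec, form b' y0 y1 y3 y2 =
      i * (fm c2 y2 y1 * fm c2 y0 y3) + j * (fm c1 y0 y1 * fm c1 y2 y3))
    (hk : ∀ k k' l l' : ℂ, (∀ y0 y1 y2 y3 : Vec,
      k * (fm c2 y2 y1 * fm c2 y0 y3) + k' * (fm c1 y0 y1 * fm c1 y2 y3) =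
      l * (fm c2 y1 y2 * fm c2 y3 y0) + l' * (fm c1 y1 y0 * fm c1 y3 y2)) → k * j = k' * i) :
    ∃ κ : ℂ, κ ≠ 0 ∧ ∀ y0 y1 y2 y3, form s.loop.T y0 y1 y2 y3 = κ * form t.loop.T y0 y1 y2 y3 := by
  obtain ⟨k, k', l, l', hk0, -, -, -, -, h1, h2⟩ := hs.valid.exists_T_eq_of_ns hns
  simp only [hm, hm', ht.m0, ht.m1, ht.m2, ht.m3, ht.m0', ht.m1', ht.m2', ht.m3'] at h1 h2
  have hkj := hk k k' l l' fun y0 y1 y2 y3 => (h1 y0 y1 y2 y3).symm.trans (h2 y0 y1 y2 y3)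
  refine ⟨k / i, div_ne_zero hk0 hi, fun y0 y1 y2 y3 => ?_⟩
  rw [h1, ht.T, hb]
  field_simp
  linear_combination -(fm c1 y0 y1 * fm c1 y2 y3) * hkj

lemma bil_diagonal {M : Fin 2 → Fin 2 → ℂ} (h0 : bil M e0 e0 = 0) (h1 : bil M e1 e1 = 0)
    (y z : Vec) : bil M y z = M 0 1 * (y 0 * z 1) + M 1 0 * (y 1 * z 0) := by
  simp [bil] at h0 h1
  simp [bil, h0, h1]

lemma exists_gl_diagonal {a : ℂ} (ha : a ≠ 0) :
    ∃ g : GL (Fin 2) ℂ, ∀ u : Vec, g.1.mulVec u = ![a * u 0, u 1] := by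
  obtain ⟨g, hg⟩ := exists_gl_affine ha 0
  exact ⟨g, fun u => by rw [hg, zero_mul, add_zero]⟩

/-- The relations between the coefficients of the forms `m i` and `m' i` if all of them vanish at
`(0, 0)` and `(∞, ∞)`. -/
lemma relations_of_antidiagonal {k k' l l' p p' q q' w w' s s' n n' : ℂ}
    (hk : k ≠ 0) (hk' : k' ≠ 0) (hl' : l' ≠ 0)
    (hp' : p' ≠ 0) (hq' : q' ≠ 0) (hw' : w' ≠ 0) (hpp : p + p' ≠ 0)
    (hqq : q + q' ≠ 0) (hkl : k * l' = k' * l)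
    (e1 : k * (q * s') = -l) (e2 : k * (q' * s) = -l) (e3 : k' * n' = l' * (p * w'))
    (e4 : -(k' * n) = l' * (p' * w)) (e5 : k * (q' * s') + k' * n = l + l' * (p * w))
    (e6 : k * (q * s) - k' * n' = l + l' * (p' * w')) {u v : ℂ} (hu : u ^ 2 = -p / p')
    (hv : v ^ 2 = -q / q') :
    p = -(u ^ 2 * p') ∧ q = -(v ^ 2 * q') ∧ s = -(v ^ 2 * s') ∧ w' = -(v ^ 2 * w) ∧
      n' = -(u ^ 2 * v ^ 2 * n) ∧ n = p' * q' * w' * s' := by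
  have rp : p = -(u ^ 2 * p') := by rw [hu]; field_simp
  have rq : q = -(v ^ 2 * q') := by rw [hv]; field_simp
  generalize u ^ 2 = U at *
  generalize v ^ 2 = V at *
  subst rp rq
  have rs : s = -(V * s') := by
    refine mul_left_cancel₀ (mul_ne_zero hk hq') ?_
    linear_combination e2 - e1
  subst rs
  have rl : l = k * V * q' * s' := by linear_combination e2
  subst rl
  have hU : 1 - U ≠ 0 := by
    intro h; apply hpp; linear_combination p' * h
  have r5 : k * q' * s' * (1 - V) = l' * w * p' * (1 - U) := by linear_combination e5 + e4
  have r6 : k * V * q' * s' * (V - 1) = l' * w' * p' * (1 - U) := by linear_combination e6 + e3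
  have rw' : w' = -(V * w) := by
    refine mul_left_cancel₀ (mul_ne_zero (mul_ne_zero hl' hp') hU) ?_
    linear_combination -r6 - V * r5
  have rl' : l' = k' * V * q' * s' := by
    refine mul_left_cancel₀ hk ?_
    linear_combination hkl
  refine ⟨rfl, rfl, rfl, rw', ?_, ?_⟩
  · refine mul_left_cancel₀ hk' ?_
    subst rw'
    linear_combination e3 - U * V * e4
  · refine mul_left_cancel₀ hk' ?_
    subst rw'
    subst rl'
    linear_combination -e4

/-! ### Reduction to the third system -/

lemma Std.ns_of_diag {s : Sys} (h : Std s) (h0 : ∀ y z, bil (s.loop.m 0) y z = om y z)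
    {y : Vec} (hy : bil (s.loop.m' 0) y y ≠ 0) : s.loop.NS := by
  refine h.valid.ns 0 fun a ha => hy ?_
  rw [ha, bil_smul, h0, om]
  ring

lemma exists_sq_eq (a : ℂ) : ∃ u : ℂ, u ^ 2 = a :=
  IsAlgClosed.exists_pow_nat_eq _ two_pos

lemma fm_face3 (δ η α β : ℂ) (y z : Vec) :
    fm (face3 δ η α β) y z = α * (y 0 * z 1) - β * (y 1 * z 0) := by
  rw [face3, fm_faceT]
  ring

/-- The comparison of two expressions of `T` by products of coefficients. -/
lemma coeff_relation3 {δ η δ' η' u v k k' l l' : ℂ} (hu : u ≠ 0) (hv : v ≠ 0)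
    (h : ∀ y0 y1 y2 y3 : Vec,
      k * (fm (face3 δ' η' 1 v) y2 y1 * fm (face3 δ' η' 1 v) y0 y3) +
        k' * (fm (face3 δ η 1 u) y0 y1 * fm (face3 δ η 1 u) y2 y3) =
      l * (fm (face3 δ' η' 1 v) y1 y2 * fm (face3 δ' η' 1 v) y3 y0) +
        l' * (fm (face3 δ η 1 u) y1 y0 * fm (face3 δ η 1 u) y3 y2)) :
    k * (1 - v ^ 2) = -(k' * (1 - u ^ 2)) := by
  simp only [fm_face3] at h
  have h1 := h e0 e0 e1 e1
  have h2 := h e0 e1 e1 e0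
  have h3 := h e0 e1 e0 e1
  simp only [e0_zero, e0_one, e1_zero, e1_one] at h1 h2 h3
  have hl : l = k := mul_left_cancel₀ hv (by linear_combination h1)
  have hl' : l' = k' := mul_left_cancel₀ hu (by linear_combination h2)
  subst hl hl'
  linear_combination h3

/-- If the forms `m i` and `m' i` are those of the third system, the system is equivalent to the
third system. -/
lemma Std.exists_sysRel_three {s : Sys} (h : Std s) {u v : ℂ} (hu : u ≠ 0)
    (hv : v ≠ 0) (hu1 : 1 ≠ u ^ 2) (hv1 : 1 ≠ v ^ 2)
    (m0 : ∀ y z, bil (s.loop.m 0) y z = y 0 * z 1 - u * (y 1 * z 0))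
    (m1 : ∀ y z, bil (s.loop.m 1) y z = y 0 * z 1 - v * (y 1 * z 0))
    (m2 : ∀ y z, bil (s.loop.m 2) y z = y 0 * z 1 - u * (y 1 * z 0))
    (m3 : ∀ y z, bil (s.loop.m 3) y z = y 0 * z 1 - v * (y 1 * z 0))
    (m0' : ∀ y z, bil (s.loop.m' 0) y z = z 0 * y 1 - u * (z 1 * y 0))
    (m1' : ∀ y z, bil (s.loop.m' 1) y z = z 0 * y 1 - v * (z 1 * y 0))
    (m2' : ∀ y z, bil (s.loop.m' 2) y z = z 0 * y 1 - u * (z 1 * y 0))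
    (m3' : ∀ y z, bil (s.loop.m' 3) y z = z 0 * y 1 - v * (z 1 * y 0)) :
    ∃ k δ ε α β γ, Admissible k α β γ ∧ SysRel s (faces k δ ε α β γ).sys := by
  have hu' := sub_ne_zero.2 hu1
  have hns : s.loop.NS := h.valid.ns 0 fun a ha => hu1 (by
    have e01 := m0' e0 e1
    have e10 := m0' e1 e0
    rw [ha, bil_smul, m0] at e01 e10
    simp at e01 e10
    linear_combination -e10 - u * e01)
  have huv : u ^ 2 ≠ v ^ 2 := by
    intro huv
    obtain ⟨k, k', l, l', hk0, -, -, -, -, hk, hl⟩ := h.valid.exists_T_eq_of_ns hns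
    simp only [m0, m1, m2, m3, m0', m1', m2', m3'] at hk hl
    have := coeff_relation3 (δ := 0) (η := 0) (δ' := 0) (η' := 0) (k := k) (k' := k') (l := l)
      (l' := l') hu hv
      fun y0 y1 y2 y3 => by
        simp only [fm_face3]
        linear_combination (hk y0 y1 y2 y3).symm.trans (hl y0 y1 y2 y3)
    rw [← huv] at this
    have hkk : k = -k' := mul_right_cancel₀ hu' (by linear_combination this)
    obtain ⟨y1, y3, hy⟩ := h.valid.nv.n02 e0 e0 e0_ne_zero e0_ne_zero
    apply hy
    rw [hk, hkk]
    simp only [e0_zero, e0_one]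
    ring
  set n := s.loop.n 2 with hn
  set δ := n 1 1 / (1 - u ^ 2) with hδ
  set ε := u * n 0 0 / (1 - u ^ 2) with hε
  have had : Admissible 2 1 u v :=
    ⟨one_ne_zero, hu, hv, by simpa using hu1, huv, by simpa using hv1⟩
  have ht := had.std δ ε
  have hL : LoopOf (faces 2 δ ε 1 u v).sys.loop (face3 δ (ε / (1 * u)) 1 u)
      (face3 δ (ε / (1 * v)) 1 v) (quad3 δ 1 u v 0) :=
    loopOf_faces _ _ (form_faceT_symm _ _ _ _ _ _) (form_faceT_symm _ _ _ _ _ _)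
  have hm : ∀ i y z, bil (s.loop.m i) y z = bil ((faces 2 δ ε 1 u v).sys.loop.m i) y z := by
    refine forall_fin_four ?_ ?_ ?_ ?_ <;> intro y z
    · rw [m0, hL.m0, fm_face3]; ring
    · rw [m1, hL.m1, fm_face3]; ring
    · rw [m2, hL.m2, fm_face3]; ring
    · rw [m3, hL.m3, fm_face3]; ring
  have hm' : ∀ i y z, bil (s.loop.m' i) y z = bil ((faces 2 δ ε 1 u v).sys.loop.m' i) y z := by
    refine forall_fin_four ?_ ?_ ?_ ?_ <;> intro y z
    · rw [m0', hL.m0', fm_face3]; ring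
    · rw [m1', hL.m1', fm_face3]; ring
    · rw [m2', hL.m2', fm_face3]; ring
    · rw [m3', hL.m3', fm_face3]; ring
  obtain ⟨κ, hκ, hT⟩ := h.exists_smul_T (t := (faces 2 δ ε 1 u v).sys) hns hL hm hm'
    (i := -(1 - u ^ 2)) (j := 1 - v ^ 2) (neg_ne_zero.2 hu') (fun y0 y1 y2 y3 => by
      rw [quad3, form_kleinT]
      simp only [fm_face3]
      ring) (fun k k' l l' hk => by
        rw [coeff_relation3 hu hv hk]
        ring)
  refine ⟨2, δ, ε, 1, u, v, had, h.sysRel_of_eq_two ht hns hm hm' hκ hT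
    (a := (n 0 1 + u * n 1 0) / (1 - u ^ 2)) (b := (n 1 0 + u * n 0 1) / (1 - u ^ 2))
    fun y z => ?_⟩
  rw [← hm, ← hm', m2, m2', hL.n2, face3, form_faceT, bil, ← hn]
  simp only [e1_zero, e1_one]
  rw [hδ, hε]
  field_simp
  ring

/-- The non-scalar case if the diagonal of `m' 0` has two zeros. -/
lemma Std.exists_sysRel_of_two_zeros {s : Sys} (h : Std s) (hns : s.loop.NS)
    (h0 : ∀ y z, bil (s.loop.m 0) y z = om y z) (h1 : ∀ y z, bil (s.loop.m 1) y z = om y z)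
    (h3 : ∀ y z, bil (s.loop.m 3) y z = om y z) (z0 : bil (s.loop.m' 0) e0 e0 = 0)
    (z1 : bil (s.loop.m' 0) e1 e1 = 0) :
    ∃ k δ ε α β γ, Admissible k α β γ ∧ SysRel s (faces k δ ε α β γ).sys := by
  obtain ⟨-, -, -, -, hd⟩ := h.diag hns h0 h1 h3
  obtain ⟨a1, a3, a2, a2'⟩ := hd e0 z0
  obtain ⟨b1, b3, b2, b2'⟩ := hd e1 z1
  obtain ⟨k, k', l, l', hk0, hk'0, hl0, hl'0, hkl, hk, hl⟩ := h.valid.exists_T_eq_of_ns hns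
  have hP := bil_diagonal z0 z1
  have hQ := bil_diagonal a1 b1
  have hR := bil_diagonal a3 b3
  have hN := bil_diagonal a2 b2
  have hS := bil_diagonal a2' b2'
  have det (i : Fin 4) (ha : bil (s.loop.m' i) e0 e0 = 0) :
      s.loop.m' i 0 1 ≠ 0 ∧ s.loop.m' i 1 0 ≠ 0 := by
    have hdet := (h.det_loop i).2
    simp [bil] at ha
    rw [det2, ha] at hdet
    constructor <;> intro h' <;> rw [h'] at hdet <;> simp at hdet
  have hpp : s.loop.m' 0 0 1 + s.loop.m' 0 1 0 ≠ 0 := fun h' =>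
    hns 0 (s.loop.m' 0 0 1) (eq_smul_of_bil fun y z => by
      rw [hP, h0, om]; linear_combination (y 1 * z 0) * h')
  have hqq : s.loop.m' 1 0 1 + s.loop.m' 1 1 0 ≠ 0 := fun h' =>
    hns 1 (s.loop.m' 1 0 1) (eq_smul_of_bil fun y z => by
      rw [hQ, h1, om]; linear_combination (y 1 * z 0) * h')
  obtain ⟨hp, hp'⟩ := det 0 z0
  obtain ⟨hq, hq'⟩ := det 1 a1
  obtain ⟨hw, hw'⟩ := det 2 a2'
  obtain ⟨hs, hs'⟩ := det 3 a3
  have hTT (y0 y1 y2 y3 : Vec) := (hk y0 y1 y2 y3).symm.trans (hl y0 y1 y2 y3)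
  simp only [h0, h1, h3, hP, hQ, hR, hN, hS, om] at hTT
  generalize s.loop.m' 0 0 1 = p at *
  generalize s.loop.m' 0 1 0 = p' at *
  generalize s.loop.m' 1 0 1 = q at *
  generalize s.loop.m' 1 1 0 = q' at *
  generalize s.loop.m' 2 0 1 = w at *
  generalize s.loop.m' 2 1 0 = w' at *
  generalize s.loop.m' 3 0 1 = r at *
  generalize s.loop.m' 3 1 0 = r' at *
  generalize s.loop.m 2 0 1 = n at *
  generalize s.loop.m 2 1 0 = n' at *
  obtain ⟨u, hu⟩ := exists_sq_eq (-p / p')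
  obtain ⟨v, hv⟩ := exists_sq_eq (-q / q')
  obtain ⟨rp, rq, rs, rw', rn', rn⟩ := relations_of_antidiagonal (k := k) (k' := k') (l := l)
    (l' := l') (s := r) (s' := r') (n := n) (n' := n') (w := w) (w' := w') hk0 hk'0 hl'0 hp' hq'
    hw' hpp hqq hkl
    (by simpa using hTT e0 e0 e1 e1) (by simpa using hTT e1 e1 e0 e0)
    (by simpa using hTT e0 e1 e1 e0) (by simpa using hTT e1 e0 e0 e1)
    (by simpa using hTT e0 e1 e0 e1) (by simpa [sub_eq_add_neg] using hTT e1 e0 e1 e0) hu hv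
  have hu0 : u ≠ 0 := by rintro rfl; simp [rp] at hp
  have hv0 : v ≠ 0 := by rintro rfl; simp [rq] at hq
  have hn0 : n ≠ 0 := by
    rw [rn]
    exact mul_ne_zero (mul_ne_zero (mul_ne_zero hp' hq') hw') hs'
  obtain ⟨g1, hg1⟩ := exists_gl_diagonal hu0
  obtain ⟨g2, hg2⟩ := exists_gl_diagonal (mul_ne_zero hu0 hv0)
  obtain ⟨g3, hg3⟩ := exists_gl_diagonal (inv_ne_zero hv0)
  obtain ⟨t, hr, ht, tm, tm', -⟩ := h.exists_change ![1, g1, g2, g3]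
    (σ := ![1, 1 / (u * p'), 1 / (p' * u * v * q'), n * v / (p' * q' * w')])
    (c := ![1, p', p' * q' / n, p' * q' * w' / n])
    (forall_fin_four one_ne_zero (by simp [hu0, hp']) (by simp [hu0, hv0, hp', hq'])
      (by simp [hn0, hv0, hp', hq', hw']))
    (forall_fin_four one_ne_zero (by simp [hp']) (by simp [hp', hq', hn0])
      (by simp [hp', hq', hw', hn0])) 0
  have h1u : 1 ≠ u ^ 2 := fun h' => hpp (by rw [rp, ← h']; ring)
  have h1v : 1 ≠ v ^ 2 := fun h' => hqq (by rw [rq, ← h']; ring)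
  obtain ⟨k, δ, ε, α, β, γ, had, hrel⟩ := ht.exists_sysRel_three hu0 hv0 h1u h1v
    (fun y z => by
      rw [tm, h0, om]
      simp [hg1]
      ring)
    (fun y z => by
      rw [tm, h1, om]
      simp [hg1, hg2]
      field_simp)
    (fun y z => by
      rw [tm, hN, rn']
      simp [hg2, hg3]
      field_simp
      ring)
    (fun y z => by
      rw [tm, h3, om]
      simp [hg3]
      field_simp)
    (fun y z => by
      rw [tm', hP, rp]
      simp [hg1]
      field_simp
      ring)
    (fun y z => by
      rw [tm', hQ, rq]
      simp [hg1, hg2]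
      field_simp
      ring)
    (fun y z => by
      rw [tm', hS, rw']
      simp [hg2, hg3]
      field_simp
      ring)
    (fun y z => by
      rw [tm', hR, rs, rn]
      simp [hg3]
      field_simp
      ring)
  exact ⟨k, δ, ε, α, β, γ, had, hr.trans hrel⟩

/-! ### Reduction to the second system -/

lemma fm_face2 (ε α β : ℂ) (y z : Vec) :
    fm (face2 ε α β) y z = om y z - (α - β) * (y 1 * z 1) := by
  rw [face2, fm_faceT, om]
  ring

/-- The forms `m i` and `m' i` of the second system, with `a = α - β` and `b = α - γ`. -/
structure Loop.Translated (L : Loop) (a b : ℂ) : Prop where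
  m0 : ∀ y z, bil (L.m 0) y z = om y z - a * (y 1 * z 1)
  m1 : ∀ y z, bil (L.m 1) y z = om y z - b * (y 1 * z 1)
  m2 : ∀ y z, bil (L.m 2) y z = om y z - a * (y 1 * z 1)
  m3 : ∀ y z, bil (L.m 3) y z = om y z - b * (y 1 * z 1)
  m0' : ∀ y z, bil (L.m' 0) y z = om z y - a * (z 1 * y 1)
  m1' : ∀ y z, bil (L.m' 1) y z = om z y - b * (z 1 * y 1)
  m2' : ∀ y z, bil (L.m' 2) y z = om z y - a * (z 1 * y 1)
  m3' : ∀ y z, bil (L.m' 3) y z = om z y - b * (z 1 * y 1)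

/-- The comparison of two expressions of `T` by products of coefficients. -/
lemma coeff_relation2 {a b k k' l l' : ℂ} (h : ∀ y0 y1 y2 y3 : Vec,
      k * ((om y2 y1 - b * (y2 1 * y1 1)) * (om y0 y3 - b * (y0 1 * y3 1))) +
        k' * ((om y0 y1 - a * (y0 1 * y1 1)) * (om y2 y3 - a * (y2 1 * y3 1))) =
      l * ((om y1 y2 - b * (y1 1 * y2 1)) * (om y3 y0 - b * (y3 1 * y0 1))) +
        l' * ((om y1 y0 - a * (y1 1 * y0 1)) * (om y3 y2 - a * (y3 1 * y2 1)))) :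
    k * b = -(k' * a) := by
  have h1 := h e0 e0 e1 e1
  have h2 := h e0 e1 e1 e0
  have h3 := h e1 e1 e1 e0
  simp only [om, e0_zero, e0_one, e1_zero, e1_one] at h1 h2 h3
  have hl : l = k := by linear_combination h1
  have hl' : l' = k' := by linear_combination h2
  subst hl hl'
  linear_combination h3 / 2

section

variable {s : Sys} {a b : ℂ}

lemma Loop.Translated.ns (hL : s.loop.Translated a b) (h : Std s) (ha : a ≠ 0) : s.loop.NS :=
  h.valid.ns 0 fun t ht => ha (by
    have e11 := hL.m0' e1 e1
    have e01 := hL.m0' e0 e1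
    rw [ht, bil_smul, hL.m0] at e11 e01
    simp [om] at e11 e01
    rw [e01] at e11
    linear_combination -e11 / 2)

/-- For `a = b` the form `T` would be degenerate. -/
lemma Loop.Translated.ne (hL : s.loop.Translated a b) (h : Std s) (ha : a ≠ 0) : a ≠ b := by
  rintro rfl
  obtain ⟨k, k', l, l', -, -, -, -, -, hk, hl⟩ := h.valid.exists_T_eq_of_ns (hL.ns h ha)
  simp only [hL.m0, hL.m1, hL.m2, hL.m3, hL.m0', hL.m1', hL.m2', hL.m3'] at hk hl
  have hkk : k = -k' := mul_right_cancel₀ ha (by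
    linear_combination coeff_relation2 fun y0 y1 y2 y3 =>
      (hk y0 y1 y2 y3).symm.trans (hl y0 y1 y2 y3))
  obtain ⟨y1, y3, hy⟩ := h.valid.nv.n02 e0 e0 e0_ne_zero e0_ne_zero
  apply hy
  rw [hk, hkk]
  simp only [om, e0_zero, e0_one]
  ring

variable {α β γ : ℂ}

lemma loopOf_face2 (δ ε : ℂ) : LoopOf (faces 1 δ ε α β γ).sys.loop (face2 ε α β) (face2 ε α γ)
    (quad2 α β γ 0) :=
  loopOf_faces _ _ (form_faceT_symm _ _ _ _ _ _) (form_faceT_symm _ _ _ _ _ _)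

lemma Loop.Translated.eq_m (hL : s.loop.Translated (α - β) (α - γ)) (δ ε : ℂ) (i : Fin 4)
    (y z : Vec) : bil (s.loop.m i) y z = bil ((faces 1 δ ε α β γ).sys.loop.m i) y z := by
  have h := loopOf_face2 (α := α) (β := β) (γ := γ) δ ε
  revert i
  refine forall_fin_four ?_ ?_ ?_ ?_
  · rw [hL.m0, h.m0, fm_face2]
  · rw [hL.m1, h.m1, fm_face2]
  · rw [hL.m2, h.m2, fm_face2]
  · rw [hL.m3, h.m3, fm_face2]

lemma Loop.Translated.eq_m' (hL : s.loop.Translated (α - β) (α - γ)) (δ ε : ℂ) (i : Fin 4)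
    (y z : Vec) : bil (s.loop.m' i) y z = bil ((faces 1 δ ε α β γ).sys.loop.m' i) y z := by
  have h := loopOf_face2 (α := α) (β := β) (γ := γ) δ ε
  revert i
  refine forall_fin_four ?_ ?_ ?_ ?_
  · rw [hL.m0', h.m0', fm_face2]
  · rw [hL.m1', h.m1', fm_face2]
  · rw [hL.m2', h.m2', fm_face2]
  · rw [hL.m3', h.m3', fm_face2]

lemma Loop.Translated.exists_smul_T (hL : s.loop.Translated (α - β) (α - γ)) (h : Std s)
    (hab : α ≠ β) (δ ε : ℂ) : ∃ κ : ℂ, κ ≠ 0 ∧ ∀ y0 y1 y2 y3, form s.loop.T y0 y1 y2 y3 =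
      κ * form (faces 1 δ ε α β γ).sys.loop.T y0 y1 y2 y3 := by
  have ha := sub_ne_zero.2 hab
  refine h.exists_smul_T (hL.ns h ha) (loopOf_face2 δ ε) (hL.eq_m δ ε) (hL.eq_m' δ ε)
    (i := α - β) (j := -(α - γ)) ha (fun y0 y1 y2 y3 => ?_) fun k k' l l' hk => ?_
  · rw [quad2, form_kleinT]
    simp only [fm_face2, om]
    ring
  · simp only [fm_face2] at hk
    linear_combination -coeff_relation2 hk

/-- The equivalence with the second system if the quadratic and linear parts of `n 2` agree. -/
lemma Loop.Translated.sysRel (hL : s.loop.Translated (α - β) (α - γ)) (h : Std s)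
    (hab : α ≠ β) (had : Admissible 1 α β γ) {ε : ℂ}
    (h00 : s.loop.n 2 0 0 = -(4 * ε * (α - β)))
    (h01 : s.loop.n 2 0 1 + s.loop.n 2 1 0 = 2 * (-(α - β) - 2 * ε * (α - β) * (α + β))) :
    SysRel s (faces 1 0 ε α β γ).sys := by
  have ha := sub_ne_zero.2 hab
  obtain ⟨κ, hκ, hT⟩ := hL.exists_smul_T h hab 0 ε
  set d := -((α - β) * (α + β)) - ε * (α - β) * (α + β) ^ 2 - ε * (α - β) ^ 3 with hd
  obtain ⟨c, hc⟩ := exists_eq_mul (a := d - s.loop.n 2 1 1) ha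
  refine h.sysRel_of_eq_two (had.std 0 ε) (hL.ns h ha) (hL.eq_m 0 ε) (hL.eq_m' 0 ε) hκ hT
    (a := c / 2 + (s.loop.n 2 0 1 - s.loop.n 2 1 0) / 4)
    (b := c / 2 - (s.loop.n 2 0 1 - s.loop.n 2 1 0) / 4) fun y z => ?_
  rw [(loopOf_face2 0 ε).n2, ← hL.eq_m, ← hL.eq_m', hL.m2, hL.m2', face2, form_faceT, ← hd, om, om,
    bil, h00]
  simp only [e1_zero, e1_one]
  linear_combination (y 0 * z 1 + y 1 * z 0) / 2 * h01 - (y 1 * z 1) * hc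

/-- Rescaling of the terms `n i`. -/
lemma Std.exists_scale {s : Sys} (h : Std s) {σ : ℂ} (hσ : σ ≠ 0) : ∃ t, SysRel s t ∧ Std t ∧
    (∀ i y z, bil (t.loop.m i) y z = bil (s.loop.m i) y z) ∧
    (∀ i y z, bil (t.loop.m' i) y z = bil (s.loop.m' i) y z) ∧
    (∀ i y z, bil (t.loop.n i) y z = σ * bil (s.loop.n i) y z) ∧
    ∀ y0 y1 y2 y3, form t.loop.T y0 y1 y2 y3 = form s.loop.T y0 y1 y2 y3 := by
  obtain ⟨t, h1, h2, h3, h4, h5, h6⟩ := h.exists_change (fun _ => 1) (σ := fun _ => σ⁻¹)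
    (c := fun _ => σ) (fun _ => inv_ne_zero hσ) (fun _ => hσ) (fun _ => 0)
  simp only [one_mulVec_vec, mul_inv_cancel_left₀ hσ, zero_mul, add_zero] at h3 h4 h5 h6
  exact ⟨t, h1, h2, h3, h4, h5, h6⟩

lemma apply_of_bil {M N : Fin 2 → Fin 2 → ℂ} {σ : ℂ} (h : ∀ y z, bil M y z = σ * bil N y z)
    (i j : Fin 2) : M i j = σ * N i j := by
  rw [eq_smul_of_bil h]
  rfl

lemma Loop.Translated.of_eq {L L' : Loop} {a b : ℂ} (h : L.Translated a b)
    (hm : ∀ i y z, bil (L'.m i) y z = bil (L.m i) y z)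
    (hm' : ∀ i y z, bil (L'.m' i) y z = bil (L.m' i) y z) : L'.Translated a b where
  m0 y z := by rw [hm, h.m0]
  m1 y z := by rw [hm, h.m1]
  m2 y z := by rw [hm, h.m2]
  m3 y z := by rw [hm, h.m3]
  m0' y z := by rw [hm', h.m0']
  m1' y z := by rw [hm', h.m1']
  m2' y z := by rw [hm', h.m2']
  m3' y z := by rw [hm', h.m3']

section

variable {s : Sys} {a b : ℂ}

/-- The equivalence with the second system if the terms `n i` cannot be removed. -/
lemma Loop.Translated.exists_sysRel (hL : s.loop.Translated a b) (h : Std s) (ha : a ≠ 0)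
    (hb : b ≠ 0) (hn : s.loop.n 2 0 0 ≠ 0 ∨ s.loop.n 2 0 1 + s.loop.n 2 1 0 ≠ 0) :
    ∃ k δ ε α β γ, Admissible k α β γ ∧ SysRel s (faces k δ ε α β γ).sys := by
  suffices H : ∃ σ ε α : ℂ, σ ≠ 0 ∧ σ * s.loop.n 2 0 0 = -(4 * ε * a) ∧
      σ * (s.loop.n 2 0 1 + s.loop.n 2 1 0) = 2 * (-a - 2 * ε * a * (2 * α - a)) by
    obtain ⟨σ, ε, α, hσ, h0, h1⟩ := H
    obtain ⟨t, r, ht, tm, tm', tn, -⟩ := h.exists_scale hσ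
    obtain ⟨β, rfl⟩ : ∃ β, a = α - β := ⟨α - a, by ring⟩
    obtain ⟨γ, rfl⟩ : ∃ γ, b = α - γ := ⟨α - b, by ring⟩
    have hab := sub_ne_zero.1 ha
    have had : Admissible 1 α β γ :=
      ⟨hab, fun hbc => hL.ne h ha (by rw [hbc]), sub_ne_zero.1 hb⟩
    refine ⟨1, 0, ε, α, β, γ, had, r.trans ((hL.of_eq tm tm').sysRel ht hab had ?_ ?_)⟩
    · rw [apply_of_bil (tn 2), h0]
    · rw [apply_of_bil (tn 2), apply_of_bil (tn 2), ← mul_add, h1]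
      ring
  generalize s.loop.n 2 0 1 + s.loop.n 2 1 0 = ν at *
  generalize s.loop.n 2 0 0 = N at *
  by_cases hN : N = 0
  · have hν : ν ≠ 0 := hn.resolve_left (by simpa using hN)
    exact ⟨-2 * a / ν, 0, 0, by simp [ha, hν], by simp [hN], by field_simp; ring⟩
  · -- the parameter `ε` is normalized to `1`, and `α` is determined by the linear part
    exact ⟨-4 * a / N, 1, (ν / N + a - 1 / 2) / 2, by simp [ha, hN], by field_simp,
      by field_simp; ring⟩

end

lemma Std.form_A {s : Sys} (h : Std s) (u v w z : Vec) : form s.A u v w z =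
    u 0 * w 1 * bil (s.loop.m 0) v z + u 1 * w 0 * bil (s.loop.m' 0) v z +
      u 1 * w 1 * bil (s.loop.n 0) v z := by
  rw [form_of_vanish h.vA, Sys.loop_m₀, Sys.loop_m'₀, Sys.loop_n₀]

lemma Std.form_C' {s : Sys} (h : Std s) (u v w z : Vec) : form s.C' u v w z =
    u 0 * w 1 * bil (s.loop.m 1) v z + u 1 * w 0 * bil (s.loop.m' 1) v z +
      u 1 * w 1 * bil (s.loop.n 1) v z := by
  rw [form_of_vanish h.vC', Sys.loop_m₁, Sys.loop_m'₁, Sys.loop_n₁]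

lemma Std.form_A' {s : Sys} (h : Std s) (u v w z : Vec) : form s.A' u v w z =
    u 0 * w 1 * bil (s.loop.m' 2) z v + u 1 * w 0 * bil (s.loop.m 2) z v +
      u 1 * w 1 * bil (s.loop.n 2) z v := by
  rw [form_of_vanish h.vA', Sys.loop_m₂, Sys.loop_m'₂, Sys.loop_n₂]

lemma Std.form_C {s : Sys} (h : Std s) (u v w z : Vec) : form s.C u v w z =
    u 0 * w 1 * bil (s.loop.m' 3) z v + u 1 * w 0 * bil (s.loop.m 3) z v +
      u 1 * w 1 * bil (s.loop.n 3) z v := by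
  rw [form_of_vanish h.vC, Sys.loop_m₃, Sys.loop_m'₃, Sys.loop_n₃]

/-! ### Reduction to the reflection of the first system -/

/-- The Möbius transformation `x ↦ (x + 1) / (x - 1)`. -/
lemma exists_gl_cayley : ∃ g : GL (Fin 2) ℂ, ∀ u : Vec, g.1.mulVec u = ![u 0 + u 1, u 0 - u 1] := by
  obtain ⟨g, hg⟩ := exists_gl_mulVec (p := ![1, 1]) (p' := ![1, -1]) (by norm_num)
  refine ⟨g, fun u => ?_⟩
  rw [hg]
  ext i
  fin_cases i <;> simp
  ring

/-- If all terms `n i` vanish, the system is equivalent to the reflection of the first system with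
`ε = -1`. The transformation `x ↦ (x + 1) / (x - 1)` of the variables at the face of `B` transforms
`(x₀ - x₂) (x₁ - x₃) - a (x₀ + x₂)` into a multiple of `(x₀ - x₂) (x₁ - x₃) - a (1 - x₀ x₂)`. -/
lemma Loop.Translated.sysRel_mirror {s : Sys} {α β γ : ℂ}
    (hL : s.loop.Translated (α - β) (α - γ)) (h : Std s) (had : Admissible 0 α β γ)
    (hn : ∀ i y z, bil (s.loop.n i) y z = 0) :
    SysRel s (faces 0 0 (-1) α β γ).sys.mirror := by
  obtain ⟨κ, hκ, hT⟩ := hL.exists_smul_T h had.1 0 0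
  obtain ⟨g, hg⟩ := exists_gl_cayley
  have h2 : (-1 / 2 : ℂ) ≠ 0 := by norm_num
  refine h.sysRel_of_faceRel (had.std 0 (-1)).toGood.mirror ![g, 1, g, g, 1, 1, g, 1]
    (FaceRel.of_forall h2 fun u v w z => ?_) (FaceRel.of_forall h2 fun u v w z => ?_)
    (FaceRel.of_forall hκ fun u v w z => ?_)
    (FaceRel.of_forall h2 fun u v w z => ?_) (FaceRel.of_forall h2 fun u v w z => ?_)
  · change form s.A u v w z = _ * form (mir (face1 (-1) α β)) _ _ _ _
    rw [h.form_A, hn, hL.m0, hL.m0', form_mir, face1, form_faceT]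
    simp [hg, om]
    ring
  · change form s.A' u v w z = _ * form (mir (face1 (-1) α β)) _ _ _ _
    rw [h.form_A', hn, hL.m2, hL.m2', form_mir, face1, form_faceT]
    simp [hg, om]
    ring
  · change form s.B' u v w z = _ * form (quad1 α β γ (-1)) _ _ _ _
    have := hT u v z w
    rw [(loopOf_face2 0 0).T] at this
    simp only [Sys.loop, form_swap] at this
    rw [this, quad1, quad2, form_kleinT, form_kleinT]
    simp only [one_mulVec_vec, Matrix.cons_val_zero, Matrix.cons_val_one, Matrix.cons_val]
    ring
  · change form s.C u v w z = _ * form (mir (face1 (-1) α γ)) _ _ _ _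
    rw [h.form_C, hn, hL.m3, hL.m3', form_mir, face1, form_faceT]
    simp [hg, om]
    ring
  · change form s.C' u v w z = _ * form (mir (face1 (-1) α γ)) _ _ _ _
    rw [h.form_C', hn, hL.m1, hL.m1', form_mir, face1, form_faceT]
    simp [hg, om]
    ring

/-- In the non-scalar case, all terms `n i` can be removed if one of them can. -/
lemma Std.exists_n_eq_zero {s : Sys} (h : Std s) (hns : s.loop.NS) {a b : ℂ}
    (hn : ∀ y z, bil (s.loop.n 2) y z = a * bil (s.loop.m 2) y z + b * bil (s.loop.m' 2) y z) :
    ∃ t, SysRel s t ∧ Std t ∧ (∀ i y z, bil (t.loop.m i) y z = bil (s.loop.m i) y z) ∧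
      (∀ i y z, bil (t.loop.m' i) y z = bil (s.loop.m' i) y z) ∧
      ∀ i y z, bil (t.loop.n i) y z = 0 := by
  obtain ⟨k, k', l, l', hk0, -, hl0, hl'0, hkl, hk, hl⟩ := h.valid.exists_T_eq_of_ns hns
  obtain ⟨t, r1, ht, tm, tm', tn, tT⟩ := h.exists_translate ![0, 0, -a, -b]
  have hn2 (y z : Vec) : bil (t.loop.n 2) y z = 0 := by
    have := tn 2 y z
    rw [hn] at this
    rw [this]
    simp
  obtain ⟨r, hr⟩ := ht.valid.exists_const_eq (l := l) (l' := l') (fun y0 y1 y2 y3 => by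
    rw [tT, hl, tm, tm, tm', tm'])
  obtain ⟨w1, w3, h3, h1, h0⟩ := h.valid.exists_translation hns hk0 hl0 hl'0 hkl hk hl
    (d0 := t.loop.n 0) (d1 := t.loop.n 1) (d3 := t.loop.n 3) (r := r) (fun y0 y1 y2 y3 => by
      have e := hr y0 y1 y2 y3
      rw [tT] at e
      simp only [tm, tm', hn2] at e
      rw [← e]
      ring)
  obtain ⟨t2, r2, ht2, m2, m2', n2, -⟩ := ht.exists_translate ![-w3, -w1, 0, 0]
  refine ⟨t2, r1.trans r2, ht2, fun i y z => by rw [m2, tm], fun i y z => by rw [m2', tm'],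
    forall_fin_four ?_ ?_ ?_ ?_⟩ <;> intro y z
  · rw [n2, h0, tm, tm']
    simp
  · rw [n2, h1, tm, tm', bil_smul]
    simp
  · rw [n2, hn2]
    simp
  · rw [n2, h3, tm, tm', bil_smul]
    simp

/-! ### Classification for coefficients that are not proportional -/

/-- The system or its reflection is equivalent to a listed system. -/
def Sys.IsListed (s : Sys) : Prop := ∃ k δ ε α β γ, Admissible k α β γ ∧
  (SysRel s (faces k δ ε α β γ).sys ∨ SysRel s.mirror (faces k δ ε α β γ).sys)

lemma Sys.IsListed.of_rel {s t : Sys} (h : SysRel s t) (ht : t.IsListed) : s.IsListed := by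
  obtain ⟨k, δ, ε, α, β, γ, had, h1 | h1⟩ := ht
  · exact ⟨k, δ, ε, α, β, γ, had, Or.inl (h.trans h1)⟩
  · exact ⟨k, δ, ε, α, β, γ, had, Or.inr (h.mirror.trans h1)⟩

lemma Sys.IsListed.of_exists {s : Sys}
    (h : ∃ k δ ε α β γ, Admissible k α β γ ∧ SysRel s (faces k δ ε α β γ).sys) : s.IsListed := by
  obtain ⟨k, δ, ε, α, β, γ, had, h1⟩ := h
  exact ⟨k, δ, ε, α, β, γ, had, Or.inl h1⟩

lemma Loop.Translated.isListed {s : Sys} {a b : ℂ} (hL : s.loop.Translated a b) (h : Std s)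
    (ha : a ≠ 0) (hb : b ≠ 0) : s.IsListed := by
  by_cases hn : s.loop.n 2 0 0 ≠ 0 ∨ s.loop.n 2 0 1 + s.loop.n 2 1 0 ≠ 0
  · exact Sys.IsListed.of_exists (hL.exists_sysRel h ha hb hn)
  · push Not at hn
    obtain ⟨h0, h1⟩ := hn
    obtain ⟨c, hc⟩ := exists_eq_mul (a := s.loop.n 2 1 1) ha
    obtain ⟨t, r, ht, tm, tm', tn⟩ := h.exists_n_eq_zero (hL.ns h ha)
      (a := s.loop.n 2 0 1 / 2 - c / 2) (b := -(s.loop.n 2 0 1 / 2) - c / 2) fun y z => by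
        rw [hL.m2, hL.m2', bil, h0, om, om]
        linear_combination (y 1 * z 1) * hc + (y 1 * z 0) * h1
    obtain ⟨β, hβ⟩ : ∃ β, a = 0 - β := ⟨-a, by ring⟩
    obtain ⟨γ, hγ⟩ : ∃ γ, b = 0 - γ := ⟨-b, by ring⟩
    have hne := hL.ne h ha
    subst hβ hγ
    have had : Admissible 0 0 β γ := ⟨sub_ne_zero.1 ha, fun hbc => hne (by rw [hbc]),
      sub_ne_zero.1 hb⟩
    have := (hL.of_eq tm tm').sysRel_mirror ht had tn
    exact Sys.IsListed.of_rel r ⟨0, 0, -1, 0, β, γ, had, Or.inr this.mirror⟩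

lemma exists_gl_translation (τ : ℂ) :
    ∃ g : GL (Fin 2) ℂ, ∀ u : Vec, g.1.mulVec u = ![u 0 + τ * u 1, u 1] := by
  obtain ⟨g, hg⟩ := exists_gl_affine one_ne_zero τ
  exact ⟨g, fun u => by rw [hg, one_mul]⟩

/-- A bilinear form whose diagonal is a multiple of `y₁²`. -/
lemma bil_eq_om_add {M : Fin 2 → Fin 2 → ℂ} (hM : det2 M ≠ 0) {f : ℂ}
    (h : ∀ y, bil M y y = f * (y 1 * y 1)) : ∃ p q : ℂ, p ≠ 0 ∧ f = p * q ∧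
      ∀ y z, bil M y z = p * (om y z + q * (y 1 * z 1)) := by
  have h0 := h e0
  have h1 := h e1
  have h01 := h ![1, 1]
  simp [bil] at h0 h1 h01
  have hp : M 0 1 ≠ 0 := by
    intro hp
    apply hM
    rw [det2, h0, hp]
    ring
  refine ⟨M 0 1, f / M 0 1, hp, by field_simp, fun y z => ?_⟩
  simp only [bil, om, h0, h1]
  field_simp
  rw [h0, h1] at h01
  linear_combination y 1 * z 0 * h01

/-- The non-scalar case if the diagonal of `m' 0` has a double zero. -/
lemma Std.isListed_of_double_zero {s : Sys} (h : Std s)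
    (h0 : ∀ y z, bil (s.loop.m 0) y z = om y z) (h1 : ∀ y z, bil (s.loop.m 1) y z = om y z)
    (h3 : ∀ y z, bil (s.loop.m 3) y z = om y z) {f : ℂ} (hf : f ≠ 0)
    (hd : ∀ y, bil (s.loop.m' 0) y y = f * (y 1 * y 1)) : s.IsListed := by
  have hns : s.loop.NS := h.ns_of_diag h0 (y := e1) (by rw [hd]; simpa using hf)
  obtain ⟨-, ⟨a, hQ⟩, ⟨a', hQR⟩, ⟨w, hSR⟩, -⟩ := h.diag hns h0 h1 h3
  obtain ⟨k, k', l, l', hk0, hk'0, hl0, hl'0, hkl, hk, hl⟩ := h.valid.exists_T_eq_of_ns hns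
  obtain ⟨p, f0, hp, rfl, hP⟩ := bil_eq_om_add (h.det_loop 0).2 hd
  have ha' : a' ≠ 0 := by
    rintro rfl
    exact (h.det_loop 1).2 (by rw [hQR]; simp [det2])
  have hw : w ≠ 0 := by
    rintro rfl
    exact (h.det_loop 2).2 (by rw [hSR]; simp [det2])
  obtain ⟨r, f1, hr, -, hR⟩ := bil_eq_om_add (f := a * (p * f0) / a') (h.det_loop 3).2 fun y => by
    have := hQ y
    rw [hQR, bil_smul, hd] at this
    field_simp
    linear_combination this
  have hQ' (y z : Vec) : bil (s.loop.m' 1) y z = a' * r * (om y z + f1 * (y 1 * z 1)) := by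
    rw [hQR, bil_smul, hR]; ring
  have hS (y z : Vec) : bil (s.loop.m' 2) y z = -(w * r) * (om y z - f1 * (y 1 * z 1)) := by
    rw [hSR, bil_smul, bil_tr, hR, om, om]; ring
  have hf0 : f0 ≠ 0 := right_ne_zero_of_mul hf
  have hf1 : f1 ≠ 0 := by
    rintro rfl
    refine hns 3 r (eq_smul_of_bil fun y z => ?_)
    rw [hR, h3]; ring
  have hTT (y0 y1 y2 y3 : Vec) := (hk y0 y1 y2 y3).symm.trans (hl y0 y1 y2 y3)
  simp only [h0, h1, h3, hP, hQ', hR, hS] at hTT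
  have hrq : a' * r ≠ 0 := mul_ne_zero ha' hr
  have hsw : -(w * r) ≠ 0 := neg_ne_zero.2 (mul_ne_zero hw hr)
  clear hQ hd hf hQR hSR a
  generalize a' * r = q at *
  generalize -(w * r) = w' at *
  -- the relations between the coefficients, from the equality of the two formulas for `T`
  have e1 : l = k * q * r := by
    have := hTT _root_.e0 _root_.e0 _root_.e1 _root_.e1
    simp [om] at this
    linear_combination -this
  have e2 : k' * p * w' * f0 = -(k * f1) := by
    have := hTT _root_.e1 _root_.e1 _root_.e1 _root_.e1
    simp [om] at this
    subst e1
    refine mul_left_cancel₀ (mul_ne_zero (mul_ne_zero (mul_ne_zero hk0 hf1) hrq) hr) ?_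
    linear_combination k * this - f1 * p * w' * f0 * hkl
  have hl'e : l' = k' * q * r := mul_left_cancel₀ hk0 (by rw [hkl, e1]; ring)
  have hN (y z : Vec) : bil (s.loop.m 2) y z =
      p * q * r * w' * (om y z - (f0 + f1) * (y 1 * z 1)) := by
    have := hTT _root_.e0 _root_.e1 y z
    refine mul_left_cancel₀ hk'0 ?_
    subst e1 hl'e
    simp [om] at this
    simp only [om]
    linear_combination this + q * r * y 1 * z 1 * e2
  obtain ⟨g1, hg1⟩ := exists_gl_translation (f0 / 2)
  obtain ⟨g2, hg2⟩ := exists_gl_translation (f0 / 2 + f1 / 2)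
  obtain ⟨g3, hg3⟩ := exists_gl_translation (-(f1 / 2))
  have hn : p * q * r * w' ≠ 0 := by simp [hp, hrq, hr, hsw]
  obtain ⟨t, hrel, ht, tm, tm', -⟩ := h.exists_change ![1, g1, g2, g3]
    (σ := ![1, -1 / p, 1 / (p * q), -r])
    (c := ![1, -p, 1 / (r * w'), -1 / r])
    (forall_fin_four one_ne_zero (by simp [hp]) (by simp [hp, hrq]) (by simp [hr]))
    (forall_fin_four one_ne_zero (by simp [hp]) (by simp [hr, hsw]) (by simp [hr])) 0
  have hL : t.loop.Translated (f0 / 2) (f1 / 2) := by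
    constructor <;> intro y z
    · rw [tm, h0]
      simp [hg1, om]
      ring
    · rw [tm, h1]
      simp [hg1, hg2, om]
      field_simp
      ring
    · rw [tm, hN]
      simp [hg2, hg3, om]
      field_simp
      ring
    · rw [tm, h3]
      simp [hg3, om]
      field_simp
      ring
    · rw [tm', hP]
      simp [hg1, om]
      field_simp
      ring
    · rw [tm', hQ']
      simp [hg1, hg2, om]
      field_simp
      ring
    · rw [tm', hS]
      simp [hg2, hg3, om]
      field_simp
      ring
    · rw [tm', hR]
      simp [hg3, om]
      field_simp
      ring
  exact Sys.IsListed.of_rel hrel (hL.isListed ht (by simpa using hf0) (by simpa using hf1))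

/-- In a basis of determinant one, either both basis vectors are zeros of the quadratic form
`bil M y y`, or one of them is a double zero. -/
lemma exists_zero_basis (M : Fin 2 → Fin 2 → ℂ) : ∃ p p' : Vec, om p p' = 1 ∧ bil M p p = 0 ∧
    (bil M p' p' = 0 ∨ bil M p p' + bil M p' p = 0) := by
  obtain ⟨p, hp, hz⟩ := exists_quadratic_zero (M 0 0) (M 0 1 + M 1 0) (M 1 1)
  have hp0 : bil M p p = 0 := by
    rw [bil]
    linear_combination hz
  obtain ⟨p', hp'⟩ := exists_om_eq_one hp
  by_cases hb : bil M p p' + bil M p' p = 0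
  · exact ⟨p, p', hp', hp0, Or.inr hb⟩
  · refine ⟨p, p' + (-(bil M p' p') / (bil M p p' + bil M p' p)) • p, ?_, hp0, Or.inl ?_⟩
    · rw [← hp']
      simp only [om, Pi.add_apply, Pi.smul_apply, smul_eq_mul]
      ring
    · generalize hx : -(bil M p' p') / (bil M p p' + bil M p' p) = x
      rw [div_eq_iff hb] at hx
      have := bil_comb₀ M 1 x p' p (p' + x • p)
      have e1 := bil_comb₁ M 1 x p' p' p
      have e2 := bil_comb₁ M 1 x p p' p
      rw [one_smul] at this e1 e2
      rw [this, e1, e2, hp0]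
      linear_combination -hx

/-- The cases are distinguished by the zeros of the quadratic form `bil (m' 0) y y`. -/
lemma Std.isListed_of_ns {s : Sys} (h : Std s) (h0 : ∀ y z, bil (s.loop.m 0) y z = om y z)
    (h1 : ∀ y z, bil (s.loop.m 1) y z = om y z) (h3 : ∀ y z, bil (s.loop.m 3) y z = om y z)
    (hns : s.loop.NS) : s.IsListed := by
  obtain ⟨⟨w, hw⟩, -⟩ := h.diag hns h0 h1 h3
  obtain ⟨p, p', hp, hz, hz'⟩ := exists_zero_basis (s.loop.m' 0)
  obtain ⟨t, r, ht, t0, t1, t3, -, tm', -⟩ := h.exists_basis h0 h1 h3 hp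
  refine Sys.IsListed.of_rel r ?_
  have hw' : bil (t.loop.m' 0) ![om w p', om p w] ![om w p', om p w] ≠ 0 := by
    rw [tm']
    simp only [Matrix.cons_val_zero, Matrix.cons_val_one]
    rwa [← om_decomp hp]
  have e00 : bil (t.loop.m' 0) e0 e0 = 0 := by simpa [tm'] using hz
  have hns' := ht.ns_of_diag t0 hw'
  obtain hz' | hz' := hz'
  · exact Sys.IsListed.of_exists (ht.exists_sysRel_of_two_zeros hns' t0 t1 t3 e00
      (by simpa [tm'] using hz'))
  · have e01 : bil (t.loop.m' 0) e0 e1 + bil (t.loop.m' 0) e1 e0 = 0 := by simpa [tm'] using hz'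
    have hd (y : Vec) : bil (t.loop.m' 0) y y = t.loop.m' 0 1 1 * (y 1 * y 1) := by
      simp [bil] at e00 e01
      rw [bil, e00]
      linear_combination (y 0 * y 1) * e01
    refine ht.isListed_of_double_zero t0 t1 t3 (fun hf => hw' ?_) hd
    rw [hd, hf, zero_mul]

/-! ### Classification for proportional coefficients -/

lemma fm_face1 (ε α β : ℂ) (y z : Vec) : fm (face1 ε α β) y z = om y z := by
  rw [face1, fm_faceT, om]
  ring

lemma om_self (y : Vec) : om y y = 0 := by
  rw [om]
  ring

/-- All forms `m i` are the determinant, and all forms `m' i` its negative. -/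
structure Loop.IsDet (L : Loop) : Prop where
  m : ∀ i y z, bil (L.m i) y z = om y z
  m' : ∀ i y z, bil (L.m' i) y z = -om y z

lemma Loop.IsDet.of_eq {L L' : Loop} (h : L.IsDet)
    (hm : ∀ i y z, bil (L'.m i) y z = bil (L.m i) y z)
    (hm' : ∀ i y z, bil (L'.m' i) y z = bil (L.m' i) y z) : L'.IsDet where
  m i y z := by rw [hm, h.m]
  m' i y z := by rw [hm', h.m']

/-- If the coefficients of every face are proportional, all of them can be transformed into the
determinant, with factor of proportionality `-1`. -/
lemma Std.exists_det {s : Sys} (h : Std s) (h0 : ∀ y z, bil (s.loop.m 0) y z = om y z)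
    (h1 : ∀ y z, bil (s.loop.m 1) y z = om y z) (h3 : ∀ y z, bil (s.loop.m 3) y z = om y z)
    {a : Fin 4 → ℂ} (ha : ∀ i, s.loop.m' i = a i • s.loop.m i) :
    ∃ t, SysRel s t ∧ Std t ∧ t.loop.IsDet := by
  have hprod := h.valid.prod_eq_one_of_scalar ha
  have ha0 (i : Fin 4) : a i ≠ 0 := by
    intro hi
    refine (h.det_loop i).2 ?_
    rw [ha, hi]
    simp [det2]
  -- the variables `u i` are rescaled so that `m' i = -m i`
  obtain ⟨t, r, ht, tm, tm', -⟩ := h.exists_change (fun _ => 1)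
    (σ := ![1, -1 / a 0, 1 / (a 0 * a 1), -a 3]) (c := ![1, -a 0, a 0 * a 1, -1 / a 3])
    (forall_fin_four one_ne_zero (by simp [ha0]) (by simp [ha0]) (by simp [ha0]))
    (forall_fin_four one_ne_zero (by simp [ha0]) (by simp [ha0]) (by simp [ha0])) 0
  simp only [one_mulVec_vec] at tm tm'
  have hm (i : Fin 4) (y z : Vec) : bil (t.loop.m i) y z = bil (s.loop.m i) y z := by
    rw [tm]
    have h0' := ha0 0
    have h1' := ha0 1
    have h3' := ha0 3
    revert i
    refine forall_fin_four ?_ ?_ ?_ ?_ <;> simp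
    · field_simp
    · field_simp
    · field_simp
  have hm' (i : Fin 4) : t.loop.m' i = (-1 : ℂ) • t.loop.m i := by
    refine eq_smul_of_bil fun y z => ?_
    rw [tm', hm, ha, bil_smul]
    have h0' := ha0 0
    have h1' := ha0 1
    have h3' := ha0 3
    revert i
    refine forall_fin_four ?_ ?_ ?_ ?_ <;> simp
    · field_simp
    · field_simp
    · linear_combination bil (s.loop.m 2) y z * hprod
    · field_simp
  obtain ⟨k, k', hk0, hk'0, hk⟩ := ht.valid.exists_T_eq_of_scalar hm'
  obtain ⟨r', hr'⟩ := ht.valid.exists_const_eq_of_scalar hm' hk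
  have t0 (y z : Vec) := (hm 0 y z).trans (h0 y z)
  have t1 (y z : Vec) := (hm 1 y z).trans (h1 y z)
  have t3 (y z : Vec) := (hm 3 y z).trans (h3 y z)
  -- on the diagonal, the product of `n 0` and `m 2` vanishes
  have hn : ∃ y, bil (t.loop.n 0) y y ≠ 0 := by
    by_contra! hd
    obtain ⟨b, hb⟩ := eq_smul_om_of_diag t0 hd
    exact ht.valid.hn 0 (-1) b (hm' 0) hb
  obtain ⟨b, hb⟩ := eq_smul_om_of_diag t0 (N := t.loop.m 2)
    (eq_zero_of_mul_of_ne (f := fun y => bil (t.loop.n 0) y y) (by fun_prop)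
      (g := fun y => bil (t.loop.m 2) y y) (by fun_prop) hn fun y => by
        have := hr' y y y y
        rw [hk, t0, t1, t3, om_self] at this
        have h' : k' * (bil (t.loop.n 0) y y * bil (t.loop.m 2) y y) = 0 := by
          linear_combination -this
        exact (mul_eq_zero.1 h').resolve_left hk'0)
  have hb0 : b ≠ 0 := by
    rintro rfl
    exact (ht.det_loop 2).1 (by rw [hb]; simp [det2])
  obtain ⟨t', r2, ht', tm2, tm2', -⟩ := ht.exists_change (fun _ => 1) (σ := fun _ => 1)
    (c := ![1, 1, b⁻¹, 1]) (fun _ => one_ne_zero)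
    (forall_fin_four one_ne_zero one_ne_zero (by simpa using hb0) one_ne_zero) 0
  simp only [one_mulVec_vec] at tm2 tm2'
  have hd (i : Fin 4) (y z : Vec) : bil (t'.loop.m i) y z = om y z := by
    rw [tm2]
    revert i
    refine forall_fin_four ?_ ?_ ?_ ?_
    · simp [t0]
    · simp [t1]
    · simp [hb, bil_smul, t0, hb0]
    · simp [t3]
  refine ⟨t', r.trans r2, ht', hd, fun i y z => ?_⟩
  rw [← hd i, tm2, tm2', hm', bil_smul]
  ring

/-- The relations between the terms `n i`. -/
lemma Loop.IsDet.exists_relations {s : Sys} (hd : s.loop.IsDet) (h : Std s) :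
    ∃ k c : ℂ, k ≠ 0 ∧ c ≠ 0 ∧ c ≠ 1 ∧ (∀ y0 y1 y2 y3, form s.loop.T y0 y1 y2 y3 =
      k * (om y1 y2 * om y3 y0 - c * (om y0 y1 * om y2 y3))) ∧
    (∀ y, bil (s.loop.n 1) y y = c * bil (s.loop.n 0) y y) ∧
    (∀ y, bil (s.loop.n 2) y y = bil (s.loop.n 0) y y) ∧
    (∀ y, bil (s.loop.n 3) y y = c * bil (s.loop.n 0) y y) ∧
    bil (s.loop.n 0) e0 e1 + bil (s.loop.n 1) e0 e1 =
      bil (s.loop.n 2) e1 e0 + bil (s.loop.n 3) e1 e0 := by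
  have hm (i : Fin 4) : s.loop.m' i = (-1 : ℂ) • s.loop.m i :=
    eq_smul_of_bil fun y z => by rw [hd.m, hd.m', neg_one_mul]
  obtain ⟨k, k', hk0, hk'0, hk⟩ := h.valid.exists_T_eq_of_scalar hm
  obtain ⟨r, hr⟩ := h.valid.exists_const_eq_of_scalar hm hk
  simp only [hd.m] at hk hr
  simp only [hk] at hr
  have hT (y0 y1 y2 y3 : Vec) : form s.loop.T y0 y1 y2 y3 =
      k * (om y1 y2 * om y3 y0 - (-k' / k) * (om y0 y1 * om y2 y3)) := by
    rw [hk]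
    field_simp
    ring
  have anti (y z : Vec) : om y z = -om z y := by simp only [om]; ring
  have r01 (p : Vec) : k * bil (s.loop.n 1) p p + k' * bil (s.loop.n 0) p p = 0 := by
    by_cases hp : p = 0
    · simp [hp, bil]
    obtain ⟨q, hq⟩ := exists_om_ne hp
    have := hr p p p q
    rw [om_self, anti q p] at this
    refine (mul_eq_zero.1 ?_).resolve_left hq
    linear_combination -this
  have r12 (p : Vec) : k * bil (s.loop.n 1) p p + k' * bil (s.loop.n 2) p p = 0 := by
    by_cases hp : p = 0
    · simp [hp, bil]
    obtain ⟨q, hq⟩ := exists_om_ne hp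
    have := hr q p p p
    rw [om_self, anti q p] at this
    refine (mul_eq_zero.1 ?_).resolve_left hq
    linear_combination this
  have r23 (p : Vec) : k * bil (s.loop.n 3) p p + k' * bil (s.loop.n 2) p p = 0 := by
    by_cases hp : p = 0
    · simp [hp, bil]
    obtain ⟨q, hq⟩ := exists_om_ne hp
    have := hr p q p p
    rw [om_self, anti q p] at this
    refine (mul_eq_zero.1 ?_).resolve_left hq
    linear_combination -this
  have r20 (p : Vec) : bil (s.loop.n 2) p p = bil (s.loop.n 0) p p :=
    mul_left_cancel₀ hk'0 (by linear_combination r12 p - r01 p)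
  refine ⟨k, -k' / k, hk0, div_ne_zero (neg_ne_zero.2 hk'0) hk0, ?_, hT, fun p => ?_, r20,
    fun p => ?_, ?_⟩
  · intro hc
    obtain ⟨y1, y3, hy⟩ := h.valid.nv.n02 e0 e0 e0_ne_zero e0_ne_zero
    apply hy
    rw [hT, hc]
    simp only [om]
    ring
  · field_simp
    linear_combination r01 p
  · field_simp
    linear_combination r23 p + k' * (r20 p).symm
  · have h1 := hr e0 e0 e1 e1
    have h2 := hr e0 e1 e1 e0
    simp [om] at h1 h2
    have h1' : bil (s.loop.n 1) e0 e1 - bil (s.loop.n 3) e1 e0 = r :=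
      mul_left_cancel₀ hk0 (by linear_combination -h1)
    have h2' : bil (s.loop.n 0) e0 e1 - bil (s.loop.n 2) e1 e0 = -r :=
      mul_left_cancel₀ hk'0 (by linear_combination -h2)
    linear_combination h1' + h2'

/-- If the form is not a multiple of the determinant, its symmetric part is diagonal in a suitable
basis of determinant one. -/
lemma exists_orthogonal_basis {N : Fin 2 → Fin 2 → ℂ} (hN : ∃ y, bil N y y ≠ 0) :
    ∃ p q : Vec, om p q = 1 ∧ bil N q q ≠ 0 ∧ bil N p q + bil N q p = 0 := by
  obtain ⟨q, hq⟩ := hN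
  have hq0 : q ≠ 0 := by
    rintro rfl
    simp [bil] at hq
  obtain ⟨p', hp'⟩ := exists_om_eq_one hq0
  obtain ⟨x, hx⟩ := exists_eq_mul (a := (bil N p' q + bil N q p') / 2) hq
  refine ⟨(-1 : ℂ) • p' + x • q, q, ?_, hq, ?_⟩
  · refine Eq.trans ?_ hp'
    simp only [om, Pi.add_apply, Pi.smul_apply, smul_eq_mul]
    ring
  · rw [bil_comb₀, bil_comb₁]
    linear_combination -2 * hx

lemma loopOf_face1 (δ ε α β γ : ℂ) : LoopOf (faces 0 δ ε α β γ).sys.loop (face1 ε α β)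
    (face1 ε α γ) (quad1 α β γ 0) :=
  loopOf_faces _ _ (form_faceT_symm _ _ _ _ _ _) (form_faceT_symm _ _ _ _ _ _)

/-- A bilinear form, from its diagonal and one of the off-diagonal coefficients. -/
lemma bil_eq_of_diag {M : Fin 2 → Fin 2 → ℂ} {a b : ℂ}
    (h : ∀ y, bil M y y = a * (y 0 * y 0) + b * (y 1 * y 1)) (y z : Vec) :
    bil M y z = a * (y 0 * z 0) + b * (y 1 * z 1) + bil M e0 e1 * om y z := by
  have h00 := h e0
  have h11 := h e1
  have h01 := h ![1, 1]
  simp [bil] at h00 h11 h01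
  simp only [bil, om, h00, h11, e0_zero, e0_one, e1_zero, e1_one]
  linear_combination (y 1 * z 0) * h01 - (y 1 * z 0) * h00 - (y 1 * z 0) * h11

/-- The symmetric part of `n 0` is diagonalized; with coefficients `-ε` and `-1`, it is that of the
first system, and the symmetric parts of the other `n i` are multiples of it. -/
lemma Loop.IsDet.isListed {s : Sys} (hd : s.loop.IsDet) (h : Std s) : s.IsListed := by
  have hn : ∃ y, bil (s.loop.n 0) y y ≠ 0 := by
    by_contra! hz
    obtain ⟨b, hb⟩ := eq_smul_om_of_diag (hd.m 0) hz
    exact h.valid.hn 0 (-1) b (eq_smul_of_bil fun y z => by rw [hd.m, hd.m', neg_one_mul]) hb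
  -- the quadratic form on the diagonal of `n 0` is diagonalized and normalized
  obtain ⟨p, q, hpq, hq, horth⟩ := exists_orthogonal_basis hn
  obtain ⟨s1, r1, hs1, -, -, -, m1, m1', n1, -⟩ := h.exists_basis (hd.m 0) (hd.m 1) (hd.m 3) hpq
  have hom (y z : Vec) : om (y 0 • p + y 1 • q) (z 0 • p + z 1 • q) = om y z := by
    have : om (y 0 • p + y 1 • q) (z 0 • p + z 1 • q) = om p q * om y z := by
      simp only [om, Pi.add_apply, Pi.smul_apply, smul_eq_mul]
      ring
    rw [this, hpq, one_mul]
  have hσ : -(bil (s.loop.n 0) q q)⁻¹ ≠ 0 := neg_ne_zero.2 (inv_ne_zero hq)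
  obtain ⟨s2, r2, hs2, m2, m2', n2, -⟩ := hs1.exists_scale hσ
  have hd2 : s2.loop.IsDet := by
    refine ⟨fun i y z => ?_, fun i y z => ?_⟩
    · rw [m2, m1, hd.m, hom]
    · rw [m2', m1', hd.m', hom]
  obtain ⟨k, c, hk0, hc0, hc1, hT, d1, d2, d3, hsum⟩ := hd2.exists_relations hs2
  obtain ⟨ε, hε⟩ : ∃ ε : ℂ, ∀ y, bil (s2.loop.n 0) y y = -ε * (y 0 * y 0) + -1 * (y 1 * y 1) := by
    refine ⟨(bil (s.loop.n 0) q q)⁻¹ * bil (s.loop.n 0) p p, fun y => ?_⟩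
    rw [n2, n1, bil_comb₀, bil_comb₁, bil_comb₁]
    field_simp
    linear_combination -(y 0 * y 1) * horth
  have f0 := bil_eq_of_diag hε
  have f1 := bil_eq_of_diag (M := s2.loop.n 1) (a := -(c * ε)) (b := -c) fun y => by
    rw [d1, hε]; ring
  have f2 := bil_eq_of_diag (M := s2.loop.n 2) (a := -ε) (b := -1) fun y => by rw [d2, hε]
  have f3 := bil_eq_of_diag (M := s2.loop.n 3) (a := -(c * ε)) (b := -c) fun y => by
    rw [d3, hε]; ring
  have g2 := f2 e1 e0
  have g3 := f3 e1 e0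
  simp only [om, e0_zero, e0_one, e1_zero, e1_one] at g2 g3
  generalize bil (s2.loop.n 0) e0 e1 = x0 at *
  generalize bil (s2.loop.n 1) e0 e1 = x1 at *
  generalize bil (s2.loop.n 2) e0 e1 = x2 at *
  generalize bil (s2.loop.n 3) e0 e1 = x3 at *
  have hx : x0 + x1 + x2 + x3 = 0 := by linear_combination hsum + g2 + g3
  -- the antisymmetric parts of the terms `n i` sum to zero and are removed by translations
  obtain ⟨s3, r3, hs3, m3, m3', n3, T3⟩ := hs2.exists_translate ![0, x0, x0 + x1, x0 + x1 + x2]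
  have hd3 := hd2.of_eq m3 m3'
  have had : Admissible 0 0 (-1) (-c) := by
    refine ⟨by norm_num, fun h' => hc1 ?_, fun h' => hc0 ?_⟩
    · linear_combination h'
    · linear_combination h'
  have hL := loopOf_face1 0 ε 0 (-1) (-c)
  refine Sys.IsListed.of_rel (r1.trans (r2.trans r3)) ⟨0, 0, ε, 0, -1, -c, had, Or.inl ?_⟩
  refine hs3.sysRel_of_loop (had.std 0 ε) ?_ ?_ ?_ hk0 ?_
  · refine forall_fin_four ?_ ?_ ?_ ?_ <;> intro y z <;> rw [hd3.m]
    · rw [hL.m0, fm_face1]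
    · rw [hL.m1, fm_face1]
    · rw [hL.m2, fm_face1]
    · rw [hL.m3, fm_face1]
  · have anti (y z : Vec) : -om y z = om z y := by simp only [om]; ring
    refine forall_fin_four ?_ ?_ ?_ ?_ <;> intro y z <;> rw [hd3.m', anti]
    · rw [hL.m0', fm_face1]
    · rw [hL.m1', fm_face1]
    · rw [hL.m2', fm_face1]
    · rw [hL.m3', fm_face1]
  · refine forall_fin_four ?_ ?_ ?_ ?_ <;> intro y z <;> rw [n3, hd2.m, hd2.m']
    · rw [hL.n0, face1, form_faceT, f0]
      simp
    · rw [hL.n1, face1, form_faceT, f1]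
      simp
      ring
    · rw [hL.n2, face1, form_faceT, f2]
      simp
      ring
    · rw [hL.n3, face1, form_faceT, f3]
      simp
      linear_combination om y z * hx
  · intro y0 y1 y2 y3
    rw [T3, hT, hL.T, quad1, form_kleinT]
    simp only [om]
    ring

/-- The normal forms in the cases of proportional and of non-proportional coefficients. -/
theorem Std.isListed {s : Sys} (h : Std s) : s.IsListed := by
  obtain ⟨t, r, ht, h0, h1, h3⟩ := h.exists_om
  refine Sys.IsListed.of_rel r ?_
  by_cases hns : t.loop.NS
  · exact ht.isListed_of_ns h0 h1 h3 hns
  · have ha (i : Fin 4) : ∃ a : ℂ, t.loop.m' i = a • t.loop.m i := by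
      by_contra! hi
      exact hns (ht.valid.ns i hi)
    choose a ha using ha
    obtain ⟨t', r', ht', hd⟩ := ht.exists_det h0 h1 h3 ha
    exact Sys.IsListed.of_rel r' (hd.isListed ht')

/-- The products missing in `C` are those at `x, x₃` or those at `x₁, x₁₃`; in the second case the
reflected system is normalized. -/
theorem Good.isListed {s : Sys} (h : Good s) : s.IsListed := by
  obtain ⟨p, q, hp, hq, hv⟩ | ⟨p, q, hp, hq, hv⟩ := h.hC.exists_vanish
  · obtain ⟨t, r, ht⟩ := h.exists_std hp hq hv
    exact Sys.IsListed.of_rel r ht.isListed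
  · obtain ⟨t, r, ht⟩ := h.mirror.exists_std hp hq (fun v z => by
      change form (mir s.C) p v q z = 0
      rw [form_mir]
      exact hv _ _)
    obtain ⟨k, δ, ε, α, β, γ, had, h1 | h1⟩ := Sys.IsListed.of_rel r ht.isListed
    · exact ⟨k, δ, ε, α, β, γ, had, Or.inr h1⟩
    · exact ⟨k, δ, ε, α, β, γ, had, Or.inl h1⟩

lemma Sys.IsListed.exists_isTetraPair {s : Sys} (h : s.IsListed) :
    ∃ κ κ', s.IsTetraPair κ κ' := by
  obtain ⟨k, δ, ε, α, β, γ, had, h1 | h1⟩ := h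
  · exact h1.exists_isTetraPair (had.isTetraPair δ ε)
  · obtain ⟨κ, κ', hκ⟩ := h1.exists_isTetraPair (had.isTetraPair δ ε)
    exact hκ.of_mirror

end

theorem mainTheorem6 :
    (∀ S : CubeSystem, S.HasTwoQFourH4 → S.IsConsistent →
      S.HasTetrahedronProperty ∧
      ∃ (k : Fin 3) (δ ε α β γ : ℂ), Admissible k α β γ ∧
        (S.MoebEquiv (listedSystem k δ ε α β γ).toCubeSystem ∨
          S.mirror.MoebEquiv (listedSystem k δ ε α β γ).toCubeSystem)) ∧
    (∀ (k : Fin 3) (δ ε α β γ : ℂ), Admissible k α β γ →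
      (listedSystem k δ ε α β γ).toCubeSystem.HasTwoQFourH4 ∧
      (listedSystem k δ ε α β γ).toCubeSystem.IsConsistent ∧
      (listedSystem k δ ε α β γ).toCubeSystem.IsTetrahedronPair
        (listedSystem k δ ε α β γ).K (listedSystem k δ ε α β γ).K' ∧
      listedSystem k δ ε α β γ = (firstCaseSystem k δ ε α β γ).flip) := by
  refine ⟨fun S hS hc => ?_, fun k δ ε α β γ h => h.listedSystem δ ε⟩
  obtain ⟨s, rfl⟩ : ∃ s : Sys, S = s.toCube := by
    obtain ⟨A, A', B, B', C, C'⟩ := S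
    obtain ⟨hB, hB', hA, hA', hC, hC', -⟩ := hS
    obtain ⟨A, rfl⟩ := exists_eq_ofTen hA.1.2
    obtain ⟨A', rfl⟩ := exists_eq_ofTen hA'.1.2
    obtain ⟨B, rfl⟩ := exists_eq_ofTen hB.1.2
    obtain ⟨B', rfl⟩ := exists_eq_ofTen hB'.1.2
    obtain ⟨C, rfl⟩ := exists_eq_ofTen hC.1.2
    obtain ⟨C', rfl⟩ := exists_eq_ofTen hC'.1.2
    exact ⟨⟨A, A', B, B', C, C'⟩, rfl⟩
  have h := (good_of_hasTwoQFourH4 hS hc).isListed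
  obtain ⟨κ, κ', hκ⟩ := h.exists_isTetraPair
  refine ⟨⟨_, _, hκ.isTetrahedronPair⟩, ?_⟩
  obtain ⟨k, δ, ε, α, β, γ, had, hr⟩ := h
  refine ⟨k, δ, ε, α, β, γ, had, ?_⟩
  rw [listedSystem_eq, ← Sys.toCube_mirror]
  exact hr.imp SysRel.moebEquiv SysRel.moebEquiv
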